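/- Let $d\ge 1$, let $\sigma_d$ be the surface area measure on the unit sphere $\mathbb S^d\subset\mathbb R^{d+1}$, and write $\omega_{k}=2\pi^{(k+1)/2}/\Gamma((k+1)/2)$. Let $f$ be a probability density on $\mathbb S^d$ with respect to $\sigma_d$, different from the uniform density, whose radial extension $\bar f(x)=f(x/\|x\|)$ is twice continuously differentiable on $\mathbb R^{d+1}\setminus\{0\}$ (so that $\bar f$ and its second partial derivatives are automatically bounded and square integrable on $\mathbb S^d$). For $L:[0,\infty)\to[0,\infty)$ and $h>0$ put $$\lambda_d(L)=2^{d/2-1}\omega_{d-1}\int_0^\infty L(s)s^{d/2-1}\,ds,\qquad \lambda_{h,d}(L)=\omega_{d-1}\int_0^{2h^{-2}}L(s)s^{d/2-1}(2-sh^2)^{d/2-1}\,ds,$$ $$v_d(L)=\frac{\lambda_d(L^2)}{\lambda_d(L)^{2}},\qquad v_{h,d}(L)=\frac{\lambda_{h,d}(L^2)}{\lambda_{h,d}(L)^{2}},\qquad b_d(L)=\frac{\int_0^\infty L(s)s^{d/2}\,ds}{d\int_0^\infty L(s)s^{d/2-1}\,ds}.$$ Let the kernel $L:[0,\infty)\to[0,\infty)$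 be bounded, integrable, with $0<\lambda_d(L^k)<\infty$ for $k=1,2$ and $\int_0^\infty L(s)s^{d/2}\,ds<\infty$; assume also that $L$ is continuous at $0$ with $L(0)>0$ and is of bounded variation on $[0,\infty)$. Let $X_1,X_2,\dots$ be independent with density $f$. Put $$L_h(x,y)=\frac{L((1-x^\top y)/h^2)}{\int_{\mathbb S^d}L((1-z^\top y)/h^2)\,\sigma_d(dz)},\qquad K_h(x,y)=\int_{\mathbb S^d}L_h(x,z)L_h(y,z)\,\sigma_d(dz)-2L_h(x,y),$$ $$\hat f(x;h)=\frac1n\sum_{i=1}^nL_h(x,X_i),\qquad \mathrm{MISE}(h)=\mathbb E\int_{\mathbb S^d}\{\hat f(x;h)-f(x)\}^2\,\sigma_d(dx),$$ $$\mathrm{CV}(h)=n^{-1}h^{-d}v_{h,d}(L)+\binom n2^{-1}\sum_{1\le i<j\le n}K_h(X_i,X_j).$$ For all large $n$ let $h_{\rm MISE}=h_{\rm MISE}(n)$ be a minimizer of $\mathrm{MISE}(h)$ over $h\in(0,\infty)$. Let $$c_0=\left\{\frac{d\,v_d(L)}{4\,b_d(L)^2\int_{\mathbb S^d}\{\nabla^2\bar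 f(x)\}^2\,\sigma_d(dx)}\right\}^{1/(d+4)},$$ let $0<\varepsilon<M<\infty$ be constants with $\varepsilon\le c_0\le M$, and for each $n\ge2$ let $\hat h_{\rm CV}$ be (almost surely) a minimizer of $\mathrm{CV}(h)$ over $h\in[\varepsilon n^{-1/(d+4)},Mn^{-1/(d+4)}]$. Then $\hat h_{\rm CV}/h_{\rm MISE}\to1$ in probability as $n\to\infty$. -/

import Mathlib

open MeasureTheory ProbabilityTheory Filter Topology Set
open scoped InnerProductSpace

noncomputable section

namespace SphereKDE

/-- The unit sphere `𝕊^d` of `ℝ^{d+1}`. -/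
abbrev Sph (d : ℕ) : Type := Metric.sphere (0 : EuclideanSpace ℝ (Fin (d + 1))) 1

/-- The surface area measure `σ_d` on `𝕊^d`. -/
def surf (d : ℕ) : Measure (Sph d) :=
  (volume : Measure (EuclideanSpace ℝ (Fin (d + 1)))).toSphere

/-- The surface area `ω_k = 2 π^{(k+1)/2} / Γ((k+1)/2)` of `𝕊^k`. -/
def area (k : ℕ) : ℝ :=
  2 * Real.pi ^ (((k : ℝ) + 1) / 2) / Real.Gamma (((k : ℝ) + 1) / 2)

/-! ### Kernel functionals

A kernel is a function `L : ℝ → ℝ` of which only the values on `[0, ∞)` are ever used. -/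

/-- `λ_{h,d}(L) = ω_{d-1} ∫_0^{2h⁻²} L(s) s^{d/2-1} (2 - s h²)^{d/2-1} ds`. -/
def lamH (d : ℕ) (L : ℝ → ℝ) (h : ℝ) : ℝ :=
  area (d - 1) * ∫ s in (0 : ℝ)..(2 / h ^ 2),
    L s * s ^ ((d : ℝ) / 2 - 1) * (2 - s * h ^ 2) ^ ((d : ℝ) / 2 - 1)

/-- `λ_d(L) = 2^{d/2-1} ω_{d-1} ∫_0^∞ L(s) s^{d/2-1} ds`. -/
def lam (d : ℕ) (L : ℝ → ℝ) : ℝ :=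
  2 ^ ((d : ℝ) / 2 - 1) * area (d - 1) * ∫ s in Ioi (0 : ℝ), L s * s ^ ((d : ℝ) / 2 - 1)

/-- `v_{h,d}(L) = λ_{h,d}(L²) λ_{h,d}(L)⁻²`. -/
def vH (d : ℕ) (L : ℝ → ℝ) (h : ℝ) : ℝ :=
  lamH d (fun s => L s ^ 2) h / lamH d L h ^ 2

/-- `v_d(L) = λ_d(L²) λ_d(L)⁻²`. -/
def v (d : ℕ) (L : ℝ → ℝ) : ℝ :=
  lam d (fun s => L s ^ 2) / lam d L ^ 2

/-- `b_d(L) = ∫_0^∞ L(s) s^{d/2} ds / (d ∫_0^∞ L(s) s^{d/2-1} ds)`, the constant for which the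
pointwise bias of the estimator is `b_d(L) h² Δf + o(h²)`. -/
def b (d : ℕ) (L : ℝ → ℝ) : ℝ :=
  (∫ s in Ioi (0 : ℝ), L s * s ^ ((d : ℝ) / 2)) /
    (d * ∫ s in Ioi (0 : ℝ), L s * s ^ ((d : ℝ) / 2 - 1))

/-- The assumptions on the kernel: it is nonnegative, bounded, integrable, with
`0 < λ_d(L), λ_d(L²) < ∞` and a finite integral `∫_0^∞ L(s) s^{d/2} ds`. Moreover, `L` is
continuous at `0` with `L(0) > 0`, and it has bounded variation on `[0, ∞)`. -/
structure KernelAssumptions (d : ℕ) (L : ℝ → ℝ) : Prop where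
  nonneg : ∀ s, 0 ≤ s → 0 ≤ L s
  bounded : ∃ B : ℝ, ∀ s, 0 ≤ s → L s ≤ B
  integrable : IntegrableOn L (Ici 0)
  lam_one_finite : IntegrableOn (fun s => L s * s ^ ((d : ℝ) / 2 - 1)) (Ioi 0)
  lam_one_pos : 0 < lam d L
  lam_two_finite : IntegrableOn (fun s => L s ^ 2 * s ^ ((d : ℝ) / 2 - 1)) (Ioi 0)
  lam_two_pos : 0 < lam d (fun s => L s ^ 2)
  second_moment_finite : IntegrableOn (fun s => L s * s ^ ((d : ℝ) / 2)) (Ioi 0)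
  continuous_zero : ContinuousWithinAt L (Ici 0) 0
  pos_zero : 0 < L 0
  variation : BoundedVariationOn L (Ici 0)

/-! ### The density -/

/-- `f` is a probability density function with respect to `σ_d`. -/
structure IsDensity {d : ℕ} (f : Sph d → ℝ) : Prop where
  nonneg : ∀ x, 0 ≤ f x
  integrable : Integrable f (surf d)
  integral_eq_one : ∫ x, f x ∂(surf d) = 1

open Classical in
/-- The radial extension `x ↦ f (x / ‖x‖)` of `f` to `ℝ^{d+1} ∖ {0}` (with value `0` at `0`). -/
def radialExt {d : ℕ} (f : Sph d → ℝ) (x : EuclideanSpace ℝ (Fin (d + 1))) : ℝ :=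
  if hx : x ≠ 0 then
    f ⟨‖x‖⁻¹ • x, by
      rw [mem_sphere_zero_iff_norm, norm_smul, norm_inv, norm_norm,
        inv_mul_cancel₀ (norm_ne_zero_iff.mpr hx)]⟩
  else 0

/-- `R(∇² f̄)`, the integral over the sphere of the squared Laplacian of the radial extension. -/
def lapRoughness {d : ℕ} (f : Sph d → ℝ) : ℝ :=
  ∫ x : Sph d, (Laplacian.laplacian (radialExt f) (x : EuclideanSpace ℝ (Fin (d + 1)))) ^ 2
    ∂(surf d)

/-- `c_0 = {d v_d(L) / (4 b_d(L)² R(∇² f̄))}^{1/(d+4)}`, so that `c_0 n^{-1/(d+4)}` minimises the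
asymptotic MISE `n⁻¹ h^{-d} v_d(L) + h⁴ b_d(L)² R(∇² f̄)`. -/
def c₀ {d : ℕ} (L : ℝ → ℝ) (f : Sph d → ℝ) : ℝ :=
  (d * v d L / (4 * b d L ^ 2 * lapRoughness f)) ^ (1 / ((d : ℝ) + 4))

/-! ### The kernel density estimator and the two criteria -/

/-- The normalizing constant `c_{d,L}(h)`, with
`c_{d,L}(h)⁻¹ = ∫ L((1 - xᵀy)/h²) σ_d(dx)` (whose value is the same for all `y ∈ 𝕊^d`). -/
def normConst {d : ℕ} (L : ℝ → ℝ) (h : ℝ) (y : Sph d) : ℝ :=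
  (∫ x : Sph d, L ((1 - ⟪(x : EuclideanSpace ℝ (Fin (d + 1))), y⟫_ℝ) / h ^ 2) ∂(surf d))⁻¹

/-- The normalized kernel `L_h(x, y) = c_{d,L}(h) L((1 - xᵀy)/h²)`. -/
def kerH {d : ℕ} (L : ℝ → ℝ) (h : ℝ) (x y : Sph d) : ℝ :=
  normConst L h y * L ((1 - ⟪(x : EuclideanSpace ℝ (Fin (d + 1))), y⟫_ℝ) / h ^ 2)

/-- `L̃_h(x, y) = ∫ L_h(x, z) L_h(y, z) σ_d(dz)`. -/
def kerTilde {d : ℕ} (L : ℝ → ℝ) (h : ℝ) (x y : Sph d) : ℝ :=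
  ∫ z, kerH L h x z * kerH L h y z ∂(surf d)

/-- `K_h = L̃_h - 2 L_h`. -/
def kerK {d : ℕ} (L : ℝ → ℝ) (h : ℝ) (x y : Sph d) : ℝ :=
  kerTilde L h x y - 2 * kerH L h x y

/-- The kernel density estimator `f̂(x; h) = n⁻¹ ∑_{i<n} L_h(x, X_i)` of the first `n` points of
the sequence `X`. -/
def kde {d : ℕ} (L : ℝ → ℝ) (n : ℕ) (X : ℕ → Sph d) (h : ℝ) (x : Sph d) : ℝ :=
  (n : ℝ)⁻¹ * ∑ i ∈ Finset.range n, kerH L h x (X i)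

/-- `MISE(h) = 𝔼 ∫ {f̂(x; h) - f(x)}² σ_d(dx)` for the sample of size `n`. -/
def MISE {d : ℕ} {Ω : Type*} [MeasurableSpace Ω] (P : Measure Ω) (X : ℕ → Ω → Sph d)
    (L : ℝ → ℝ) (f : Sph d → ℝ) (n : ℕ) (h : ℝ) : ℝ :=
  ∫ ω, (∫ x, (kde L n (fun i => X i ω) h x - f x) ^ 2 ∂(surf d)) ∂P

/-- The least-squares cross-validation criterion
`CV(h) = n⁻¹ h^{-d} v_{h,d}(L) + (n choose 2)⁻¹ ∑_{i<j<n} K_h(X_i, X_j)`. -/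
def CV {d : ℕ} (L : ℝ → ℝ) (n : ℕ) (X : ℕ → Sph d) (h : ℝ) : ℝ :=
  (n : ℝ)⁻¹ * (h ^ d)⁻¹ * vH d L h +
    (n.choose 2 : ℝ)⁻¹ * ∑ j ∈ Finset.range n, ∑ i ∈ Finset.range j, kerK L h (X i) (X j)

/-- The search interval `[ε n^{-1/(d+4)}, M n^{-1/(d+4)}]`. -/
def searchInterval (d : ℕ) (ε M : ℝ) (n : ℕ) : Set ℝ :=
  Icc (ε * (n : ℝ) ^ (-(1 / ((d : ℝ) + 4)))) (M * (n : ℝ) ^ (-(1 / ((d : ℝ) + 4))))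

end SphereKDE

end

/-!
# Consistency of the cross-validation bandwidth on the sphere

Both criteria have the same deterministic core, `crit`: the variance term `n⁻¹ h^{-d} v_{h,d}(L)`
plus the integrated squared bias `isb`. After division by `n^{-4/(d+4)}` and with
`h = τ n^{-1/(d+4)}`, it behaves like `amise τ = v_d(L) τ^{-d} + b_d(L)² R(∇² f̄) τ⁴`, whose strict
minimum is at `τ = c₀`. It suffices that both minimizers, divided by the rate, approach `c₀`.

**The bias.** The estimator is a convolution with a zonal kernel, and integrals of functions of
`1 - xᵀy` reduce to the measure `nu d` on `(0, 2)` (`surf_map_zonal`). A Taylor expansion of the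
radial extension shows that the bias is `h² b_d(L) Δf(x) + farMass · (f(-x) - f(x)) + o(h²)`
(`IsC2.bias_expansion`). The antipodal term comes from the tail of `L`. On the circle, where the
density of `nu 1` is unbounded at the antipode, the moment assumption does not make this term `o(h²)`
along all bandwidths, but two facts suffice.
* Its correlation with the Laplacian is nonnegative, because the Laplacian is a limit of zonal
  operators, which have nonnegative Dirichlet forms and commute with the antipodal map
  (`IsC2.integral_lap_mul_antipodal_nonneg`). Hence the antipodal term can only increase the
  squared bias, and the lower bound `IsC2.isb_lower` holds for every small bandwidth.
* Averaged over the bandwidths `τ n^{-1/(d+4)}` with `τ` in a short interval, the far mass is `o(h²)`,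
  so the matching upper bound `IsC2.isb_upper` holds for some bandwidth near the optimal one
  (`KernelAssumptions.exists_good_bandwidth`).

The Laplacian of a nonuniform density is not identically zero (`IsC2.lapRoughness_pos`), so `c₀` is
positive. Together with a lower bound for bandwidths away from zero (`exists_isb_ge`), the core
exceeds its near-minimal value by a fixed multiple of `n^{-4/(d+4)}` as soon as `h n^{1/(d+4)}` stays
away from `c₀` (`IsC2.eventually_crit_ge`, `IsC2.eventually_exists_crit_le`).

**The mean integrated squared error** differs from the core by `O(n⁻¹)`, uniformly in `h`, which
settles its minimizer (`IsSample.tendsto_MISE_bandwidth`).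

**The cross-validation criterion** is, by Hoeffding's decomposition (`CV_eq`), the sum of the core, a
random term that does not depend on `h`, a degenerate `U`-statistic, and a centred linear statistic
whose summands are bounded by the supremum of the bias, hence by a multiple of the square root of
`isb` (`IsC2.bias_sq_le`). Inequalities for arbitrarily high moments (`IsIID.integral_sum_pow_le`,
`IsIID.integral_ustat_pow_le`) make both random terms negligible relative to the core at each
bandwidth, outside an event of polynomially small probability with an exponent of choice. So a union
bound over a grid of polynomial size is possible, and the bounded variation of `L` controls the
criterion between grid points. The resulting uniform comparison `IsSample.tendsto_cv_uniform` shows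
that a minimizer over the search interval is near `c₀ n^{-1/(d+4)}`.
-/


open MeasureTheory ProbabilityTheory Filter Topology Set
open scoped InnerProductSpace

noncomputable section

namespace SphereKDE

/-! ### Zonal integration on the sphere -/

open scoped Pointwise in
lemma surf_map_linearIsometryEquiv {d : ℕ}
    (Φ : EuclideanSpace ℝ (Fin (d + 1)) ≃ₗᵢ[ℝ] EuclideanSpace ℝ (Fin (d + 1))) :
    MeasurePreserving (fun x : Sph d => (⟨Φ x, by simp⟩ : Sph d)) (surf d) (surf d) := by
  have hm : Measurable (fun x : Sph d => (⟨Φ x, by simp⟩ : Sph d)) := by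
    apply Continuous.measurable; fun_prop
  refine ⟨hm, ?_⟩
  ext s hs
  rw [Measure.map_apply hm hs, surf, Measure.toSphere_apply' _ hs, Measure.toSphere_apply' _ (hm hs)]
  congr 1
  have h1 : Φ ⁻¹' (Ioo (0:ℝ) 1 • (Subtype.val '' s)) =
      Ioo (0:ℝ) 1 • (Subtype.val '' ((fun x : Sph d => (⟨Φ x, by simp⟩ : Sph d)) ⁻¹' s)) := by
    ext z
    simp only [mem_preimage, Set.mem_smul, mem_image, Subtype.exists]
    constructor
    · rintro ⟨r, hr, _, ⟨y, hy, hys, rfl⟩, h⟩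
      refine ⟨r, hr, Φ.symm y, ⟨Φ.symm y, ?_, ?_, rfl⟩, ?_⟩
      · simpa using hy
      · simpa using hys
      · apply Φ.injective; simp [h]
    · rintro ⟨r, hr, _, ⟨y, hy, hys, rfl⟩, rfl⟩
      exact ⟨r, hr, Φ y, ⟨Φ y, by simpa using hy, hys, rfl⟩, by simp⟩
  rw [← h1]
  exact (Φ.measurePreserving.measure_preimage_emb Φ.toHomeomorph.measurableEmbedding _)

/-- The volume of the unit ball of `ℝ^d` is `ω_{d-1} / d`. -/
lemma volume_ball_eq_area (d : ℕ) (hd : 1 ≤ d) :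
    (volume (Metric.ball (0 : EuclideanSpace ℝ (Fin d)) 1)) =
      ENNReal.ofReal (area (d - 1) / d) := by
  obtain ⟨k, rfl⟩ : ∃ k, d = k + 1 := ⟨d - 1, by omega⟩
  rw [EuclideanSpace.volume_ball]
  simp only [ENNReal.ofReal_one, one_pow, one_mul, Fintype.card_fin, area]
  congr 1
  have h1 : (((k + 1 : ℕ) : ℝ) / 2 + 1) = ((k+1:ℝ)/2) + 1 := by push_cast; ring
  rw [h1, Real.Gamma_add_one (by positivity)]
  have : √Real.pi ^ (k+1) = Real.pi ^ (((k:ℝ)+1)/2) := by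
    rw [Real.sqrt_eq_rpow, ← Real.rpow_natCast, ← Real.rpow_mul Real.pi_pos.le]
    congr 1; push_cast; ring
  rw [this]
  simp only [Nat.add_sub_cancel]
  have := Real.Gamma_pos_of_pos (s := ((k:ℝ)+1)/2) (by positivity)
  push_cast
  field_simp

lemma area_pos (k : ℕ) : 0 < area k := by
  unfold area
  have := Real.Gamma_pos_of_pos (s := ((k:ℝ)+1)/2) (by positivity)
  positivity

/-- Integration in polar coordinates of a radial function. -/
lemma lintegral_radial (d : ℕ) (hd : 1 ≤ d) (g : ℝ → ENNReal) (hg : Measurable g) :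
    ∫⁻ z : EuclideanSpace ℝ (Fin d), g ‖z‖ =
      ENNReal.ofReal (area (d - 1)) * ∫⁻ r in Ioi (0:ℝ), ENNReal.ofReal (r ^ (d - 1)) * g r := by
  have : Nontrivial (EuclideanSpace ℝ (Fin d)) := by
    have : Nonempty (Fin d) := ⟨⟨0, hd⟩⟩
    infer_instance
  let E := EuclideanSpace ℝ (Fin d)
  calc ∫⁻ z : EuclideanSpace ℝ (Fin d), g ‖z‖
      = ∫⁻ z : ({(0 : E)}ᶜ : Set E), g ‖z.1‖ ∂((volume : Measure E).comap Subtype.val) := by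
        rw [lintegral_subtype_comap (measurableSet_singleton _).compl (fun x : E => g ‖x‖),
          restrict_compl_singleton]
    _ = ∫⁻ x : Metric.sphere (0:E) 1 × Ioi (0:ℝ), g x.2.1
          ∂((volume : Measure E).toSphere.prod (Measure.volumeIoiPow (Module.finrank ℝ E - 1))) := by
        simpa using (volume : Measure E).measurePreserving_homeomorphUnitSphereProd.lintegral_comp_emb
          (Homeomorph.measurableEmbedding _) (g ∘ Subtype.val ∘ Prod.snd)
    _ = (volume : Measure E).toSphere univ * ∫⁻ x : Ioi (0:ℝ), g x.1 ∂(Measure.volumeIoiPow (Module.finrank ℝ E - 1)) := by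
        rw [lintegral_prod _ (by fun_prop)]
        simp only [lintegral_const]
        rw [mul_comm]
    _ = _ := by
        rw [Measure.volumeIoiPow, lintegral_withDensity_eq_lintegral_mul _ (by fun_prop) (by fun_prop)]
        rw [Measure.toSphere_apply_univ, volume_ball_eq_area d hd]
        simp only [E, finrank_euclideanSpace, Fintype.card_fin]
        congr 1
        · rw [← ENNReal.ofReal_natCast, ← ENNReal.ofReal_mul (by positivity)]
          congr 1
          have : (d:ℝ) ≠ 0 := by positivity
          field_simp
        · rw [← lintegral_subtype_comap measurableSet_Ioi]
          rfl

/-- Splitting off the first coordinate of `ℝ^{d+1}`. -/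
lemma lintegral_euclidean_succ (d : ℕ) (G : ℝ → ℝ → ENNReal) (hG : Measurable (Function.uncurry G)) :
    ∫⁻ z : EuclideanSpace ℝ (Fin (d + 1)), G (z 0) ‖z‖ =
      ∫⁻ t : ℝ, ∫⁻ y : EuclideanSpace ℝ (Fin d), G t (√(t ^ 2 + ‖y‖ ^ 2)) := by
  have h1 : ∫⁻ z : EuclideanSpace ℝ (Fin (d + 1)), G (z 0) ‖z‖ =
      ∫⁻ z : Fin (d+1) → ℝ, G (z 0) (√(∑ i, z i ^ 2)) := by
    rw [← (PiLp.volume_preserving_ofLp (Fin (d+1))).lintegral_comp_emb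
      (MeasurableEquiv.toLp 2 (Fin (d+1) → ℝ)).symm.measurableEmbedding]
    simp [EuclideanSpace.norm_eq]
  have h2 : ∀ t, ∫⁻ y : EuclideanSpace ℝ (Fin d), G t (√(t ^ 2 + ‖y‖ ^ 2)) =
      ∫⁻ y : Fin d → ℝ, G t (√(t ^ 2 + ∑ i, y i ^ 2)) := by
    intro t
    rw [← (PiLp.volume_preserving_ofLp (Fin d)).lintegral_comp_emb
      (MeasurableEquiv.toLp 2 (Fin d → ℝ)).symm.measurableEmbedding]
    simp [EuclideanSpace.norm_sq_eq]
  simp_rw [h2]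
  rw [h1, ← (volume_preserving_piFinSuccAbove (fun _ : Fin (d+1) => ℝ) 0).symm.lintegral_comp_emb
    (MeasurableEquiv.measurableEmbedding _)]
  have hG' : Measurable fun p : ℝ × (Fin d → ℝ) => G p.1 (√(p.1^2 + ∑ i, p.2 i ^2)) := by
    exact hG.comp (f := fun p : ℝ × (Fin d → ℝ) => (p.1, √(p.1^2 + ∑ i, p.2 i ^2))) (by fun_prop)
  rw [← lintegral_prod _ hG'.aemeasurable]
  apply lintegral_congr
  intro p
  simp [Fin.sum_univ_succ, MeasurableEquiv.piFinSuccAbove]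

/-- The law of `u = 1 - ⟪x, y⟫` when `y` is distributed according to `σ_d`: the measure on `(0, 2)`
with density `ω_{d-1} (u (2 - u))^{d/2-1}`. -/
def nu (d : ℕ) : Measure ℝ :=
  (volume.restrict (Ioo (0:ℝ) 2)).withDensity
    (fun u => ENNReal.ofReal (area (d - 1) * (u * (2 - u)) ^ ((d:ℝ) / 2 - 1)))

/-- The substitution `u = 1 - cos θ`, for which `u (2 - u) = sin² θ`. -/
lemma lintegral_one_sub_cos (d : ℕ) (hd : 1 ≤ d) (g : ℝ → ENNReal) :
    ∫⁻ u in Ioo (0:ℝ) 2, ENNReal.ofReal ((u * (2 - u)) ^ ((d:ℝ) / 2 - 1)) * g u =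
      ∫⁻ θ in Ioo 0 Real.pi, ENNReal.ofReal (Real.sin θ ^ (d - 1)) * g (1 - Real.cos θ) := by
  have himg : (fun θ => 1 - Real.cos θ) '' Ioo 0 Real.pi = Ioo 0 2 := by
    ext u
    simp only [mem_image, mem_Ioo]
    constructor
    · rintro ⟨θ, ⟨h0, h1⟩, rfl⟩
      have h2 := Real.cos_lt_cos_of_nonneg_of_le_pi le_rfl h1.le h0
      have h3 := Real.cos_lt_cos_of_nonneg_of_le_pi h0.le le_rfl h1
      simp at h2 h3
      constructor <;> linarith
    · rintro ⟨h0, h1⟩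
      refine ⟨Real.arccos (1 - u), ⟨?_, ?_⟩, ?_⟩
      · rw [Real.arccos_pos]; linarith
      · refine lt_of_le_of_ne (Real.arccos_le_pi _) ?_
        rw [Ne, Real.arccos_eq_pi]; linarith
      · rw [Real.cos_arccos] <;> linarith
  rw [← himg, lintegral_image_eq_lintegral_abs_deriv_mul measurableSet_Ioo
    (f' := Real.sin) (fun θ _ => by
      have := (Real.hasDerivAt_cos θ).const_sub 1
      simpa using this.hasDerivWithinAt)]
  · refine setLIntegral_congr_fun measurableSet_Ioo (fun θ hθ => ?_)
    have hs : 0 < Real.sin θ := Real.sin_pos_of_pos_of_lt_pi hθ.1 hθ.2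
    rw [← mul_assoc, ← ENNReal.ofReal_mul (abs_nonneg _), abs_of_pos hs]
    congr 2
    have h1 : (1 - Real.cos θ) * (2 - (1 - Real.cos θ)) = Real.sin θ ^ (2:ℝ) := by
      rw [Real.rpow_two, Real.sin_sq]; ring
    have h2 : ((d - 1 : ℕ) : ℝ) = 1 + 2 * ((d:ℝ) / 2 - 1) := by
      rw [Nat.cast_sub hd]; push_cast; ring
    rw [h1, ← Real.rpow_mul hs.le, ← Real.rpow_natCast, h2, Real.rpow_add hs, Real.rpow_one]
  · intro a ha b hb hab
    apply Real.injOn_cos ⟨ha.1.le, ha.2.le⟩ ⟨hb.1.le, hb.2.le⟩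
    simpa using hab

open scoped Pointwise in
/-- Archimedes' hat-box theorem in dimension `d`: the law of one coordinate under the surface
measure. Since `surf` is defined through the volumes of cones, the cone over a set that depends on
one coordinate is integrated in polar coordinates, with respect to that coordinate and the
distance to its axis. -/
lemma surf_map_coord (d : ℕ) (hd : 1 ≤ d) :
    (surf d).map (fun y : Sph d => 1 - (y : EuclideanSpace ℝ (Fin (d + 1))) 0) = nu d := by
  have hm : Measurable (fun y : Sph d => 1 - (y : EuclideanSpace ℝ (Fin (d + 1))) 0) := by
    fun_prop
  ext A hA
  rw [Measure.map_apply hm hA, surf, Measure.toSphere_apply' _ (hm hA), nu,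
    withDensity_apply _ hA]
  let S : Set (ℝ × ℝ) := {p | 0 < p.2 ∧ p.2 < 1 ∧ 1 - p.1 / p.2 ∈ A}
  have hS : MeasurableSet S := by
    refine (measurableSet_lt measurable_const measurable_snd).inter
      ((measurableSet_lt measurable_snd measurable_const).inter ?_)
    exact (show Measurable fun p : ℝ × ℝ => 1 - p.1 / p.2 by fun_prop) hA
  let G : ℝ → ℝ → ENNReal := fun t r => S.indicator 1 (t, r)
  have hG : Measurable (Function.uncurry G) := (measurable_one.indicator hS)
  have hcone : (Ioo (0:ℝ) 1 • (Subtype.val '' ((fun y : Sph d =>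
      1 - (y : EuclideanSpace ℝ (Fin (d + 1))) 0) ⁻¹' A))) =
      {z : EuclideanSpace ℝ (Fin (d + 1)) | (z 0, ‖z‖) ∈ S} := by
    ext z
    simp only [mem_preimage, Set.mem_smul, mem_image, Subtype.exists, S, mem_ofPred_eq]
    constructor
    · rintro ⟨r, hr, _, ⟨y, hy, hys, rfl⟩, rfl⟩
      have hy1 : ‖y‖ = 1 := by simpa using hy
      have hr0 := hr.1
      simp [norm_smul, hy1, abs_of_pos hr.1, hr.1, hr.2]
      rw [mul_div_cancel_left₀ _ hr0.ne']
      exact hys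
    · rintro ⟨h0, h1, h2⟩
      refine ⟨‖z‖, ⟨h0, h1⟩, ‖z‖⁻¹ • z, ⟨‖z‖⁻¹ • z, ?_, ?_, rfl⟩, ?_⟩
      · simp [norm_smul, h0.ne']
      · simpa [div_eq_inv_mul] using h2
      · rw [smul_smul, mul_inv_cancel₀ h0.ne', one_smul]
  have hvol : volume {z : EuclideanSpace ℝ (Fin (d + 1)) | (z 0, ‖z‖) ∈ S} =
      ∫⁻ z : EuclideanSpace ℝ (Fin (d + 1)), G (z 0) ‖z‖ := by
    rw [← lintegral_indicator_one]
    · rfl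
    · exact (show Measurable fun z : EuclideanSpace ℝ (Fin (d + 1)) => (z 0, ‖z‖) by fun_prop) hS
  rw [hcone, hvol, lintegral_euclidean_succ d G hG]
  have hrad : ∀ t, ∫⁻ y : EuclideanSpace ℝ (Fin d), G t (√(t ^ 2 + ‖y‖ ^ 2)) =
      ENNReal.ofReal (area (d - 1)) *
        ∫⁻ r in Ioi (0:ℝ), ENNReal.ofReal (r ^ (d - 1)) * G t (√(t ^ 2 + r ^ 2)) := by
    intro t
    exact lintegral_radial d hd (fun r => G t (√(t ^ 2 + r ^ 2)))
      (hG.comp (f := fun r => (t, √(t ^ 2 + r ^ 2))) (by fun_prop))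
  simp_rw [hrad]
  have hG2 : Measurable fun p : ℝ × ℝ =>
      (Ioi (0:ℝ)).indicator (fun r => ENNReal.ofReal (r ^ (d-1)) * G p.1 (√(p.1^2 + r^2))) p.2 := by
    have : (fun p : ℝ × ℝ =>
      (Ioi (0:ℝ)).indicator (fun r => ENNReal.ofReal (r ^ (d-1)) * G p.1 (√(p.1^2 + r^2))) p.2) =
      (Prod.snd ⁻¹' Ioi (0:ℝ)).indicator (fun p : ℝ × ℝ => ENNReal.ofReal (p.2 ^ (d-1)) *
        Function.uncurry G (p.1, √(p.1^2 + p.2^2))) := by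
      ext p; simp [indicator]
    rw [this]
    exact Measurable.indicator (by fun_prop) (measurable_snd measurableSet_Ioi)
  have hstep : ∫⁻ t : ℝ, ENNReal.ofReal (area (d - 1)) *
        ∫⁻ r in Ioi (0:ℝ), ENNReal.ofReal (r ^ (d - 1)) * G t (√(t ^ 2 + r ^ 2)) =
      ENNReal.ofReal (area (d - 1)) * ∫⁻ p : ℝ × ℝ,
        (Ioi (0:ℝ)).indicator (fun r => ENNReal.ofReal (r ^ (d-1)) * G p.1 (√(p.1^2 + r^2))) p.2 := by
    rw [lintegral_const_mul' _ _ ENNReal.ofReal_ne_top]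
    congr 1
    rw [Measure.volume_eq_prod, lintegral_prod _ hG2.aemeasurable]
    apply lintegral_congr
    intro t
    exact (lintegral_indicator measurableSet_Ioi _).symm
  rw [hstep, ← lintegral_comp_polarCoord_symm]
  have hpol : ∫⁻ p in polarCoord.target, ENNReal.ofReal p.1 •
      (Ioi (0:ℝ)).indicator (fun r => ENNReal.ofReal (r ^ (d-1)) *
        G (polarCoord.symm p).1 (√((polarCoord.symm p).1^2 + r^2))) (polarCoord.symm p).2 =
      ∫⁻ p in Ioi (0:ℝ) ×ˢ Ioo (-Real.pi) Real.pi,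
        ((Iio (1:ℝ)).indicator (fun r => ENNReal.ofReal (r ^ d)) p.1) *
        ((Ioo 0 Real.pi).indicator (fun θ => ENNReal.ofReal (Real.sin θ ^ (d-1)) *
          A.indicator 1 (1 - Real.cos θ)) p.2) := by
    refine setLIntegral_congr_fun (measurableSet_Ioi.prod measurableSet_Ioo) (fun p hp => ?_)
    obtain ⟨r, θ⟩ := p
    obtain ⟨hr, hθ⟩ := hp
    simp only [mem_Ioi] at hr
    simp only [polarCoord_symm_apply, smul_eq_mul]
    have hsq : √((r * Real.cos θ) ^ 2 + (r * Real.sin θ)^2) = r := by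
      have : (r * Real.cos θ) ^ 2 + (r * Real.sin θ)^2 = r ^ 2 := by
        nlinarith [Real.sin_sq_add_cos_sq θ]
      rw [this, Real.sqrt_sq hr.le]
    by_cases hs : θ ∈ Ioo 0 Real.pi
    · have hsin : 0 < Real.sin θ := Real.sin_pos_of_pos_of_lt_pi hs.1 hs.2
      have h1 : r * Real.sin θ ∈ Ioi (0:ℝ) := mul_pos hr hsin
      rw [indicator_of_mem h1, indicator_of_mem hs, hsq]
      by_cases hr1 : r < 1
      · rw [indicator_of_mem (show r ∈ Iio 1 from hr1)]
        have hGA : G (r * Real.cos θ) r = A.indicator 1 (1 - Real.cos θ) := by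
          have : (r * Real.cos θ, r) ∈ S ↔ 1 - Real.cos θ ∈ A := by
            simp only [S, mem_ofPred_eq, hr, hr1, true_and, mul_div_cancel_left₀ _ hr.ne']
          by_cases hA' : 1 - Real.cos θ ∈ A
          · simp [G, indicator_of_mem (this.mpr hA'), hA']
          · simp [G, indicator_of_notMem (fun h => hA' (this.mp h)), hA']
        rw [hGA, ← mul_assoc, ← mul_assoc, ← ENNReal.ofReal_mul hr.le,
          ← ENNReal.ofReal_mul (by positivity)]
        congr 2
        obtain ⟨k, rfl⟩ : ∃ k, d = k + 1 := ⟨d - 1, by omega⟩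
        simp only [Nat.add_sub_cancel]; ring
      · rw [indicator_of_notMem (show r ∉ Iio 1 from hr1)]
        have hGA : G (r * Real.cos θ) r = 0 := by simp [G, S, hr1]
        simp [hGA]
    · rw [indicator_of_notMem hs]
      have : r * Real.sin θ ∉ Ioi (0:ℝ) := by
        simp only [mem_Ioi, not_lt]
        have : Real.sin θ ≤ 0 := by
          by_contra hcon
          push Not at hcon
          apply hs
          refine ⟨?_, hθ.2⟩
          by_contra h0
          push Not at h0
          linarith [Real.sin_nonpos_of_nonpos_of_neg_pi_le h0 hθ.1.le]
        exact mul_nonpos_of_nonneg_of_nonpos hr.le this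
      rw [indicator_of_notMem this]; simp
  rw [hpol, Measure.volume_eq_prod, ← Measure.prod_restrict]
  have hmA : Measurable (A.indicator (1 : ℝ → ENNReal)) := measurable_one.indicator hA
  rw [lintegral_prod_mul (Measurable.aemeasurable (Measurable.indicator (by fun_prop) measurableSet_Iio))
    (Measurable.aemeasurable (Measurable.indicator (by fun_prop) measurableSet_Ioo))]
  have hrint : ∫⁻ r in Ioi (0:ℝ), (Iio (1:ℝ)).indicator (fun r => ENNReal.ofReal (r ^ d)) r =
      ENNReal.ofReal (1 / (d + 1)) := by
    rw [lintegral_indicator measurableSet_Iio, Measure.restrict_restrict measurableSet_Iio,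
      Iio_inter_Ioi, ← ofReal_integral_eq_lintegral_ofReal]
    · rw [← integral_Ioc_eq_integral_Ioo, ← intervalIntegral.integral_of_le zero_le_one]
      simp
    · exact ((continuous_pow d).integrableOn_Icc (a := 0) (b := 1)).mono_set Ioo_subset_Icc_self
    · filter_upwards [ae_restrict_mem measurableSet_Ioo] with y hy
      exact pow_nonneg hy.1.le _
  have hθint : ∫⁻ θ in Ioo (-Real.pi) Real.pi, (Ioo 0 Real.pi).indicator (fun θ =>
      ENNReal.ofReal (Real.sin θ ^ (d-1)) * A.indicator 1 (1 - Real.cos θ)) θ =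
      ∫⁻ u in Ioo (0:ℝ) 2, ENNReal.ofReal ((u * (2 - u)) ^ ((d:ℝ) / 2 - 1)) * A.indicator 1 u := by
    rw [lintegral_one_sub_cos d hd, lintegral_indicator measurableSet_Ioo,
      Measure.restrict_restrict measurableSet_Ioo]
    congr 2
    apply inter_eq_left.mpr
    exact Ioo_subset_Ioo (by linarith [Real.pi_pos]) le_rfl
  rw [hrint, hθint]
  have hfin : ∫⁻ u in A, ENNReal.ofReal (area (d - 1) * (u * (2 - u)) ^ ((d:ℝ) / 2 - 1))
      ∂(volume.restrict (Ioo 0 2)) = ENNReal.ofReal (area (d-1)) *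
      ∫⁻ u in Ioo (0:ℝ) 2, ENNReal.ofReal ((u * (2 - u)) ^ ((d:ℝ) / 2 - 1)) * A.indicator 1 u := by
    rw [← lintegral_indicator hA, ← lintegral_const_mul' _ _ ENNReal.ofReal_ne_top]
    apply lintegral_congr
    intro u
    by_cases hu : u ∈ A
    · simp [hu, ENNReal.ofReal_mul (area_pos (d-1)).le]
    · simp [hu]
  rw [hfin, finrank_euclideanSpace, Fintype.card_fin]
  have : ((d + 1 : ℕ) : ENNReal) * ENNReal.ofReal (1 / (d + 1)) = 1 := by
    rw [← ENNReal.ofReal_natCast, ← ENNReal.ofReal_mul (by positivity)]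
    rw [← ENNReal.ofReal_one]; congr 1; push_cast; field_simp
  rw [← mul_one (ENNReal.ofReal (area (d-1)) * ∫⁻ u in Ioo (0:ℝ) 2, _), ← this]
  ring


/-- The isometry group acts transitively on the sphere. -/
lemma exists_isometry_map {d : ℕ} (x y : Sph d) :
    ∃ Φ : EuclideanSpace ℝ (Fin (d + 1)) ≃ₗᵢ[ℝ] EuclideanSpace ℝ (Fin (d + 1)),
      Φ (x : EuclideanSpace ℝ (Fin (d + 1))) = y := by
  refine ⟨Submodule.reflection (ℝ ∙ ((x : EuclideanSpace ℝ (Fin (d + 1))) - y))ᗮ, ?_⟩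
  exact Submodule.reflection_sub (by simp)

lemma measurable_zonal {d : ℕ} (x : Sph d) :
    Measurable (fun y : Sph d => 1 - ⟪(x : EuclideanSpace ℝ (Fin (d + 1))), y⟫_ℝ) := by
  apply Continuous.measurable; fun_prop

/-- The image of the surface measure under `y ↦ 1 - xᵀy` is the same measure `nu d` for every `x`;
hence integrals of zonal functions are one-dimensional. -/
lemma surf_map_zonal {d : ℕ} (hd : 1 ≤ d) (x : Sph d) :
    (surf d).map (fun y : Sph d => 1 - ⟪(x : EuclideanSpace ℝ (Fin (d + 1))), y⟫_ℝ) = nu d := by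
  obtain ⟨Φ, hΦ⟩ := exists_isometry_map x ⟨EuclideanSpace.single 0 1, by simp⟩
  have hm : Measurable (fun y : Sph d => 1 - (y : EuclideanSpace ℝ (Fin (d + 1))) 0) := by
    fun_prop
  rw [← surf_map_coord d hd, ← (surf_map_linearIsometryEquiv Φ).map_eq,
    Measure.map_map hm (surf_map_linearIsometryEquiv Φ).measurable,
    (surf_map_linearIsometryEquiv Φ).map_eq]
  congr 1
  ext y
  simp only [Function.comp]
  rw [← Φ.inner_map_map, hΦ]
  simp only [EuclideanSpace.inner_single_left]
  simp

instance isFiniteMeasure_surf (d : ℕ) : IsFiniteMeasure (surf d) := by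
  unfold surf; infer_instance

lemma isFiniteMeasure_nu {d : ℕ} (hd : 1 ≤ d) : IsFiniteMeasure (nu d) := by
  rw [← surf_map_zonal hd ⟨EuclideanSpace.single 0 1, by simp⟩]
  infer_instance

lemma nu_ae_mem (d : ℕ) : ∀ᵐ u ∂(nu d), u ∈ Ioo (0:ℝ) 2 :=
  (withDensity_absolutelyContinuous _ _).ae_le (ae_restrict_mem measurableSet_Ioo)

lemma integral_zonal {d : ℕ} (hd : 1 ≤ d) (x : Sph d) {k : ℝ → ℝ} (hk : Measurable k) :
    ∫ y : Sph d, k (1 - ⟪(x : EuclideanSpace ℝ (Fin (d + 1))), y⟫_ℝ) ∂(surf d) = ∫ u, k u ∂(nu d) := by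
  rw [← surf_map_zonal hd x, integral_map (measurable_zonal x).aemeasurable
    hk.aestronglyMeasurable]

lemma integral_nu (d : ℕ) (k : ℝ → ℝ) :
    ∫ u, k u ∂(nu d) = area (d - 1) * ∫ u in Ioo (0:ℝ) 2, k u * (u * (2 - u)) ^ ((d:ℝ) / 2 - 1) := by
  unfold nu
  rw [← integral_const_mul, integral_withDensity_eq_integral_toReal_smul (by fun_prop) (by simp)]
  refine setIntegral_congr_fun measurableSet_Ioo (fun u hu => ?_)
  have h1 : 0 ≤ u * (2 - u) := mul_nonneg hu.1.le (by linarith [hu.2])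
  have := area_pos (d - 1)
  simp only [smul_eq_mul]
  rw [ENNReal.toReal_ofReal (by positivity)]
  ring

lemma integral_comp_isometry {d : ℕ} {F : Type*} [NormedAddCommGroup F] [NormedSpace ℝ F]
    (Φ : EuclideanSpace ℝ (Fin (d + 1)) ≃ₗᵢ[ℝ] EuclideanSpace ℝ (Fin (d + 1)))
    (g : Sph d → F) :
    ∫ y : Sph d, g ⟨Φ y, by simp⟩ ∂(surf d) = ∫ y, g y ∂(surf d) := by
  have hemb : MeasurableEmbedding (fun x : Sph d => (⟨Φ x, by simp⟩ : Sph d)) := by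
    apply Continuous.measurableEmbedding
    · fun_prop
    · intro a b h
      simpa [Subtype.ext_iff] using h
  exact (surf_map_linearIsometryEquiv Φ).integral_comp hemb g

/-! ### Moments of zonal kernels -/

lemma integrable_zonal_mul {d : ℕ} {k : ℝ → ℝ} (hk : Measurable k) {B : ℝ} (hB : ∀ u, |k u| ≤ B)
    (x : Sph d) {g : Sph d → ℝ} (hg : Continuous g) :
    Integrable (fun y : Sph d => k (1 - ⟪(x : EuclideanSpace ℝ (Fin (d + 1))), y⟫_ℝ) * g y)
      (surf d) := by
  obtain ⟨C, hC⟩ := isCompact_univ.exists_bound_of_continuousOn (f := g) hg.continuousOn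
  refine Integrable.of_bound (C := B * C) ?_ (ae_of_all _ fun y => ?_)
  · exact ((hk.comp (measurable_zonal x)).mul hg.measurable).aestronglyMeasurable
  · rw [norm_mul]
    exact mul_le_mul (hB _) (hC y (mem_univ _)) (norm_nonneg _) ((abs_nonneg _).trans (hB 0))

/-- Integrals against a zonal kernel centred at `x` are invariant under the isometries that fix
`x`. -/
lemma integral_zonal_mul_isometry {d : ℕ} (k : ℝ → ℝ) (x : Sph d)
    (Φ : EuclideanSpace ℝ (Fin (d + 1)) ≃ₗᵢ[ℝ] EuclideanSpace ℝ (Fin (d + 1)))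
    (hΦ : Φ x = x) (g : EuclideanSpace ℝ (Fin (d + 1)) → ℝ) :
    ∫ y : Sph d, k (1 - ⟪(x : EuclideanSpace ℝ (Fin (d + 1))), y⟫_ℝ) * g (Φ y) ∂(surf d) =
      ∫ y : Sph d, k (1 - ⟪(x : EuclideanSpace ℝ (Fin (d + 1))), y⟫_ℝ) * g y ∂(surf d) := by
  rw [← integral_comp_isometry Φ
    (fun y : Sph d => k (1 - ⟪(x : EuclideanSpace ℝ (Fin (d + 1))), y⟫_ℝ) * g y)]
  congr 1
  ext y
  simp only
  congr 3
  nth_rw 2 [← hΦ]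
  rw [Φ.inner_map_map]

/-- The first moment of a zonal kernel is radial. -/
lemma integral_zonal_linear {d : ℕ} (k : ℝ → ℝ) (x : Sph d)
    (ℓ : EuclideanSpace ℝ (Fin (d + 1)) →L[ℝ] ℝ) (hℓ : ℓ x = 0) :
    ∫ y : Sph d, k (1 - ⟪(x : EuclideanSpace ℝ (Fin (d + 1))), y⟫_ℝ) * ℓ (y - x) ∂(surf d) = 0 := by
  let Φ := Submodule.reflection (ℝ ∙ (x : EuclideanSpace ℝ (Fin (d + 1))))
  have hΦ : Φ x = x := Submodule.reflection_mem_subspace_eq_self (Submodule.mem_span_singleton_self _)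
  have h := integral_zonal_mul_isometry k x Φ hΦ (fun z => ℓ (z - x))
  have h2 : ∀ y : EuclideanSpace ℝ (Fin (d + 1)), ℓ (Φ y - x) = - ℓ (y - x) := by
    intro y
    have : Φ y = (2 * ⟪(x : EuclideanSpace ℝ (Fin (d + 1))), y⟫_ℝ) • (x : EuclideanSpace ℝ (Fin (d + 1))) - y := by
      simp only [Φ]
      rw [Submodule.reflection_apply, Submodule.starProjection_singleton]
      simp [two_smul, two_mul, add_smul]
    rw [this]
    simp [hℓ]
  simp only [h2, mul_neg, integral_neg] at h
  linarith

lemma norm_sub_sq_sphere {d : ℕ} (x y : Sph d) :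
    ‖(y : EuclideanSpace ℝ (Fin (d + 1))) - x‖ ^ 2 =
      2 * (1 - ⟪(x : EuclideanSpace ℝ (Fin (d + 1))), y⟫_ℝ) := by
  rw [norm_sub_sq_real, real_inner_comm]
  simp; ring

/-- Second moments of a zonal kernel, evaluated on a bilinear form which vanishes at `x`. -/
lemma integral_zonal_quadratic {d : ℕ} (hd : 1 ≤ d) {k : ℝ → ℝ} (hk : Measurable k) {B : ℝ}
    (hB : ∀ u, |k u| ≤ B) (x : Sph d)
    (A : EuclideanSpace ℝ (Fin (d + 1)) →L[ℝ] EuclideanSpace ℝ (Fin (d + 1)) →L[ℝ] ℝ)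
    (hA : A x x = 0) (v : OrthonormalBasis (Fin (d + 1)) ℝ (EuclideanSpace ℝ (Fin (d + 1))))
    (hv : v 0 = x) :
    ∫ y : Sph d, k (1 - ⟪(x : EuclideanSpace ℝ (Fin (d + 1))), y⟫_ℝ) * A (y - x) (y - x) ∂(surf d) =
      (d : ℝ)⁻¹ * (∫ u, k u * (u * (2 - u)) ∂(nu d)) * ∑ i, A (v i) (v i) := by
  let m : Fin (d + 1) → Fin (d + 1) → ℝ := fun i j =>
    ∫ y : Sph d, k (1 - ⟪(x : EuclideanSpace ℝ (Fin (d + 1))), y⟫_ℝ) *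
      (⟪v i, (y : EuclideanSpace ℝ (Fin (d + 1))) - x⟫_ℝ *
        ⟪v j, (y : EuclideanSpace ℝ (Fin (d + 1))) - x⟫_ℝ) ∂(surf d)
  have hint : ∀ i j, Integrable (fun y : Sph d => k (1 - ⟪(x : EuclideanSpace ℝ (Fin (d + 1))), y⟫_ℝ) *
      (⟪v i, (y : EuclideanSpace ℝ (Fin (d + 1))) - x⟫_ℝ *
        ⟪v j, (y : EuclideanSpace ℝ (Fin (d + 1))) - x⟫_ℝ)) (surf d) := fun i j =>
    integrable_zonal_mul hk hB x (g := fun y : Sph d =>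
      ⟪v i, (y : EuclideanSpace ℝ (Fin (d + 1))) - x⟫_ℝ *
        ⟪v j, (y : EuclideanSpace ℝ (Fin (d + 1))) - x⟫_ℝ) (by fun_prop)
  have hvij : ∀ i j, i ≠ j → ⟪v i, v j⟫_ℝ = 0 := fun i j h => v.orthonormal.2 h
  have hsymm : ∀ i j, m i j = m j i := by
    intro i j; simp only [m]; congr 1; ext y; ring
  have hoff' : ∀ i j, i ≠ j → j ≠ 0 → m i j = 0 := by
    intro i j hij hj0
    let Φ := Submodule.reflection (ℝ ∙ (v j))ᗮ
    have hΦi : ∀ i, i ≠ j → Φ (v i) = v i := fun i hi =>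
      Submodule.reflection_mem_subspace_eq_self
        (Submodule.mem_orthogonal_singleton_iff_inner_right.mpr (hvij _ _ (Ne.symm hi)))
    have hΦj : Φ (v j) = - v j := Submodule.reflection_orthogonalComplement_singleton_eq_neg _
    have hΦx : Φ x = x := by rw [← hv]; exact hΦi 0 (Ne.symm hj0)
    have h := integral_zonal_mul_isometry k x Φ hΦx (fun z => ⟪v i, z - x⟫_ℝ * ⟪v j, z - x⟫_ℝ)
    have h2 : ∀ y : EuclideanSpace ℝ (Fin (d + 1)), ⟪v i, Φ y - x⟫_ℝ * ⟪v j, Φ y - x⟫_ℝ =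
        - (⟪v i, y - x⟫_ℝ * ⟪v j, y - x⟫_ℝ) := by
      intro y
      have e1 : Φ y - x = Φ (y - x) := by rw [map_sub, hΦx]
      have e2 : ⟪v i, Φ (y - x)⟫_ℝ = ⟪v i, y - x⟫_ℝ := by
        nth_rw 1 [← hΦi i hij]; rw [Φ.inner_map_map]
      have e3 : ⟪v j, Φ (y - x)⟫_ℝ = - ⟪v j, y - x⟫_ℝ := by
        have : v j = Φ (- v j) := by rw [map_neg, hΦj, neg_neg]
        nth_rw 1 [this]; rw [Φ.inner_map_map, inner_neg_left]
      rw [e1, e2, e3]; ring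
    simp only [h2, mul_neg, integral_neg] at h
    simp only [m]
    linarith
  have hoff : ∀ i j, i ≠ j → m i j = 0 := by
    intro i j hij
    by_cases hj : j = 0
    · rw [hsymm]; exact hoff' j i (Ne.symm hij) (fun hi => hij (hi.trans hj.symm))
    · exact hoff' i j hij hj
  have hdiag : ∀ i j, i ≠ 0 → j ≠ 0 → m i i = m j j := by
    intro i j hi hj
    by_cases hij : i = j
    · rw [hij]
    let Φ := Submodule.reflection (ℝ ∙ (v i - v j))ᗮ
    have hΦ : Φ (v i) = v j := Submodule.reflection_sub (by simp)
    have hΦx : Φ x = x := by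
      refine Submodule.reflection_mem_subspace_eq_self
        (Submodule.mem_orthogonal_singleton_iff_inner_right.mpr ?_)
      rw [← hv, inner_sub_left, hvij _ _ hi, hvij _ _ hj, sub_zero]
    have h := integral_zonal_mul_isometry k x Φ hΦx (fun z => ⟪v j, z - x⟫_ℝ * ⟪v j, z - x⟫_ℝ)
    have h2 : ∀ y : EuclideanSpace ℝ (Fin (d + 1)), ⟪v j, Φ y - x⟫_ℝ = ⟪v i, y - x⟫_ℝ := by
      intro y
      have e1 : Φ y - x = Φ (y - x) := by rw [map_sub, hΦx]
      rw [e1, ← hΦ, Φ.inner_map_map]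
    simp only [h2] at h
    exact h
  have hsum : ∑ i ∈ Finset.univ.erase (0 : Fin (d + 1)), m i i = ∫ u, k u * (u * (2 - u)) ∂(nu d) := by
    rw [← integral_zonal hd x (k := fun u => k u * (u * (2 - u))) (by fun_prop)]
    simp only [m]
    rw [← integral_finsetSum _ (fun i _ => hint i i)]
    congr 1
    ext y
    rw [← Finset.mul_sum]
    congr 1
    have h1 := v.sum_sq_inner_right ((y : EuclideanSpace ℝ (Fin (d + 1))) - x)
    rw [← Finset.add_sum_erase _ _ (Finset.mem_univ (0 : Fin (d+1))), hv] at h1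
    rw [norm_sub_sq_sphere] at h1
    have h2 : ⟪(x : EuclideanSpace ℝ (Fin (d + 1))), (y : EuclideanSpace ℝ (Fin (d + 1))) - x⟫_ℝ =
        - (1 - ⟪(x : EuclideanSpace ℝ (Fin (d + 1))), y⟫_ℝ) := by
      rw [inner_sub_right]; simp
    simp only [← pow_two]
    rw [h2] at h1
    linarith
  have hmii : ∀ i, i ≠ 0 → m i i = (d : ℝ)⁻¹ * ∫ u, k u * (u * (2 - u)) ∂(nu d) := by
    intro i hi
    have : ∑ j ∈ Finset.univ.erase (0 : Fin (d + 1)), m j j = d * m i i := by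
      rw [Finset.sum_congr rfl (fun j hj => hdiag j i (Finset.ne_of_mem_erase hj) hi)]
      simp
    have hd0 : (d : ℝ) ≠ 0 := by positivity
    rw [← hsum, this]; field_simp
  have hexp : ∀ y : Sph d, k (1 - ⟪(x : EuclideanSpace ℝ (Fin (d + 1))), y⟫_ℝ) * A (y - x) (y - x) =
      ∑ i, ∑ j, A (v i) (v j) * (k (1 - ⟪(x : EuclideanSpace ℝ (Fin (d + 1))), y⟫_ℝ) *
      (⟪v i, (y : EuclideanSpace ℝ (Fin (d + 1))) - x⟫_ℝ *
        ⟪v j, (y : EuclideanSpace ℝ (Fin (d + 1))) - x⟫_ℝ)) := by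
    intro y
    conv_lhs => rw [← v.sum_repr' ((y : EuclideanSpace ℝ (Fin (d + 1))) - x)]
    simp only [map_sum, map_smul, sum_apply, smul_apply,
      smul_eq_mul, Finset.mul_sum]
    rw [Finset.sum_comm]
    refine Finset.sum_congr rfl fun i _ => Finset.sum_congr rfl fun j _ => ?_
    ring
  simp_rw [hexp]
  rw [integral_finsetSum _ (fun i _ => integrable_finsetSum _ fun j _ => (hint i j).const_mul _)]
  rw [Finset.mul_sum]
  refine Finset.sum_congr rfl fun i _ => ?_
  rw [integral_finsetSum _ (fun j _ => (hint i j).const_mul _)]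
  simp_rw [integral_const_mul]
  rw [Finset.sum_eq_single i]
  · by_cases hi : i = 0
    · subst hi; rw [hv, hA]; simp
    · rw [mul_comm]; congr 1; exact hmii i hi
  · intro j _ hj
    have := hoff i j (Ne.symm hj)
    simp only [m] at this
    rw [this, mul_zero]
  · simp

/-! ### Second-order expansion of a function on the sphere -/

/-- Second-order Taylor expansion along a segment, with a remainder controlled by the oscillation
of the second derivative. -/
lemma taylor_two_segment {E : Type*} [NormedAddCommGroup E] [NormedSpace ℝ E] {F : E → ℝ}
    {U : Set E} (hU : IsOpen U) (hF : ContDiffOn ℝ 2 F U) {x y : E} (hs : segment ℝ x y ⊆ U)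
    {ω : ℝ} (hω : ∀ z ∈ segment ℝ x y, ‖fderiv ℝ (fderiv ℝ F) z - fderiv ℝ (fderiv ℝ F) x‖ ≤ ω) :
    |F y - F x - fderiv ℝ F x (y - x) - 2⁻¹ * fderiv ℝ (fderiv ℝ F) x (y - x) (y - x)| ≤
      ω * ‖y - x‖ ^ 2 := by
  have hconv : Convex ℝ (segment ℝ x y) := convex_segment x y
  have hx : x ∈ segment ℝ x y := left_mem_segment ℝ x y
  have hy : y ∈ segment ℝ x y := right_mem_segment ℝ x y
  have hD1 : ContDiffOn ℝ 1 (fderiv ℝ F) U := hF.fderiv_of_isOpen hU (by norm_num)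
  have hd1 : ∀ z ∈ U, HasFDerivAt F (fderiv ℝ F z) z := fun z hz =>
    ((hF.differentiableOn (by norm_num)).differentiableAt (hU.mem_nhds hz)).hasFDerivAt
  have hd2 : ∀ z ∈ U, HasFDerivAt (fderiv ℝ F) (fderiv ℝ (fderiv ℝ F) z) z := fun z hz =>
    ((hD1.differentiableOn (by norm_num)).differentiableAt (hU.mem_nhds hz)).hasFDerivAt
  have hω0 : 0 ≤ ω := le_trans (norm_nonneg (fderiv ℝ (fderiv ℝ F) x - fderiv ℝ (fderiv ℝ F) x)) (hω x hx)
  have step1 : ∀ z ∈ segment ℝ x y,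
      ‖fderiv ℝ F z - fderiv ℝ F x - fderiv ℝ (fderiv ℝ F) x (z - x)‖ ≤ ω * ‖z - x‖ := fun z hz =>
    hconv.norm_image_sub_le_of_norm_hasFDerivWithin_le'
      (fun w hw => (hd2 w (hs hw)).hasFDerivWithinAt) hω hx hz
  have hsym : IsSymmSndFDerivAt ℝ F x :=
    (hF.contDiffAt (hU.mem_nhds (hs hx))).isSymmSndFDerivAt (by simp)
  set A := fderiv ℝ (fderiv ℝ F) x with hA
  have hG : ∀ z ∈ segment ℝ x y, HasFDerivWithinAt (fun z => F z - 2⁻¹ * A (z - x) (z - x))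
      (fderiv ℝ F z - A (z - x)) (segment ℝ x y) z := by
    intro z hz
    have h1 : HasFDerivAt (fun z => z - x) (ContinuousLinearMap.id ℝ E) z :=
      (hasFDerivAt_id z).sub_const x
    have h2 : HasFDerivAt (fun z => A (z - x)) (A.comp (ContinuousLinearMap.id ℝ E)) z :=
      A.hasFDerivAt.comp z h1
    have h3 := (hd1 z (hs hz)).sub ((h2.clm_apply h1).const_mul 2⁻¹)
    refine (h3.congr_fderiv ?_).hasFDerivWithinAt
    ext h
    have := hsym h (z - x)
    simp only [← hA, map_sub, sub_apply] at this
    simp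
    linarith
  have step2 := hconv.norm_image_sub_le_of_norm_hasFDerivWithin_le' hG
    (φ := fderiv ℝ F x) (C := ω * ‖y - x‖) (fun z hz => by
      have h1 := step1 z hz
      have h2 : ‖z - x‖ ≤ ‖y - x‖ := by
        have := norm_sub_le_of_mem_segment hz
        exact this
      rw [sub_right_comm]
      exact h1.trans (mul_le_mul_of_nonneg_left h2 hω0)) hx hy
  rw [Real.norm_eq_abs] at step2
  calc _ = |F y - 2⁻¹ * A (y - x) (y - x) - (F x - 2⁻¹ * A (x - x) (x - x)) - fderiv ℝ F x (y - x)| := by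
        congr 1; simp; ring
    _ ≤ _ := step2
    _ = _ := by ring

/-- If `G (s x) x = 0` for `s` near `1`, then differentiating in `s` gives `G' x x = 0`. For the
derivative `G` of a radially constant function, this removes the radial part of the Hessian. -/
lemma apply_self_eq_zero_of_radial {E : Type*} [NormedAddCommGroup E] [NormedSpace ℝ E]
    {G : E → E →L[ℝ] ℝ} {x : E} {G' : E →L[ℝ] E →L[ℝ] ℝ} (hG : HasFDerivAt G G' x)
    (h : ∀ᶠ s : ℝ in 𝓝 1, G (s • x) x = 0) : G' x x = 0 := by
  have hg : HasFDerivAt (fun z => G z x) ((ContinuousLinearMap.apply ℝ ℝ x).comp G') x :=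
    (ContinuousLinearMap.apply ℝ ℝ x).hasFDerivAt.comp x hG
  have h2 : HasDerivAt (fun s : ℝ => s • x) x 1 := by
    simpa using (hasDerivAt_id (1:ℝ)).smul_const x
  have h1 : HasDerivAt (fun s : ℝ => G (s • x) x) ((ContinuousLinearMap.apply ℝ ℝ x).comp G' x) 1 :=
    HasFDerivAt.comp_hasDerivAt_of_eq (1:ℝ) hg h2 (by simp)
  have h3 : HasDerivAt (fun s : ℝ => G (s • x) x) 0 1 :=
    (hasDerivAt_const (1:ℝ) (0:ℝ)).congr_of_eventuallyEq h
  exact h1.unique h3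

/-- Uniform continuity and boundedness on a compact set, in the form needed for a Taylor
remainder. -/
lemma exists_modulus {E G : Type*} [NormedAddCommGroup E] [NormedAddCommGroup G] {K : Set E}
    (hK : IsCompact K) {D : E → G} (hD : ContinuousOn D K) {η : ℝ} (hη : 0 < η) :
    ∃ δ > 0, ∃ C ≥ 0, ∀ x ∈ K, ∀ z ∈ K,
      (‖z - x‖ < δ → ‖D z - D x‖ ≤ η) ∧ ‖D z - D x‖ ≤ C := by
  obtain ⟨C0, hC0⟩ := hK.exists_bound_of_continuousOn hD
  obtain ⟨δ, hδ, hδK⟩ :=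
    Metric.uniformContinuousOn_iff.mp (hK.uniformContinuousOn_of_continuous hD) η hη
  refine ⟨δ, hδ, max (2 * C0) 0, le_max_right _ _, fun x hx z hz => ⟨fun h => ?_, ?_⟩⟩
  · rw [← dist_eq_norm] at h ⊢
    exact (hδK z hz x hx h).le
  · refine (norm_sub_le _ _).trans ((?_ : _ ≤ 2 * C0).trans (le_max_left _ _))
    linarith [hC0 x hx, hC0 z hz]

/-- Functions on the sphere with a twice continuously differentiable radial extension. -/
def IsC2 {d : ℕ} (f : Sph d → ℝ) : Prop := ContDiffOn ℝ 2 (radialExt f) {0}ᶜ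

lemma sphere_ne_zero {d : ℕ} (x : Sph d) : (x : EuclideanSpace ℝ (Fin (d + 1))) ≠ 0 := by
  intro h
  have := norm_eq_of_mem_sphere x
  rw [h] at this; simp at this

lemma radialExt_smul {d : ℕ} (f : Sph d → ℝ) (x : Sph d) {t : ℝ} (ht : 0 < t) :
    radialExt f (t • (x : EuclideanSpace ℝ (Fin (d + 1)))) = f x := by
  have hx : t • (x : EuclideanSpace ℝ (Fin (d + 1))) ≠ 0 := smul_ne_zero ht.ne' (sphere_ne_zero x)
  rw [radialExt, dif_pos hx]
  congr 1
  ext1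
  simp only [norm_smul, norm_eq_of_mem_sphere, Real.norm_eq_abs, abs_of_pos ht, mul_one, smul_smul,
    inv_mul_cancel₀ ht.ne', one_smul]

lemma radialExt_coe {d : ℕ} (f : Sph d → ℝ) (x : Sph d) :
    radialExt f (x : EuclideanSpace ℝ (Fin (d + 1))) = f x := by
  simpa using radialExt_smul f x one_pos

lemma radialExt_of_ne {d : ℕ} (f : Sph d → ℝ) {z : EuclideanSpace ℝ (Fin (d + 1))} (hz : z ≠ 0) :
    ∃ x : Sph d, (x : EuclideanSpace ℝ (Fin (d + 1))) = ‖z‖⁻¹ • z ∧ radialExt f z = f x := by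
  refine ⟨⟨‖z‖⁻¹ • z, by simp [norm_smul, hz]⟩, rfl, ?_⟩
  rw [radialExt, dif_pos hz]

namespace IsC2

variable {d : ℕ} {f : Sph d → ℝ}

lemma continuous (hf : IsC2 f) : Continuous f := by
  have h : f = fun x : Sph d => radialExt f x := by ext x; rw [radialExt_coe]
  rw [h]
  exact hf.continuousOn.comp_continuous continuous_subtype_val (fun x => sphere_ne_zero x)

lemma contDiffOn_fderiv (hf : IsC2 f) : ContDiffOn ℝ 1 (fderiv ℝ (radialExt f)) {0}ᶜ :=
  ContDiffOn.fderiv_of_isOpen hf isOpen_compl_singleton (by norm_num)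

lemma continuousOn_fderiv2 (hf : IsC2 f) :
    ContinuousOn (fderiv ℝ (fderiv ℝ (radialExt f))) {0}ᶜ :=
  hf.contDiffOn_fderiv.continuousOn_fderiv_of_isOpen isOpen_compl_singleton (by norm_num)

lemma differentiableAt (hf : IsC2 f) {z : EuclideanSpace ℝ (Fin (d + 1))} (hz : z ≠ 0) :
    DifferentiableAt ℝ (radialExt f) z :=
  (ContDiffOn.differentiableOn hf (by norm_num)).differentiableAt (isOpen_compl_singleton.mem_nhds hz)

lemma differentiableAt_fderiv (hf : IsC2 f) {z : EuclideanSpace ℝ (Fin (d + 1))} (hz : z ≠ 0) :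
    DifferentiableAt ℝ (fderiv ℝ (radialExt f)) z :=
  (hf.contDiffOn_fderiv.differentiableOn (by norm_num)).differentiableAt
    (isOpen_compl_singleton.mem_nhds hz)

/-- The derivative of the radial extension vanishes in the radial direction. -/
lemma fderiv_radial (hf : IsC2 f) (x : Sph d) {t : ℝ} (ht : 0 < t) :
    fderiv ℝ (radialExt f) (t • (x : EuclideanSpace ℝ (Fin (d + 1)))) x = 0 := by
  have h1 : HasDerivAt (fun s : ℝ => radialExt f (s • (x : EuclideanSpace ℝ (Fin (d + 1)))))
      (fderiv ℝ (radialExt f) (t • (x : EuclideanSpace ℝ (Fin (d + 1)))) x) t := by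
    have h2 : HasDerivAt (fun s : ℝ => s • (x : EuclideanSpace ℝ (Fin (d + 1)))) (x : EuclideanSpace ℝ (Fin (d + 1))) t := by
      simpa using (hasDerivAt_id t).smul_const (x : EuclideanSpace ℝ (Fin (d + 1)))
    exact (hf.differentiableAt (smul_ne_zero ht.ne' (sphere_ne_zero x))).hasFDerivAt.comp_hasDerivAt t h2
  have h3 : HasDerivAt (fun s : ℝ => radialExt f (s • (x : EuclideanSpace ℝ (Fin (d + 1))))) 0 t := by
    refine (hasDerivAt_const t (f x)).congr_of_eventuallyEq ?_
    filter_upwards [lt_mem_nhds ht] with s hs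
    exact radialExt_smul f x hs
  exact h1.unique h3

/-- The Hessian of the radial extension vanishes in the radial direction. -/
lemma fderiv2_radial (hf : IsC2 f) (x : Sph d) :
    fderiv ℝ (fderiv ℝ (radialExt f)) (x : EuclideanSpace ℝ (Fin (d + 1))) x x = 0 := by
  refine apply_self_eq_zero_of_radial (hf.differentiableAt_fderiv (sphere_ne_zero x)).hasFDerivAt ?_
  filter_upwards [lt_mem_nhds (zero_lt_one)] with s hs
  exact hf.fderiv_radial x hs

/-- A uniform second-order expansion at `x` over the half-sphere around `x`. -/
lemma exists_taylor (hf : IsC2 f) {η : ℝ} (hη : 0 < η) : ∃ C, 0 ≤ C ∧ ∀ x y : Sph d,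
    0 ≤ ⟪(x : EuclideanSpace ℝ (Fin (d + 1))), y⟫_ℝ →
    |f y - f x - fderiv ℝ (radialExt f) x ((y : EuclideanSpace ℝ (Fin (d + 1))) - x) -
      2⁻¹ * fderiv ℝ (fderiv ℝ (radialExt f)) x ((y : EuclideanSpace ℝ (Fin (d + 1))) - x)
        ((y : EuclideanSpace ℝ (Fin (d + 1))) - x)| ≤
      η * (1 - ⟪(x : EuclideanSpace ℝ (Fin (d + 1))), y⟫_ℝ) +
        C * (1 - ⟪(x : EuclideanSpace ℝ (Fin (d + 1))), y⟫_ℝ) ^ 2 := by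
  let K : Set (EuclideanSpace ℝ (Fin (d + 1))) := Metric.closedBall 0 1 \ Metric.ball 0 2⁻¹
  have hK : IsCompact K := (isCompact_closedBall _ _).diff Metric.isOpen_ball
  have hK0 : K ⊆ {0}ᶜ := by
    intro z hz h0
    apply hz.2
    rw [show z = 0 from h0]; simp
  have hcont := hf.continuousOn_fderiv2.mono hK0
  obtain ⟨δ, hδ, C0, hC00, hmod⟩ := exists_modulus
    (G := EuclideanSpace ℝ (Fin (d + 1)) →L[ℝ] EuclideanSpace ℝ (Fin (d + 1)) →L[ℝ] ℝ) hK hcont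
    (η := η / 2) (by positivity)
  have hseg : ∀ x y : Sph d, 0 ≤ ⟪(x : EuclideanSpace ℝ (Fin (d + 1))), y⟫_ℝ →
      segment ℝ (x : EuclideanSpace ℝ (Fin (d + 1))) y ⊆ K := by
    rintro x y hxy z ⟨a, b, ha, hb, hab, rfl⟩
    have hn : ‖a • (x : EuclideanSpace ℝ (Fin (d + 1))) + b • (y : EuclideanSpace ℝ (Fin (d + 1)))‖ ^ 2 =
        a ^ 2 + 2 * (a * b * ⟪(x : EuclideanSpace ℝ (Fin (d + 1))), y⟫_ℝ) + b ^ 2 := by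
      rw [norm_add_sq_real, inner_smul_left, inner_smul_right, norm_smul, norm_smul]
      simp; ring
    constructor
    · have := (convex_closedBall (0 : EuclideanSpace ℝ (Fin (d + 1))) 1)
      exact this (by simp) (by simp) ha hb hab
    · simp only [Metric.mem_ball, dist_zero_right, not_lt]
      by_contra hcon
      push Not at hcon
      have h1 : ‖a • (x : EuclideanSpace ℝ (Fin (d + 1))) + b • (y : EuclideanSpace ℝ (Fin (d + 1)))‖ ^ 2 < 2⁻¹ ^ 2 := by
        gcongr
      rw [hn] at h1
      have h2 : 0 ≤ a * b * ⟪(x : EuclideanSpace ℝ (Fin (d + 1))), y⟫_ℝ := by positivity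
      have : b = 1 - a := by linarith
      subst this
      nlinarith [sq_nonneg (a - 1/2)]
  refine ⟨4 * C0 / δ ^ 2, by positivity, fun x y hxy => ?_⟩
  have hs := hseg x y hxy
  have hxK : (x : EuclideanSpace ℝ (Fin (d + 1))) ∈ K := hs (left_mem_segment ℝ _ _)
  set u := 1 - ⟪(x : EuclideanSpace ℝ (Fin (d + 1))), y⟫_ℝ with hu
  have hsq := norm_sub_sq_sphere x y
  rw [← hu] at hsq
  have hu0 : 0 ≤ u := by nlinarith [sq_nonneg ‖(y : EuclideanSpace ℝ (Fin (d + 1))) - x‖]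
  rw [← radialExt_coe f y, ← radialExt_coe f x]
  by_cases hclose : ‖(y : EuclideanSpace ℝ (Fin (d + 1))) - x‖ < δ
  · have h := taylor_two_segment isOpen_compl_singleton hf (hs.trans hK0) (ω := η / 2) (fun z hz =>
      (hmod x hxK z (hs hz)).1 ((norm_sub_le_of_mem_segment hz).trans_lt hclose))
    refine h.trans ?_
    rw [hsq]
    have : 0 ≤ 4 * C0 / δ ^ 2 * u ^ 2 := by positivity
    linarith
  · push Not at hclose
    have h := taylor_two_segment isOpen_compl_singleton hf (hs.trans hK0) (ω := C0) (fun z hz =>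
      (hmod x hxK z (hs hz)).2)
    refine h.trans ?_
    have h3 : δ ^ 2 ≤ 2 * u := by rw [← hsq]; gcongr
    have h4 : C0 * ‖(y : EuclideanSpace ℝ (Fin (d + 1))) - x‖ ^ 2 ≤ 4 * C0 / δ ^ 2 * u ^ 2 := by
      rw [hsq, div_mul_eq_mul_div, le_div_iff₀ (by positivity)]
      nlinarith [mul_le_mul_of_nonneg_left h3 (mul_nonneg hC00 hu0)]
    have : 0 ≤ η * u := by positivity
    linarith

end IsC2

/-! ### Zonal operators and their bias -/

/-- The integral operator with kernel `k(1 - ⟪x, y⟫)`. -/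
def zonalOp {d : ℕ} (k : ℝ → ℝ) (g : Sph d → ℝ) (x : Sph d) : ℝ :=
  ∫ y : Sph d, k (1 - ⟪(x : EuclideanSpace ℝ (Fin (d + 1))), y⟫_ℝ) * g y ∂(surf d)

/-- The Laplacian of the radial extension, restricted to the sphere. -/
def lap {d : ℕ} (f : Sph d → ℝ) (x : Sph d) : ℝ :=
  Laplacian.laplacian (radialExt f) (x : EuclideanSpace ℝ (Fin (d + 1)))

lemma lap_eq_sum {d : ℕ} (f : Sph d → ℝ) (x : Sph d)
    (v : OrthonormalBasis (Fin (d + 1)) ℝ (EuclideanSpace ℝ (Fin (d + 1)))) :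
    lap f x = ∑ i, fderiv ℝ (fderiv ℝ (radialExt f)) x (v i) (v i) := by
  rw [lap, InnerProductSpace.laplacian_eq_iteratedFDeriv_orthonormalBasis _ v]
  simp [iteratedFDeriv_two_apply]

lemma IsC2.continuous_lap {d : ℕ} {f : Sph d → ℝ} (hf : IsC2 f) : Continuous (lap f) := by
  have h : lap f = fun x : Sph d => ∑ i, fderiv ℝ (fderiv ℝ (radialExt f)) x
      (EuclideanSpace.basisFun (Fin (d + 1)) ℝ i) (EuclideanSpace.basisFun (Fin (d + 1)) ℝ i) := by
    ext x; exact lap_eq_sum f x _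
  rw [h]
  have hc : Continuous fun x : Sph d => fderiv ℝ (fderiv ℝ (radialExt f))
      (x : EuclideanSpace ℝ (Fin (d + 1))) :=
    hf.continuousOn_fderiv2.comp_continuous continuous_subtype_val (fun x => sphere_ne_zero x)
  refine continuous_finsetSum _ fun i _ => ?_
  exact (hc.clm_apply continuous_const).clm_apply continuous_const

lemma exists_bound_of_continuous {d : ℕ} {g : Sph d → ℝ} (hg : Continuous g) :
    ∃ C, 0 ≤ C ∧ ∀ x, |g x| ≤ C := by
  obtain ⟨C, hC⟩ := isCompact_univ.exists_bound_of_continuousOn (f := g) hg.continuousOn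
  exact ⟨max C 0, le_max_right _ _, fun x => (hC x (mem_univ _)).trans (le_max_left _ _)⟩

lemma exists_basis_of_mem {d : ℕ} (x : Sph d) :
    ∃ v : OrthonormalBasis (Fin (d + 1)) ℝ (EuclideanSpace ℝ (Fin (d + 1))), v 0 = x := by
  obtain ⟨Φ, hΦ⟩ := exists_isometry_map (⟨EuclideanSpace.single 0 1, by simp⟩ : Sph d) x
  refine ⟨(EuclideanSpace.basisFun (Fin (d + 1)) ℝ).map Φ, ?_⟩
  simpa using hΦ

lemma one_sub_inner_mem {d : ℕ} (x y : Sph d) :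
    1 - ⟪(x : EuclideanSpace ℝ (Fin (d + 1))), y⟫_ℝ ∈ Icc (0:ℝ) 2 := by
  have h := abs_real_inner_le_norm (x : EuclideanSpace ℝ (Fin (d + 1))) y
  simp only [norm_eq_of_mem_sphere, mul_one] at h
  obtain ⟨h1, h2⟩ := abs_le.mp h
  constructor <;> linarith

/-- A kernel concentrated on the half-sphere around `x` acts on a `C²` function like a multiple of
the Laplacian, up to an error controlled by the moments of the kernel. -/
lemma IsC2.exists_near_bias {d : ℕ} (hd : 1 ≤ d) {f : Sph d → ℝ} (hf : IsC2 f) {η : ℝ} (hη : 0 < η) :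
    ∃ C, 0 ≤ C ∧ ∀ (k : ℝ → ℝ) (B : ℝ), Measurable k → (∀ u, 0 ≤ k u) → (∀ u, k u ≤ B) →
      (∀ u, 1 < u → k u = 0) → ∀ x : Sph d,
      |zonalOp k f x - (∫ u, k u ∂(nu d)) * f x -
        (2 * d : ℝ)⁻¹ * (∫ u, k u * (u * (2 - u)) ∂(nu d)) * lap f x| ≤
      η * (∫ u, k u * u ∂(nu d)) + C * ∫ u, k u * u ^ 2 ∂(nu d) := by
  obtain ⟨C, hC0, hC⟩ := hf.exists_taylor hη
  refine ⟨C, hC0, fun k B hk hk0 hkB hk1 x => ?_⟩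
  have hB : ∀ u, |k u| ≤ B := fun u => by rw [abs_of_nonneg (hk0 u)]; exact hkB u
  obtain ⟨v, hv⟩ := exists_basis_of_mem x
  set ℓ := fderiv ℝ (radialExt f) (x : EuclideanSpace ℝ (Fin (d + 1))) with hℓ
  set A := fderiv ℝ (fderiv ℝ (radialExt f)) (x : EuclideanSpace ℝ (Fin (d + 1))) with hA
  have hℓ0 : ℓ x = 0 := by
    have := hf.fderiv_radial x one_pos
    rwa [one_smul] at this
  have e1 := integral_zonal_linear k x ℓ hℓ0
  have e2 := integral_zonal_quadratic hd hk hB x A (hf.fderiv2_radial x) v hv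
  rw [hA, ← lap_eq_sum f x v, ← hA] at e2
  have e3 := integral_zonal hd x hk
  have i0 := integrable_zonal_mul hk hB x hf.continuous
  have i1 := integrable_zonal_mul hk hB x (g := fun y : Sph d => ℓ (y - x)) (by fun_prop)
  have i2 := integrable_zonal_mul hk hB x (g := fun y : Sph d => A (y - x) (y - x)) (by
    exact (A.continuous.comp (by fun_prop)).clm_apply (by fun_prop))
  have i3 := integrable_zonal_mul hk hB x (g := fun y : Sph d => f x) continuous_const
  have e4 : ∫ y : Sph d, k (1 - ⟪(x : EuclideanSpace ℝ (Fin (d + 1))), y⟫_ℝ) *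
      (f y - f x - ℓ (y - x) - 2⁻¹ * A (y - x) (y - x)) ∂(surf d) =
      zonalOp k f x - (∫ u, k u ∂(nu d)) * f x -
        (2 * d : ℝ)⁻¹ * (∫ u, k u * (u * (2 - u)) ∂(nu d)) * lap f x := by
    have : ∀ y : Sph d, k (1 - ⟪(x : EuclideanSpace ℝ (Fin (d + 1))), y⟫_ℝ) *
      (f y - f x - ℓ (y - x) - 2⁻¹ * A (y - x) (y - x)) =
      k (1 - ⟪(x : EuclideanSpace ℝ (Fin (d + 1))), y⟫_ℝ) * f y -
      k (1 - ⟪(x : EuclideanSpace ℝ (Fin (d + 1))), y⟫_ℝ) * f x -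
      k (1 - ⟪(x : EuclideanSpace ℝ (Fin (d + 1))), y⟫_ℝ) * ℓ (y - x) -
      2⁻¹ * (k (1 - ⟪(x : EuclideanSpace ℝ (Fin (d + 1))), y⟫_ℝ) * A (y - x) (y - x)) := by
      intro y; ring
    simp_rw [this]
    have j1 : Integrable (fun y : Sph d =>
        k (1 - ⟪(x : EuclideanSpace ℝ (Fin (d + 1))), y⟫_ℝ) * f y -
        k (1 - ⟪(x : EuclideanSpace ℝ (Fin (d + 1))), y⟫_ℝ) * f x) (surf d) := i0.sub i3
    have j2 : Integrable (fun y : Sph d =>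
        k (1 - ⟪(x : EuclideanSpace ℝ (Fin (d + 1))), y⟫_ℝ) * f y -
        k (1 - ⟪(x : EuclideanSpace ℝ (Fin (d + 1))), y⟫_ℝ) * f x -
        k (1 - ⟪(x : EuclideanSpace ℝ (Fin (d + 1))), y⟫_ℝ) * ℓ (y - x)) (surf d) := j1.sub i1
    rw [integral_sub j2 (i2.const_mul _), integral_sub j1 i1,
      integral_sub i0 i3, integral_const_mul, e1, e2, integral_mul_const, e3, zonalOp, mul_inv]
    ring
  rw [← e4]
  have im : ∀ g : ℝ → ℝ, Continuous g → Integrable (fun y : Sph d =>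
      k (1 - ⟪(x : EuclideanSpace ℝ (Fin (d + 1))), y⟫_ℝ) *
        g (1 - ⟪(x : EuclideanSpace ℝ (Fin (d + 1))), y⟫_ℝ)) (surf d) := fun g hg =>
    integrable_zonal_mul hk hB x (g := fun y : Sph d => g (1 - ⟪(x : EuclideanSpace ℝ (Fin (d + 1))), y⟫_ℝ))
      (by fun_prop)
  have e5 : ∫ y : Sph d, k (1 - ⟪(x : EuclideanSpace ℝ (Fin (d + 1))), y⟫_ℝ) *
      (η * (1 - ⟪(x : EuclideanSpace ℝ (Fin (d + 1))), y⟫_ℝ) +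
        C * (1 - ⟪(x : EuclideanSpace ℝ (Fin (d + 1))), y⟫_ℝ) ^ 2) ∂(surf d) =
      η * (∫ u, k u * u ∂(nu d)) + C * ∫ u, k u * u ^ 2 ∂(nu d) := by
    have a1 := integral_zonal hd x (k := fun u => k u * u) (by fun_prop)
    have a2 := integral_zonal hd x (k := fun u => k u * u ^ 2) (by fun_prop)
    rw [← a1, ← a2, ← integral_const_mul, ← integral_const_mul, ← integral_add]
    · congr 1; ext y; ring
    · exact (im (fun u => u) continuous_id).const_mul _
    · exact (im (fun u => u ^ 2) (by fun_prop)).const_mul _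
  rw [← e5]
  refine (abs_integral_le_integral_abs).trans (integral_mono_of_nonneg (ae_of_all _ fun y => abs_nonneg _)
    (im (fun u => η * u + C * u ^ 2) (by fun_prop)) (ae_of_all _ fun y => ?_))
  simp only
  rw [abs_mul, abs_of_nonneg (hk0 _)]
  by_cases hy : 0 ≤ ⟪(x : EuclideanSpace ℝ (Fin (d + 1))), y⟫_ℝ
  · exact mul_le_mul_of_nonneg_left (hC x y hy) (hk0 _)
  · rw [hk1 _ (by push Not at hy; linarith)]; simp

lemma coe_neg_sph {d : ℕ} (x : Sph d) :
    ((-x : Sph d) : EuclideanSpace ℝ (Fin (d + 1))) = -(x : EuclideanSpace ℝ (Fin (d + 1))) := rfl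

lemma IsC2.comp_neg {d : ℕ} {f : Sph d → ℝ} (hf : IsC2 f) : IsC2 (fun x => f (-x)) := by
  have h : radialExt (fun x => f (-x)) = fun z => radialExt f (-z) := by
    ext z
    by_cases hz : z = 0
    · simp [radialExt, hz]
    · rw [radialExt, radialExt, dif_pos hz, dif_pos (neg_ne_zero.mpr hz)]
      congr 1
      ext1
      rw [coe_neg_sph]
      simp
  unfold IsC2
  rw [h]
  refine ContDiffOn.comp hf contDiff_neg.contDiffOn ?_
  intro z hz
  simpa using hz

lemma integral_comp_neg_sph {d : ℕ} (g : Sph d → ℝ) :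
    ∫ y, g (-y) ∂(surf d) = ∫ y, g y ∂(surf d) :=
  integral_comp_isometry (LinearIsometryEquiv.neg ℝ) g

/-- The measure `nu d` is invariant under `u ↦ 2 - u`, which corresponds to the antipodal map. -/
lemma integral_nu_reflect {d : ℕ} (hd : 1 ≤ d) {k : ℝ → ℝ} (hk : Measurable k) :
    ∫ u, k (2 - u) ∂(nu d) = ∫ u, k u ∂(nu d) := by
  let x : Sph d := ⟨EuclideanSpace.single 0 1, by simp⟩
  rw [← integral_zonal hd (-x) hk, ← integral_zonal hd x (k := fun u => k (2 - u)) (by fun_prop)]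
  congr 1
  ext y
  rw [coe_neg_sph, inner_neg_left]
  congr 1; ring

/-- Reflecting both the kernel and the function leaves a zonal operator unchanged; the mass of a
kernel near the antipode is thereby moved to the origin. -/
lemma zonalOp_reflect {d : ℕ} (k : ℝ → ℝ) (f : Sph d → ℝ) (x : Sph d) :
    zonalOp (fun u => k (2 - u)) (fun y => f (-y)) x = zonalOp k f x := by
  unfold zonalOp
  rw [← integral_comp_neg_sph (fun y : Sph d =>
    k (1 - ⟪(x : EuclideanSpace ℝ (Fin (d + 1))), y⟫_ℝ) * f y)]
  congr 1
  ext y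
  rw [coe_neg_sph, inner_neg_right]
  congr 2; ring_nf

/-- The part of a zonal kernel on the closed half-sphere around the base point. -/
def near (k : ℝ → ℝ) : ℝ → ℝ := (Iic (1:ℝ)).indicator k

/-- The part of a zonal kernel on the open half-sphere opposite to the base point. -/
def far (k : ℝ → ℝ) : ℝ → ℝ := (Ioi (1:ℝ)).indicator k

lemma near_add_far (k : ℝ → ℝ) (u : ℝ) : near k u + far k u = k u := by
  rcases le_or_gt u 1 with h | h
  · simp [near, far, h, not_lt.mpr h]
  · simp [near, far, h, not_le.mpr h]

/-- Nonnegative bounded measurable kernels. -/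
structure IsKer (k : ℝ → ℝ) (B : ℝ) : Prop where
  meas : Measurable k
  nonneg : ∀ u, 0 ≤ k u
  le : ∀ u, k u ≤ B

namespace IsKer

variable {k : ℝ → ℝ} {B : ℝ}

lemma abs_le (hk : IsKer k B) (u : ℝ) : |k u| ≤ B := by
  rw [abs_of_nonneg (hk.nonneg u)]; exact hk.le u

lemma bound_nonneg (hk : IsKer k B) : 0 ≤ B := (hk.nonneg 0).trans (hk.le 0)

lemma indicator (hk : IsKer k B) {s : Set ℝ} (hs : MeasurableSet s) : IsKer (s.indicator k) B where
  meas := hk.meas.indicator hs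
  nonneg u := indicator_nonneg (fun u _ => hk.nonneg u) u
  le u := indicator_apply_le' (fun _ => hk.le u) (fun _ => hk.bound_nonneg)

lemma near (hk : IsKer k B) : IsKer (near k) B := hk.indicator measurableSet_Iic

lemma far (hk : IsKer k B) : IsKer (far k) B := hk.indicator measurableSet_Ioi

lemma reflect (hk : IsKer k B) : IsKer (fun u => k (2 - u)) B where
  meas := hk.meas.comp (by fun_prop)
  nonneg u := hk.nonneg _
  le u := hk.le _

lemma integrable_mul (hk : IsKer k B) {d : ℕ} (hd : 1 ≤ d) {g : ℝ → ℝ} (hg : Continuous g) :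
    Integrable (fun u => k u * g u) (nu d) := by
  have := isFiniteMeasure_nu hd
  obtain ⟨C, hC⟩ := (isCompact_Icc (a := (0:ℝ)) (b := 2)).exists_bound_of_continuousOn hg.continuousOn
  refine Integrable.of_bound (C := B * C) (hk.meas.mul hg.measurable).aestronglyMeasurable ?_
  filter_upwards [nu_ae_mem d] with u hu
  rw [norm_mul]
  exact mul_le_mul (hk.abs_le u) (hC u ⟨hu.1.le, hu.2.le⟩) (norm_nonneg _) hk.bound_nonneg

lemma integrable (hk : IsKer k B) {d : ℕ} (hd : 1 ≤ d) : Integrable k (nu d) := by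
  simpa using hk.integrable_mul hd (g := fun _ => 1) continuous_const

lemma integral_near_add_far (hk : IsKer k B) {d : ℕ} (hd : 1 ≤ d) :
    ∫ u, SphereKDE.near k u ∂(nu d) + ∫ u, SphereKDE.far k u ∂(nu d) = ∫ u, k u ∂(nu d) := by
  rw [← integral_add (hk.near.integrable hd) (hk.far.integrable hd)]
  simp_rw [near_add_far]

end IsKer

/-- The bias of a zonal operator: the half-sphere around `x` contributes a multiple of the
Laplacian, the opposite half-sphere contributes a multiple of `f (-x) - f x`. -/
lemma IsC2.exists_bias {d : ℕ} (hd : 1 ≤ d) {f : Sph d → ℝ} (hf : IsC2 f) {η : ℝ} (hη : 0 < η) :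
    ∃ C, 0 ≤ C ∧ ∀ (k : ℝ → ℝ) (B : ℝ), IsKer k B → ∀ x : Sph d,
      |zonalOp k f x - (∫ u, k u ∂(nu d)) * f x -
        (2 * d : ℝ)⁻¹ * (∫ u, near k u * (u * (2 - u)) ∂(nu d)) * lap f x -
        (∫ u, far k u ∂(nu d)) * (f (-x) - f x)| ≤
      η * (∫ u, near k u * u ∂(nu d)) +
        C * (∫ u, near k u * u ^ 2 ∂(nu d) + ∫ u, far k u * (2 - u) ∂(nu d)) := by
  obtain ⟨C1, hC1, h1⟩ := hf.exists_near_bias hd hη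
  obtain ⟨C2, hC2, h2⟩ := hf.comp_neg.exists_near_bias hd one_pos
  obtain ⟨C3, hC3, h3⟩ := exists_bound_of_continuous hf.comp_neg.continuous_lap
  refine ⟨C1 + (C3 + 1 + C2), by positivity, fun k B hk x => ?_⟩
  have hd0 : (1:ℝ) ≤ d := by exact_mod_cast hd
  have a1 := h1 (near k) B hk.near.meas hk.near.nonneg hk.near.le
    (fun u hu => by simp [near, hu]) x
  have a2 := h2 (fun u => far k (2 - u)) B hk.far.reflect.meas hk.far.reflect.nonneg hk.far.reflect.le
    (fun u hu => indicator_of_notMem (by simp; linarith) _) x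
  rw [zonalOp_reflect (far k) f x, integral_nu_reflect hd hk.far.meas] at a2
  have e1 : ∫ u, far k (2 - u) * (u * (2 - u)) ∂(nu d) = ∫ u, far k u * (u * (2 - u)) ∂(nu d) := by
    rw [← integral_nu_reflect hd (k := fun u => far k u * (u * (2 - u)))
      (hk.far.meas.mul (by fun_prop))]
    congr 1; ext u; ring
  have e2 : ∫ u, far k (2 - u) * u ∂(nu d) = ∫ u, far k u * (2 - u) ∂(nu d) := by
    rw [← integral_nu_reflect hd (k := fun u => far k u * (2 - u)) (hk.far.meas.mul (by fun_prop))]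
    congr 1; ext u; ring
  have e3 : ∫ u, far k (2 - u) * u ^ 2 ∂(nu d) = ∫ u, far k u * (2 - u) ^ 2 ∂(nu d) := by
    rw [← integral_nu_reflect hd (k := fun u => far k u * (2 - u) ^ 2) (hk.far.meas.mul (by fun_prop))]
    congr 1; ext u; ring
  rw [e1, e2, e3] at a2
  set m := ∫ u, far k u * (2 - u) ∂(nu d) with hm
  have im := hk.far.integrable_mul hd (g := fun u => 2 - u) (by fun_prop)
  have m0 : 0 ≤ m := integral_nonneg_of_ae (by
    filter_upwards [nu_ae_mem d] with u hu
    exact mul_nonneg (hk.far.nonneg u) (by linarith [hu.2]))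
  have f1 : |∫ u, far k u * (u * (2 - u)) ∂(nu d)| ≤ 2 * m := by
    rw [hm, ← integral_const_mul]
    refine (abs_integral_le_integral_abs).trans (integral_mono_of_nonneg
      (ae_of_all _ fun y => abs_nonneg _) (im.const_mul 2) ?_)
    filter_upwards [nu_ae_mem d] with u hu
    have : 0 ≤ far k u * (2 - u) := mul_nonneg (hk.far.nonneg u) (by linarith [hu.2])
    have h4 : far k u * (u * (2 - u)) = (far k u * (2 - u)) * u := by ring
    rw [h4, abs_mul, abs_of_nonneg this, abs_of_pos hu.1]
    nlinarith [hu.2]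
  have f2 : ∫ u, far k u * (2 - u) ^ 2 ∂(nu d) ≤ m := by
    refine integral_mono_of_nonneg (ae_of_all _ fun u => mul_nonneg (hk.far.nonneg u) (sq_nonneg _)) im ?_
    filter_upwards [nu_ae_mem d] with u hu2
    by_cases hu : 1 < u
    · exact mul_le_mul_of_nonneg_left (by nlinarith [hu2.2]) (hk.far.nonneg u)
    · simp [far, hu]
  have n2 : 0 ≤ ∫ u, near k u * u ^ 2 ∂(nu d) :=
    integral_nonneg fun u => mul_nonneg (hk.near.nonneg u) (sq_nonneg _)
  have hz : zonalOp k f x = zonalOp (near k) f x + zonalOp (far k) f x := by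
    unfold zonalOp
    rw [← integral_add (integrable_zonal_mul hk.near.meas hk.near.abs_le x hf.continuous)
      (integrable_zonal_mul hk.far.meas hk.far.abs_le x hf.continuous)]
    congr 1; ext y; rw [← add_mul, near_add_far]
  have hi := hk.integral_near_add_far hd
  have g1 : |(2 * d : ℝ)⁻¹ * (∫ u, far k u * (u * (2 - u)) ∂(nu d)) * lap (fun x => f (-x)) x| ≤
      C3 * m := by
    rw [abs_mul, abs_mul, abs_of_nonneg (by positivity : (0:ℝ) ≤ (2 * d : ℝ)⁻¹)]
    have : (2 * d : ℝ)⁻¹ * |∫ u, far k u * (u * (2 - u)) ∂(nu d)| ≤ m := by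
      rw [inv_mul_le_iff₀ (by positivity)]
      nlinarith
    calc _ ≤ m * C3 := mul_le_mul this (h3 x) (abs_nonneg _) m0
      _ = _ := mul_comm _ _
  have key : |zonalOp (far k) f x - (∫ u, far k u ∂(nu d)) * f (-x)| ≤ (C3 + 1 + C2) * m := by
    have : zonalOp (far k) f x - (∫ u, far k u ∂(nu d)) * f (-x) =
      (zonalOp (far k) f x - (∫ u, far k u ∂(nu d)) * f (-x) -
        (2 * d : ℝ)⁻¹ * (∫ u, far k u * (u * (2 - u)) ∂(nu d)) * lap (fun x => f (-x)) x) +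
      (2 * d : ℝ)⁻¹ * (∫ u, far k u * (u * (2 - u)) ∂(nu d)) * lap (fun x => f (-x)) x := by ring
    rw [this]
    refine (abs_add_le _ _).trans ?_
    have := mul_le_mul_of_nonneg_left f2 hC2
    linarith
  have dec : zonalOp k f x - (∫ u, k u ∂(nu d)) * f x -
        (2 * d : ℝ)⁻¹ * (∫ u, near k u * (u * (2 - u)) ∂(nu d)) * lap f x -
        (∫ u, far k u ∂(nu d)) * (f (-x) - f x) =
      (zonalOp (near k) f x - (∫ u, near k u ∂(nu d)) * f x -
        (2 * d : ℝ)⁻¹ * (∫ u, near k u * (u * (2 - u)) ∂(nu d)) * lap f x) +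
      (zonalOp (far k) f x - (∫ u, far k u ∂(nu d)) * f (-x)) := by
    rw [hz, ← hi]; ring
  rw [dec]
  refine (abs_add_le _ _).trans ?_
  have s1 : 0 ≤ (C3 + 1 + C2) * ∫ u, near k u * u ^ 2 ∂(nu d) := by positivity
  have s2 : 0 ≤ C1 * m := by positivity
  linarith

/-! ### Symmetry and positivity of zonal operators -/

/-- Bounded measurable functions on the sphere. -/
structure IsBM {d : ℕ} (g : Sph d → ℝ) : Prop where
  meas : Measurable g
  bdd : ∃ C, 0 ≤ C ∧ ∀ x, |g x| ≤ C

lemma isBM_of_continuous {d : ℕ} {g : Sph d → ℝ} (hg : Continuous g) : IsBM g :=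
  ⟨hg.measurable, exists_bound_of_continuous hg⟩

namespace IsBM

variable {d : ℕ} {g h : Sph d → ℝ}

lemma add (hg : IsBM g) (hh : IsBM h) : IsBM (fun x => g x + h x) := by
  obtain ⟨C, hC, h1⟩ := hg.bdd
  obtain ⟨C', hC', h2⟩ := hh.bdd
  exact ⟨hg.meas.add hh.meas, C + C', by positivity, fun x => (abs_add_le _ _).trans
    (add_le_add (h1 x) (h2 x))⟩

lemma mul (hg : IsBM g) (hh : IsBM h) : IsBM (fun x => g x * h x) := by
  obtain ⟨C, hC, h1⟩ := hg.bdd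
  obtain ⟨C', hC', h2⟩ := hh.bdd
  refine ⟨hg.meas.mul hh.meas, C * C', by positivity, fun x => ?_⟩
  rw [abs_mul]
  exact mul_le_mul (h1 x) (h2 x) (abs_nonneg _) hC

lemma const (c : ℝ) : IsBM (fun _ : Sph d => c) := isBM_of_continuous continuous_const

lemma const_mul (hg : IsBM g) (c : ℝ) : IsBM (fun x => c * g x) := (const c).mul hg

lemma sub (hg : IsBM g) (hh : IsBM h) : IsBM (fun x => g x - h x) := by
  simpa [sub_eq_add_neg] using hg.add (hh.const_mul (-1))

lemma sq (hg : IsBM g) : IsBM (fun x => g x ^ 2) := by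
  simpa [pow_two] using hg.mul hg

lemma integrable (hg : IsBM g) : Integrable g (surf d) := by
  obtain ⟨C, hC, h1⟩ := hg.bdd
  exact Integrable.of_bound hg.meas.aestronglyMeasurable C (ae_of_all _ h1)

lemma comp_neg (hg : IsBM g) : IsBM (fun x => g (-x)) := by
  obtain ⟨C, hC, h1⟩ := hg.bdd
  exact ⟨hg.meas.comp continuous_neg.measurable, C, hC, fun x => h1 _⟩

end IsBM

lemma measurable_kernel {d : ℕ} {k : ℝ → ℝ} (hk : Measurable k) : Measurable (fun p : Sph d × Sph d =>
    k (1 - ⟪(p.1 : EuclideanSpace ℝ (Fin (d + 1))), p.2⟫_ℝ)) := by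
  apply hk.comp
  apply Continuous.measurable
  fun_prop

lemma IsKer.integrable_prod {k : ℝ → ℝ} {B : ℝ} (hk : IsKer k B) {d : ℕ}
    {G : Sph d × Sph d → ℝ} (hG : Measurable G) {C : ℝ} (hC : ∀ p, |G p| ≤ C) :
    Integrable (fun p : Sph d × Sph d =>
      k (1 - ⟪(p.1 : EuclideanSpace ℝ (Fin (d + 1))), p.2⟫_ℝ) * G p) ((surf d).prod (surf d)) := by
  refine Integrable.of_bound (C := B * C) ((measurable_kernel hk.meas).mul hG).aestronglyMeasurable
    (ae_of_all _ fun p => ?_)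
  rw [norm_mul]
  exact mul_le_mul (hk.abs_le _) (hC p) (norm_nonneg _) hk.bound_nonneg

lemma IsKer.integrable_zonal_mul {k : ℝ → ℝ} {B : ℝ} (hk : IsKer k B) {d : ℕ} (x : Sph d)
    {g : Sph d → ℝ} (hg : IsBM g) : Integrable (fun y : Sph d =>
      k (1 - ⟪(x : EuclideanSpace ℝ (Fin (d + 1))), y⟫_ℝ) * g y) (surf d) := by
  obtain ⟨C, hC, h1⟩ := hg.bdd
  refine Integrable.of_bound (C := B * C)
    ((hk.meas.comp (measurable_zonal x)).mul hg.meas).aestronglyMeasurable (ae_of_all _ fun p => ?_)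
  rw [norm_mul]
  exact mul_le_mul (hk.abs_le _) (h1 p) (norm_nonneg _) hk.bound_nonneg

section

variable {d : ℕ} {k : ℝ → ℝ} {B : ℝ} {g h : Sph d → ℝ}

lemma IsKer.integral_nonneg (hk : IsKer k B) : 0 ≤ ∫ u, k u ∂(nu d) :=
  MeasureTheory.integral_nonneg hk.nonneg

lemma abs_zonalOp_le (hd : 1 ≤ d) (hk : IsKer k B) {C : ℝ} (hC : ∀ x, |g x| ≤ C) (x : Sph d) :
    |zonalOp k g x| ≤ (∫ u, k u ∂(nu d)) * C := by
  rw [← integral_zonal hd x hk.meas, ← integral_mul_const]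
  refine abs_integral_le_integral_abs.trans (integral_mono_of_nonneg (ae_of_all _ fun y => abs_nonneg _)
    ?_ (ae_of_all _ fun y => ?_))
  · exact hk.integrable_zonal_mul x (IsBM.const C)
  · simp only
    rw [abs_mul, abs_of_nonneg (hk.nonneg _)]
    exact mul_le_mul_of_nonneg_left (hC y) (hk.nonneg _)

lemma IsBM.zonalOp (hg : IsBM g) (hd : 1 ≤ d) (hk : IsKer k B) : IsBM (zonalOp k g) := by
  obtain ⟨C, hC, h1⟩ := hg.bdd
  refine ⟨?_, (∫ u, k u ∂(nu d)) * C, mul_nonneg hk.integral_nonneg hC,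
    fun x => abs_zonalOp_le hd hk h1 x⟩
  have : StronglyMeasurable (fun p : Sph d × Sph d =>
      k (1 - ⟪(p.1 : EuclideanSpace ℝ (Fin (d + 1))), p.2⟫_ℝ) * g p.2) :=
    ((measurable_kernel hk.meas).mul (hg.meas.comp measurable_snd)).stronglyMeasurable
  exact this.integral_prod_right'.measurable

lemma zonalOp_sub (hk : IsKer k B) (hg : IsBM g) (hh : IsBM h) (x : Sph d) :
    zonalOp k (fun y => g y - h y) x = zonalOp k g x - zonalOp k h x := by
  unfold zonalOp
  rw [← integral_sub (hk.integrable_zonal_mul x hg) (hk.integrable_zonal_mul x hh)]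
  simp_rw [mul_sub]

lemma zonalOp_const (hd : 1 ≤ d) (hk : Measurable k) (c : ℝ) (x : Sph d) :
    zonalOp k (fun _ => c) x = (∫ u, k u ∂(nu d)) * c := by
  unfold zonalOp
  rw [integral_mul_const, integral_zonal hd x hk]

lemma zonalOp_neg (k : ℝ → ℝ) (g : Sph d → ℝ) (x : Sph d) :
    zonalOp k (fun y => g (-y)) x = zonalOp k g (-x) := by
  unfold zonalOp
  rw [← integral_comp_neg_sph (fun y : Sph d =>
    k (1 - ⟪((-x : Sph d) : EuclideanSpace ℝ (Fin (d + 1))), y⟫_ℝ) * g y)]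
  simp

/-- Zonal operators are self-adjoint. -/
lemma integral_mul_zonalOp (hk : IsKer k B) (hg : IsBM g) (hh : IsBM h) :
    ∫ x, g x * zonalOp k h x ∂(surf d) = ∫ x, zonalOp k g x * h x ∂(surf d) := by
  obtain ⟨C, hC, h1⟩ := hg.bdd
  obtain ⟨C', hC', h2⟩ := hh.bdd
  have hi := hk.integrable_prod (d := d) (G := fun p => g p.1 * h p.2)
    ((hg.meas.comp measurable_fst).mul (hh.meas.comp measurable_snd)) (C := C * C') (fun p => by
      rw [abs_mul]; exact mul_le_mul (h1 _) (h2 _) (abs_nonneg _) hC)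
  unfold zonalOp
  simp_rw [← integral_const_mul, ← integral_mul_const]
  rw [integral_integral_swap]
  · congr 1; ext x; congr 1; ext y
    rw [real_inner_comm]; ring
  · convert hi using 1
    ext p; simp only [Function.uncurry]; ring

/-- The Dirichlet form of a zonal kernel. -/
lemma dirichlet_form (hd : 1 ≤ d) (hk : IsKer k B) (hg : IsBM g) :
    ∫ x, ∫ y : Sph d, k (1 - ⟪(x : EuclideanSpace ℝ (Fin (d + 1))), y⟫_ℝ) * (g x - g y) ^ 2
      ∂(surf d) ∂(surf d) =
      2 * ((∫ u, k u ∂(nu d)) * ∫ x, g x ^ 2 ∂(surf d) - ∫ x, g x * zonalOp k g x ∂(surf d)) := by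
  have e1 : ∀ x : Sph d, ∫ y : Sph d, k (1 - ⟪(x : EuclideanSpace ℝ (Fin (d + 1))), y⟫_ℝ) *
      (g x - g y) ^ 2 ∂(surf d) = (∫ u, k u ∂(nu d)) * g x ^ 2 - 2 * (g x * zonalOp k g x) +
      zonalOp k (fun y => g y ^ 2) x := by
    intro x
    have i1 := hk.integrable_zonal_mul x (IsBM.const (g x ^ 2))
    have i2 := (hk.integrable_zonal_mul x hg).const_mul (2 * g x)
    have i3 := hk.integrable_zonal_mul x hg.sq
    have : ∀ y : Sph d, k (1 - ⟪(x : EuclideanSpace ℝ (Fin (d + 1))), y⟫_ℝ) * (g x - g y) ^ 2 =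
      k (1 - ⟪(x : EuclideanSpace ℝ (Fin (d + 1))), y⟫_ℝ) * g x ^ 2 -
      2 * g x * (k (1 - ⟪(x : EuclideanSpace ℝ (Fin (d + 1))), y⟫_ℝ) * g y) +
      k (1 - ⟪(x : EuclideanSpace ℝ (Fin (d + 1))), y⟫_ℝ) * g y ^ 2 := fun y => by ring
    simp_rw [this]
    have i12 : Integrable (fun y : Sph d =>
      k (1 - ⟪(x : EuclideanSpace ℝ (Fin (d + 1))), y⟫_ℝ) * g x ^ 2 -
      2 * g x * (k (1 - ⟪(x : EuclideanSpace ℝ (Fin (d + 1))), y⟫_ℝ) * g y)) (surf d) := i1.sub i2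
    rw [integral_add i12 i3, integral_sub i1 i2, integral_mul_const, integral_const_mul,
      integral_zonal hd x hk.meas]
    unfold zonalOp
    ring
  simp_rw [e1]
  have j1 := (hg.sq.const_mul (∫ u, k u ∂(nu d))).integrable
  have j2 := ((hg.mul (hg.zonalOp hd hk)).const_mul 2).integrable
  have j3 := (hg.sq.zonalOp hd hk).integrable
  have j12 : Integrable (fun x => (∫ u, k u ∂(nu d)) * g x ^ 2 - 2 * (g x * zonalOp k g x)) (surf d) :=
    j1.sub j2
  rw [integral_add j12 j3, integral_sub j1 j2, integral_const_mul, integral_const_mul]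
  have e3 : ∫ x, zonalOp k (fun y => g y ^ 2) x ∂(surf d) =
      (∫ u, k u ∂(nu d)) * ∫ x, g x ^ 2 ∂(surf d) := by
    have := integral_mul_zonalOp hk (IsBM.const (d := d) 1) hg.sq
    simp only [one_mul, zonalOp_const hd hk.meas, mul_one] at this
    rw [this, integral_const_mul]
  rw [e3]; ring

/-- Zonal operators with a nonnegative kernel of mass `m` have quadratic form at most `m ∫ g²`,
because the Dirichlet form is nonnegative. -/
lemma integral_mul_zonalOp_le (hd : 1 ≤ d) (hk : IsKer k B) (hg : IsBM g) :
    ∫ x, g x * zonalOp k g x ∂(surf d) ≤ (∫ u, k u ∂(nu d)) * ∫ x, g x ^ 2 ∂(surf d) := by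
  have h1 := dirichlet_form hd hk hg
  have h2 : 0 ≤ ∫ x, ∫ y : Sph d, k (1 - ⟪(x : EuclideanSpace ℝ (Fin (d + 1))), y⟫_ℝ) *
      (g x - g y) ^ 2 ∂(surf d) ∂(surf d) :=
    MeasureTheory.integral_nonneg fun x => MeasureTheory.integral_nonneg fun y =>
      mul_nonneg (hk.nonneg _) (sq_nonneg _)
  linarith

/-- The bias of a zonal operator is nonnegatively correlated with `f (-x) - f x`, because the
operator commutes with the antipodal map. -/
lemma integral_bias_mul_antipodal_nonneg (hd : 1 ≤ d) (hk : IsKer k B) (hg : IsBM g) :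
    0 ≤ ∫ x, (zonalOp k g x - (∫ u, k u ∂(nu d)) * g x) * (g (-x) - g x) ∂(surf d) := by
  set I := ∫ u, k u ∂(nu d) with hI
  have hT := hg.zonalOp hd hk
  have hb := hT.sub (hg.const_mul I)
  have hD := hg.comp_neg.sub hg
  have e1 : ∫ x, (zonalOp k g (-x) - I * g (-x)) * (g x - g (-x)) ∂(surf d) =
      ∫ x, (zonalOp k g x - I * g x) * (g (-x) - g x) ∂(surf d) := by
    rw [← integral_comp_neg_sph (fun x => (zonalOp k g x - I * g x) * (g (-x) - g x))]
    simp
  have e2 := integral_mul_zonalOp_le hd hk hD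
  have e3 : ∀ x, (zonalOp k g x - I * g x) * (g (-x) - g x) +
      (zonalOp k g (-x) - I * g (-x)) * (g x - g (-x)) =
      I * (g (-x) - g x) ^ 2 - (g (-x) - g x) * zonalOp k (fun x => g (-x) - g x) x := by
    intro x
    rw [zonalOp_sub hk hg.comp_neg hg, zonalOp_neg]; ring
  have e4 : ∫ x, (zonalOp k g x - I * g x) * (g (-x) - g x) ∂(surf d) +
      ∫ x, (zonalOp k g (-x) - I * g (-x)) * (g x - g (-x)) ∂(surf d) =
      I * ∫ x, (g (-x) - g x) ^ 2 ∂(surf d) -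
        ∫ x, (g (-x) - g x) * zonalOp k (fun x => g (-x) - g x) x ∂(surf d) := by
    rw [← integral_add (hb.mul hD).integrable
      ((hT.comp_neg.sub (hg.comp_neg.const_mul I)).mul (hg.sub hg.comp_neg)).integrable]
    simp_rw [e3]
    rw [integral_sub (hD.sq.const_mul I).integrable (hD.mul (hD.zonalOp hd hk)).integrable,
      integral_const_mul]
  linarith

end

/-! ### The Laplacian as a limit of zonal operators -/

lemma nu_Ioo_pos {d : ℕ} {r : ℝ} (hr : 0 < r) (hr2 : r ≤ 2) : 0 < nu d (Ioo 0 r) := by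
  rw [nu, withDensity_apply _ measurableSet_Ioo, Measure.restrict_restrict measurableSet_Ioo,
    inter_eq_left.mpr (Ioo_subset_Ioo le_rfl hr2)]
  rw [lintegral_pos_iff_support (by fun_prop)]
  refine lt_of_lt_of_le (?_ : 0 < volume.restrict (Ioo 0 r) (Ioo 0 r)) (measure_mono fun u hu => ?_)
  · simp [hr]
  · have : 0 < u * (2 - u) := mul_pos hu.1 (by linarith [hu.2])
    have := area_pos (d - 1)
    simp only [Function.mem_support, ne_eq, ENNReal.ofReal_eq_zero, not_le]
    positivity

/-- The Laplacian is a uniform limit of rescaled zonal averages minus the identity: indicators of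
small caps do. Identities for zonal operators thus pass to the Laplacian without integration by
parts. -/
lemma IsC2.exists_kernel_lap {d : ℕ} (hd : 1 ≤ d) {f : Sph d → ℝ} (hf : IsC2 f) {ε : ℝ} (hε : 0 < ε) :
    ∃ (k : ℝ → ℝ) (β : ℝ), IsKer k 1 ∧ 0 < β ∧ ∀ x,
      |zonalOp k f x - (∫ u, k u ∂(nu d)) * f x - β * lap f x| ≤ ε * β := by
  have hd0 : (0:ℝ) < d := by exact_mod_cast hd
  obtain ⟨C, hC, h⟩ := hf.exists_near_bias hd (η := ε / (4 * d)) (by positivity)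
  set r := min 1 (ε / (4 * d * (C + 1))) with hr
  have hr0 : 0 < r := by positivity
  have hr1 : r ≤ 1 := min_le_left _ _
  let k : ℝ → ℝ := (Ioo 0 r).indicator 1
  have hk : IsKer k 1 := ⟨measurable_one.indicator measurableSet_Ioo,
    fun u => indicator_nonneg (fun _ _ => zero_le_one) u,
    fun u => indicator_apply_le' (fun _ => le_rfl) (fun _ => zero_le_one)⟩
  have hk1 : ∀ u, 1 < u → k u = 0 := fun u hu =>
    indicator_of_notMem (fun h => by linarith [h.2]) _
  have i1 := hk.integrable_mul hd (g := fun u => u) continuous_id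
  have i2 := hk.integrable_mul hd (g := fun u => u * (2 - u)) (by fun_prop)
  have i3 := hk.integrable_mul hd (g := fun u => u ^ 2) (by fun_prop)
  have hpos : 0 < ∫ u, k u * u ∂(nu d) := by
    rw [integral_pos_iff_support_of_nonneg_ae _ i1]
    · refine (nu_Ioo_pos (d := d) hr0 (by linarith)).trans_le (measure_mono fun u hu => ?_)
      simp [k, hu, hu.1.ne']
    · filter_upwards [nu_ae_mem d] with u hu
      exact mul_nonneg (hk.nonneg u) hu.1.le
  have hle1 : ∫ u, k u * u ∂(nu d) ≤ ∫ u, k u * (u * (2 - u)) ∂(nu d) := by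
    refine integral_mono i1 i2 fun u => ?_
    by_cases hu : u ∈ Ioo 0 r
    · simp only [k, indicator_of_mem hu, Pi.one_apply, one_mul]
      nlinarith [hu.1, hu.2]
    · simp [k, hu]
  have hle2 : ∫ u, k u * u ^ 2 ∂(nu d) ≤ r * ∫ u, k u * u ∂(nu d) := by
    rw [← integral_const_mul]
    refine integral_mono i3 (i1.const_mul r) fun u => ?_
    by_cases hu : u ∈ Ioo 0 r
    · simp only [k, indicator_of_mem hu, Pi.one_apply, one_mul]
      nlinarith [hu.1, hu.2]
    · simp [k, hu]
  have hpos2 := hpos.trans_le hle1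
  refine ⟨k, (2 * d : ℝ)⁻¹ * ∫ u, k u * (u * (2 - u)) ∂(nu d), hk, by positivity, fun x => ?_⟩
  refine (h k 1 hk.meas hk.nonneg hk.le hk1 x).trans ?_
  set m := ∫ u, k u * u ∂(nu d) with hm
  have a1 : C * ∫ u, k u * u ^ 2 ∂(nu d) ≤ ε / (4 * d) * m := by
    calc C * ∫ u, k u * u ^ 2 ∂(nu d) ≤ (C + 1) * (r * m) := by
          refine mul_le_mul (by linarith) hle2 ?_ (by positivity)
          exact integral_nonneg fun u => mul_nonneg (hk.nonneg u) (sq_nonneg u)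
      _ ≤ (C + 1) * (ε / (4 * d * (C + 1)) * m) := by
          gcongr; exact min_le_right _ _
      _ = _ := by field_simp
  calc _ ≤ ε / (4 * d) * m + ε / (4 * d) * m := by linarith
    _ = ε * ((2 * d : ℝ)⁻¹ * m) := by field_simp; norm_num
    _ ≤ _ := by gcongr

/-- The Laplacian is nonnegatively correlated with `f (-x) - f x`. -/
lemma IsC2.integral_lap_mul_antipodal_nonneg {d : ℕ} (hd : 1 ≤ d) {f : Sph d → ℝ} (hf : IsC2 f) :
    0 ≤ ∫ x, lap f x * (f (-x) - f x) ∂(surf d) := by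
  have hb := isBM_of_continuous hf.continuous
  have hD := hb.comp_neg.sub hb
  have hl := isBM_of_continuous hf.continuous_lap
  have hDa : IsBM (fun x => |f (-x) - f x|) := ⟨hD.meas.abs, by simpa using hD.bdd⟩
  set J := ∫ x, |f (-x) - f x| ∂(surf d) with hJ
  have hJ0 : 0 ≤ J := integral_nonneg fun x => abs_nonneg _
  refine le_of_forall_pos_le_add fun ε hε => ?_
  obtain ⟨k, β, hk, hβ, h⟩ := hf.exists_kernel_lap hd (ε := ε / (J + 1)) (by positivity)
  have h1 := integral_bias_mul_antipodal_nonneg hd hk hb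
  have h2 : ∫ x, (zonalOp k f x - (∫ u, k u ∂(nu d)) * f x) * (f (-x) - f x) ∂(surf d) ≤
      β * ∫ x, lap f x * (f (-x) - f x) ∂(surf d) + ε / (J + 1) * β * J := by
    rw [hJ, ← integral_const_mul, ← integral_const_mul, ← integral_add
      ((hl.mul hD).const_mul β).integrable (hDa.const_mul _).integrable]
    refine integral_mono (((hb.zonalOp hd hk).sub (hb.const_mul _)).mul hD).integrable
      (((hl.mul hD).const_mul β).add (hDa.const_mul _)).integrable fun x => ?_
    have h3 : (zonalOp k f x - (∫ u, k u ∂(nu d)) * f x - β * lap f x) * (f (-x) - f x) ≤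
        ε / (J + 1) * β * |f (-x) - f x| := by
      refine (le_abs_self _).trans ?_
      rw [abs_mul]
      exact mul_le_mul_of_nonneg_right (h x) (abs_nonneg _)
    simp only
    linarith
  have h4 : ε / (J + 1) * β * J ≤ β * ε := by
    have : J / (J + 1) ≤ 1 := (div_le_one (by positivity)).mpr (by linarith)
    calc ε / (J + 1) * β * J = β * ε * (J / (J + 1)) := by ring
      _ ≤ β * ε * 1 := by gcongr
      _ = _ := mul_one _
  have h5 : 0 ≤ β * (∫ x, lap f x * (f (-x) - f x) ∂(surf d) + ε) := by linarith
  exact nonneg_of_mul_nonneg_right h5 hβ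

/-- The Laplacian has integral zero, because zonal operators are
symmetric and multiply constants by their mass. -/
lemma IsC2.integral_lap {d : ℕ} (hd : 1 ≤ d) {f : Sph d → ℝ} (hf : IsC2 f) :
    ∫ x, lap f x ∂(surf d) = 0 := by
  have hb := isBM_of_continuous hf.continuous
  have hl := isBM_of_continuous hf.continuous_lap
  set W := (surf d).real univ with hW
  have hW0 : 0 ≤ W := measureReal_nonneg
  refine abs_eq_zero.mp (le_antisymm (le_of_forall_pos_le_add fun ε hε => ?_) (abs_nonneg _))
  obtain ⟨k, β, hk, hβ, h⟩ := hf.exists_kernel_lap hd (ε := ε / (W + 1)) (by positivity)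
  have h1 : ∫ x, (zonalOp k f x - (∫ u, k u ∂(nu d)) * f x) ∂(surf d) = 0 := by
    rw [integral_sub (hb.zonalOp hd hk).integrable (hb.const_mul _).integrable, integral_const_mul]
    have := integral_mul_zonalOp hk (IsBM.const (d := d) 1) hb
    simp only [one_mul, zonalOp_const hd hk.meas, mul_one] at this
    rw [this, integral_const_mul, sub_self]
  have h2 : |∫ x, (zonalOp k f x - (∫ u, k u ∂(nu d)) * f x - β * lap f x) ∂(surf d)| ≤
      ε / (W + 1) * β * W := by
    exact norm_integral_le_of_norm_le_const (μ := surf d)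
      (f := fun x => zonalOp k f x - (∫ u, k u ∂(nu d)) * f x - β * lap f x) (ae_of_all _ h)
  rw [integral_sub ((hb.zonalOp hd hk).sub (hb.const_mul _)).integrable (hl.const_mul β).integrable,
    h1, integral_const_mul, zero_sub, abs_neg, abs_mul, abs_of_pos hβ] at h2
  have h4 : ε / (W + 1) * β * W ≤ β * ε := by
    have : W / (W + 1) ≤ 1 := (div_le_one (by positivity)).mpr (by linarith)
    calc ε / (W + 1) * β * W = β * ε * (W / (W + 1)) := by ring
      _ ≤ β * ε * 1 := by gcongr
      _ = _ := mul_one _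
  have := le_of_mul_le_mul_left (h2.trans h4) hβ
  linarith

/-- The second derivative of `F²`. -/
lemma fderiv2_sq {E : Type*} [NormedAddCommGroup E] [NormedSpace ℝ E] {F : E → ℝ} {U : Set E}
    (hU : IsOpen U) (hF : ContDiffOn ℝ 2 F U) {x : E} (hx : x ∈ U) (v w : E) :
    fderiv ℝ (fderiv ℝ (fun z => F z ^ 2)) x v w =
      2 * F x * fderiv ℝ (fderiv ℝ F) x v w + 2 * fderiv ℝ F x v * fderiv ℝ F x w := by
  have hD1 : ContDiffOn ℝ 1 (fderiv ℝ F) U := hF.fderiv_of_isOpen hU (by norm_num)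
  have hd1 : ∀ z ∈ U, HasFDerivAt F (fderiv ℝ F z) z := fun z hz =>
    ((hF.differentiableOn (by norm_num)).differentiableAt (hU.mem_nhds hz)).hasFDerivAt
  have hd2 : HasFDerivAt (fderiv ℝ F) (fderiv ℝ (fderiv ℝ F) x) x :=
    ((hD1.differentiableOn (by norm_num)).differentiableAt (hU.mem_nhds hx)).hasFDerivAt
  have h1 : fderiv ℝ (fun z => F z ^ 2) =ᶠ[𝓝 x] fun z => (2 * F z) • fderiv ℝ F z := by
    filter_upwards [hU.mem_nhds hx] with z hz
    rw [((hd1 z hz).pow 2).fderiv]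
    simp
  have h2 : HasFDerivAt (fun z => (2 * F z) • fderiv ℝ F z) _ x :=
    ((hd1 x hx).const_mul 2).smul hd2
  rw [h1.fderiv_eq, h2.fderiv]
  simp

lemma IsC2.sq {d : ℕ} {f : Sph d → ℝ} (hf : IsC2 f) : IsC2 (fun x => f x ^ 2) := by
  have h : radialExt (fun x => f x ^ 2) = fun z => radialExt f z ^ 2 := by
    ext z
    by_cases hz : z = 0
    · simp [radialExt, hz]
    · simp [radialExt, hz]
  unfold IsC2
  rw [h]
  exact ContDiffOn.pow hf 2

/-- The identity `Δ(f²) = 2 f Δf + 2 |∇f|²`. -/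
lemma IsC2.lap_sq {d : ℕ} {f : Sph d → ℝ} (hf : IsC2 f) (x : Sph d)
    (v : OrthonormalBasis (Fin (d + 1)) ℝ (EuclideanSpace ℝ (Fin (d + 1)))) :
    lap (fun x => f x ^ 2) x =
      2 * f x * lap f x + 2 * ∑ i, (fderiv ℝ (radialExt f) x (v i)) ^ 2 := by
  have h : radialExt (fun x => f x ^ 2) = fun z => radialExt f z ^ 2 := by
    ext z
    by_cases hz : z = 0
    · simp [radialExt, hz]
    · simp [radialExt, hz]
  rw [lap_eq_sum _ x v, lap_eq_sum _ x v, h, Finset.mul_sum, Finset.mul_sum,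
    ← Finset.sum_add_distrib]
  refine Finset.sum_congr rfl fun i _ => ?_
  rw [fderiv2_sq isOpen_compl_singleton hf (sphere_ne_zero x), radialExt_coe]
  ring

instance isOpenPosMeasure_surf (d : ℕ) : (surf d).IsOpenPosMeasure := by
  unfold surf; infer_instance

lemma eq_zero_of_integral_eq_zero {d : ℕ} {g : Sph d → ℝ} (hg : Continuous g) (h0 : ∀ x, 0 ≤ g x)
    (h : ∫ x, g x ∂(surf d) = 0) (x : Sph d) : g x = 0 := by
  have h1 := (integral_eq_zero_iff_of_nonneg h0 (isBM_of_continuous hg).integrable).mp h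
  exact congrFun ((hg.ae_eq_iff_eq (surf d) continuous_const).mp h1) x

/-- A `C²` function on the sphere whose Laplacian vanishes is constant. -/
lemma IsC2.eq_of_lap_eq_zero {d : ℕ} (hd : 1 ≤ d) {f : Sph d → ℝ} (hf : IsC2 f)
    (h : ∀ x, lap f x = 0) (x y : Sph d) : f x = f y := by
  -- `Δ(f²) = 2 |∇f|²` is nonnegative with integral zero, so the gradient of `f` vanishes
  have h1 := hf.sq.integral_lap hd
  let v := EuclideanSpace.basisFun (Fin (d + 1)) ℝ
  have h2 : ∀ x, lap (fun x => f x ^ 2) x = 2 * ∑ i, (fderiv ℝ (radialExt f) x (v i)) ^ 2 := by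
    intro x; rw [hf.lap_sq x v, h x]; ring
  have h3 : ∀ x, lap (fun x => f x ^ 2) x = 0 :=
    eq_zero_of_integral_eq_zero hf.sq.continuous_lap (fun x => by rw [h2]; positivity) h1
  have h4 : ∀ x : Sph d, fderiv ℝ (radialExt f) (x : EuclideanSpace ℝ (Fin (d + 1))) = 0 := by
    intro x
    have h5 := h3 x
    rw [h2] at h5
    have h6 : ∑ i, (fderiv ℝ (radialExt f) x (v i)) ^ 2 = 0 := by linarith
    rw [Finset.sum_eq_zero_iff_of_nonneg (fun i _ => sq_nonneg _)] at h6
    refine ContinuousLinearMap.ext fun w => ?_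
    rw [← v.sum_repr' w]
    simp only [map_sum, map_smul]
    refine (Finset.sum_eq_zero fun i hi => ?_).trans (by simp)
    rw [pow_eq_zero_iff (two_ne_zero) |>.mp (h6 i hi), smul_zero]
  have h5 : ∀ z : EuclideanSpace ℝ (Fin (d + 1)), z ≠ 0 → fderiv ℝ (radialExt f) z = 0 := by
    intro z hz
    have hn : 0 < ‖z‖ := norm_pos_iff.mpr hz
    let x : Sph d := ⟨‖z‖⁻¹ • z, by simp [norm_smul, hn.ne']⟩
    have e1 : radialExt f =ᶠ[𝓝 z] fun w => radialExt f (‖z‖⁻¹ • w) := by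
      filter_upwards [isOpen_compl_singleton.mem_nhds hz] with w hw
      obtain ⟨y, hy, hy2⟩ := radialExt_of_ne f hw
      have hwn : 0 < ‖w‖ := norm_pos_iff.mpr hw
      have hw2 : ‖z‖⁻¹ • w = (‖z‖⁻¹ * ‖w‖) • (y : EuclideanSpace ℝ (Fin (d + 1))) := by
        rw [hy, smul_smul, mul_assoc, mul_inv_cancel₀ hwn.ne', mul_one]
      rw [hy2, hw2, radialExt_smul _ _ (by positivity)]
    have e2 : HasFDerivAt (radialExt f) (0 : EuclideanSpace ℝ (Fin (d + 1)) →L[ℝ] ℝ) (‖z‖⁻¹ • z) := by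
      have := (hf.differentiableAt (sphere_ne_zero x)).hasFDerivAt
      rwa [h4 x] at this
    have e3 : HasFDerivAt (fun w : EuclideanSpace ℝ (Fin (d + 1)) => ‖z‖⁻¹ • w)
      (‖z‖⁻¹ • ContinuousLinearMap.id ℝ _) z :=
      (‖z‖⁻¹ • ContinuousLinearMap.id ℝ (EuclideanSpace ℝ (Fin (d + 1)))).hasFDerivAt
    have e4 := e2.comp z e3
    rw [ContinuousLinearMap.zero_comp] at e4
    exact (e4.congr_of_eventuallyEq e1).fderiv
  have hconn : IsPreconnected ({0}ᶜ : Set (EuclideanSpace ℝ (Fin (d + 1)))) := by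
    refine (isConnected_compl_singleton_of_one_lt_rank ?_ 0).isPreconnected
    rw [rank_eq_card_basis (EuclideanSpace.basisFun (Fin (d + 1)) ℝ).toBasis]
    simp; omega
  have := isOpen_compl_singleton.is_const_of_fderiv_eq_zero hconn
    (ContDiffOn.differentiableOn hf (by norm_num)) (fun z hz => h5 z hz)
    (sphere_ne_zero x) (sphere_ne_zero y)
  rwa [radialExt_coe, radialExt_coe] at this

/-- A function that is not constant has a nonzero Laplacian somewhere, hence, by continuity, a
positive integral of the squared Laplacian. -/
lemma IsC2.lapRoughness_pos {d : ℕ} (hd : 1 ≤ d) {f : Sph d → ℝ} (hf : IsC2 f)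
    (hfu : ∃ x y, f x ≠ f y) : 0 < lapRoughness f := by
  refine lt_of_le_of_ne (integral_nonneg fun x => sq_nonneg _) fun h => ?_
  obtain ⟨x, y, hxy⟩ := hfu
  refine hxy (hf.eq_of_lap_eq_zero hd (fun z => ?_) x y)
  have := eq_zero_of_integral_eq_zero (g := fun x => lap f x ^ 2) (hf.continuous_lap.pow 2)
    (fun x => sq_nonneg _) h.symm z
  exact pow_eq_zero_iff two_ne_zero |>.mp this

/-! ### The smoothing kernel -/

/-- The kernel `L`, extended to the left of `0` by the constant `L 0`. -/
def ext0 (L : ℝ → ℝ) (s : ℝ) : ℝ := L (max s 0)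

lemma ext0_of_nonneg (L : ℝ → ℝ) {s : ℝ} (hs : 0 ≤ s) : ext0 L s = L s := by
  rw [ext0, max_eq_left hs]

/-- The rescaled kernel `u ↦ L(u / h²)`. -/
def dil (L : ℝ → ℝ) (h : ℝ) (u : ℝ) : ℝ := ext0 L (u / h ^ 2)

namespace KernelAssumptions

variable {d : ℕ} {L : ℝ → ℝ}

/-- A monotone function dominating the oscillations of `L`, namely its variation function. -/
lemma exists_variation (hL : KernelAssumptions d L) : ∃ (Q : ℝ → ℝ) (V : ℝ), Monotone Q ∧
    (∀ s, 0 ≤ Q s) ∧ (∀ s, Q s ≤ V) ∧ ∀ s t, s ≤ t → |ext0 L t - ext0 L s| ≤ Q t - Q s := by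
  have hloc := hL.variation.locallyBoundedVariationOn
  have hmem : ∀ s : ℝ, max s 0 ∈ Ici (0:ℝ) := fun s => mem_Ici.mpr (le_max_right _ _)
  refine ⟨fun s => variationOnFromTo L (Ici 0) 0 (max s 0), (eVariationOn L (Ici 0)).toReal,
    ?_, ?_, ?_, ?_⟩
  · intro s t hst
    exact variationOnFromTo.monotoneOn hloc self_mem_Ici (hmem s) (hmem t) (max_le_max_right 0 hst)
  · intro s
    exact variationOnFromTo.nonneg_of_le _ _ (hmem s)
  · intro s
    exact (le_abs_self _).trans (variationOnFromTo.abs_le_eVariationOn hL.variation)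
  · intro s t hst
    exact variationOnFromTo.abs_sub_le_sub_of_le hloc self_mem_Ici (hmem s) (hmem t)
      (max_le_max_right 0 hst)

lemma measurable (hL : KernelAssumptions d L) : Measurable (ext0 L) := by
  obtain ⟨Q, V, hQ, -, -, h⟩ := hL.exists_variation
  have h2 : Monotone (fun s => Q s - ext0 L s) := by
    intro s t hst
    have := (abs_le.mp (h s t hst)).2
    simp only
    linarith
  have : ext0 L = fun s => Q s - (Q s - ext0 L s) := by ext s; ring
  rw [this]
  exact hQ.measurable.sub h2.measurable

lemma exists_isKer (hL : KernelAssumptions d L) : ∃ B, 0 < B ∧ IsKer (ext0 L) B := by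
  obtain ⟨B, hB⟩ := hL.bounded
  refine ⟨B, hL.pos_zero.trans_le (hB 0 le_rfl), hL.measurable, fun s => hL.nonneg _ (le_max_right _ _),
    fun s => hB _ (le_max_right _ _)⟩

/-- The kernel tends to `0` at infinity: bounded variation gives a limit, and integrability forces
it to be `0`. -/
lemma tendsto_zero (hL : KernelAssumptions d L) : Tendsto (ext0 L) atTop (𝓝 0) := by
  obtain ⟨l, hl⟩ := hL.variation.exists_tendsto_atTop
  have h1 : Tendsto L atTop (𝓝 l) :=
    hl.mono_left (le_inf (le_principal_iff.mpr (Ici_mem_atTop 0)) le_rfl)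
  have h2 : l = 0 := by
    by_contra hne
    have hpos : 0 < |l| := abs_pos.mpr hne
    have h3 : ∀ᶠ s in atTop, |l| / 2 < |L s| := h1.abs.eventually (lt_mem_nhds (by linarith))
    obtain ⟨T, hT⟩ := eventually_atTop.mp h3
    have h4 : IntegrableOn (fun _ : ℝ => |l| / 2) (Ioi (max T 0)) := by
      refine Integrable.mono (hL.integrable.mono_set (fun s hs => ?_)) (by fun_prop) ?_
      · exact ((le_max_right T 0).trans_lt hs).le
      · filter_upwards [ae_restrict_mem measurableSet_Ioi] with s hs
        rw [Real.norm_eq_abs, abs_of_pos (by positivity)]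
        exact (hT s ((le_max_left T 0).trans_lt hs).le).le
    rw [integrableOn_const_iff] at h4
    rcases h4 with h4 | h4
    · simp [hne] at h4
    · simp at h4
  rw [h2] at h1
  refine h1.congr' ?_
  filter_upwards [eventually_ge_atTop 0] with s hs
  rw [ext0_of_nonneg L hs]

lemma dil_isKer {B : ℝ} (hB : IsKer (ext0 L) B) (h : ℝ) : IsKer (dil L h) B :=
  ⟨hB.meas.comp (by fun_prop), fun _ => hB.nonneg _, fun _ => hB.le _⟩

end KernelAssumptions

/-! ### Small-bandwidth asymptotics of the kernel functionals -/

/-- The substitution `u = s h²` in integrals of a dilated kernel. -/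
lemma integral_zero_mul_eq {d : ℕ} (G ψ : ℝ → ℝ) {h : ℝ} (hh : 0 < h) {T : ℝ} (hT : 0 ≤ T) (hT2 : T ≤ 2) :
    ∫ u in (0:ℝ)..T, G (u / h ^ 2) * ψ u * (u * (2 - u)) ^ ((d:ℝ) / 2 - 1) =
      h ^ d * ∫ s in (0:ℝ)..(T / h ^ 2), G s * s ^ ((d:ℝ) / 2 - 1) *
        (ψ (s * h ^ 2) * (2 - s * h ^ 2) ^ ((d:ℝ) / 2 - 1)) := by
  have h2 : 0 < h ^ 2 := by positivity
  have e1 := intervalIntegral.integral_comp_mul_right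
    (fun u => G (u / h ^ 2) * ψ u * (u * (2 - u)) ^ ((d:ℝ) / 2 - 1)) h2.ne' (a := 0) (b := T / h ^ 2)
  rw [zero_mul, div_mul_cancel₀ _ h2.ne', smul_eq_mul] at e1
  have e2 : ∫ u in (0:ℝ)..T, G (u / h ^ 2) * ψ u * (u * (2 - u)) ^ ((d:ℝ) / 2 - 1) =
      h ^ 2 * ∫ s in (0:ℝ)..(T / h ^ 2), G (s * h ^ 2 / h ^ 2) * ψ (s * h ^ 2) *
        (s * h ^ 2 * (2 - s * h ^ 2)) ^ ((d:ℝ) / 2 - 1) := by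
    rw [e1]; field_simp
  rw [e2, ← intervalIntegral.integral_const_mul, ← intervalIntegral.integral_const_mul]
  refine intervalIntegral.integral_congr fun s hs => ?_
  rw [uIcc_of_le (by positivity)] at hs
  have hs1 : s * h ^ 2 ≤ T := (le_div_iff₀ h2).mp hs.2
  rw [mul_div_cancel_right₀ _ h2.ne', Real.mul_rpow (mul_nonneg hs.1 h2.le) (by linarith),
    Real.mul_rpow hs.1 h2.le]
  have : h ^ 2 * (h ^ 2) ^ ((d:ℝ) / 2 - 1) = h ^ d := by
    rw [← Real.rpow_natCast h 2, ← Real.rpow_mul hh.le, ← Real.rpow_add hh, ← Real.rpow_natCast]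
    congr 1; push_cast; ring
  rw [← this]; ring

/-- The functional `λ_{h,d}` is the rescaled integral of the dilated kernel. -/
lemma integral_comp_div_sq {d : ℕ} (G : ℝ → ℝ) {h : ℝ} (hh : 0 < h) :
    ∫ u, G (u / h ^ 2) ∂(nu d) = h ^ d * lamH d G h := by
  rw [integral_nu, lamH, ← integral_Ioc_eq_integral_Ioo,
    ← intervalIntegral.integral_of_le (by norm_num)]
  have := integral_zero_mul_eq (d := d) G (fun _ => 1) hh (T := 2) (by norm_num) le_rfl
  simp only [mul_one, one_mul] at this
  rw [this]; ring

lemma lamH_congr {d : ℕ} {G G' : ℝ → ℝ} (hG : ∀ s, 0 ≤ s → G s = G' s) (h : ℝ) :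
    lamH d G h = lamH d G' h := by
  unfold lamH
  congr 1
  refine intervalIntegral.integral_congr fun s hs => ?_
  rw [uIcc_of_le (by positivity)] at hs
  simp only [hG s hs.1]

/-- The substitution `u = s h²` in the near part of integrals with respect to `nu d`, where the
upper limit becomes `h⁻²`. -/
lemma integral_near_mul {d : ℕ} (G ψ : ℝ → ℝ) {h : ℝ} (hh : 0 < h) :
    ∫ u, near (fun u => G (u / h ^ 2)) u * ψ u ∂(nu d) =
      area (d - 1) * (h ^ d * ∫ s in (0:ℝ)..(1 / h ^ 2), G s * s ^ ((d:ℝ) / 2 - 1) *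
        (ψ (s * h ^ 2) * (2 - s * h ^ 2) ^ ((d:ℝ) / 2 - 1))) := by
  rw [integral_nu, ← integral_zero_mul_eq G ψ hh zero_le_one (by norm_num),
    intervalIntegral.integral_of_le zero_le_one]
  congr 1
  have : ∀ u, near (fun u => G (u / h ^ 2)) u * ψ u * (u * (2 - u)) ^ ((d:ℝ) / 2 - 1) =
      (Iic (1:ℝ)).indicator (fun u => G (u / h ^ 2) * ψ u * (u * (2 - u)) ^ ((d:ℝ) / 2 - 1)) u := by
    intro u
    by_cases hu : u ≤ 1 <;> simp [near, hu]
  simp_rw [this]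
  rw [integral_indicator measurableSet_Iic, Measure.restrict_restrict measurableSet_Iic]
  congr 2
  ext u
  simp only [mem_inter_iff, mem_Iic, mem_Ioo, mem_Ioc]
  constructor
  · rintro ⟨h1, h2, h3⟩; exact ⟨h2, h1⟩
  · rintro ⟨h1, h2⟩; exact ⟨h2, h1, by linarith⟩

/-- A dominated convergence statement for truncated dilated integrals. -/
lemma tendsto_integral_dilated {g φ : ℝ → ℝ} (hg : IntegrableOn g (Ioi 0)) (hφ : Measurable φ) {C : ℝ}
    (hC : ∀ u ∈ Icc (0:ℝ) 1, |φ u| ≤ C) (hφ0 : ContinuousAt φ 0) :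
    Tendsto (fun h : ℝ => ∫ s in (0:ℝ)..(1 / h ^ 2), g s * φ (s * h ^ 2)) (𝓝[>] 0)
      (𝓝 (φ 0 * ∫ s in Ioi (0:ℝ), g s)) := by
  have hC0 : 0 ≤ C := (abs_nonneg _).trans (hC 0 (by simp))
  have e : ∀ h : ℝ, 0 < h → ∫ s in (0:ℝ)..(1 / h ^ 2), g s * φ (s * h ^ 2) =
      ∫ s in Ioi (0:ℝ), (Iic (1 / h ^ 2)).indicator (fun s => g s * φ (s * h ^ 2)) s := by
    intro h hh
    rw [intervalIntegral.integral_of_le (by positivity), integral_indicator measurableSet_Iic,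
      Measure.restrict_restrict measurableSet_Iic, Iic_inter_Ioi]
  rw [← integral_const_mul]
  refine Tendsto.congr' (f₁ := fun h : ℝ => ∫ s in Ioi (0:ℝ),
    (Iic (1 / h ^ 2)).indicator (fun s => g s * φ (s * h ^ 2)) s) ?_ ?_
  · filter_upwards [self_mem_nhdsWithin] with h hh
    rw [e h hh]
  · refine tendsto_integral_filter_of_dominated_convergence (fun s => C * |g s|) ?_ ?_
      (hg.abs.const_mul C) ?_
    · refine Eventually.of_forall fun h => ?_
      exact (hg.aestronglyMeasurable.mul
        (hφ.comp (measurable_id.mul_const _)).aestronglyMeasurable).indicator measurableSet_Iic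
    · filter_upwards [self_mem_nhdsWithin] with h (hh : 0 < h)
      filter_upwards [ae_restrict_mem measurableSet_Ioi] with s hs
      by_cases hs1 : s ≤ 1 / h ^ 2
      · rw [indicator_of_mem (show s ∈ Iic _ from hs1), norm_mul, mul_comm]
        have : s * h ^ 2 ≤ 1 := (le_div_iff₀ (by positivity)).mp hs1
        exact mul_le_mul_of_nonneg_right (hC _ ⟨mul_nonneg (le_of_lt hs) (by positivity), this⟩)
          (abs_nonneg _)
      · rw [indicator_of_notMem (show s ∉ Iic _ from hs1), norm_zero]
        positivity
    · refine ae_of_all _ fun s => ?_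
      have t0 : Tendsto (fun h : ℝ => s * h ^ 2) (𝓝[>] 0) (𝓝 0) := by
        have : Tendsto (fun h : ℝ => s * h ^ 2) (𝓝 0) (𝓝 (s * 0 ^ 2)) :=
          Continuous.tendsto (by fun_prop) 0
        simpa using this.mono_left nhdsWithin_le_nhds
      have t1 : Tendsto (fun h : ℝ => g s * φ (s * h ^ 2)) (𝓝[>] 0) (𝓝 (g s * φ 0)) :=
        (hφ0.tendsto.comp t0).const_mul _
      rw [mul_comm (φ 0)]
      refine t1.congr' ?_
      filter_upwards [t0.eventually (gt_mem_nhds (zero_lt_one)), self_mem_nhdsWithin] with h h1 h2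
      rw [indicator_of_mem]
      exact (le_div_iff₀ (pow_pos h2 2)).mpr h1.le

lemma abs_two_sub_rpow_le {p u : ℝ} (hu : u ∈ Icc (0:ℝ) 1) : |(2 - u) ^ p| ≤ 2 ^ |p| := by
  have h1 : 1 ≤ 2 - u := by linarith [hu.2]
  rw [abs_of_nonneg (Real.rpow_nonneg (by linarith) _)]
  calc (2 - u) ^ p ≤ (2 - u) ^ |p| := Real.rpow_le_rpow_of_exponent_le h1 (le_abs_self p)
    _ ≤ 2 ^ |p| := Real.rpow_le_rpow (by linarith) (by linarith [hu.1]) (abs_nonneg _)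

/-- The near part of the integral of a dilated kernel. -/
lemma tendsto_near (d : ℕ) {G : ℝ → ℝ}
    (hG : IntegrableOn (fun s => G s * s ^ ((d:ℝ) / 2 - 1)) (Ioi 0)) :
    Tendsto (fun h : ℝ => (h ^ d)⁻¹ * ∫ u, near (fun u => G (u / h ^ 2)) u ∂(nu d)) (𝓝[>] 0)
      (𝓝 (lam d G)) := by
  have h1 := tendsto_integral_dilated hG (φ := fun u => (2 - u) ^ ((d:ℝ) / 2 - 1)) (by fun_prop)
    (fun u hu => abs_two_sub_rpow_le hu)
    (ContinuousAt.rpow_const (by fun_prop) (by norm_num))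
  have h2 := h1.const_mul (area (d - 1))
  have h3 : lam d G = area (d - 1) * ((2 - 0) ^ ((d:ℝ) / 2 - 1) *
      ∫ s in Ioi (0:ℝ), G s * s ^ ((d:ℝ) / 2 - 1)) := by
    rw [lam]; simp only [sub_zero]; ring
  rw [h3]
  refine h2.congr' ?_
  filter_upwards [self_mem_nhdsWithin] with h (hh : 0 < h)
  have := integral_near_mul (d := d) G (fun _ => 1) hh
  simp only [mul_one, one_mul] at this
  have alg : ∀ a J : ℝ, (h ^ d)⁻¹ * (a * (h ^ d * J)) = a * J := by intro a J; field_simp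
  rw [this, alg]

lemma tendsto_near_mul (d : ℕ) {G : ℝ → ℝ} {j : ℕ}
    (hG : IntegrableOn (fun s => G s * s ^ ((d:ℝ) / 2)) (Ioi 0)) :
    Tendsto (fun h : ℝ => (h ^ (d + 2))⁻¹ * ∫ u, near (fun u => G (u / h ^ 2)) u * (u * u ^ j) ∂(nu d))
      (𝓝[>] 0)
      (𝓝 (area (d - 1) * (0 ^ j * 2 ^ ((d:ℝ) / 2 - 1) * ∫ s in Ioi (0:ℝ), G s * s ^ ((d:ℝ) / 2)))) := by
  have h1 := tendsto_integral_dilated hG (φ := fun u => u ^ j * (2 - u) ^ ((d:ℝ) / 2 - 1)) (by fun_prop)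
    (C := 2 ^ |(d:ℝ) / 2 - 1|)
    (fun u hu => by
      rw [abs_mul, ← one_mul ((2:ℝ) ^ |(d:ℝ) / 2 - 1|)]
      refine mul_le_mul ?_ (abs_two_sub_rpow_le hu) (abs_nonneg _) zero_le_one
      rw [abs_of_nonneg (pow_nonneg hu.1 _)]
      exact pow_le_one₀ hu.1 hu.2)
    (ContinuousAt.mul (by fun_prop) (ContinuousAt.rpow_const (by fun_prop) (by norm_num)))
  have h2 := h1.const_mul (area (d - 1))
  simp only [sub_zero] at h2
  refine h2.congr' ?_
  filter_upwards [self_mem_nhdsWithin] with h (hh : 0 < h)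
  rw [integral_near_mul (d := d) G (fun u => u * u ^ j) hh]
  have : ∫ s in (0:ℝ)..(1 / h ^ 2), G s * s ^ ((d:ℝ) / 2 - 1) *
        (s * h ^ 2 * (s * h ^ 2) ^ j * (2 - s * h ^ 2) ^ ((d:ℝ) / 2 - 1)) =
      h ^ 2 * ∫ s in (0:ℝ)..(1 / h ^ 2), G s * s ^ ((d:ℝ) / 2) *
        ((s * h ^ 2) ^ j * (2 - s * h ^ 2) ^ ((d:ℝ) / 2 - 1)) := by
    rw [← intervalIntegral.integral_const_mul]
    refine intervalIntegral.integral_congr_ae (ae_of_all _ fun s hs => ?_)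
    rw [uIoc_of_le (by positivity)] at hs
    have : s ^ ((d:ℝ) / 2) = s ^ ((d:ℝ) / 2 - 1) * s := by
      rw [← Real.rpow_add_one hs.1.ne']; congr 1; ring
    rw [this]; ring
  have alg : ∀ a J : ℝ, (h ^ (d + 2))⁻¹ * (a * (h ^ d * (h ^ 2 * J))) = a * J := by
    intro a J; rw [pow_add]; field_simp
  rw [this, alg]

/-! ### The far part of a dilated kernel -/

/-- The tail of the second moment integral of the kernel. -/
def tailMoment (d : ℕ) (L : ℝ → ℝ) (T : ℝ) : ℝ := ∫ s in Ioi T, ext0 L s * s ^ ((d:ℝ) / 2)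

section

variable {d : ℕ} {L : ℝ → ℝ}

lemma KernelAssumptions.integrableOn_moment (hL : KernelAssumptions d L) :
    IntegrableOn (fun s => ext0 L s * s ^ ((d:ℝ) / 2)) (Ioi 0) :=
  hL.second_moment_finite.congr_fun (fun s hs => by simp only [ext0_of_nonneg L (le_of_lt hs)])
    measurableSet_Ioi

lemma KernelAssumptions.ext0_nonneg (hL : KernelAssumptions d L) (s : ℝ) : 0 ≤ ext0 L s :=
  hL.nonneg _ (le_max_right _ _)

lemma KernelAssumptions.tailMoment_nonneg (hL : KernelAssumptions d L) {T : ℝ} (hT : 0 ≤ T) :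
    0 ≤ tailMoment d L T :=
  setIntegral_nonneg measurableSet_Ioi fun s hs =>
    mul_nonneg (hL.ext0_nonneg s) (Real.rpow_nonneg (hT.trans (le_of_lt hs)) _)

lemma tendsto_tailMoment (d : ℕ) (L : ℝ → ℝ) :
    Tendsto (tailMoment d L) atTop (𝓝 0) := by
  exact tendsto_integral_Ioi_zero tendsto_id

lemma tendsto_tailMoment_inv_sq (d : ℕ) (L : ℝ → ℝ) :
    Tendsto (fun h : ℝ => tailMoment d L (1 / h ^ 2)) (𝓝[>] 0) (𝓝 0) := by
  refine (tendsto_tailMoment d L).comp ?_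
  simp only [one_div]
  refine tendsto_inv_nhdsGT_zero.comp ?_
  rw [tendsto_nhdsWithin_iff]
  constructor
  · have : Tendsto (fun h : ℝ => h ^ 2) (𝓝 0) (𝓝 (0 ^ 2)) := Continuous.tendsto (by fun_prop) 0
    simpa using this.mono_left nhdsWithin_le_nhds
  · filter_upwards [self_mem_nhdsWithin] with h hh
    exact pow_pos (mem_Ioi.mp hh) 2

/-- On `s > h⁻²` one has `1 ≤ h^d s^{d/2}`, so the mass of the kernel there is `o(h^d)`. -/
lemma KernelAssumptions.setIntegral_le_tailMoment (hL : KernelAssumptions d L) {h : ℝ} (hh : 0 < h)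
    {S : Set ℝ} (hS : MeasurableSet S) (hSs : S ⊆ Ioi (1 / h ^ 2)) :
    ∫ s in S, ext0 L s ≤ h ^ d * tailMoment d L (1 / h ^ 2) := by
  have hpos : 0 < 1 / h ^ 2 := by positivity
  have hi : IntegrableOn (fun s => ext0 L s * s ^ ((d:ℝ) / 2)) (Ioi (1 / h ^ 2)) :=
    hL.integrableOn_moment.mono_set (Ioi_subset_Ioi hpos.le)
  calc ∫ s in S, ext0 L s ≤ ∫ s in S, h ^ d * (ext0 L s * s ^ ((d:ℝ) / 2)) := by
        refine integral_mono_of_nonneg (ae_of_all _ fun s => hL.ext0_nonneg s)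
          ((hi.mono_set hSs).const_mul _) ?_
        filter_upwards [ae_restrict_mem hS] with s hs
        have h1 : 1 / h ^ 2 ≤ s := le_of_lt (hSs hs)
        have h2 : (h ^ d)⁻¹ ≤ s ^ ((d:ℝ) / 2) := by
          calc (h ^ d)⁻¹ = (1 / h ^ 2) ^ ((d:ℝ) / 2) := by
                rw [one_div, Real.inv_rpow (by positivity), ← Real.rpow_natCast h 2,
                  ← Real.rpow_mul hh.le, ← Real.rpow_natCast h d]
                congr 2; push_cast; ring
            _ ≤ _ := Real.rpow_le_rpow hpos.le h1 (by positivity)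
        calc ext0 L s = ext0 L s * (h ^ d * (h ^ d)⁻¹) := by
              rw [mul_inv_cancel₀ (by positivity), mul_one]
          _ ≤ ext0 L s * (h ^ d * s ^ ((d:ℝ) / 2)) := by
              have := hL.ext0_nonneg s
              gcongr
          _ = _ := by ring
    _ = h ^ d * ∫ s in S, ext0 L s * s ^ ((d:ℝ) / 2) := integral_const_mul _ _
    _ ≤ _ := by
        refine mul_le_mul_of_nonneg_left ?_ (by positivity)
        refine setIntegral_mono_set hi ?_ hSs.eventuallyLE
        filter_upwards [ae_restrict_mem measurableSet_Ioi] with s hs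
        exact mul_nonneg (hL.ext0_nonneg s) (Real.rpow_nonneg (hpos.le.trans (le_of_lt hs)) _)

lemma KernelAssumptions.integral_dil_le (hL : KernelAssumptions d L) {h : ℝ} (hh : 0 < h) :
    ∫ u in (1:ℝ)..2, dil L h u ≤ h ^ (d + 2) * tailMoment d L (1 / h ^ 2) := by
  have h2 : 0 < h ^ 2 := by positivity
  have : ∫ u in (1:ℝ)..2, dil L h u = h ^ 2 * ∫ s in (1 / h ^ 2)..(2 / h ^ 2), ext0 L s := by
    simp only [dil]
    rw [intervalIntegral.integral_comp_div _ h2.ne', smul_eq_mul]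
  rw [this, intervalIntegral.integral_of_le (by gcongr; norm_num)]
  calc _ ≤ h ^ 2 * (h ^ d * tailMoment d L (1 / h ^ 2)) := by
        gcongr
        exact hL.setIntegral_le_tailMoment hh measurableSet_Ioc (fun s hs => hs.1)
    _ = _ := by ring

end

/-- Bounding an integral over the far hemisphere by one with respect to Lebesgue measure. -/
lemma integral_far_mul_le {d : ℕ} {k ψ R : ℝ → ℝ} {B : ℝ} (hk : IsKer k B)
    (hψ : ∀ u ∈ Ioo (1:ℝ) 2, 0 ≤ ψ u) (hR : IntervalIntegrable R volume 1 2)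
    (h : ∀ u ∈ Ioo (1:ℝ) 2, k u * ψ u * (u * (2 - u)) ^ ((d:ℝ) / 2 - 1) ≤ R u) :
    ∫ u, far k u * ψ u ∂(nu d) ≤ area (d - 1) * ∫ u in (1:ℝ)..2, R u := by
  rw [integral_nu]
  refine mul_le_mul_of_nonneg_left ?_ (area_pos _).le
  rw [intervalIntegral.integral_of_le one_le_two, integral_Ioc_eq_integral_Ioo]
  rw [intervalIntegrable_iff_integrableOn_Ioo_of_le one_le_two] at hR
  have e : ∫ u in Ioo (1:ℝ) 2, R u = ∫ u in Ioo (0:ℝ) 2, (Ioo (1:ℝ) 2).indicator R u := by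
    rw [integral_indicator measurableSet_Ioo, Measure.restrict_restrict measurableSet_Ioo,
      inter_eq_left.mpr (Ioo_subset_Ioo_left zero_le_one)]
  rw [e]
  refine integral_mono_of_nonneg ?_
    (hR.integrable_indicator measurableSet_Ioo).integrableOn ?_
  · filter_upwards [ae_restrict_mem measurableSet_Ioo] with u hu
    by_cases hu1 : 1 < u
    · exact mul_nonneg (mul_nonneg (hk.far.nonneg u) (hψ u ⟨hu1, hu.2⟩))
        (Real.rpow_nonneg (mul_nonneg hu.1.le (by linarith [hu.2])) _)
    · simp [far, hu1]
  · filter_upwards [ae_restrict_mem measurableSet_Ioo] with u hu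
    by_cases hu1 : 1 < u
    · have hu' : u ∈ Ioo (1:ℝ) 2 := ⟨hu1, hu.2⟩
      rw [indicator_of_mem hu', far, indicator_of_mem (show u ∈ Ioi (1:ℝ) from hu1)]
      exact h u hu'
    · rw [indicator_of_notMem (fun hh => hu1 hh.1), far,
        indicator_of_notMem (show u ∉ Ioi (1:ℝ) from hu1)]
      simp

lemma IsKer.intervalIntegrable {k : ℝ → ℝ} {B : ℝ} (hk : IsKer k B) (a b : ℝ) :
    IntervalIntegrable k volume a b :=
  (intervalIntegrable_const (c := B)).mono_fun hk.meas.aestronglyMeasurable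
    (ae_of_all _ fun u => by
      simp only [Real.norm_eq_abs, abs_of_nonneg hk.bound_nonneg]; exact hk.abs_le u)

section

variable {d : ℕ} {L : ℝ → ℝ}

lemma mul_two_sub_mem {u : ℝ} (hu : u ∈ Ioo (1:ℝ) 2) : 0 < u * (2 - u) ∧ u * (2 - u) ≤ 1 ∧ 2 - u ≤ u * (2 - u) := by
  obtain ⟨h1, h2⟩ := hu
  refine ⟨mul_pos (by linarith) (by linarith), by nlinarith [sq_nonneg (u - 1)], by nlinarith⟩

/-- The factor `2 - u` compensates for the singularity of `nu d` at the antipode when `d = 1`. -/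
lemma KernelAssumptions.integral_far_mul_le (hL : KernelAssumptions d L) {h : ℝ} (hh : 0 < h) :
    ∫ u, far (dil L h) u * (2 - u) ∂(nu d) ≤
      area (d - 1) * (h ^ (d + 2) * tailMoment d L (1 / h ^ 2)) := by
  obtain ⟨B, hB, hk⟩ := hL.exists_isKer
  have hkd := dil_isKer hk h
  refine (SphereKDE.integral_far_mul_le hkd (ψ := fun u => 2 - u) (R := dil L h)
    (fun u hu => by linarith [hu.2]) (hkd.intervalIntegrable _ _) ?_).trans
    (mul_le_mul_of_nonneg_left (hL.integral_dil_le hh) (area_pos _).le)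
  intro u hu
  obtain ⟨h1, h2, h3⟩ := mul_two_sub_mem hu
  rw [mul_assoc]
  refine mul_le_of_le_one_right (hkd.nonneg u) ?_
  calc (2 - u) * (u * (2 - u)) ^ ((d:ℝ) / 2 - 1) ≤ (u * (2 - u)) * (u * (2 - u)) ^ ((d:ℝ) / 2 - 1) := by
        gcongr
    _ = (u * (2 - u)) ^ ((d:ℝ) / 2) := by
        rw [mul_comm, ← Real.rpow_add_one h1.ne']; congr 1; ring
    _ ≤ 1 := Real.rpow_le_one h1.le h2 (by positivity)

lemma KernelAssumptions.integral_far_nonneg (hL : KernelAssumptions d L) (h : ℝ) :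
    0 ≤ ∫ u, far (dil L h) u ∂(nu d) := by
  obtain ⟨B, hB, hk⟩ := hL.exists_isKer
  exact integral_nonneg fun u => (dil_isKer hk h).far.nonneg u

/-- For `d ≥ 2` the density of `nu d` is bounded, and the far mass is `o(h^{d+2})` for all
bandwidths. -/
lemma KernelAssumptions.integral_far_le_of_two_le (hL : KernelAssumptions d L) (hd : 2 ≤ d) {h : ℝ} (hh : 0 < h) :
    ∫ u, far (dil L h) u ∂(nu d) ≤
      area (d - 1) * (h ^ (d + 2) * tailMoment d L (1 / h ^ 2)) := by
  obtain ⟨B, hB, hk⟩ := hL.exists_isKer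
  have hkd := dil_isKer hk h
  have hd' : (2:ℝ) ≤ d := by exact_mod_cast hd
  have := SphereKDE.integral_far_mul_le (d := d) hkd (ψ := fun _ => 1) (R := dil L h)
    (fun u hu => zero_le_one) (hkd.intervalIntegrable _ _) ?_
  · simp only [mul_one] at this
    exact this.trans (mul_le_mul_of_nonneg_left (hL.integral_dil_le hh) (area_pos _).le)
  intro u hu
  obtain ⟨h1, h2, h3⟩ := mul_two_sub_mem hu
  rw [mul_one]
  exact mul_le_of_le_one_right (hkd.nonneg u) (Real.rpow_le_one h1.le h2 (by linarith))

/-- On the circle the density of `nu 1` is unbounded near the antipode, where the decay of `L` at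
infinity has to be used. -/
lemma KernelAssumptions.integral_far_le_of_eq_one (hL : KernelAssumptions 1 L) {h S : ℝ} (hh : 0 < h)
    (hS : ∀ s, 1 / h ^ 2 ≤ s → ext0 L s ≤ S) :
    ∫ u, far (dil L h) u ∂(nu 1) ≤
      area (1 - 1) * (h * tailMoment 1 L (1 / h ^ 2) + 4 * S * h) := by
  obtain ⟨B, hB, hk⟩ := hL.exists_isKer
  have hkd := dil_isKer hk h
  have h2 : 0 < h ^ 2 := by positivity
  have hS0 : 0 ≤ S := (hL.ext0_nonneg _).trans (hS _ le_rfl)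
  have hr : IntervalIntegrable (fun u : ℝ => (2 - u) ^ (-(3/4) : ℝ)) volume 1 2 := by
    have := (intervalIntegral.intervalIntegrable_rpow' (a := 1) (b := 0)
      (r := -(3/4)) (by norm_num)).comp_sub_left 2
    norm_num at this ⊢
    exact this
  have hri : ∫ u in (1:ℝ)..2, (2 - u) ^ (-(3/4) : ℝ) = 4 := by
    rw [intervalIntegral.integral_comp_sub_left (fun u => u ^ (-(3/4) : ℝ)), integral_rpow (by norm_num)]
    norm_num
  have hi1 : IntervalIntegrable (fun u => (h ^ 2)⁻¹ * dil L h u) volume 1 2 :=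
    (hkd.intervalIntegrable _ _).const_mul _
  have hi2 : IntervalIntegrable (fun u : ℝ => S * h * (2 - u) ^ (-(3/4) : ℝ)) volume 1 2 := hr.const_mul _
  have := SphereKDE.integral_far_mul_le (d := 1) hkd (ψ := fun _ => 1)
    (R := fun u => (h ^ 2)⁻¹ * dil L h u + S * h * (2 - u) ^ (-(3/4) : ℝ))
    (fun u hu => zero_le_one) (hi1.add hi2) ?_
  · simp only [mul_one] at this
    refine this.trans (mul_le_mul_of_nonneg_left ?_ (area_pos _).le)
    rw [intervalIntegral.integral_add hi1 hi2, intervalIntegral.integral_const_mul,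
      intervalIntegral.integral_const_mul, hri]
    have := hL.integral_dil_le hh
    calc _ ≤ (h ^ 2)⁻¹ * (h ^ (1 + 2) * tailMoment 1 L (1 / h ^ 2)) + S * h * 4 := by gcongr
      _ = _ := by field_simp; ring
  intro u hu
  obtain ⟨h1, h2', h3⟩ := mul_two_sub_mem hu
  have ht : 0 < 2 - u := by linarith [hu.2]
  have hLS : dil L h u ≤ S := hS _ (by gcongr; exact hu.1.le)
  rw [mul_one]
  set a := (2 - u) ^ (-(1/4) : ℝ) with ha
  have ha0 : 0 < a := Real.rpow_pos_of_pos ht _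
  have e2 : (2 - u) ^ (-(1/2) : ℝ) = a ^ 2 := by
    rw [ha, ← Real.rpow_natCast, ← Real.rpow_mul ht.le]; norm_num
  have e3 : (2 - u) ^ (-(3/4) : ℝ) = a ^ 3 := by
    rw [ha, ← Real.rpow_natCast, ← Real.rpow_mul ht.le]; norm_num
  have e4 : (u * (2 - u)) ^ (((1:ℕ):ℝ) / 2 - 1) ≤ a ^ 2 := by
    rw [← e2]
    have : ((1:ℕ):ℝ) / 2 - 1 = -(1/2) := by norm_num
    rw [this]
    exact Real.rpow_le_rpow_of_nonpos ht h3 (by norm_num)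
  -- the split of `(2 - u)^{-1/2}` at `2 - u = h⁴` keeps both parts integrable
  have e5 : a ^ 2 ≤ (h ^ 2)⁻¹ + h * a ^ 3 := by
    rcases le_total 1 (h * a) with h4 | h4
    · have : a ^ 2 ≤ h * a ^ 3 := by nlinarith [sq_nonneg a]
      have : 0 < (h ^ 2)⁻¹ := by positivity
      linarith
    · have : a ^ 2 ≤ (h ^ 2)⁻¹ := by
        rw [le_inv_comm₀ (by positivity) h2]
        rw [← one_div, le_div_iff₀ (by positivity)]
        calc h ^ 2 * a ^ 2 = (h * a) ^ 2 := by ring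
          _ ≤ 1 := pow_le_one₀ (by positivity) h4
      have : 0 < h * a ^ 3 := by positivity
      linarith
  have h0 := hkd.nonneg u
  calc dil L h u * (u * (2 - u)) ^ (((1:ℕ):ℝ) / 2 - 1) ≤ dil L h u * ((h ^ 2)⁻¹ + h * a ^ 3) := by
        gcongr; exact e4.trans e5
    _ = (h ^ 2)⁻¹ * dil L h u + dil L h u * (h * a ^ 3) := by ring
    _ ≤ (h ^ 2)⁻¹ * dil L h u + S * (h * a ^ 3) := by gcongr
    _ = _ := by rw [e3]; ring

/-- The second-order part of the far mass is `o(h^{d+2})`, as the bias expansion requires. -/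
lemma KernelAssumptions.tendsto_far_mul (hL : KernelAssumptions d L) :
    Tendsto (fun h : ℝ => (h ^ (d + 2))⁻¹ * ∫ u, far (dil L h) u * (2 - u) ∂(nu d)) (𝓝[>] 0) (𝓝 0) := by
  have h1 := (tendsto_tailMoment_inv_sq d L).const_mul (area (d - 1))
  rw [mul_zero] at h1
  obtain ⟨B, hB, hk⟩ := hL.exists_isKer
  refine squeeze_zero' ?_ ?_ h1
  · filter_upwards [self_mem_nhdsWithin] with h (hh : 0 < h)
    refine mul_nonneg (by positivity) (integral_nonneg_of_ae ?_)
    filter_upwards [nu_ae_mem d] with u hu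
    exact mul_nonneg ((dil_isKer hk h).far.nonneg u) (by linarith [hu.2])
  · filter_upwards [self_mem_nhdsWithin] with h (hh : 0 < h)
    rw [inv_mul_le_iff₀ (by positivity)]
    exact (hL.integral_far_mul_le hh).trans_eq (by ring)

/-- The far mass itself is only shown to be `o(h^d)`, so that it does not affect the total mass.
-/
lemma KernelAssumptions.tendsto_far (hL : KernelAssumptions d L) (hd : 1 ≤ d) :
    Tendsto (fun h : ℝ => (h ^ d)⁻¹ * ∫ u, far (dil L h) u ∂(nu d)) (𝓝[>] 0) (𝓝 0) := by
  have t0 : Tendsto (fun h : ℝ => h ^ 2) (𝓝[>] 0) (𝓝 0) := by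
    have : Tendsto (fun h : ℝ => h ^ 2) (𝓝 0) (𝓝 (0 ^ 2)) := Continuous.tendsto (by fun_prop) 0
    simpa using this.mono_left nhdsWithin_le_nhds
  rcases hd.eq_or_lt with rfl | hd2
  · rw [Metric.tendsto_nhds]
    intro γ hγ
    have ha := area_pos (1 - 1)
    set δ := γ / (6 * area (1 - 1)) with hδ
    have hδ0 : 0 < δ := by positivity
    obtain ⟨T, hT⟩ := eventually_atTop.mp (hL.tendsto_zero.eventually (gt_mem_nhds hδ0))
    have t1 : Tendsto (fun h : ℝ => 1 / h ^ 2) (𝓝[>] 0) atTop := by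
      simp only [one_div]
      refine tendsto_inv_nhdsGT_zero.comp ?_
      rw [tendsto_nhdsWithin_iff]
      refine ⟨t0, ?_⟩
      filter_upwards [self_mem_nhdsWithin] with h hh
      exact pow_pos (mem_Ioi.mp hh) 2
    filter_upwards [self_mem_nhdsWithin, t1.eventually_ge_atTop T,
      (tendsto_tailMoment_inv_sq 1 L).eventually (gt_mem_nhds hδ0)] with h (hh : 0 < h) h1 h2
    have := hL.integral_far_le_of_eq_one hh (S := δ) (fun s hs => (hT s (h1.trans hs)).le)
    have h0 := hL.integral_far_nonneg h
    rw [Real.dist_eq, sub_zero, abs_of_nonneg (by positivity), inv_mul_lt_iff₀ (by positivity)]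
    calc _ ≤ area (1 - 1) * (h * tailMoment 1 L (1 / h ^ 2) + 4 * δ * h) := this
      _ ≤ area (1 - 1) * (h * δ + 4 * δ * h) := by gcongr
      _ = h * (γ * (5 / 6)) := by rw [hδ]; field_simp; ring
      _ < h ^ 1 * γ := by rw [pow_one]; gcongr; linarith
  · have h1 := (t0.mul (tendsto_tailMoment_inv_sq d L)).const_mul (area (d - 1))
    rw [mul_zero, mul_zero] at h1
    refine squeeze_zero' ?_ ?_ h1
    · filter_upwards [self_mem_nhdsWithin] with h (hh : 0 < h)
      exact mul_nonneg (by positivity) (hL.integral_far_nonneg h)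
    · filter_upwards [self_mem_nhdsWithin] with h (hh : 0 < h)
      rw [inv_mul_le_iff₀ (by positivity)]
      exact (hL.integral_far_le_of_two_le hd2 hh).trans_eq (by ring)

/-- Averaging the dilated kernel at a fixed point over the bandwidths `τ η` amounts, after the
substitution `s = u / (τ η)²`, to integrating the tail of `L`; no regularity of `L` at infinity is
used. -/
lemma KernelAssumptions.integral_bandwidth_le (hL : KernelAssumptions d L) {τ₁ τ₂ η u : ℝ}
    (h1 : 0 < τ₁) (h12 : τ₁ < τ₂) (hη : 0 < η) (hu : 1 < u) :
    ∫ τ in Icc τ₁ τ₂, dil L (τ * η) u ≤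
      τ₂ ^ 3 * η ^ 2 / 2 * ((τ₂ * η) ^ d * tailMoment d L (1 / (τ₂ * η) ^ 2)) := by
  have h2 : 0 < τ₂ := h1.trans h12
  obtain ⟨B, hB, hk⟩ := hL.exists_isKer
  set g : ℝ → ℝ := fun τ => u / (τ * η) ^ 2 with hg
  have hder : ∀ τ ∈ Icc τ₁ τ₂, HasDerivWithinAt g (-(2 * u / (τ ^ 3 * η ^ 2))) (Icc τ₁ τ₂) τ := by
    intro τ hτ
    have hτ0 : 0 < τ := h1.trans_le hτ.1
    have : HasDerivAt g ((0 * (τ * η) ^ 2 - u * ((2:ℕ) * (τ * η) ^ (2 - 1) * (1 * η))) / ((τ * η) ^ 2) ^ 2) τ :=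
      (hasDerivAt_const τ u).div (((hasDerivAt_id τ).mul_const η).pow 2) (by positivity)
    refine (this.congr_deriv ?_).hasDerivWithinAt
    field_simp; ring
  have hinj : InjOn g (Icc τ₁ τ₂) := by
    intro s hs t ht hst
    have hs0 : 0 < s := h1.trans_le hs.1
    have ht0 : 0 < t := h1.trans_le ht.1
    simp only [hg] at hst
    rw [div_eq_div_iff (by positivity) (by positivity), mul_pow, mul_pow] at hst
    have h3 : t ^ 2 = s ^ 2 := by
      have : u * η ^ 2 * t ^ 2 = u * η ^ 2 * s ^ 2 := by linarith
      exact mul_left_cancel₀ (by positivity) this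
    exact (pow_left_inj₀ hs0.le ht0.le two_ne_zero).mp h3.symm
  have hcv := integral_image_eq_integral_abs_deriv_smul measurableSet_Icc hder hinj (ext0 L)
  have hsub : g '' Icc τ₁ τ₂ ⊆ Ioi (1 / (τ₂ * η) ^ 2) := by
    rintro _ ⟨τ, hτ, rfl⟩
    have hτ0 : 0 < τ := h1.trans_le hτ.1
    simp only [hg, mem_Ioi]
    calc 1 / (τ₂ * η) ^ 2 ≤ 1 / (τ * η) ^ 2 := by gcongr; exact hτ.2
      _ < u / (τ * η) ^ 2 := by gcongr
  have hcont : ContinuousOn (fun τ : ℝ => |-(2 * u / (τ ^ 3 * η ^ 2))|) (Icc τ₁ τ₂) := by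
    refine ContinuousOn.abs (ContinuousOn.neg (ContinuousOn.div (by fun_prop) (by fun_prop) ?_))
    intro τ hτ
    have hτ0 : 0 < τ := h1.trans_le hτ.1
    positivity
  have hmi : MeasurableSet (g '' Icc τ₁ τ₂) := by
    have hc : ContinuousOn g (Icc τ₁ τ₂) := fun τ hτ => (hder τ hτ).continuousWithinAt
    exact (isCompact_Icc.image_of_continuousOn hc).measurableSet
  have h3 := hL.setIntegral_le_tailMoment (h := τ₂ * η) (by positivity) hmi hsub
  refine le_trans ?_ (mul_le_mul_of_nonneg_left h3 (by positivity))
  rw [hcv, ← integral_const_mul]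
  have hint : IntegrableOn (fun τ => |-(2 * u / (τ ^ 3 * η ^ 2))| * ext0 L (g τ)) (Icc τ₁ τ₂) := by
    have hm : AEStronglyMeasurable (fun τ => ext0 L (g τ)) (volume.restrict (Icc τ₁ τ₂)) :=
      (hk.meas.comp (by fun_prop)).aestronglyMeasurable
    exact (hcont.integrableOn_Icc).mul_bdd (c := B) hm (ae_of_all _ fun τ => hk.abs_le _)
  refine integral_mono_of_nonneg (ae_of_all _ fun τ => (dil_isKer hk _).nonneg u)
    (hint.const_mul _) ?_
  filter_upwards [ae_restrict_mem measurableSet_Icc] with τ hτ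
  have hτ0 : 0 < τ := h1.trans_le hτ.1
  simp only [smul_eq_mul]
  rw [abs_neg, abs_of_pos (by positivity), ← mul_assoc]
  refine le_mul_of_one_le_left (hL.ext0_nonneg _) ?_
  calc (1:ℝ) = τ ^ 3 * η ^ 2 / 2 * (2 * 1 / (τ ^ 3 * η ^ 2)) := by field_simp
    _ ≤ τ₂ ^ 3 * η ^ 2 / 2 * (2 * u / (τ ^ 3 * η ^ 2)) := by gcongr; exact hτ.2

/-- Although the far mass of the kernel need not be `o(h^{d+2})` along every sequence of
bandwidths, it is so for some bandwidth in each interval of the form `[τ₁ η, τ₂ η]`. -/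
lemma KernelAssumptions.exists_good_bandwidth (hL : KernelAssumptions d L) (hd : 1 ≤ d) {τ₁ τ₂ γ : ℝ}
    (h1 : 0 < τ₁) (h12 : τ₁ < τ₂) (hγ : 0 < γ) :
    ∀ᶠ η : ℝ in 𝓝[>] 0, ∃ τ ∈ Icc τ₁ τ₂, ∫ u, far (dil L (τ * η)) u ∂(nu d) ≤ γ * η ^ (d + 2) := by
  have := isFiniteMeasure_nu hd
  have h2 : 0 < τ₂ := h1.trans h12
  obtain ⟨B, hB, hk⟩ := hL.exists_isKer
  set N := (nu d).real univ with hN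
  have hN0 : 0 ≤ N := measureReal_nonneg
  set C := (N + 1) * (τ₂ ^ 3 / 2 * τ₂ ^ d) with hC
  have hC0 : 0 < C := by positivity
  have t1 : Tendsto (fun η : ℝ => τ₂ * η) (𝓝[>] 0) (𝓝[>] 0) := by
    rw [tendsto_nhdsWithin_iff]
    constructor
    · have : Tendsto (fun h : ℝ => τ₂ * h) (𝓝 0) (𝓝 (τ₂ * 0)) := Continuous.tendsto (by fun_prop) 0
      simpa using this.mono_left nhdsWithin_le_nhds
    · filter_upwards [self_mem_nhdsWithin] with h (hh : 0 < h)
      exact mul_pos h2 hh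
  filter_upwards [self_mem_nhdsWithin, ((tendsto_tailMoment_inv_sq d L).comp t1).eventually
    (gt_mem_nhds (show 0 < γ * (τ₂ - τ₁) / C from div_pos (mul_pos hγ (by linarith)) hC0))]
    with η (hη : 0 < η) hsm
  simp only [Function.comp_apply] at hsm
  by_contra! hcon
  have hmeas : Measurable (fun p : ℝ × ℝ => far (dil L (p.1 * η)) p.2) := by
    have : (fun p : ℝ × ℝ => far (dil L (p.1 * η)) p.2) =
        (Prod.snd ⁻¹' Ioi (1:ℝ)).indicator (fun p => ext0 L (p.2 / (p.1 * η) ^ 2)) := by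
      ext p
      by_cases hp : 1 < p.2 <;> simp [far, hp, dil]
    rw [this]
    exact (hk.meas.comp (by fun_prop)).indicator (measurable_snd measurableSet_Ioi)
  have hint : Integrable (fun p : ℝ × ℝ => far (dil L (p.1 * η)) p.2)
      ((volume.restrict (Icc τ₁ τ₂)).prod (nu d)) :=
    Integrable.of_bound hmeas.aestronglyMeasurable B
      (ae_of_all _ fun p => (dil_isKer hk _).far.abs_le _)
  have hswap := integral_integral_swap (f := fun τ u => far (dil L (τ * η)) u) hint
  have hlow : (τ₂ - τ₁) * (γ * η ^ (d + 2)) ≤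
      ∫ τ in Icc τ₁ τ₂, ∫ u, far (dil L (τ * η)) u ∂(nu d) := by
    have : ∫ τ in Icc τ₁ τ₂, γ * η ^ (d + 2) = (τ₂ - τ₁) * (γ * η ^ (d + 2)) := by
      rw [setIntegral_const, Measure.real, Real.volume_Icc, ENNReal.toReal_ofReal (by linarith), smul_eq_mul]
    rw [← this]
    refine setIntegral_mono_on (integrableOn_const (by simp)) hint.integral_prod_left measurableSet_Icc ?_
    intro τ hτ
    exact (hcon τ hτ).le
  have hup : ∫ u, (∫ τ in Icc τ₁ τ₂, far (dil L (τ * η)) u) ∂(nu d) ≤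
      N * (τ₂ ^ 3 * η ^ 2 / 2 * ((τ₂ * η) ^ d * tailMoment d L (1 / (τ₂ * η) ^ 2))) := by
    rw [hN, ← smul_eq_mul, ← integral_const]
    refine integral_mono hint.integral_prod_right (integrable_const _) fun u => ?_
    have hT := hL.tailMoment_nonneg (T := 1 / (τ₂ * η) ^ 2) (by positivity)
    by_cases hu : 1 < u
    · simp only [far, indicator_of_mem (show u ∈ Ioi (1:ℝ) from hu)]
      exact hL.integral_bandwidth_le h1 h12 hη hu
    · simp only [far, indicator_of_notMem (show u ∉ Ioi (1:ℝ) from hu), integral_zero]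
      positivity
  have hT := hL.tailMoment_nonneg (T := 1 / (τ₂ * η) ^ 2) (by positivity)
  rw [lt_div_iff₀ hC0] at hsm
  have : (τ₂ - τ₁) * (γ * η ^ (d + 2)) ≤ η ^ (d + 2) * (tailMoment d L (1 / (τ₂ * η) ^ 2) * C) :=
    calc _ ≤ _ := hlow
      _ = _ := hswap
      _ ≤ _ := hup
      _ ≤ (N + 1) * (τ₂ ^ 3 * η ^ 2 / 2 * ((τ₂ * η) ^ d * tailMoment d L (1 / (τ₂ * η) ^ 2))) := by
        gcongr; linarith
      _ = _ := by rw [hC, mul_pow]; ring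
  have hp : 0 < η ^ (d + 2) := by positivity
  nlinarith

end

/-! ### The normalized kernel -/

/-- The mass `∫ L((1 - xᵀy)/h²) σ_d(dy)` of the dilated kernel. -/
def mass (d : ℕ) (L : ℝ → ℝ) (h : ℝ) : ℝ := ∫ u, dil L h u ∂(nu d)

/-- The dilated kernel, normalized to have mass one with respect to `nu d`. -/
def nker (d : ℕ) (L : ℝ → ℝ) (h u : ℝ) : ℝ := (mass d L h)⁻¹ * dil L h u

/-- The mass of the normalized kernel on the far hemisphere. -/
def farMass (d : ℕ) (L : ℝ → ℝ) (h : ℝ) : ℝ := ∫ u, far (nker d L h) u ∂(nu d)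

/-- The coefficient of the Laplacian in the bias of the estimator. -/
def biasCoeff (d : ℕ) (L : ℝ → ℝ) (h : ℝ) : ℝ :=
  (2 * d : ℝ)⁻¹ * ∫ u, near (nker d L h) u * (u * (2 - u)) ∂(nu d)

lemma near_nker (d : ℕ) (L : ℝ → ℝ) (h u : ℝ) :
    near (nker d L h) u = (mass d L h)⁻¹ * near (dil L h) u := by
  by_cases hu : u ≤ 1 <;> simp [near, nker, hu]

lemma far_nker (d : ℕ) (L : ℝ → ℝ) (h u : ℝ) :
    far (nker d L h) u = (mass d L h)⁻¹ * far (dil L h) u := by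
  by_cases hu : 1 < u <;> simp [far, nker, hu]

namespace KernelAssumptions

variable {d : ℕ} {L : ℝ → ℝ}

/-- The kernel is bounded below near the origin. -/
lemma exists_lower (hL : KernelAssumptions d L) :
    ∃ r, 0 < r ∧ ∀ s, s < r → L 0 / 2 ≤ ext0 L s := by
  have h1 := hL.continuous_zero
  rw [ContinuousWithinAt, Metric.tendsto_nhdsWithin_nhds] at h1
  obtain ⟨r, hr, h⟩ := h1 (L 0 / 2) (half_pos hL.pos_zero)
  refine ⟨r, hr, fun s hs => ?_⟩
  have := h (x := max s 0) (mem_Ici.mpr (le_max_right _ _)) (by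
    rw [Real.dist_eq, sub_zero, abs_of_nonneg (le_max_right _ _)]; exact max_lt hs hr)
  rw [Real.dist_eq, abs_lt] at this
  rw [ext0]; linarith [this.1]

lemma mass_pos (hL : KernelAssumptions d L) (hd : 1 ≤ d) {h : ℝ} (hh : 0 < h) : 0 < mass d L h := by
  have := isFiniteMeasure_nu hd
  obtain ⟨B, hB, hk⟩ := hL.exists_isKer
  obtain ⟨r, hr, hlow⟩ := hL.exists_lower
  have hkd := dil_isKer hk h
  have hρ : 0 < min (r * h ^ 2) 2 := by positivity
  have hnu := nu_Ioo_pos (d := d) hρ (min_le_right _ _)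
  have h1 : (nu d).real (Ioo 0 (min (r * h ^ 2) 2)) * (L 0 / 2) ≤ mass d L h := by
    calc _ = ∫ u in Ioo 0 (min (r * h ^ 2) 2), L 0 / 2 ∂(nu d) := by
          rw [setIntegral_const, smul_eq_mul]
      _ ≤ ∫ u in Ioo 0 (min (r * h ^ 2) 2), dil L h u ∂(nu d) := by
          refine setIntegral_mono_on (integrable_const _) (hkd.integrable hd).integrableOn measurableSet_Ioo ?_
          intro u hu
          refine hlow _ ?_
          rw [div_lt_iff₀ (by positivity)]
          exact hu.2.trans_le (min_le_left _ _)
      _ ≤ _ := setIntegral_le_integral (hkd.integrable hd) (ae_of_all _ hkd.nonneg)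
  refine lt_of_lt_of_le (mul_pos ?_ (half_pos hL.pos_zero)) h1
  exact ENNReal.toReal_pos hnu.ne' (measure_ne_top _ _)

lemma nker_isKer (hL : KernelAssumptions d L) (hd : 1 ≤ d) {B : ℝ} (hk : IsKer (ext0 L) B) {h : ℝ}
    (hh : 0 < h) : IsKer (nker d L h) ((mass d L h)⁻¹ * B) := by
  have hm := hL.mass_pos hd hh
  have hkd := dil_isKer hk h
  exact ⟨hkd.meas.const_mul _, fun u => mul_nonneg (by positivity) (hkd.nonneg u),
    fun u => mul_le_mul_of_nonneg_left (hkd.le u) (by positivity)⟩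

lemma integral_nker (hL : KernelAssumptions d L) (hd : 1 ≤ d) {h : ℝ} (hh : 0 < h) :
    ∫ u, nker d L h u ∂(nu d) = 1 := by
  simp only [nker]
  rw [integral_const_mul]
  exact inv_mul_cancel₀ (hL.mass_pos hd hh).ne'

/-- The inverse normalizing constant is `h^d λ_{h,d}(L)`. -/
lemma mass_eq {h : ℝ} (hh : 0 < h) : mass d L h = h ^ d * lamH d L h := by
  rw [mass]
  simp only [dil]
  rw [integral_comp_div_sq _ hh, lamH_congr (fun s hs => ext0_of_nonneg L hs)]

/-- The squared `L²` norm of the normalized kernel is `h^{-d} v_{h,d}(L)`, the variance factor in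
both criteria. -/
lemma integral_nker_sq {h : ℝ} (hh : 0 < h) :
    ∫ u, nker d L h u ^ 2 ∂(nu d) = (h ^ d)⁻¹ * vH d L h := by
  have h1 : ∫ u, dil L h u ^ 2 ∂(nu d) = h ^ d * lamH d (fun s => L s ^ 2) h := by
    simp only [dil]
    rw [integral_comp_div_sq (fun s => ext0 L s ^ 2) hh,
      lamH_congr (G' := fun s => L s ^ 2) (fun s hs => by simp only [ext0_of_nonneg L hs])]
  simp only [nker, mul_pow]
  rw [integral_const_mul, h1, mass_eq hh, vH]
  have : h ^ d ≠ 0 := by positivity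
  by_cases h0 : lamH d L h = 0
  · simp [h0]
  · field_simp

lemma lam_ext0 : lam d (ext0 L) = lam d L := by
  rw [lam, lam]
  congr 1
  exact setIntegral_congr_fun measurableSet_Ioi fun s hs => by simp only [ext0_of_nonneg L (le_of_lt hs)]

lemma lam_ext0_sq : lam d (fun s => ext0 L s ^ 2) = lam d (fun s => L s ^ 2) := by
  rw [lam, lam]
  congr 1
  exact setIntegral_congr_fun measurableSet_Ioi fun s hs => by simp only [ext0_of_nonneg L (le_of_lt hs)]

lemma tendsto_mass (hL : KernelAssumptions d L) (hd : 1 ≤ d) :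
    Tendsto (fun h : ℝ => (h ^ d)⁻¹ * mass d L h) (𝓝[>] 0) (𝓝 (lam d L)) := by
  obtain ⟨B, hB, hk⟩ := hL.exists_isKer
  have hi : IntegrableOn (fun s => ext0 L s * s ^ ((d:ℝ) / 2 - 1)) (Ioi 0) :=
    hL.lam_one_finite.congr_fun (fun s hs => by simp only [ext0_of_nonneg L (le_of_lt hs)])
      measurableSet_Ioi
  have h1 := (tendsto_near d hi).add (hL.tendsto_far hd)
  rw [add_zero, lam_ext0] at h1
  refine h1.congr fun h => ?_
  rw [← mul_add, mass]
  exact congrArg _ ((dil_isKer hk h).integral_near_add_far hd)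

/-- Convergence `λ_{h,d}(L²) → λ_d(L²)`. The far part is dominated by that of `L`, the kernel
being bounded. -/
lemma tendsto_lamH_sq (hL : KernelAssumptions d L) (hd : 1 ≤ d) :
    Tendsto (fun h : ℝ => lamH d (fun s => L s ^ 2) h) (𝓝[>] 0) (𝓝 (lam d (fun s => L s ^ 2))) := by
  obtain ⟨B, hB, hk⟩ := hL.exists_isKer
  have hi : IntegrableOn (fun s => ext0 L s ^ 2 * s ^ ((d:ℝ) / 2 - 1)) (Ioi 0) :=
    hL.lam_two_finite.congr_fun (fun s hs => by simp only [ext0_of_nonneg L (le_of_lt hs)])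
      measurableSet_Ioi
  have hk2 : IsKer (fun s => ext0 L s ^ 2) (B ^ 2) := ⟨hk.meas.pow_const 2, fun s => sq_nonneg _,
    fun s => pow_le_pow_left₀ (hk.nonneg s) (hk.le s) 2⟩
  have hk2d : ∀ h : ℝ, IsKer (fun u => ext0 L (u / h ^ 2) ^ 2) (B ^ 2) := fun h =>
    ⟨hk2.meas.comp (g := fun s => ext0 L s ^ 2) (by fun_prop), fun _ => sq_nonneg _, fun _ => hk2.le _⟩
  have hfar : Tendsto (fun h : ℝ => (h ^ d)⁻¹ * ∫ u, far (fun u => ext0 L (u / h ^ 2) ^ 2) u ∂(nu d))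
      (𝓝[>] 0) (𝓝 0) := by
    have h1 := (hL.tendsto_far hd).const_mul B
    rw [mul_zero] at h1
    refine squeeze_zero' ?_ ?_ h1
    · filter_upwards [self_mem_nhdsWithin] with h (hh : 0 < h)
      exact mul_nonneg (by positivity) (integral_nonneg (f := far (fun u => ext0 L (u / h ^ 2) ^ 2)) fun u => (hk2d h).far.nonneg u)
    · filter_upwards [self_mem_nhdsWithin] with h (hh : 0 < h)
      rw [mul_left_comm, ← integral_const_mul B]
      refine mul_le_mul_of_nonneg_left ?_ (inv_nonneg.mpr (pow_nonneg hh.le d))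
      refine integral_mono ((hk2d h).far.integrable hd)
        (((dil_isKer hk h).far.integrable hd).const_mul B) fun u => ?_
      by_cases hu : 1 < u
      · simp only [far, indicator_of_mem (show u ∈ Ioi (1:ℝ) from hu), dil]
        rw [pow_two]
        exact mul_le_mul_of_nonneg_right (hk.le _) (hk.nonneg _)
      · simp [far, hu]
  have h1 := (tendsto_near d (G := fun s => ext0 L s ^ 2) hi).add hfar
  rw [add_zero, lam_ext0_sq] at h1
  refine h1.congr' ?_
  filter_upwards [self_mem_nhdsWithin] with h (hh : 0 < h)
  rw [← mul_add, (hk2d h).integral_near_add_far hd, integral_comp_div_sq (fun s => ext0 L s ^ 2) hh,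
    lamH_congr (G' := fun s => L s ^ 2) (fun s hs => by simp only [ext0_of_nonneg L hs])]
  have : h ^ d ≠ 0 := by positivity
  field_simp

lemma tendsto_lamH (hL : KernelAssumptions d L) (hd : 1 ≤ d) :
    Tendsto (fun h : ℝ => lamH d L h) (𝓝[>] 0) (𝓝 (lam d L)) := by
  refine (hL.tendsto_mass hd).congr' ?_
  filter_upwards [self_mem_nhdsWithin] with h (hh : 0 < h)
  rw [mass_eq hh]
  have : h ^ d ≠ 0 := by positivity
  field_simp

lemma tendsto_vH (hL : KernelAssumptions d L) (hd : 1 ≤ d) :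
    Tendsto (fun h : ℝ => vH d L h) (𝓝[>] 0) (𝓝 (v d L)) :=
  (hL.tendsto_lamH_sq hd).div ((hL.tendsto_lamH hd).pow 2) (pow_pos hL.lam_one_pos 2).ne'

lemma v_pos (hL : KernelAssumptions d L) : 0 < v d L := div_pos hL.lam_two_pos (pow_pos hL.lam_one_pos 2)

/-- Passing from the dilated to the normalized kernel in limits. -/
lemma tendsto_div_mass (hL : KernelAssumptions d L) (hd : 1 ≤ d) {F : ℝ → ℝ} {l : ℝ}
    (hF : Tendsto (fun h : ℝ => (h ^ (d + 2))⁻¹ * F h) (𝓝[>] 0) (𝓝 l)) :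
    Tendsto (fun h : ℝ => (h ^ 2)⁻¹ * ((mass d L h)⁻¹ * F h)) (𝓝[>] 0) (𝓝 (l / lam d L)) := by
  refine (hF.div (hL.tendsto_mass hd) hL.lam_one_pos.ne').congr' ?_
  filter_upwards [self_mem_nhdsWithin] with h (hh : 0 < h)
  have h0 := hL.mass_pos hd hh
  simp only [Pi.div_apply, pow_add]
  field_simp

lemma tendsto_near_nker_mul (hL : KernelAssumptions d L) (hd : 1 ≤ d) (j : ℕ) :
    Tendsto (fun h : ℝ => (h ^ 2)⁻¹ * ∫ u, near (nker d L h) u * (u * u ^ j) ∂(nu d)) (𝓝[>] 0)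
      (𝓝 (0 ^ j * (d * b d L))) := by
  have h1 := hL.tendsto_div_mass hd (tendsto_near_mul d (j := j) hL.integrableOn_moment)
  have hM : ∫ s in Ioi (0:ℝ), ext0 L s * s ^ ((d:ℝ) / 2) = ∫ s in Ioi (0:ℝ), L s * s ^ ((d:ℝ) / 2) :=
    setIntegral_congr_fun measurableSet_Ioi fun s hs => by simp only [ext0_of_nonneg L (le_of_lt hs)]
  have hlim : area (d - 1) * (0 ^ j * 2 ^ ((d:ℝ) / 2 - 1) * ∫ s in Ioi (0:ℝ), ext0 L s * s ^ ((d:ℝ) / 2)) /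
      lam d L = 0 ^ j * (d * b d L) := by
    rw [hM, b]
    have hl := hL.lam_one_pos
    rw [lam] at hl ⊢
    have hd0 : (d:ℝ) ≠ 0 := by positivity
    have hI : ∫ s in Ioi (0:ℝ), L s * s ^ ((d:ℝ) / 2 - 1) ≠ 0 := right_ne_zero_of_mul hl.ne'
    have ha := (area_pos (d - 1)).ne'
    generalize (∫ s in Ioi (0:ℝ), L s * s ^ ((d:ℝ) / 2 - 1)) = I at *
    generalize (∫ s in Ioi (0:ℝ), L s * s ^ ((d:ℝ) / 2)) = M
    have h2 : (2:ℝ) ^ ((d:ℝ) / 2 - 1) ≠ 0 := by positivity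
    generalize (2:ℝ) ^ ((d:ℝ) / 2 - 1) = t at *
    generalize (0:ℝ) ^ j = z
    field_simp
  rw [hlim] at h1
  refine h1.congr fun h => ?_
  rw [← integral_const_mul]
  congr 1
  refine integral_congr_ae (ae_of_all _ fun u => ?_)
  simp only [near_nker]
  rw [← mul_assoc]; rfl

lemma tendsto_near_nker_one (hL : KernelAssumptions d L) (hd : 1 ≤ d) :
    Tendsto (fun h : ℝ => (h ^ 2)⁻¹ * ∫ u, near (nker d L h) u * u ∂(nu d)) (𝓝[>] 0)
      (𝓝 (d * b d L)) := by
  simpa using hL.tendsto_near_nker_mul hd 0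

lemma tendsto_near_nker_two (hL : KernelAssumptions d L) (hd : 1 ≤ d) :
    Tendsto (fun h : ℝ => (h ^ 2)⁻¹ * ∫ u, near (nker d L h) u * u ^ 2 ∂(nu d)) (𝓝[>] 0) (𝓝 0) := by
  have := hL.tendsto_near_nker_mul hd 1
  simpa [pow_two] using this

lemma tendsto_biasCoeff (hL : KernelAssumptions d L) (hd : 1 ≤ d) :
    Tendsto (fun h : ℝ => (h ^ 2)⁻¹ * biasCoeff d L h) (𝓝[>] 0) (𝓝 (b d L)) := by
  obtain ⟨B, hB, hk⟩ := hL.exists_isKer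
  have hd0 : (0:ℝ) < d := by exact_mod_cast hd
  have h1 := (((hL.tendsto_near_nker_one hd).const_mul 2).sub (hL.tendsto_near_nker_two hd)).const_mul
    (2 * d : ℝ)⁻¹
  have hlim : (2 * d : ℝ)⁻¹ * (2 * (d * b d L) - 0) = b d L := by field_simp; ring
  rw [hlim] at h1
  refine h1.congr' ?_
  filter_upwards [self_mem_nhdsWithin] with h (hh : 0 < h)
  have hkn := (hL.nker_isKer hd hk hh).near
  have i1 : Integrable (fun u => near (nker d L h) u * u) (nu d) := hkn.integrable_mul hd continuous_id
  have i2 : Integrable (fun u => near (nker d L h) u * u ^ 2) (nu d) :=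
    hkn.integrable_mul hd (continuous_pow 2)
  have : ∫ u, near (nker d L h) u * (u * (2 - u)) ∂(nu d) =
      2 * (∫ u, near (nker d L h) u * u ∂(nu d)) - ∫ u, near (nker d L h) u * u ^ 2 ∂(nu d) := by
    rw [← integral_const_mul, ← integral_sub (i1.const_mul 2) i2]
    refine integral_congr_ae (ae_of_all _ fun u => ?_)
    simp only; ring
  rw [biasCoeff, this]; ring

lemma tendsto_far_nker_mul (hL : KernelAssumptions d L) (hd : 1 ≤ d) :
    Tendsto (fun h : ℝ => (h ^ 2)⁻¹ * ∫ u, far (nker d L h) u * (2 - u) ∂(nu d)) (𝓝[>] 0) (𝓝 0) := by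
  have h1 := hL.tendsto_div_mass hd hL.tendsto_far_mul
  rw [zero_div] at h1
  refine h1.congr fun h => ?_
  rw [← integral_const_mul]
  congr 1
  refine integral_congr_ae (ae_of_all _ fun u => ?_)
  simp only [far_nker, mul_assoc]

lemma farMass_eq (h : ℝ) : farMass d L h = (mass d L h)⁻¹ * ∫ u, far (dil L h) u ∂(nu d) := by
  rw [farMass, ← integral_const_mul]
  simp only [far_nker]

lemma farMass_nonneg (hL : KernelAssumptions d L) (hd : 1 ≤ d) {h : ℝ} (hh : 0 < h) :
    0 ≤ farMass d L h := by
  rw [farMass_eq]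
  exact mul_nonneg (inv_nonneg.mpr (hL.mass_pos hd hh).le) (hL.integral_far_nonneg h)

lemma eventually_mass_ge (hL : KernelAssumptions d L) (hd : 1 ≤ d) :
    ∀ᶠ h : ℝ in 𝓝[>] 0, lam d L / 2 * h ^ d ≤ mass d L h := by
  filter_upwards [self_mem_nhdsWithin, (hL.tendsto_mass hd).eventually
    (lt_mem_nhds (half_lt_self hL.lam_one_pos))] with h (hh : 0 < h) h1
  rw [lt_inv_mul_iff₀ (by positivity)] at h1
  linarith

/-- In each interval `[τ₁ η, τ₂ η]` some bandwidth has far mass of order smaller than `η²`. -/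
lemma exists_small_farMass (hL : KernelAssumptions d L) (hd : 1 ≤ d) {τ₁ τ₂ γ : ℝ}
    (h1 : 0 < τ₁) (h12 : τ₁ < τ₂) (hγ : 0 < γ) :
    ∀ᶠ η : ℝ in 𝓝[>] 0, ∃ τ ∈ Icc τ₁ τ₂, farMass d L (τ * η) ≤ γ * η ^ 2 := by
  have hl := hL.lam_one_pos
  have h2 : 0 < τ₂ := h1.trans h12
  have hev := hL.eventually_mass_ge hd
  rw [eventually_nhdsWithin_iff, Metric.eventually_nhds_iff] at hev
  obtain ⟨r, hr, hev⟩ := hev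
  have hsm : ∀ᶠ η : ℝ in 𝓝[>] 0, η < r / τ₂ :=
    nhdsWithin_le_nhds (gt_mem_nhds (by positivity))
  filter_upwards [self_mem_nhdsWithin, hsm, hL.exists_good_bandwidth hd h1 h12
    (show 0 < γ * (lam d L / 2 * τ₁ ^ d) by positivity)] with η (hη : 0 < η) hηr ⟨τ, hτ, hle⟩
  refine ⟨τ, hτ, ?_⟩
  have hτ0 : 0 < τ := h1.trans_le hτ.1
  have hτη : 0 < τ * η := by positivity
  have hm := hev (y := τ * η) (by
    rw [Real.dist_eq, sub_zero, abs_of_pos hτη]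
    calc τ * η ≤ τ₂ * η := by gcongr; exact hτ.2
      _ < τ₂ * (r / τ₂) := by gcongr
      _ = r := by field_simp) hτη
  rw [farMass_eq, inv_mul_le_iff₀ (hL.mass_pos hd hτη)]
  calc _ ≤ _ := hle
    _ = lam d L / 2 * (τ₁ * η) ^ d * (γ * η ^ 2) := by ring
    _ ≤ lam d L / 2 * (τ * η) ^ d * (γ * η ^ 2) := by gcongr; exact hτ.1
    _ ≤ _ := by gcongr

/-- The normalized kernels for bandwidths bounded away from zero are uniformly bounded below near
the origin. -/
lemma exists_nker_lower (hL : KernelAssumptions d L) (hd : 1 ≤ d) {δ : ℝ} (hδ : 0 < δ) :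
    ∃ c r, 0 < c ∧ 0 < r ∧ ∀ h, δ ≤ h → ∀ u, u < r → c ≤ nker d L h u := by
  have := isFiniteMeasure_nu hd
  obtain ⟨B, hB, hk⟩ := hL.exists_isKer
  obtain ⟨r, hr, hlow⟩ := hL.exists_lower
  have hL0 := hL.pos_zero
  have hN : 0 ≤ (nu d).real univ := measureReal_nonneg
  refine ⟨(((nu d).real univ + 1) * B)⁻¹ * (L 0 / 2), r * δ ^ 2, by positivity, by positivity, fun h hh u hu => ?_⟩
  have hh0 : 0 < h := hδ.trans_le hh
  have hm := hL.mass_pos hd hh0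
  have hkd := dil_isKer hk h
  have hmle : mass d L h ≤ ((nu d).real univ + 1) * B := by
    calc mass d L h ≤ ∫ u, B ∂(nu d) := integral_mono (hkd.integrable hd) (integrable_const _) hkd.le
      _ = (nu d).real univ * B := by rw [integral_const, smul_eq_mul]
      _ ≤ _ := by gcongr; linarith
  have h1 : L 0 / 2 ≤ dil L h u := by
    refine hlow _ ?_
    rw [div_lt_iff₀ (by positivity)]
    exact hu.trans_le (by gcongr)
  exact mul_le_mul (inv_anti₀ hm hmle) h1 (by positivity) (by positivity)

end KernelAssumptions

/-! ### The estimator in terms of the normalized kernel -/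

section

variable {d : ℕ} {L : ℝ → ℝ}

lemma normConst_eq (hL : KernelAssumptions d L) (hd : 1 ≤ d) (h : ℝ) (y : Sph d) :
    normConst L h y = (mass d L h)⁻¹ := by
  obtain ⟨B, hB, hk⟩ := hL.exists_isKer
  rw [normConst, mass, ← integral_zonal hd y (KernelAssumptions.dil_isKer hk h).meas]
  congr 1
  refine integral_congr_ae (ae_of_all _ fun x => ?_)
  simp only [dil]
  rw [real_inner_comm, ext0_of_nonneg]
  exact div_nonneg (one_sub_inner_mem y x).1 (by positivity)

lemma kerH_eq (hL : KernelAssumptions d L) (hd : 1 ≤ d) (h : ℝ) (x y : Sph d) :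
    kerH L h x y = nker d L h (1 - ⟪(x : EuclideanSpace ℝ (Fin (d + 1))), y⟫_ℝ) := by
  rw [kerH, normConst_eq hL hd, nker, dil, ext0_of_nonneg]
  exact div_nonneg (one_sub_inner_mem x y).1 (by positivity)

lemma kerTilde_eq (hL : KernelAssumptions d L) (hd : 1 ≤ d) (h : ℝ) (x y : Sph d) :
    kerTilde L h x y = zonalOp (nker d L h)
      (fun z => nker d L h (1 - ⟪(y : EuclideanSpace ℝ (Fin (d + 1))), z⟫_ℝ)) x := by
  simp only [kerTilde, zonalOp, kerH_eq hL hd]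

lemma kerTilde_self (hL : KernelAssumptions d L) (hd : 1 ≤ d) {h : ℝ} (hh : 0 < h) (x : Sph d) :
    kerTilde L h x x = (h ^ d)⁻¹ * vH d L h := by
  obtain ⟨B, hB, hk⟩ := hL.exists_isKer
  rw [← KernelAssumptions.integral_nker_sq hh, ← integral_zonal hd x ((hL.nker_isKer hd hk hh).meas.pow_const 2)]
  simp only [kerTilde, kerH_eq hL hd, pow_two]

end

/-! ### The bias -/

/-- The bias `𝔼 f̂(x; h) - f(x)` of the estimator. -/
def bias {d : ℕ} (L : ℝ → ℝ) (f : Sph d → ℝ) (h : ℝ) (x : Sph d) : ℝ := zonalOp (nker d L h) f x - f x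

/-- The integrated squared bias. -/
def isb {d : ℕ} (L : ℝ → ℝ) (f : Sph d → ℝ) (h : ℝ) : ℝ := ∫ x, bias L f h x ^ 2 ∂(surf d)

section

variable {d : ℕ} {L : ℝ → ℝ} {f : Sph d → ℝ}

lemma KernelAssumptions.b_pos (hL : KernelAssumptions d L) (hd : 1 ≤ d) : 0 < b d L := by
  obtain ⟨r, hr, hlow⟩ := hL.exists_lower
  have hL0 := hL.pos_zero
  have hd0 : (0:ℝ) < d := by exact_mod_cast hd
  have hI : 0 < ∫ s in Ioi (0:ℝ), L s * s ^ ((d:ℝ) / 2 - 1) :=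
    pos_of_mul_pos_right hL.lam_one_pos (mul_pos (by positivity) (area_pos _)).le
  refine div_pos ?_ (mul_pos hd0 hI)
  have hi : IntegrableOn (fun s => L s * s ^ ((d:ℝ) / 2)) (Ioi 0) := hL.second_moment_finite
  rw [setIntegral_pos_iff_support_of_nonneg_ae ?_ hi]
  · refine lt_of_lt_of_le (?_ : 0 < volume (Ioo 0 r)) (measure_mono fun s hs => ⟨?_, hs.1⟩)
    · simp [hr]
    · have := hlow s hs.2
      rw [ext0_of_nonneg L hs.1.le] at this
      exact (mul_pos (by linarith) (Real.rpow_pos_of_pos hs.1 _)).ne'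
  · filter_upwards [ae_restrict_mem measurableSet_Ioi] with s hs
    exact mul_nonneg (hL.nonneg s (le_of_lt hs)) (Real.rpow_nonneg (le_of_lt hs) _)

lemma IsBM.bias (hf : IsBM f) (hL : KernelAssumptions d L) (hd : 1 ≤ d) {h : ℝ} (hh : 0 < h) :
    IsBM (bias L f h) := by
  obtain ⟨B, hB, hk⟩ := hL.exists_isKer
  exact (hf.zonalOp hd (hL.nker_isKer hd hk hh)).sub hf

lemma isb_nonneg (L : ℝ → ℝ) (f : Sph d → ℝ) (h : ℝ) : 0 ≤ isb L f h := integral_nonneg fun _ => sq_nonneg _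

lemma IsC2.isBM (hf : IsC2 f) : IsBM f := isBM_of_continuous hf.continuous

/-- Uniform expansion of the bias. The far mass contributes a term that involves the values of the
density at antipodal points. -/
lemma IsC2.bias_expansion (hf : IsC2 f) (hL : KernelAssumptions d L) (hd : 1 ≤ d) {γ : ℝ} (hγ : 0 < γ) :
    ∀ᶠ h : ℝ in 𝓝[>] 0, ∀ x, |bias L f h x - (h ^ 2 * b d L * lap f x + farMass d L h * (f (-x) - f x))| ≤
      γ * h ^ 2 := by
  obtain ⟨B, hB, hk⟩ := hL.exists_isKer
  have hb := hL.b_pos hd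
  have hd0 : (0:ℝ) < d := by exact_mod_cast hd
  obtain ⟨M, hM, hMl⟩ := exists_bound_of_continuous hf.continuous_lap
  have hη : 0 < γ / (8 * (d * b d L)) := by positivity
  obtain ⟨C, hC, hexp⟩ := hf.exists_bias hd hη
  have hC1 : 0 < γ / (8 * (C + 1)) := by positivity
  have hM1 : 0 < γ / (4 * (M + 1)) := by positivity
  filter_upwards [self_mem_nhdsWithin,
    (hL.tendsto_near_nker_one hd).eventually (gt_mem_nhds (show d * b d L < 2 * (d * b d L) by
      have : 0 < d * b d L := by positivity
      linarith)),
    (hL.tendsto_near_nker_two hd).eventually (gt_mem_nhds hC1),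
    (hL.tendsto_far_nker_mul hd).eventually (gt_mem_nhds hC1),
    (Metric.tendsto_nhds.mp (hL.tendsto_biasCoeff hd)) _ hM1] with h (hh : 0 < h) h1 h2 h3 h4 x
  have hkn := hL.nker_isKer hd hk hh
  have e := hexp _ _ hkn x
  rw [hL.integral_nker hd hh, one_mul] at e
  have hh2 : 0 < h ^ 2 := by positivity
  rw [inv_mul_lt_iff₀ hh2] at h1 h2 h3
  rw [Real.dist_eq] at h4
  have h5 : |biasCoeff d L h - h ^ 2 * b d L| ≤ h ^ 2 * (γ / (4 * (M + 1))) := by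
    have : biasCoeff d L h - h ^ 2 * b d L = h ^ 2 * ((h ^ 2)⁻¹ * biasCoeff d L h - b d L) := by
      field_simp
    rw [this, abs_mul, abs_of_pos hh2]
    gcongr
  have h6 : |(biasCoeff d L h - h ^ 2 * b d L) * lap f x| ≤ γ / 4 * h ^ 2 := by
    rw [abs_mul]
    calc _ ≤ h ^ 2 * (γ / (4 * (M + 1))) * (M + 1) := by
          gcongr
          exact (hMl x).trans (by linarith)
      _ = γ / 4 * h ^ 2 := by field_simp
  have h7 : γ / (8 * (d * b d L)) * (∫ u, near (nker d L h) u * u ∂(nu d)) ≤ γ / 4 * h ^ 2 := by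
    calc _ ≤ γ / (8 * (d * b d L)) * (h ^ 2 * (2 * (d * b d L))) := by gcongr
      _ = γ / 4 * h ^ 2 := by field_simp; ring
  have h8 : C * (∫ u, near (nker d L h) u * u ^ 2 ∂(nu d) + ∫ u, far (nker d L h) u * (2 - u) ∂(nu d)) ≤
      γ / 4 * h ^ 2 := by
    calc _ ≤ C * (h ^ 2 * (γ / (8 * (C + 1))) + h ^ 2 * (γ / (8 * (C + 1)))) := by gcongr
      _ ≤ (C + 1) * (h ^ 2 * (γ / (8 * (C + 1))) + h ^ 2 * (γ / (8 * (C + 1)))) := by gcongr; linarith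
      _ = γ / 4 * h ^ 2 := by field_simp; ring
  have e2 : bias L f h x - (h ^ 2 * b d L * lap f x + farMass d L h * (f (-x) - f x)) =
      (zonalOp (nker d L h) f x - f x - biasCoeff d L h * lap f x - farMass d L h * (f (-x) - f x)) +
      (biasCoeff d L h - h ^ 2 * b d L) * lap f x := by rw [bias]; ring
  rw [e2]
  refine (abs_add_le _ _).trans ?_
  have e' : |zonalOp (nker d L h) f x - f x - biasCoeff d L h * lap f x - farMass d L h * (f (-x) - f x)| ≤
      γ / 4 * h ^ 2 + γ / 4 * h ^ 2 := e.trans (add_le_add h7 h8)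
  have : 0 < γ * h ^ 2 := by positivity
  linarith

lemma lapRoughness_eq (f : Sph d → ℝ) : lapRoughness f = ∫ x, lap f x ^ 2 ∂(surf d) := rfl

/-- The squared `L²` norm of the main part of the bias. -/
lemma IsC2.integral_main_sq (hf : IsC2 f) (β a : ℝ) :
    ∫ x, (β * lap f x + a * (f (-x) - f x)) ^ 2 ∂(surf d) =
      β ^ 2 * lapRoughness f + 2 * β * a * ∫ x, lap f x * (f (-x) - f x) ∂(surf d) +
        a ^ 2 * ∫ x, (f (-x) - f x) ^ 2 ∂(surf d) := by
  have hl : IsBM (lap f) := isBM_of_continuous hf.continuous_lap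
  have hD := hf.isBM.comp_neg.sub hf.isBM
  have : ∀ x, (β * lap f x + a * (f (-x) - f x)) ^ 2 = β ^ 2 * lap f x ^ 2 +
      2 * β * a * (lap f x * (f (-x) - f x)) + a ^ 2 * (f (-x) - f x) ^ 2 := fun x => by ring
  simp_rw [this]
  rw [integral_add ((hl.sq.const_mul _).add ((hl.mul hD).const_mul _)).integrable (hD.sq.const_mul _).integrable,
    integral_add (hl.sq.const_mul _).integrable ((hl.mul hD).const_mul _).integrable,
    integral_const_mul, integral_const_mul, integral_const_mul, lapRoughness_eq]

/-- Comparison of squared `L²` norms of uniformly close functions, from `(a + b)² ≤ (1 + t) a² +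
(1 + t⁻¹) b²`. -/
lemma integral_sq_le_of_abs_sub_le {g m : Sph d → ℝ} (hg : IsBM g) (hm : IsBM m) {e t : ℝ} (ht : 0 < t)
    (h : ∀ x, |g x - m x| ≤ e) :
    ∫ x, g x ^ 2 ∂(surf d) ≤ (1 + t) * ∫ x, m x ^ 2 ∂(surf d) + (1 + t⁻¹) * e ^ 2 * (surf d).real univ := by
  have e1 : (1 + t) * ∫ x, m x ^ 2 ∂(surf d) + (1 + t⁻¹) * e ^ 2 * (surf d).real univ =
      ∫ x, ((1 + t) * m x ^ 2 + (1 + t⁻¹) * e ^ 2) ∂(surf d) := by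
    rw [integral_add (hm.sq.const_mul _).integrable (integrable_const _), integral_const_mul,
      integral_const, smul_eq_mul]
    ring
  rw [e1]
  refine integral_mono hg.sq.integrable ((hm.sq.const_mul _).add (IsBM.const _)).integrable fun x => ?_
  have h1 : (g x - m x) ^ 2 ≤ e ^ 2 := sq_le_sq.mpr ((h x).trans (le_abs_self e))
  have h2 : g x ^ 2 ≤ (1 + t) * m x ^ 2 + (1 + t⁻¹) * (g x - m x) ^ 2 := by
    have : (1 + t) * m x ^ 2 + (1 + t⁻¹) * (g x - m x) ^ 2 - g x ^ 2 =
        t⁻¹ * (t * m x - (g x - m x)) ^ 2 := by field_simp; ring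
    have : 0 ≤ t⁻¹ * (t * m x - (g x - m x)) ^ 2 := by positivity
    linarith
  have h3 : 0 < 1 + t⁻¹ := by positivity
  simp only
  nlinarith

/-- Lower bound for the integrated squared bias, valid for all small bandwidths. -/
lemma IsC2.isb_lower (hf : IsC2 f) (hL : KernelAssumptions d L) (hd : 1 ≤ d)
    (hfu : ∃ x y, f x ≠ f y) {γ : ℝ} (hγ : 0 < γ) :
    ∀ᶠ h : ℝ in 𝓝[>] 0, b d L ^ 2 * lapRoughness f * h ^ 4 +
      farMass d L h ^ 2 * ∫ x, (f (-x) - f x) ^ 2 ∂(surf d) ≤ (1 + γ) * isb L f h := by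
  have hb := hL.b_pos hd
  have hR := hf.lapRoughness_pos hd hfu
  set W := (surf d).real univ with hW
  have hW0 : 0 ≤ W := measureReal_nonneg
  set bR := b d L ^ 2 * lapRoughness f with hbR
  have hbR0 : 0 < bR := by positivity
  -- `t` and the tolerance `e h²` are tuned so that the errors are absorbed
  obtain ⟨t, ht, htγ⟩ : ∃ t, 0 < t ∧ (1 + t) * (1 + t) ≤ 1 + γ := by
    refine ⟨min 1 (γ / 4), by positivity, ?_⟩
    have h1 := min_le_left 1 (γ / 4)
    have h2 := min_le_right 1 (γ / 4)
    have h3 : 0 < min 1 (γ / 4) := by positivity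
    nlinarith
  obtain ⟨e, he, hesq⟩ : ∃ e, 0 < e ∧ (1 + t⁻¹) * e ^ 2 * W ≤ t / (1 + t) * bR := by
    refine ⟨√(t / (1 + t) * bR / ((1 + t⁻¹) * (W + 1))), by positivity, ?_⟩
    rw [Real.sq_sqrt (by positivity)]
    have : (1 + t⁻¹) * (t / (1 + t) * bR / ((1 + t⁻¹) * (W + 1))) * W = t / (1 + t) * bR * (W / (W + 1)) := by
      field_simp
    rw [this]
    refine mul_le_of_le_one_right (by positivity) ?_
    rw [div_le_one (by positivity)]; linarith
  filter_upwards [self_mem_nhdsWithin, hf.bias_expansion hL hd he] with h (hh : 0 < h) hexp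
  have hl : IsBM (lap f) := isBM_of_continuous hf.continuous_lap
  have hD := hf.isBM.comp_neg.sub hf.isBM
  have hm := (hl.const_mul (h ^ 2 * b d L)).add (hD.const_mul (farMass d L h))
  have h1 := integral_sq_le_of_abs_sub_le hm (hf.isBM.bias hL hd hh) ht (fun x => by
    rw [abs_sub_comm]; exact hexp x)
  rw [hf.integral_main_sq] at h1
  -- the cross term of the Laplacian and the antipodal difference is nonnegative and is dropped
  have hc := hf.integral_lap_mul_antipodal_nonneg hd
  have ha := hL.farMass_nonneg hd hh
  have hD2 : 0 ≤ ∫ x, (f (-x) - f x) ^ 2 ∂(surf d) := integral_nonneg fun _ => sq_nonneg _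
  have hcr : 0 ≤ 2 * (h ^ 2 * b d L) * farMass d L h * ∫ x, lap f x * (f (-x) - f x) ∂(surf d) := by
    positivity
  set S := bR * h ^ 4 + farMass d L h ^ 2 * ∫ x, (f (-x) - f x) ^ 2 ∂(surf d) with hS
  have h2 : (1 + t⁻¹) * (e * h ^ 2) ^ 2 * W ≤ t / (1 + t) * S := by
    calc _ = (1 + t⁻¹) * e ^ 2 * W * h ^ 4 := by ring
      _ ≤ t / (1 + t) * bR * h ^ 4 := by gcongr
      _ ≤ t / (1 + t) * S := by
        rw [mul_assoc]
        gcongr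
        rw [hS]
        have := mul_nonneg (sq_nonneg (farMass d L h)) hD2
        linarith
  have h3 : S ≤ (1 + t) * isb L f h + t / (1 + t) * S := by
    have : S = (h ^ 2 * b d L) ^ 2 * lapRoughness f + farMass d L h ^ 2 * ∫ x, (f (-x) - f x) ^ 2 ∂(surf d) := by
      rw [hS, hbR]; ring
    have h1' : (h ^ 2 * b d L) ^ 2 * lapRoughness f +
      2 * (h ^ 2 * b d L) * farMass d L h * ∫ x, lap f x * (f (-x) - f x) ∂(surf d) +
        farMass d L h ^ 2 * ∫ x, (f (-x) - f x) ^ 2 ∂(surf d) ≤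
      (1 + t) * isb L f h + (1 + t⁻¹) * (e * h ^ 2) ^ 2 * W := h1
    linarith
  have h4 : S ≤ (1 + t) * ((1 + t) * isb L f h) := by
    have h5 : (1 + t) * S ≤ (1 + t) * ((1 + t) * isb L f h) + t * S := by
      calc (1 + t) * S ≤ (1 + t) * ((1 + t) * isb L f h + t / (1 + t) * S) := by gcongr
        _ = _ := by field_simp
    linarith
  calc S ≤ (1 + t) * (1 + t) * isb L f h := by rw [mul_assoc]; exact h4
    _ ≤ _ := mul_le_mul_of_nonneg_right htγ (isb_nonneg L f h)

/-- Upper bound for the integrated squared bias at bandwidths with small far mass. -/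
lemma IsC2.isb_upper (hf : IsC2 f) (hL : KernelAssumptions d L) (hd : 1 ≤ d) {γ : ℝ} (hγ : 0 < γ) :
    ∃ ρ, 0 < ρ ∧ ∀ᶠ h : ℝ in 𝓝[>] 0, farMass d L h ≤ ρ * h ^ 2 →
      isb L f h ≤ (b d L ^ 2 * lapRoughness f + γ) * h ^ 4 := by
  have hb := hL.b_pos hd
  set R := b d L ^ 2 * lapRoughness f with hR
  have hR0 : 0 ≤ R := mul_nonneg (sq_nonneg _) (integral_nonneg fun _ => sq_nonneg _)
  set W := (surf d).real univ with hW
  have hW0 : 0 ≤ W := measureReal_nonneg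
  set c := ∫ x, lap f x * (f (-x) - f x) ∂(surf d) with hc
  have hc0 : 0 ≤ c := hf.integral_lap_mul_antipodal_nonneg hd
  set D := ∫ x, (f (-x) - f x) ^ 2 ∂(surf d) with hD
  have hD0 : 0 ≤ D := integral_nonneg fun _ => sq_nonneg _
  have hlim : Tendsto (fun t : ℝ => (1 + t) * (R + 2 * b d L * t * c + t ^ 2 * D) +
      (1 + t) * t * W) (𝓝[>] 0) (𝓝 R) := by
    have : Tendsto (fun t : ℝ => (1 + t) * (R + 2 * b d L * t * c + t ^ 2 * D) +
      (1 + t) * t * W) (𝓝 0) (𝓝 ((1 + 0) * (R + 2 * b d L * 0 * c + 0 ^ 2 * D) +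
      (1 + 0) * 0 * W)) := Continuous.tendsto (by fun_prop) 0
    simp only [add_zero, mul_zero, zero_mul, one_mul, ne_eq, OfNat.ofNat_ne_zero, not_false_eq_true,
      zero_pow] at this
    exact this.mono_left nhdsWithin_le_nhds
  obtain ⟨t, htR, ht⟩ := ((hlim.eventually (gt_mem_nhds (show R < R + γ by linarith))).and
    self_mem_nhdsWithin).exists
  have ht0 : 0 < t := ht
  refine ⟨t, ht0, ?_⟩
  filter_upwards [self_mem_nhdsWithin, hf.bias_expansion hL hd ht0] with h (hh : 0 < h) hexp hfar
  have hl : IsBM (lap f) := isBM_of_continuous hf.continuous_lap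
  have hDb := hf.isBM.comp_neg.sub hf.isBM
  have hm := (hl.const_mul (h ^ 2 * b d L)).add (hDb.const_mul (farMass d L h))
  have h1 := integral_sq_le_of_abs_sub_le (hf.isBM.bias hL hd hh) hm ht0 hexp
  rw [hf.integral_main_sq] at h1
  have ha := hL.farMass_nonneg hd hh
  calc isb L f h ≤ _ := h1
    _ ≤ (1 + t) * ((h ^ 2 * b d L) ^ 2 * lapRoughness f + 2 * (h ^ 2 * b d L) * (t * h ^ 2) * c +
        (t * h ^ 2) ^ 2 * D) + (1 + t⁻¹) * (t * h ^ 2) ^ 2 * W := by gcongr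
    _ = ((1 + t) * (R + 2 * b d L * t * c + t ^ 2 * D) + (1 + t) * t * W) * h ^ 4 := by
        rw [hR]; field_simp; ring
    _ ≤ (R + γ) * h ^ 4 := by gcongr

/-- For small bandwidths the supremum of the bias is controlled by its `L²` norm. -/
lemma IsC2.bias_sq_le (hf : IsC2 f) (hL : KernelAssumptions d L) (hd : 1 ≤ d)
    (hfu : ∃ x y, f x ≠ f y) : ∃ C, 0 < C ∧ ∀ᶠ h : ℝ in 𝓝[>] 0, ∀ x, bias L f h x ^ 2 ≤ C * isb L f h := by
  have hb := hL.b_pos hd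
  have hR := hf.lapRoughness_pos hd hfu
  obtain ⟨M, hM, hMl⟩ := exists_bound_of_continuous hf.continuous_lap
  have hDc : Continuous (fun x => f (-x) - f x) := hf.comp_neg.continuous.sub hf.continuous
  obtain ⟨N, hN, hND⟩ := exists_bound_of_continuous hDc
  set D := ∫ x, (f (-x) - f x) ^ 2 ∂(surf d) with hD
  have hD0 : 0 ≤ D := integral_nonneg fun _ => sq_nonneg _
  obtain ⟨C', hC', hCD⟩ : ∃ C', 0 ≤ C' ∧ ∀ x, (f (-x) - f x) ^ 2 ≤ C' * D := by
    rcases hD0.eq_or_lt with h0 | h0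
    · refine ⟨0, le_rfl, fun x => ?_⟩
      rw [zero_mul]
      exact (eq_zero_of_integral_eq_zero (g := fun x => (f (-x) - f x) ^ 2) (by fun_prop)
        (fun x => sq_nonneg _) h0.symm x).le
    · refine ⟨N ^ 2 / D, by positivity, fun x => ?_⟩
      rw [div_mul_cancel₀ _ h0.ne']
      exact sq_le_sq.mpr ((hND x).trans (le_abs_self N))
  set bR := b d L ^ 2 * lapRoughness f with hbR
  have hbR0 : 0 < bR := by positivity
  set A := (b d L * M + 1) ^ 2 / bR with hA
  have hA0 : 0 ≤ A := by positivity
  refine ⟨2 * (A + C') * (1 + 1) + 1, by positivity, ?_⟩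
  filter_upwards [self_mem_nhdsWithin, hf.bias_expansion hL hd one_pos,
    hf.isb_lower hL hd hfu one_pos] with h (hh : 0 < h) hexp hlow x
  have ha := hL.farMass_nonneg hd hh
  set a := farMass d L h with haa
  set E := bias L f h x - a * (f (-x) - f x) with hE
  have h1 : |E| ≤ (b d L * M + 1) * h ^ 2 := by
    have : E = (bias L f h x - (h ^ 2 * b d L * lap f x + a * (f (-x) - f x))) + h ^ 2 * b d L * lap f x := by
      rw [hE]; ring
    rw [this]
    refine (abs_add_le _ _).trans ?_
    have h2 : |h ^ 2 * b d L * lap f x| ≤ h ^ 2 * b d L * M := by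
      rw [abs_mul, abs_of_pos (by positivity)]
      exact mul_le_mul_of_nonneg_left (hMl x) (by positivity)
    have := hexp x
    linarith
  have h2 : E ^ 2 ≤ A * (bR * h ^ 4) := by
    calc E ^ 2 ≤ ((b d L * M + 1) * h ^ 2) ^ 2 := sq_le_sq.mpr (h1.trans (le_abs_self _))
      _ = _ := by rw [hA]; field_simp
  have h3 : bias L f h x ^ 2 ≤ 2 * E ^ 2 + 2 * (a ^ 2 * (f (-x) - f x) ^ 2) := by
    have : bias L f h x = E + a * (f (-x) - f x) := by rw [hE]; ring
    rw [this]
    nlinarith [sq_nonneg (E - a * (f (-x) - f x))]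
  have h4 : a ^ 2 * (f (-x) - f x) ^ 2 ≤ a ^ 2 * (C' * D) := by gcongr; exact hCD x
  have h5 : 0 ≤ a ^ 2 * D := by positivity
  have h6 : 0 ≤ bR * h ^ 4 := by positivity
  have hi := isb_nonneg L f h
  calc bias L f h x ^ 2 ≤ 2 * (A * (bR * h ^ 4)) + 2 * (C' * (a ^ 2 * D)) := by linarith
    _ ≤ 2 * (A + C') * (bR * h ^ 4 + a ^ 2 * D) := by nlinarith [mul_nonneg hA0 h5, mul_nonneg hC' h6]
    _ ≤ 2 * (A + C') * ((1 + 1) * isb L f h) := by gcongr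
    _ ≤ _ := by linarith

/-- The integrated squared bias is bounded below for bandwidths bounded away from zero: for these
the kernel is bounded below near the origin, and the Dirichlet form of `f` does not vanish, `f`
being nonconstant on a connected space. -/
lemma exists_isb_ge (hf : Continuous f) (hL : KernelAssumptions d L) (hd : 1 ≤ d)
    (hfu : ∃ x y, f x ≠ f y) {δ : ℝ} (hδ : 0 < δ) : ∃ κ, 0 < κ ∧ ∀ h, δ ≤ h → κ ≤ isb L f h := by
  obtain ⟨B, hB, hk⟩ := hL.exists_isKer
  obtain ⟨c, r, hc, hr, hlow⟩ := hL.exists_nker_lower hd hδ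
  have hfb := isBM_of_continuous hf
  set U : Set (Sph d × Sph d) := {p | 1 - ⟪(p.1 : EuclideanSpace ℝ (Fin (d + 1))), p.2⟫_ℝ < r} with hU
  have hUo : IsOpen U := isOpen_lt (by fun_prop) continuous_const
  set F : Sph d × Sph d → ℝ := fun p => (f p.1 - f p.2) ^ 2 with hF
  have hFc : Continuous F := by fun_prop
  set q := ∫ p in U, F p ∂((surf d).prod (surf d)) with hq
  have hFi : Integrable F ((surf d).prod (surf d)) := by
    obtain ⟨C, hC⟩ := isCompact_univ.exists_bound_of_continuousOn (f := F) hFc.continuousOn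
    exact Integrable.of_bound hFc.aestronglyMeasurable C (ae_of_all _ fun p => hC p (mem_univ _))
  have hq0 : 0 < q := by
    rw [hq, setIntegral_pos_iff_support_of_nonneg_ae (ae_of_all _ fun p => sq_nonneg _) hFi.integrableOn]
    have hVo : IsOpen (Function.support F ∩ U) := hFc.isOpen_support.inter hUo
    refine hVo.measure_pos _ ?_
    by_contra hne
    rw [not_nonempty_iff_eq_empty] at hne
    have hloc : IsLocallyConstant f := by
      rw [IsLocallyConstant.iff_eventually_eq]
      intro x
      have : ∀ᶠ y in 𝓝 x, (x, y) ∈ U := by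
        have hcont : Continuous (fun y : Sph d => (x, y)) := by fun_prop
        refine hcont.continuousAt.eventually (hUo.mem_nhds ?_)
        simp [hU, hr]
      filter_upwards [this] with y hy
      by_contra hxy
      have : (x, y) ∈ Function.support F ∩ U := ⟨pow_ne_zero _ (sub_ne_zero.mpr (Ne.symm hxy)), hy⟩
      rw [hne] at this
      exact this
    have : PreconnectedSpace (Sph d) := by
      rw [← isPreconnected_iff_preconnectedSpace]
      refine isPreconnected_sphere ?_ _ _
      rw [← Module.finrank_eq_rank, finrank_euclideanSpace_fin]
      exact_mod_cast Nat.lt_add_of_pos_left hd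
    obtain ⟨x, y, hxy⟩ := hfu
    exact hxy (hloc.apply_eq_of_preconnectedSpace x y)
  have hf2 : 0 ≤ ∫ x, f x ^ 2 ∂(surf d) := integral_nonneg fun _ => sq_nonneg _
  refine ⟨(c * q / 2) ^ 2 / (∫ x, f x ^ 2 ∂(surf d) + 1), by positivity, fun h hh => ?_⟩
  have hh0 : 0 < h := hδ.trans_le hh
  have hkn := hL.nker_isKer hd hk hh0
  have hbi := hfb.bias hL hd hh0
  have h1 := dirichlet_form hd hkn hfb
  rw [hL.integral_nker hd hh0, one_mul] at h1
  have hi : Integrable (fun p : Sph d × Sph d =>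
      nker d L h (1 - ⟪(p.1 : EuclideanSpace ℝ (Fin (d + 1))), p.2⟫_ℝ) * F p) ((surf d).prod (surf d)) := by
    obtain ⟨C, hC⟩ := isCompact_univ.exists_bound_of_continuousOn (f := F) hFc.continuousOn
    exact hkn.integrable_prod hFc.measurable (C := C) fun p => hC p (mem_univ _)
  have h2 : c * q ≤ ∫ x, ∫ y : Sph d, nker d L h (1 - ⟪(x : EuclideanSpace ℝ (Fin (d + 1))), y⟫_ℝ) *
      (f x - f y) ^ 2 ∂(surf d) ∂(surf d) := by
    rw [integral_integral hi, hq, ← integral_const_mul]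
    refine (setIntegral_mono_on (hFi.integrableOn.const_mul c) hi.integrableOn hUo.measurableSet ?_).trans
      (setIntegral_le_integral hi (ae_of_all _ fun p => mul_nonneg (hkn.nonneg _) (sq_nonneg _)))
    intro p hp
    exact mul_le_mul_of_nonneg_right (hlow h hh _ hp) (sq_nonneg _)
  have h3 : ∫ x, f x * bias L f h x ∂(surf d) =
      ∫ x, f x * zonalOp (nker d L h) f x ∂(surf d) - ∫ x, f x ^ 2 ∂(surf d) := by
    rw [← integral_sub (hfb.mul (hfb.zonalOp hd hkn)).integrable hfb.sq.integrable]
    simp_rw [bias]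
    congr 1; ext x; ring
  have h4 : c * q / 2 ≤ -∫ x, f x * bias L f h x ∂(surf d) := by linarith
  -- Cauchy–Schwarz, from the nonnegativity of a quadratic polynomial
  have h5 : ∀ t : ℝ, 0 ≤ isb L f h * (t * t) + (2 * ∫ x, f x * bias L f h x ∂(surf d)) * t +
      ∫ x, f x ^ 2 ∂(surf d) := by
    intro t
    have : isb L f h * (t * t) + (2 * ∫ x, f x * bias L f h x ∂(surf d)) * t + ∫ x, f x ^ 2 ∂(surf d) =
        ∫ x, (t * bias L f h x + f x) ^ 2 ∂(surf d) := by
      have e : ∀ x, (t * bias L f h x + f x) ^ 2 = t ^ 2 * bias L f h x ^ 2 +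
          2 * t * (f x * bias L f h x) + f x ^ 2 := fun x => by ring
      simp_rw [e]
      rw [integral_add ((hbi.sq.const_mul _).add ((hfb.mul hbi).const_mul _)).integrable hfb.sq.integrable,
        integral_add (hbi.sq.const_mul _).integrable ((hfb.mul hbi).const_mul _).integrable,
        integral_const_mul, integral_const_mul, isb]
      ring
    rw [this]
    exact integral_nonneg fun _ => sq_nonneg _
  have h6 := discrim_le_zero h5
  rw [discrim] at h6
  have h7 : (c * q / 2) ^ 2 ≤ (∫ x, f x * bias L f h x ∂(surf d)) ^ 2 := by
    rw [← neg_sq (∫ x, f x * bias L f h x ∂(surf d))]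
    exact pow_le_pow_left₀ (by positivity) h4 2
  rw [div_le_iff₀ (by positivity)]
  have := isb_nonneg L f h
  nlinarith

end

/-! ### Samples and the exact mean integrated squared error -/

/-- The random points `X i` are independent with density `f`. -/
structure IsSample {d : ℕ} {Ω : Type*} [MeasurableSpace Ω] (P : Measure Ω) (X : ℕ → Ω → Sph d)
    (f : Sph d → ℝ) : Prop where
  meas : ∀ i, Measurable (X i)
  indep : iIndepFun X P
  law : ∀ i, P.map (X i) = (surf d).withDensity (fun x => ENNReal.ofReal (f x))
  density : IsDensity f
  bm : IsBM f

section

variable {d : ℕ} {L : ℝ → ℝ} {f : Sph d → ℝ} {Ω : Type*} [MeasurableSpace Ω] {P : Measure Ω}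
  {X : ℕ → Ω → Sph d}

lemma IsSample.integral_comp (hX : IsSample P X f) {g : Sph d → ℝ} (hg : Measurable g) (i : ℕ) :
    ∫ ω, g (X i ω) ∂P = ∫ x, g x * f x ∂(surf d) := by
  rw [← integral_map (hX.meas i).aemeasurable hg.aestronglyMeasurable, hX.law i,
    integral_withDensity_eq_integral_toReal_smul hX.bm.meas.ennreal_ofReal (by simp)]
  refine integral_congr_ae (ae_of_all _ fun x => ?_)
  simp only [smul_eq_mul, ENNReal.toReal_ofReal (hX.density.nonneg x), mul_comm]

variable [IsProbabilityMeasure P]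

/-- The decomposition of a mean squared error into variance and squared bias. -/
lemma integral_sub_const_sq {Z : Ω → ℝ} (hZ : MemLp Z 2 P) (c : ℝ) :
    ∫ ω, (Z ω - c) ^ 2 ∂P = Var[Z; P] + (∫ ω, Z ω ∂P - c) ^ 2 := by
  have h1 : MemLp (fun ω => Z ω - c) 2 P := hZ.sub (memLp_const c)
  have h2 := variance_eq_sub h1
  rw [variance_sub_const hZ.aestronglyMeasurable] at h2
  have h3 : ∫ ω, (Z ω - c) ∂P = ∫ ω, Z ω ∂P - c := by
    rw [integral_sub (hZ.integrable (by norm_num)) (integrable_const _)]; simp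
  rw [h3] at h2
  rw [h2]
  simp

/-- The mean squared error of the estimator at a point, exactly. -/
lemma IsSample.integral_kde_sub_sq (hX : IsSample P X f) {k : ℝ → ℝ} {B : ℝ} (hk : IsKer k B) {n : ℕ} (hn : 1 ≤ n) (x : Sph d) :
    ∫ ω, ((n:ℝ)⁻¹ * ∑ i ∈ Finset.range n, k (1 - ⟪(x : EuclideanSpace ℝ (Fin (d + 1))), X i ω⟫_ℝ) - f x) ^ 2 ∂P =
      (n:ℝ)⁻¹ * (zonalOp (fun u => k u ^ 2) f x - zonalOp k f x ^ 2) + (zonalOp k f x - f x) ^ 2 := by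
  set g : Sph d → ℝ := fun y => k (1 - ⟪(x : EuclideanSpace ℝ (Fin (d + 1))), y⟫_ℝ) with hg
  have hgm : Measurable g := hk.meas.comp (measurable_zonal x)
  set Y : ℕ → Ω → ℝ := fun i ω => g (X i ω) with hY
  have hYm : ∀ i, Measurable (Y i) := fun i => hgm.comp (hX.meas i)
  have hYL : ∀ i, MemLp (Y i) 2 P := fun i =>
    MemLp.of_bound (hYm i).aestronglyMeasurable B (ae_of_all _ fun ω => hk.abs_le _)
  have hYI : iIndepFun Y P := hX.indep.comp (fun _ => g) (fun _ => hgm)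
  have hE : ∀ i, ∫ ω, Y i ω ∂P = zonalOp k f x := fun i => hX.integral_comp hgm i
  have hE2 : ∀ i, ∫ ω, Y i ω ^ 2 ∂P = zonalOp (fun u => k u ^ 2) f x := fun i =>
    hX.integral_comp (hgm.pow_const 2) i
  have hV : ∀ i, Var[Y i; P] = zonalOp (fun u => k u ^ 2) f x - zonalOp k f x ^ 2 := by
    intro i
    rw [variance_eq_sub (hYL i), ← hE2 i, ← hE i]
    rfl
  have hn0 : (n:ℝ) ≠ 0 := by positivity
  set S : Ω → ℝ := ∑ i ∈ Finset.range n, Y i with hS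
  have hSL : MemLp S 2 P := memLp_finsetSum' _ fun i _ => hYL i
  have hVS : Var[S; P] = n * (zonalOp (fun u => k u ^ 2) f x - zonalOp k f x ^ 2) := by
    rw [hS, IndepFun.variance_sum (fun i _ => hYL i) (fun i _ j _ hij => hYI.indepFun hij)]
    simp [hV, mul_sub]
  have hES : ∫ ω, S ω ∂P = n * zonalOp k f x := by
    simp only [hS, Finset.sum_apply]
    rw [integral_finsetSum _ fun i _ => (hYL i).integrable (by norm_num)]
    simp [hE]
  have h1 := integral_sub_const_sq (hSL.const_mul (n:ℝ)⁻¹) (f x)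
  rw [integral_const_mul, variance_const_mul, hVS, hES, inv_mul_cancel_left₀ hn0] at h1
  have h2 : ((n:ℝ)⁻¹) ^ 2 * (n * (zonalOp (fun u => k u ^ 2) f x - zonalOp k f x ^ 2)) =
      (n:ℝ)⁻¹ * (zonalOp (fun u => k u ^ 2) f x - zonalOp k f x ^ 2) := by field_simp
  rw [h2] at h1
  rw [← h1]
  simp only [hS, Finset.sum_apply, hY, hg]

lemma kde_eq (hL : KernelAssumptions d L) (hd : 1 ≤ d) (n : ℕ) (x' : ℕ → Sph d) (h : ℝ) (x : Sph d) :
    kde L n x' h x = (n:ℝ)⁻¹ * ∑ i ∈ Finset.range n,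
      nker d L h (1 - ⟪(x : EuclideanSpace ℝ (Fin (d + 1))), x' i⟫_ℝ) := by
  simp only [kde, kerH_eq hL hd]

lemma IsKer.sq {k : ℝ → ℝ} {B : ℝ} (hk : IsKer k B) : IsKer (fun u => k u ^ 2) (B ^ 2) :=
  ⟨hk.meas.pow_const 2, fun _ => sq_nonneg _, fun u => pow_le_pow_left₀ (hk.nonneg u) (hk.le u) 2⟩

lemma integral_zonalOp (hd : 1 ≤ d) {k : ℝ → ℝ} {B : ℝ} (hk : IsKer k B) {g : Sph d → ℝ} (hg : IsBM g) :
    ∫ x, zonalOp k g x ∂(surf d) = (∫ u, k u ∂(nu d)) * ∫ x, g x ∂(surf d) := by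
  have := integral_mul_zonalOp hk (IsBM.const (d := d) 1) hg
  simp only [one_mul, zonalOp_const hd hk.meas, mul_one] at this
  rw [this, integral_const_mul]

lemma measurable_kernel_comp {k : ℝ → ℝ} (hk : Measurable k) {Y : Ω → Sph d} (hY : Measurable Y) :
    Measurable (fun p : Ω × Sph d => k (1 - ⟪(p.2 : EuclideanSpace ℝ (Fin (d + 1))), Y p.1⟫_ℝ)) := by
  have h1 : Measurable (fun p : Ω × Sph d => (p.2, Y p.1)) :=
    measurable_snd.prodMk (hY.comp measurable_fst)
  exact (measurable_kernel hk).comp h1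

/-- The exact decomposition of the mean integrated squared error. -/
lemma IsSample.MISE_eq (hX : IsSample P X f) (hL : KernelAssumptions d L) (hd : 1 ≤ d) {n : ℕ} (hn : 1 ≤ n)
    {h : ℝ} (hh : 0 < h) :
    MISE P X L f n h = (n:ℝ)⁻¹ * ((h ^ d)⁻¹ * vH d L h - ∫ x, zonalOp (nker d L h) f x ^ 2 ∂(surf d)) +
      isb L f h := by
  obtain ⟨B, hB, hk⟩ := hL.exists_isKer
  have hkn := hL.nker_isKer hd hk hh
  set B' := (mass d L h)⁻¹ * B with hB'
  obtain ⟨C, hC, hfC⟩ := hX.bm.bdd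
  simp only [MISE, kde_eq hL hd]
  rw [integral_integral_swap]
  · simp_rw [hX.integral_kde_sub_sq hkn hn]
    have h1 := hX.bm.zonalOp hd hkn
    have h2 := hX.bm.zonalOp hd hkn.sq
    rw [integral_add ((h2.sub h1.sq).const_mul _).integrable (h1.sub hX.bm).sq.integrable, integral_const_mul,
      integral_sub h2.integrable h1.sq.integrable, integral_zonalOp hd hkn.sq hX.bm,
      hX.density.integral_eq_one, mul_one, KernelAssumptions.integral_nker_sq hh]
    rfl
  · have hm : Measurable (fun p : Ω × Sph d => ((n:ℝ)⁻¹ * ∑ i ∈ Finset.range n,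
        nker d L h (1 - ⟪(p.2 : EuclideanSpace ℝ (Fin (d + 1))), X i p.1⟫_ℝ) - f p.2) ^ 2) := by
      refine Measurable.pow_const (Measurable.sub (Measurable.const_mul ?_ _) (hX.bm.meas.comp measurable_snd)) 2
      refine Finset.measurable_fun_sum _ fun i _ => ?_
      exact measurable_kernel_comp hkn.meas (hX.meas i)
    have hn0 : (0:ℝ) < n := by exact_mod_cast hn
    have hb : ∀ p : Ω × Sph d, |(n:ℝ)⁻¹ * ∑ i ∈ Finset.range n,
        nker d L h (1 - ⟪(p.2 : EuclideanSpace ℝ (Fin (d + 1))), X i p.1⟫_ℝ) - f p.2| ≤ B' + C := by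
      intro p
      refine (abs_sub _ _).trans (add_le_add ?_ (hfC _))
      rw [abs_mul, abs_of_nonneg (inv_nonneg.mpr hn0.le), inv_mul_le_iff₀ hn0]
      refine (Finset.abs_sum_le_sum_abs _ _).trans ((Finset.sum_le_sum fun i _ => hkn.abs_le _).trans ?_)
      simp
    refine Integrable.of_bound (C := (B' + C) ^ 2) hm.aestronglyMeasurable (ae_of_all _ fun p => ?_)
    have := pow_le_pow_left₀ (abs_nonneg _) (hb p) 2
    rw [← abs_pow] at this
    exact this

end

/-! ### The asymptotic criterion and its minimizer -/

/-- The limit `τ ↦ v_d(L) τ^{-d} + b_d(L)² R(∇² f̄) τ⁴` of the rescaled criterion. -/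
def amise {d : ℕ} (L : ℝ → ℝ) (f : Sph d → ℝ) (τ : ℝ) : ℝ :=
  v d L * (τ ^ d)⁻¹ + b d L ^ 2 * lapRoughness f * τ ^ 4

/-- The common part `n⁻¹ h^{-d} v_{h,d}(L) + ∫ bias²` of the two criteria. -/
def crit {d : ℕ} (L : ℝ → ℝ) (f : Sph d → ℝ) (n : ℕ) (h : ℝ) : ℝ :=
  (n:ℝ)⁻¹ * ((h ^ d)⁻¹ * vH d L h) + isb L f h

/-- The order `n^{-1/(d+4)}` of the optimal bandwidth. -/
def rate (d n : ℕ) : ℝ := (n:ℝ) ^ (-(1 / ((d:ℝ) + 4)))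

lemma rate_pos (d : ℕ) {n : ℕ} (hn : 1 ≤ n) : 0 < rate d n := Real.rpow_pos_of_pos (by exact_mod_cast hn) _

/-- The rate is chosen so that the variance `n⁻¹ h^{-d}` and the squared bias `h⁴` balance. -/
lemma rate_pow (d n : ℕ) : rate d n ^ (d + 4) = (n:ℝ)⁻¹ := by
  rw [rate, ← Real.rpow_natCast, ← Real.rpow_mul (Nat.cast_nonneg n), ← Real.rpow_neg_one]
  congr 1
  push_cast
  field_simp

lemma tendsto_rate (d : ℕ) : Tendsto (rate d) atTop (𝓝[>] 0) := by
  rw [tendsto_nhdsWithin_iff]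
  refine ⟨(tendsto_rpow_neg_atTop (y := 1 / ((d:ℝ) + 4)) (by positivity)).comp tendsto_natCast_atTop_atTop, ?_⟩
  filter_upwards [eventually_ge_atTop 1] with n hn
  exact rate_pos d hn

lemma continuousOn_weighted_powers {d : ℕ} (p q : ℝ) :
    ContinuousOn (fun s : ℝ => p * (s ^ d)⁻¹ + q * s ^ 4) (Ioi 0) := by
  refine ContinuousOn.add (continuousOn_const.mul (ContinuousOn.inv₀ (by fun_prop) fun s hs => ?_)) (by fun_prop)
  exact (pow_pos hs d).ne'

/-- The strict minimum of `s^{-d} + (d/4) s⁴` at `s = 1`, in quantitative form. -/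
lemma exists_gap_weighted_powers {d : ℕ} (hd : 1 ≤ d) {κ : ℝ} (hκ : 0 < κ) :
    ∃ ι, 0 < ι ∧ ∀ s : ℝ, 0 < s → κ ≤ |s - 1| → 1 + (d:ℝ) / 4 + ι ≤ (s ^ d)⁻¹ + (d:ℝ) / 4 * s ^ 4 := by
  set g : ℝ → ℝ := fun s => (s ^ d)⁻¹ + (d:ℝ) / 4 * s ^ 4 with hg
  have hd0 : (0:ℝ) < d := by exact_mod_cast hd
  have hgc : ContinuousOn g (Ioi 0) := by
    have := continuousOn_weighted_powers (d := d) 1 ((d:ℝ) / 4)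
    simpa only [one_mul] using this
  have hder : ∀ s, 0 < s → HasDerivAt g (d * (s ^ (d + 1))⁻¹ * (s ^ (d + 4) - 1)) s := by
    intro s hs
    have h1 := ((hasDerivAt_pow d s).inv (pow_pos hs d).ne').add ((hasDerivAt_pow 4 s).const_mul ((d:ℝ) / 4))
    refine h1.congr_deriv ?_
    obtain ⟨m, rfl⟩ : ∃ m, d = m + 1 := ⟨d - 1, by omega⟩
    simp only [Nat.add_sub_cancel]
    push_cast
    field_simp
    ring
  have hg1 : g 1 = 1 + (d:ℝ) / 4 := by simp [hg]
  have hanti : StrictAntiOn g (Ioc 0 1) := by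
    refine strictAntiOn_of_deriv_neg (convex_Ioc 0 1) (hgc.mono fun s hs => hs.1) fun s hs => ?_
    rw [interior_Ioc] at hs
    rw [(hder s hs.1).deriv]
    have : s ^ (d + 4) < 1 := pow_lt_one₀ hs.1.le hs.2 (by omega)
    have h2 : 0 < d * (s ^ (d + 1))⁻¹ := mul_pos hd0 (inv_pos.mpr (pow_pos hs.1 _))
    nlinarith
  have hmono : StrictMonoOn g (Ici 1) := by
    refine strictMonoOn_of_deriv_pos (convex_Ici 1) (hgc.mono fun s hs => mem_Ioi.mpr (zero_lt_one.trans_le hs)) fun s hs => ?_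
    rw [interior_Ici] at hs
    have hs0 : 0 < s := zero_lt_one.trans hs
    rw [(hder s hs0).deriv]
    have : 1 < s ^ (d + 4) := one_lt_pow₀ hs (by omega)
    have h2 : 0 < d * (s ^ (d + 1))⁻¹ := mul_pos hd0 (inv_pos.mpr (pow_pos hs0 _))
    nlinarith
  set κ' := min κ (1 / 2) with hκ'
  have hk0 : 0 < κ' := by positivity
  have hk2 : κ' ≤ 1 / 2 := min_le_right _ _
  have m1 : (1 - κ') ∈ Ioc (0:ℝ) 1 := ⟨by linarith, by linarith⟩
  have m2 : (1:ℝ) ∈ Ioc (0:ℝ) 1 := ⟨by norm_num, le_rfl⟩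
  have m3 : (1 + κ') ∈ Ici (1:ℝ) := by simp [hk0.le]
  have m4 : (1:ℝ) ∈ Ici (1:ℝ) := self_mem_Ici
  have g1 : g 1 < g (1 - κ') := hanti m1 m2 (by linarith)
  have g2 : g 1 < g (1 + κ') := hmono m4 m3 (by linarith)
  refine ⟨min (g (1 - κ') - g 1) (g (1 + κ') - g 1), lt_min (by linarith) (by linarith), fun s hs hsκ => ?_⟩
  have h1 := min_le_left (g (1 - κ') - g 1) (g (1 + κ') - g 1)
  have h2 := min_le_right (g (1 - κ') - g 1) (g (1 + κ') - g 1)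
  rw [← hg1]
  change _ ≤ g s
  have hκκ : κ' ≤ |s - 1| := (min_le_left _ _).trans hsκ
  rcases le_abs.mp hκκ with h3 | h3
  · have : g (1 + κ') ≤ g s := hmono.monotoneOn m3 (show (1:ℝ) ≤ s by linarith) (by linarith)
    linarith
  · have : g (1 - κ') ≤ g s := hanti.antitoneOn ⟨hs, by linarith⟩ m1 (by linarith)
    linarith

section

variable {d : ℕ} {L : ℝ → ℝ} {f : Sph d → ℝ}

lemma IsC2.c₀_pos (hf : IsC2 f) (hL : KernelAssumptions d L) (hd : 1 ≤ d) (hfu : ∃ x y, f x ≠ f y) :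
    0 < c₀ L f := by
  have hb := hL.b_pos hd
  have hv := hL.v_pos
  have hR := hf.lapRoughness_pos hd hfu
  have hd0 : (0:ℝ) < d := by exact_mod_cast hd
  exact Real.rpow_pos_of_pos (by positivity) _

/-- In units of `c₀`, the limit criterion is a multiple of `s^{-d} + (d/4) s⁴`. -/
lemma IsC2.amise_eq (hf : IsC2 f) (hL : KernelAssumptions d L) (hd : 1 ≤ d) (hfu : ∃ x y, f x ≠ f y)
    (s : ℝ) : amise L f (c₀ L f * s) =
      v d L * (c₀ L f ^ d)⁻¹ * ((s ^ d)⁻¹ + (d:ℝ) / 4 * s ^ 4) := by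
  have hb := hL.b_pos hd
  have hv := hL.v_pos
  have hR := hf.lapRoughness_pos hd hfu
  have hc := hf.c₀_pos hL hd hfu
  have hd0 : (0:ℝ) < d := by exact_mod_cast hd
  have hpow : c₀ L f ^ (d + 4) = d * v d L / (4 * b d L ^ 2 * lapRoughness f) := by
    rw [c₀, ← Real.rpow_natCast, ← Real.rpow_mul (by positivity)]
    have : 1 / ((d:ℝ) + 4) * ((d + 4 : ℕ) : ℝ) = 1 := by push_cast; field_simp
    rw [this, Real.rpow_one]
  have h2 : b d L ^ 2 * lapRoughness f * c₀ L f ^ 4 = v d L * (c₀ L f ^ d)⁻¹ * (d / 4) := by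
    rw [pow_add, eq_div_iff (by positivity)] at hpow
    field_simp
    linarith
  rw [amise, mul_pow, mul_pow, mul_inv]
  linear_combination s ^ 4 * h2

/-- The minimum of the limit criterion at `c₀` is well separated. -/
lemma IsC2.exists_gap_amise (hf : IsC2 f) (hL : KernelAssumptions d L) (hd : 1 ≤ d)
    (hfu : ∃ x y, f x ≠ f y) {κ : ℝ} (hκ : 0 < κ) :
    ∃ ι, 0 < ι ∧ ∀ τ, 0 < τ → κ ≤ |τ - c₀ L f| → amise L f (c₀ L f) + ι ≤ amise L f τ := by
  have hv := hL.v_pos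
  have hc := hf.c₀_pos hL hd hfu
  obtain ⟨ι, hι, h⟩ := exists_gap_weighted_powers hd (κ := κ / c₀ L f) (by positivity)
  set q := v d L * (c₀ L f ^ d)⁻¹ with hq
  have hq0 : 0 < q := by positivity
  refine ⟨q * ι, by positivity, fun τ hτ hτκ => ?_⟩
  have h1 := h (τ / c₀ L f) (by positivity) (by
    rw [div_sub_one hc.ne', abs_div, abs_of_pos hc]; gcongr)
  have e1 := hf.amise_eq hL hd hfu 1
  have e2 := hf.amise_eq hL hd hfu (τ / c₀ L f)
  rw [mul_div_cancel₀ _ hc.ne'] at e2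
  rw [mul_one, one_pow, one_pow, inv_one, mul_one] at e1
  rw [e1, e2, ← hq]
  nlinarith

lemma IsC2.amise_pos (hf : IsC2 f) (hL : KernelAssumptions d L) (hd : 1 ≤ d) (hfu : ∃ x y, f x ≠ f y)
    {τ : ℝ} (hτ : 0 < τ) : 0 < amise L f τ := by
  have hb := hL.b_pos hd
  have hv := hL.v_pos
  have hR := hf.lapRoughness_pos hd hfu
  rw [amise]; positivity

lemma rate_inv_mul {n : ℕ} (hn : 1 ≤ n) {τ : ℝ} :
    (n:ℝ)⁻¹ * ((τ * rate d n) ^ d)⁻¹ = rate d n ^ 4 * (τ ^ d)⁻¹ := by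
  have h0 := rate_pos d hn
  rw [← rate_pow d n, mul_pow, mul_inv, pow_add]
  field_simp

/-- Bandwidths whose ratio to the rate is away from `c₀` are suboptimal. -/
lemma IsC2.eventually_crit_ge (hf : IsC2 f) (hL : KernelAssumptions d L) (hd : 1 ≤ d)
    (hfu : ∃ x y, f x ≠ f y) {κ : ℝ} (hκ : 0 < κ) :
    ∃ ι, 0 < ι ∧ ∀ᶠ n : ℕ in atTop, ∀ h, 0 < h → κ ≤ |h / rate d n - c₀ L f| →
      (amise L f (c₀ L f) + ι) * rate d n ^ 4 ≤ crit L f n h := by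
  have hv := hL.v_pos
  have hc := hf.c₀_pos hL hd hfu
  obtain ⟨ι, hι, hgap⟩ := hf.exists_gap_amise hL hd hfu hκ
  have hA := hf.amise_pos hL hd hfu hc
  set A := amise L f (c₀ L f) with hAdef
  -- the relative error `γ` leaves half of the gap
  set γ := ι / 2 / (A + ι) with hγ
  have hγ0 : 0 < γ := by positivity
  have hγA : (A + ι / 2) * (1 + γ) ≤ A + ι := by
    have : γ * (A + ι) = ι / 2 := by rw [hγ]; field_simp
    nlinarith
  have hevL := hf.isb_lower hL hd hfu hγ0
  have hevv : ∀ᶠ h : ℝ in 𝓝[>] 0, v d L ≤ (1 + γ) * vH d L h := by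
    have h1 : Tendsto (fun h => (1 + γ) * vH d L h) (𝓝[>] 0) (𝓝 ((1 + γ) * v d L)) :=
      (hL.tendsto_vH hd).const_mul _
    filter_upwards [h1.eventually (lt_mem_nhds (show v d L < (1 + γ) * v d L by nlinarith))] with h hh
    exact hh.le
  have hev := hevL.and hevv
  rw [eventually_nhdsWithin_iff, Metric.eventually_nhds_iff] at hev
  obtain ⟨δ, hδ, hev⟩ := hev
  obtain ⟨κ₁, hκ₁, hbig⟩ := exists_isb_ge hf.continuous hL hd hfu hδ
  refine ⟨ι / 2, by positivity, ?_⟩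
  have t4 : Tendsto (fun n => (A + ι / 2) * rate d n ^ 4) atTop (𝓝 0) := by
    have := (((tendsto_rate d).mono_right nhdsWithin_le_nhds).pow 4).const_mul (A + ι / 2)
    simpa using this
  filter_upwards [eventually_ge_atTop 1, t4.eventually (gt_mem_nhds hκ₁)] with n hn hsm h hh hκh
  have hr := rate_pos d hn
  have hvar : 0 ≤ (n:ℝ)⁻¹ * ((h ^ d)⁻¹ * vH d L h) := by
    rw [← KernelAssumptions.integral_nker_sq hh]
    exact mul_nonneg (by positivity) (integral_nonneg fun _ => sq_nonneg _)
  rcases le_or_gt δ h with hδh | hδh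
  · have := hbig h hδh
    rw [crit]; linarith
  · obtain ⟨h1, h2⟩ := hev (y := h) (by rw [Real.dist_eq, sub_zero, abs_of_pos hh]; exact hδh) hh
    set τ := h / rate d n with hτ
    have hτ0 : 0 < τ := by positivity
    have hhτ : h = τ * rate d n := by rw [hτ]; field_simp
    have h3 := hgap τ hτ0 hκh
    have h4 : amise L f τ * rate d n ^ 4 ≤ (1 + γ) * crit L f n h := by
      have e1 : amise L f τ * rate d n ^ 4 = (n:ℝ)⁻¹ * (h ^ d)⁻¹ * v d L + b d L ^ 2 * lapRoughness f * h ^ 4 := by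
        rw [hhτ, rate_inv_mul hn, amise]; ring
      have h5 : (n:ℝ)⁻¹ * (h ^ d)⁻¹ * v d L ≤ (n:ℝ)⁻¹ * (h ^ d)⁻¹ * ((1 + γ) * vH d L h) := by gcongr
      have h6 : 0 ≤ farMass d L h ^ 2 * ∫ x, (f (-x) - f x) ^ 2 ∂(surf d) :=
        mul_nonneg (sq_nonneg _) (integral_nonneg fun _ => sq_nonneg _)
      rw [e1, crit]
      linarith
    have h7 : (1 + γ) * ((A + ι / 2) * rate d n ^ 4) ≤ (1 + γ) * crit L f n h := by
      calc _ = (A + ι / 2) * (1 + γ) * rate d n ^ 4 := by ring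
        _ ≤ (A + ι) * rate d n ^ 4 := by gcongr
        _ ≤ amise L f τ * rate d n ^ 4 := by gcongr
        _ ≤ _ := h4
    exact le_of_mul_le_mul_left h7 (by linarith)

/-- There are bandwidths in the search interval at which the criterion is nearly optimal. -/
lemma IsC2.eventually_exists_crit_le (hf : IsC2 f) (hL : KernelAssumptions d L) (hd : 1 ≤ d)
    (hfu : ∃ x y, f x ≠ f y) {ε M : ℝ} (hε : 0 < ε) (hεM : ε < M) (hεc : ε ≤ c₀ L f) (hcM : c₀ L f ≤ M)
    {γ : ℝ} (hγ : 0 < γ) :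
    ∀ᶠ n : ℕ in atTop, ∃ τ ∈ Icc ε M, crit L f n (τ * rate d n) ≤ (amise L f (c₀ L f) + γ) * rate d n ^ 4 := by
  have hc := hf.c₀_pos hL hd hfu
  have hv := hL.v_pos
  have hM : 0 < M := hε.trans hεM
  have hcont : ContinuousAt (amise L f) (c₀ L f) :=
    (continuousOn_weighted_powers (d := d) (v d L) (b d L ^ 2 * lapRoughness f)).continuousAt (Ioi_mem_nhds hc)
  obtain ⟨δ, hδ, hclose⟩ := Metric.continuousAt_iff.mp hcont (γ / 2) (by positivity)
  obtain ⟨τ₁, τ₂, h1, h12, h2, hin⟩ : ∃ τ₁ τ₂, ε ≤ τ₁ ∧ τ₁ < τ₂ ∧ τ₂ ≤ M ∧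
      ∀ τ ∈ Icc τ₁ τ₂, |τ - c₀ L f| < δ := by
    rcases hεc.eq_or_lt with h0 | h0
    · refine ⟨ε, min M (ε + δ / 2), le_rfl, lt_min hεM (by linarith), min_le_left _ _, fun τ hτ => ?_⟩
      have := hτ.2.trans (min_le_right _ _)
      rw [abs_lt]; constructor <;> linarith [hτ.1]
    · refine ⟨max ε (c₀ L f - δ / 2), c₀ L f, le_max_left _ _, max_lt h0 (by linarith), hcM, fun τ hτ => ?_⟩
      have := (le_max_right _ _).trans hτ.1
      rw [abs_lt]; constructor <;> linarith [hτ.2]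
  have h10 : 0 < τ₁ := hε.trans_le h1
  set θ := γ / 4 / (M ^ 4 + 1) with hθ
  have hθ0 : 0 < θ := by positivity
  obtain ⟨ρ, hρ, hup⟩ := hf.isb_upper hL hd hθ0
  set ϑ := γ / 4 * ε ^ d with hϑ
  have hevv : ∀ᶠ h : ℝ in 𝓝[>] 0, vH d L h ≤ v d L + ϑ := by
    filter_upwards [(hL.tendsto_vH hd).eventually (gt_mem_nhds (show v d L < v d L + ϑ by
      have : 0 < ϑ := by positivity
      linarith))] with h hh
    exact hh.le
  have hev := hup.and hevv
  rw [eventually_nhdsWithin_iff, Metric.eventually_nhds_iff] at hev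
  obtain ⟨δ', hδ', hev⟩ := hev
  have hgood := (tendsto_rate d).eventually (hL.exists_small_farMass hd h10 h12
    (show 0 < ρ * τ₁ ^ 2 by positivity))
  have hsm := ((tendsto_rate d).mono_right nhdsWithin_le_nhds).eventually
    (gt_mem_nhds (show 0 < δ' / M by positivity))
  filter_upwards [eventually_ge_atTop 1, hgood, hsm] with n hn ⟨τ, hτ, hfar⟩ hsmall
  have hr := rate_pos d hn
  have hτ0 : 0 < τ := h10.trans_le hτ.1
  have hτM : τ ≤ M := hτ.2.trans h2
  have hετ : ε ≤ τ := h1.trans hτ.1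
  refine ⟨τ, ⟨hετ, hτM⟩, ?_⟩
  have hh0 : 0 < τ * rate d n := by positivity
  obtain ⟨h3, h4⟩ := hev (y := τ * rate d n) (by
    rw [Real.dist_eq, sub_zero, abs_of_pos hh0]
    calc τ * rate d n ≤ M * rate d n := by gcongr
      _ < M * (δ' / M) := by gcongr
      _ = δ' := by field_simp) hh0
  have h5 := h3 (hfar.trans (by
    rw [mul_pow, ← mul_assoc]
    gcongr
    exact hτ.1))
  have h6 := hclose (hin τ hτ)
  rw [Real.dist_eq, abs_lt] at h6
  have h7 : ϑ * (τ ^ d)⁻¹ ≤ γ / 4 := by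
    rw [← div_eq_mul_inv, div_le_iff₀ (by positivity), hϑ]
    gcongr
  have h8 : θ * τ ^ 4 ≤ γ / 4 := by
    calc θ * τ ^ 4 ≤ θ * (M ^ 4 + 1) := by
          gcongr
          have : τ ^ 4 ≤ M ^ 4 := by gcongr
          linarith
      _ = γ / 4 := by rw [hθ]; field_simp
  have h9 : (n:ℝ)⁻¹ * (((τ * rate d n) ^ d)⁻¹ * vH d L (τ * rate d n)) ≤
      rate d n ^ 4 * (τ ^ d)⁻¹ * (v d L + ϑ) := by
    rw [← mul_assoc, rate_inv_mul hn]
    gcongr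
  calc crit L f n (τ * rate d n) ≤ rate d n ^ 4 * (τ ^ d)⁻¹ * (v d L + ϑ) +
        (b d L ^ 2 * lapRoughness f + θ) * (τ * rate d n) ^ 4 := add_le_add h9 h5
    _ = (amise L f τ + ϑ * (τ ^ d)⁻¹ + θ * τ ^ 4) * rate d n ^ 4 := by rw [amise]; ring
    _ ≤ _ := mul_le_mul_of_nonneg_right (by linarith) (by positivity)

end

/-! ### The bandwidth minimizing the mean integrated squared error -/

/-- The mean integrated squared error differs from the common part by `O(n⁻¹)`, uniformly in the
bandwidth; this is of smaller order than `n^{-4/(d+4)}`. -/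
lemma IsSample.abs_MISE_sub_crit_le {d : ℕ} {L : ℝ → ℝ} {f : Sph d → ℝ} {Ω : Type*} [MeasurableSpace Ω]
    {P : Measure Ω} [IsProbabilityMeasure P] {X : ℕ → Ω → Sph d} (hX : IsSample P X f)
    (hL : KernelAssumptions d L) (hd : 1 ≤ d) :
    ∃ C, 0 ≤ C ∧ ∀ n : ℕ, 1 ≤ n → ∀ h, 0 < h → |MISE P X L f n h - crit L f n h| ≤ C * (n:ℝ)⁻¹ := by
  obtain ⟨B, hB, hk⟩ := hL.exists_isKer
  obtain ⟨C, hC, hfC⟩ := hX.bm.bdd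
  refine ⟨C ^ 2 * (surf d).real univ, by positivity, fun n hn h hh => ?_⟩
  have hkn := hL.nker_isKer hd hk hh
  rw [hX.MISE_eq hL hd hn hh, crit]
  have e : (n:ℝ)⁻¹ * ((h ^ d)⁻¹ * vH d L h - ∫ x, zonalOp (nker d L h) f x ^ 2 ∂(surf d)) + isb L f h -
      ((n:ℝ)⁻¹ * ((h ^ d)⁻¹ * vH d L h) + isb L f h) =
      -((∫ x, zonalOp (nker d L h) f x ^ 2 ∂(surf d)) * (n:ℝ)⁻¹) := by ring
  have h0 : 0 ≤ ∫ x, zonalOp (nker d L h) f x ^ 2 ∂(surf d) := integral_nonneg fun _ => sq_nonneg _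
  rw [e, abs_neg, abs_of_nonneg (by positivity)]
  gcongr
  rw [mul_comm, ← smul_eq_mul, ← integral_const]
  refine integral_mono (hX.bm.zonalOp hd hkn).sq.integrable (integrable_const _) fun x => ?_
  have := abs_zonalOp_le hd hkn hfC x
  rw [hL.integral_nker hd hh, one_mul] at this
  exact sq_le_sq.mpr (this.trans (le_abs_self C))

/-- The bandwidth minimizing the mean integrated squared error is `c₀ n^{-1/(d+4)}` to first
order. -/
lemma IsSample.tendsto_MISE_bandwidth {d : ℕ} {L : ℝ → ℝ} {f : Sph d → ℝ} {Ω : Type*} [MeasurableSpace Ω]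
    {P : Measure Ω} [IsProbabilityMeasure P] {X : ℕ → Ω → Sph d} (hX : IsSample P X f)
    (hf : IsC2 f) (hL : KernelAssumptions d L) (hd : 1 ≤ d) (hfu : ∃ x y, f x ≠ f y) {hM : ℕ → ℝ}
    (hmin : ∀ᶠ n in atTop, 0 < hM n ∧ IsMinOn (MISE P X L f n) (Ioi 0) (hM n)) :
    Tendsto (fun n => hM n / rate d n) atTop (𝓝 (c₀ L f)) := by
  rw [Metric.tendsto_nhds]
  intro κ hκ
  have hc := hf.c₀_pos hL hd hfu
  obtain ⟨ι, hι, hge⟩ := hf.eventually_crit_ge hL hd hfu hκ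
  obtain ⟨C, hC, hCM⟩ := hX.abs_MISE_sub_crit_le hL hd
  have hle := hf.eventually_exists_crit_le hL hd hfu hc (lt_add_one (c₀ L f)) le_rfl (lt_add_one _).le
    (γ := ι / 2) (by positivity)
  have t : Tendsto (fun n => 2 * C * rate d n ^ d) atTop (𝓝 0) := by
    have := (((tendsto_rate d).mono_right nhdsWithin_le_nhds).pow d).const_mul (2 * C)
    rw [zero_pow (by omega), mul_zero] at this
    exact this
  filter_upwards [eventually_ge_atTop 1, hmin, hge, hle, t.eventually (gt_mem_nhds (half_pos hι))]
    with n hn ⟨hM0, hMm⟩ hge' ⟨τ, hτ, hτle⟩ hsm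
  have hr := rate_pos d hn
  rw [Real.dist_eq]
  by_contra! hcon
  have h1 := hge' _ hM0 hcon
  have hτ0 : 0 < τ * rate d n := mul_pos (hc.trans_le hτ.1) hr
  have h2 : MISE P X L f n (hM n) ≤ MISE P X L f n (τ * rate d n) := hMm hτ0
  have h3 := (abs_le.mp (hCM n hn _ hM0)).1
  have h4 := (abs_le.mp (hCM n hn _ hτ0)).2
  have h5 : 2 * (C * (n:ℝ)⁻¹) < ι / 2 * rate d n ^ 4 := by
    rw [← rate_pow d n, pow_add]
    calc 2 * (C * (rate d n ^ d * rate d n ^ 4)) = 2 * C * rate d n ^ d * rate d n ^ 4 := by ring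
      _ < _ := by gcongr
  have h6 : (amise L f (c₀ L f) + ι / 2) * rate d n ^ 4 + ι / 2 * rate d n ^ 4 =
    (amise L f (c₀ L f) + ι) * rate d n ^ 4 := by ring
  linarith

/-! ### Moment inequalities for sums and degenerate `U`-statistics -/

/-- The `X i` are independent with common law `μ`. -/
structure IsIID {S Ω : Type*} [MeasurableSpace S] [MeasurableSpace Ω] (P : Measure Ω) (X : ℕ → Ω → S)
    (μ : Measure S) : Prop where
  meas : ∀ i, Measurable (X i)
  indep : iIndepFun X P
  law : ∀ i, P.map (X i) = μ

section

variable {S Ω : Type*} [MeasurableSpace S] [MeasurableSpace Ω] {P : Measure Ω}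
  {X : ℕ → Ω → S} {μ : Measure S}

lemma IsIID.integral_comp (hX : IsIID P X μ) {g : S → ℝ} (hg : Measurable g) (i : ℕ) :
    ∫ ω, g (X i ω) ∂P = ∫ x, g x ∂μ := by
  rw [← hX.law i, integral_map (hX.meas i).aemeasurable hg.aestronglyMeasurable]

/-- Even powers are bounded by exponentials, so exponential moments control high moments. -/
lemma pow_le_factorial_mul_exp (z : ℝ) (m : ℕ) :
    z ^ (2 * m) ≤ (2 * m).factorial * (Real.exp z + Real.exp (-z)) := by
  have h1 := Real.pow_div_factorial_le_exp (x := |z|) (abs_nonneg z) (2 * m)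
  have h2 : |z| ^ (2 * m) = z ^ (2 * m) := by rw [pow_mul, pow_mul, sq_abs]
  have h3 : Real.exp |z| ≤ Real.exp z + Real.exp (-z) := by
    rcases abs_cases z with ⟨h, -⟩ | ⟨h, -⟩ <;> rw [h] <;>
      linarith [Real.exp_pos z, Real.exp_pos (-z)]
  rw [h2, div_le_iff₀ (by positivity)] at h1
  calc _ ≤ _ := h1
    _ = (2 * m).factorial * Real.exp |z| := mul_comm _ _
    _ ≤ _ := by gcongr

/-- The constant in the moment inequality for sums of independent variables. -/
def momentConst (m : ℕ) : ℝ := (2 * m).factorial * (2 * Real.exp 1)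

lemma momentConst_pos (m : ℕ) : 0 < momentConst m := by unfold momentConst; positivity

/-- The first `j` points, as a sequence that is constant from then on. -/
def past {S Ω : Type*} (X : ℕ → Ω → S) (j : ℕ) (ω : Ω) (i : ℕ) : S := X (min i (j - 1)) ω

lemma past_of_lt {S Ω : Type*} (X : ℕ → Ω → S) {i j : ℕ} (h : i < j) (ω : Ω) : past X j ω i = X i ω := by
  rw [past, min_eq_left (by omega)]

lemma IsIID.measurable_past (hX : IsIID P X μ) (j : ℕ) : Measurable (past X j) :=
  measurable_pi_lambda _ fun _ => hX.meas _

/-- Each point is independent of the sequence of the earlier ones. -/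
lemma IsIID.indepFun_past (hX : IsIID P X μ) {j : ℕ} (hj : 1 ≤ j) : IndepFun (past X j) (X j) P := by
  have h1 := hX.indep.indepFun_finset (Finset.range j) {j} (by simp) hX.meas
  have h2 : Measurable (fun (z : (Finset.range j) → S) (i : ℕ) =>
      z ⟨min i (j - 1), Finset.mem_range.mpr (by omega)⟩) :=
    measurable_pi_lambda _ fun _ => measurable_pi_apply _
  have h3 : Measurable (fun (z : ({j} : Finset ℕ) → S) => z ⟨j, Finset.mem_singleton_self j⟩) :=
    measurable_pi_apply _
  exact h1.comp h2 h3

variable [IsProbabilityMeasure μ]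

/-- The Bernstein bound `𝔼 e^ζ ≤ e^{𝔼 ζ²}` for a centred variable with values in `[-1, 1]`. -/
lemma integral_exp_le {ζ : S → ℝ} (hζ : Measurable ζ) {σ2 : ℝ} (h1 : ∀ x, |ζ x| ≤ 1)
    (h0 : ∫ x, ζ x ∂μ = 0) (h2 : ∫ x, ζ x ^ 2 ∂μ ≤ σ2) : ∫ x, Real.exp (ζ x) ∂μ ≤ Real.exp σ2 := by
  have i1 : Integrable ζ μ := Integrable.of_bound hζ.aestronglyMeasurable 1 (ae_of_all _ h1)
  have i2 : Integrable (fun x => ζ x ^ 2) μ := by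
    refine Integrable.of_bound (hζ.pow_const 2).aestronglyMeasurable 1 (ae_of_all _ fun x => ?_)
    rw [norm_pow]; exact pow_le_one₀ (norm_nonneg _) (h1 x)
  have i3 : Integrable (fun x => Real.exp (ζ x)) μ := by
    refine Integrable.of_bound hζ.exp.aestronglyMeasurable (Real.exp 1) (ae_of_all _ fun x => ?_)
    rw [Real.norm_eq_abs, Real.abs_exp]
    exact Real.exp_le_exp.mpr (le_of_abs_le (h1 x))
  have i12 : Integrable (fun x => 1 + ζ x) μ := (integrable_const 1).add i1
  calc ∫ x, Real.exp (ζ x) ∂μ ≤ ∫ x, (1 + ζ x + ζ x ^ 2) ∂μ := by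
        refine integral_mono i3 (i12.add i2) fun x => ?_
        have := le_of_abs_le (Real.abs_exp_sub_one_sub_id_le (h1 x))
        simp only
        linarith
    _ = 1 + ∫ x, ζ x ^ 2 ∂μ := by
        rw [integral_add i12 i2, integral_add (integrable_const 1) i1, h0]; simp
    _ ≤ Real.exp σ2 := by linarith [Real.add_one_le_exp σ2]

lemma IsIID.integral_exp_sum_le (hX : IsIID P X μ) {ζ : S → ℝ} (hζ : Measurable ζ) {σ2 : ℝ} (h1 : ∀ x, |ζ x| ≤ 1)
    (h0 : ∫ x, ζ x ∂μ = 0) (h2 : ∫ x, ζ x ^ 2 ∂μ ≤ σ2) (n : ℕ) :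
    ∫ ω, Real.exp (∑ i ∈ Finset.range n, ζ (X i ω)) ∂P ≤ Real.exp (n * σ2) := by
  have hind : iIndepFun (fun i ω => ζ (X i ω)) P := hX.indep.comp (fun _ => ζ) (fun _ => hζ)
  have := hind.mgf_sum (t := 1) (fun i => hζ.comp (hX.meas i)) (Finset.range n)
  simp only [mgf, one_mul, Finset.sum_apply] at this
  rw [this]
  calc ∏ i ∈ Finset.range n, ∫ ω, Real.exp (ζ (X i ω)) ∂P ≤ ∏ i ∈ Finset.range n, Real.exp σ2 := by
        refine Finset.prod_le_prod (fun i _ => integral_nonneg fun _ => (Real.exp_pos _).le) fun i _ => ?_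
        rw [hX.integral_comp (g := fun x => Real.exp (ζ x)) hζ.exp]
        exact integral_exp_le hζ h1 h0 h2
    _ = Real.exp (n * σ2) := by rw [Finset.prod_const, Finset.card_range, Real.exp_nat_mul]

variable [IsProbabilityMeasure P]

/-- A moment inequality for sums of bounded centred independent variables. -/
lemma IsIID.integral_sum_pow_le (hX : IsIID P X μ) {ζ : S → ℝ} (hζ : Measurable ζ) {A σ2 D : ℝ}
    (hA : ∀ x, |ζ x| ≤ A) (h0 : ∫ x, ζ x ∂μ = 0) (h2 : ∫ x, ζ x ^ 2 ∂μ ≤ σ2) {n : ℕ}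
    (hD : 0 < D) (hDA : A ^ 2 ≤ D) (hDn : n * σ2 ≤ D) (m : ℕ) :
    ∫ ω, (∑ i ∈ Finset.range n, ζ (X i ω)) ^ (2 * m) ∂P ≤ momentConst m * D ^ m := by
  set t := (√D)⁻¹ with ht
  have hsD : 0 < √D := Real.sqrt_pos.mpr hD
  have ht0 : 0 < t := by positivity
  have htD : t ^ 2 * D = 1 := by
    rw [ht, inv_pow, Real.sq_sqrt hD.le, inv_mul_cancel₀ hD.ne']
  have hA' : A ≤ √D := Real.le_sqrt_of_sq_le hDA
  have hb : ∀ s : ℝ, |s| = t → (∀ x, |s * ζ x| ≤ 1) ∧ ∫ x, s * ζ x ∂μ = 0 ∧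
      ∫ x, (s * ζ x) ^ 2 ∂μ ≤ t ^ 2 * σ2 := by
    intro s hs
    refine ⟨fun x => ?_, ?_, ?_⟩
    · rw [abs_mul, hs, ht, inv_mul_le_iff₀ hsD, mul_one]
      exact (hA x).trans hA'
    · rw [integral_const_mul, h0, mul_zero]
    · simp_rw [mul_pow]
      rw [integral_const_mul, ← sq_abs s, hs]
      gcongr
  have hexp : ∀ s : ℝ, |s| = t → ∫ ω, Real.exp (s * ∑ i ∈ Finset.range n, ζ (X i ω)) ∂P ≤ Real.exp 1 := by
    intro s hs
    obtain ⟨b1, b2, b3⟩ := hb s hs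
    have := hX.integral_exp_sum_le (hζ.const_mul s) b1 b2 b3 n
    simp only [← Finset.mul_sum] at this
    refine this.trans (Real.exp_le_exp.mpr ?_)
    calc n * (t ^ 2 * σ2) = t ^ 2 * (n * σ2) := by ring
      _ ≤ t ^ 2 * D := by gcongr
      _ = 1 := htD
  set Z : Ω → ℝ := fun ω => ∑ i ∈ Finset.range n, ζ (X i ω) with hZ
  have hZm : Measurable Z := Finset.measurable_fun_sum _ fun i _ => hζ.comp (hX.meas i)
  have hZb : ∀ ω, |Z ω| ≤ n * A := by
    intro ω
    refine (Finset.abs_sum_le_sum_abs _ _).trans ((Finset.sum_le_sum fun i _ => hA _).trans ?_)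
    simp
  have hint : ∀ s : ℝ, Integrable (fun ω => Real.exp (s * Z ω)) P := by
    intro s
    refine Integrable.of_bound (hZm.const_mul s).exp.aestronglyMeasurable (Real.exp (|s| * (n * A)))
      (ae_of_all _ fun ω => ?_)
    rw [Real.norm_eq_abs, Real.abs_exp, Real.exp_le_exp]
    refine (le_abs_self _).trans ?_
    rw [abs_mul]
    exact mul_le_mul_of_nonneg_left (hZb ω) (abs_nonneg _)
  have hint2 : Integrable (fun ω => Z ω ^ (2 * m)) P := by
    refine Integrable.of_bound (hZm.pow_const _).aestronglyMeasurable ((n * A) ^ (2 * m)) (ae_of_all _ fun ω => ?_)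
    rw [norm_pow]; exact pow_le_pow_left₀ (norm_nonneg _) (hZb ω) _
  have key : t ^ (2 * m) * ∫ ω, Z ω ^ (2 * m) ∂P ≤ momentConst m := by
    rw [← integral_const_mul]
    calc ∫ ω, t ^ (2 * m) * Z ω ^ (2 * m) ∂P ≤
          ∫ ω, ((2 * m).factorial : ℝ) * (Real.exp (t * Z ω) + Real.exp (-t * Z ω)) ∂P := by
          refine integral_mono (hint2.const_mul _) (((hint t).add (hint (-t))).const_mul _) fun ω => ?_
          simp only
          rw [← mul_pow, neg_mul]
          exact pow_le_factorial_mul_exp _ _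
      _ = (2 * m).factorial * (∫ ω, Real.exp (t * Z ω) ∂P + ∫ ω, Real.exp (-t * Z ω) ∂P) := by
          rw [integral_const_mul, integral_add (hint t) (hint (-t))]
      _ ≤ (2 * m).factorial * (Real.exp 1 + Real.exp 1) := by
          gcongr
          · exact hexp t (abs_of_pos ht0)
          · exact hexp (-t) (by rw [abs_neg, abs_of_pos ht0])
      _ = momentConst m := by rw [momentConst]; ring
  have htm : t ^ (2 * m) * D ^ m = 1 := by rw [pow_mul, ← mul_pow, htD, one_pow]
  calc ∫ ω, Z ω ^ (2 * m) ∂P = (t ^ (2 * m) * ∫ ω, Z ω ^ (2 * m) ∂P) * D ^ m := by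
        rw [mul_right_comm, htm, one_mul]
    _ ≤ _ := by gcongr

/-- Integrating a function of two independent variables. -/
lemma integral_of_indepFun {T : Type*} [MeasurableSpace T] {Z : Ω → T} {Y : Ω → S} (hZ : Measurable Z) (hY : Measurable Y)
    (hlaw : P.map Y = μ) (hind : IndepFun Z Y P) {F : T → S → ℝ} (hF : Measurable (Function.uncurry F))
    {C : ℝ} (hC : ∀ z y, |F z y| ≤ C) :
    ∫ ω, F (Z ω) (Y ω) ∂P = ∫ ω, ∫ y, F (Z ω) y ∂μ ∂P := by
  have := Measure.isProbabilityMeasure_map hZ.aemeasurable (μ := P)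
  have h1 := hind.map_prod_eq_prod_map_map hZ.aemeasurable hY.aemeasurable
  rw [hlaw] at h1
  have h2 : ∫ ω, F (Z ω) (Y ω) ∂P = ∫ p, Function.uncurry F p ∂(P.map (fun ω => (Z ω, Y ω))) := by
    rw [integral_map (hZ.prodMk hY).aemeasurable hF.aestronglyMeasurable]
    rfl
  have hint : Integrable (Function.uncurry F) ((P.map Z).prod μ) :=
    Integrable.of_bound hF.aestronglyMeasurable C (ae_of_all _ fun p => hC _ _)
  rw [h2, h1, integral_prod _ hint, integral_map hZ.aemeasurable]
  · rfl
  · exact hF.stronglyMeasurable.integral_prod_right.aestronglyMeasurable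

/-- A pointwise expansion of an even power in which only the linear term is kept exactly. -/
lemma add_pow_even_le (S Y : ℝ) {N : ℝ} (hN : 1 ≤ N) (q : ℕ) :
    (S + Y) ^ (2 * (q + 1)) ≤ S ^ (2 * (q + 1)) + (2 * (q + 1) : ℕ) * (S ^ (2 * q + 1) * Y) +
      4 ^ (q + 1) * (S ^ (2 * (q + 1)) / N + N ^ q * Y ^ (2 * (q + 1))) := by
  have hN0 : 0 < N := by linarith
  have e : 2 * (q + 1) = 2 * q + 1 + 1 := by ring
  rw [add_comm S Y, add_pow, e, Finset.sum_range_succ', Finset.sum_range_succ']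
  have hev : ∀ z : ℝ, |z| ^ (2 * q + 1 + 1) = z ^ (2 * q + 1 + 1) := fun z => by
    rw [← e, pow_mul, pow_mul, sq_abs]
  set a := |S| with ha
  set y := √N * |Y| with hy
  have ha0 : 0 ≤ a := abs_nonneg _
  have hsN : 1 ≤ √N := Real.one_le_sqrt.mpr hN
  have hy0 : 0 ≤ y := by positivity
  have hterm : ∀ k ∈ Finset.range (2 * q + 1), Y ^ (k + 1 + 1) * S ^ (2 * q + 1 + 1 - (k + 1 + 1)) *
      ((2 * q + 1 + 1).choose (k + 1 + 1) : ℝ) ≤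
      (S ^ (2 * q + 1 + 1) / N + N ^ q * Y ^ (2 * q + 1 + 1)) * ((2 * q + 1 + 1).choose (k + 1 + 1) : ℝ) := by
    intro k hk
    rw [Finset.mem_range] at hk
    refine mul_le_mul_of_nonneg_right ?_ (Nat.cast_nonneg _)
    refine (le_abs_self _).trans ?_
    rw [abs_mul, abs_pow, abs_pow, ← ha]
    -- `|Y| ^ j = N ^ (-j/2) * y ^ j`, with `j ≥ 2`
    have h1 : |Y| ^ (k + 1 + 1) ≤ y ^ (k + 1 + 1) / N := by
      rw [le_div_iff₀ hN0, hy, mul_pow, mul_comm]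
      refine mul_le_mul_of_nonneg_right ?_ (by positivity)
      calc N = √N ^ 2 := (Real.sq_sqrt hN0.le).symm
        _ ≤ √N ^ (k + 1 + 1) := pow_le_pow_right₀ hsN (by omega)
    have h2 : y ^ (k + 1 + 1) * a ^ (2 * q + 1 + 1 - (k + 1 + 1)) ≤ a ^ (2 * q + 1 + 1) + y ^ (2 * q + 1 + 1) := by
      have hsum : k + 1 + 1 + (2 * q + 1 + 1 - (k + 1 + 1)) = 2 * q + 1 + 1 := by omega
      rcases le_total a y with h | h
      · calc _ ≤ y ^ (k + 1 + 1) * y ^ (2 * q + 1 + 1 - (k + 1 + 1)) := by gcongr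
          _ = y ^ (2 * q + 1 + 1) := by rw [← pow_add, hsum]
          _ ≤ _ := by have := pow_nonneg ha0 (2 * q + 1 + 1); linarith
      · calc _ ≤ a ^ (k + 1 + 1) * a ^ (2 * q + 1 + 1 - (k + 1 + 1)) := by gcongr
          _ = a ^ (2 * q + 1 + 1) := by rw [← pow_add, hsum]
          _ ≤ _ := by have := pow_nonneg hy0 (2 * q + 1 + 1); linarith
    have h3 : y ^ (2 * q + 1 + 1) = N ^ (q + 1) * Y ^ (2 * q + 1 + 1) := by
      rw [hy, mul_pow, hev, ← e, pow_mul (√N), Real.sq_sqrt hN0.le]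
    calc _ ≤ y ^ (k + 1 + 1) / N * a ^ (2 * q + 1 + 1 - (k + 1 + 1)) := by gcongr
      _ = y ^ (k + 1 + 1) * a ^ (2 * q + 1 + 1 - (k + 1 + 1)) / N := by ring
      _ ≤ (a ^ (2 * q + 1 + 1) + y ^ (2 * q + 1 + 1)) / N := by gcongr
      _ = _ := by rw [h3, ha, hev, pow_succ N q]; field_simp
  have hsum := Finset.sum_le_sum hterm
  rw [← Finset.mul_sum] at hsum
  have hchoose : ∑ k ∈ Finset.range (2 * q + 1), ((2 * q + 1 + 1).choose (k + 1 + 1) : ℝ) ≤ 4 ^ (q + 1) := by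
    have h1 : (∑ k ∈ Finset.range (2 * q + 1 + 1 + 1), ((2 * q + 1 + 1).choose k : ℝ)) = 4 ^ (q + 1) := by
      have := Nat.sum_range_choose (2 * q + 1 + 1)
      rw [← Nat.cast_sum, this, ← e, pow_mul]
      norm_num
    rw [Finset.sum_range_succ', Finset.sum_range_succ'] at h1
    have h2 : (0:ℝ) ≤ ((2 * q + 1 + 1).choose (0 + 1) : ℝ) := Nat.cast_nonneg _
    have h3 : (0:ℝ) ≤ ((2 * q + 1 + 1).choose 0 : ℝ) := Nat.cast_nonneg _
    linarith
  have hpos : 0 ≤ S ^ (2 * q + 1 + 1) / N + N ^ q * Y ^ (2 * q + 1 + 1) := by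
    rw [← hev S, ← hev Y]; positivity
  have h4 := mul_le_mul_of_nonneg_left hchoose hpos
  have e1 : (2 * q + 1 + 1 - (0 + 1)) = 2 * q + 1 := by omega
  simp only [e1, zero_add, pow_one, Nat.choose_one_right, pow_zero, one_mul, Nat.choose_zero_right,
    Nat.cast_one, mul_one, Nat.sub_zero]
  linarith [hsum, h4]

/-- The constant in the moment inequality for degenerate `U`-statistics. -/
def ustatConst (q : ℕ) : ℝ := 4 ^ (q + 1) * momentConst (q + 1) * Real.exp (4 ^ (q + 1))

lemma ustatConst_pos (q : ℕ) : 0 < ustatConst q := by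
  unfold ustatConst
  have := momentConst_pos (q + 1)
  positivity

/-- A moment inequality for degenerate `U`-statistics. The statistic is a martingale in the number
of points, and its increments are, given the new point, sums of independent variables. -/
lemma IsIID.integral_ustat_pow_le (hX : IsIID P X μ) {H : S → S → ℝ} (hH : Measurable (Function.uncurry H))
    {A σ2 D : ℝ} (hA : ∀ x y, |H x y| ≤ A) (h0 : ∀ y, ∫ x, H x y ∂μ = 0) (h0' : ∀ x, ∫ y, H x y ∂μ = 0)
    (h2 : ∀ y, ∫ x, H x y ^ 2 ∂μ ≤ σ2) {n : ℕ} (hn : 1 ≤ n)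
    (hD : 0 < D) (hDA : A ^ 2 ≤ D) (hDn : n * σ2 ≤ D) (q : ℕ) :
    ∫ ω, (∑ j ∈ Finset.range n, ∑ i ∈ Finset.range j, H (X i ω) (X j ω)) ^ (2 * (q + 1)) ∂P ≤
      ustatConst q * (n * D) ^ (q + 1) := by
  have hn0 : (1:ℝ) ≤ n := by exact_mod_cast hn
  have hσ : 0 ≤ σ2 := by
    obtain ⟨ω⟩ : Nonempty Ω := nonempty_of_isProbabilityMeasure P
    exact (integral_nonneg fun _ => sq_nonneg _).trans (h2 (X 0 ω))
  have hA0 : 0 ≤ A := by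
    obtain ⟨ω⟩ : Nonempty Ω := nonempty_of_isProbabilityMeasure P
    exact (abs_nonneg _).trans (hA (X 0 ω) (X 0 ω))
  have hHx : ∀ y, Measurable (fun x => H x y) := fun y => hH.comp (measurable_id.prodMk measurable_const)
  have hHc : ∀ {T : Type _} [MeasurableSpace T] {a b : T → S}, Measurable a → Measurable b →
      Measurable (fun t => H (a t) (b t)) := fun ha hb => hH.comp (ha.prodMk hb)
  set U : ℕ → (ℕ → S) → ℝ := fun j z => ∑ b ∈ Finset.range j, ∑ a ∈ Finset.range b, H (z a) (z b) with hU
  set Y : ℕ → (ℕ → S) → S → ℝ := fun j z y => ∑ a ∈ Finset.range j, H (z a) y with hY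
  have hUm : ∀ j, Measurable (U j) := fun j => Finset.measurable_fun_sum _ fun b _ =>
    Finset.measurable_fun_sum _ fun a _ => hHc (measurable_pi_apply a) (measurable_pi_apply b)
  have hYm : ∀ j, Measurable (Function.uncurry (Y j)) := fun j =>
    Finset.measurable_fun_sum _ fun a _ => hHc ((measurable_pi_apply a).comp measurable_fst) measurable_snd
  have hYb : ∀ j z y, |Y j z y| ≤ j * A := by
    intro j z y
    refine (Finset.abs_sum_le_sum_abs _ _).trans ((Finset.sum_le_sum fun i _ => hA _ _).trans ?_)
    simp
  have hUb : ∀ j z, |U j z| ≤ j * (j * A) := by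
    intro j z
    refine (Finset.abs_sum_le_sum_abs _ _).trans ((Finset.sum_le_sum (g := fun _ => j * A) fun b hb => ?_).trans ?_)
    · refine (hYb b z (z b)).trans ?_
      have : (b:ℝ) ≤ j := by exact_mod_cast (Finset.mem_range.mp hb).le
      gcongr
    · simp
  set u : ℕ → ℝ := fun j => ∫ ω, U j (fun i => X i ω) ^ (2 * (q + 1)) ∂P with hu
  have hXm : Measurable (fun ω i => X i ω) := measurable_pi_lambda _ hX.meas
  set c : ℝ := 4 ^ (q + 1) with hc
  have hc0 : 0 < c := by positivity
  have hstep : ∀ j, j < n → u (j + 1) ≤ u j * (1 + c / n) + c * (n ^ q * (momentConst (q + 1) * D ^ (q + 1))) := by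
    intro j hj
    rcases Nat.eq_zero_or_pos j with rfl | hj1
    · have e1 : u (0 + 1) = 0 := by simp [hu, hU]
      have e0 : u 0 = 0 := by simp [hu, hU]
      rw [e1, e0]
      have := momentConst_pos (q + 1)
      positivity
    have hjn : (j:ℝ) ≤ n := by exact_mod_cast hj.le
    have eU : ∀ ω, U j (past X j ω) = U j (fun i => X i ω) := by
      intro ω
      refine Finset.sum_congr rfl fun b hb => Finset.sum_congr rfl fun a ha => ?_
      rw [Finset.mem_range] at ha hb
      rw [past_of_lt X hb, past_of_lt X (ha.trans hb)]
    have eY : ∀ ω y, Y j (past X j ω) y = ∑ a ∈ Finset.range j, H (X a ω) y := by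
      intro ω y
      refine Finset.sum_congr rfl fun a ha => ?_
      rw [past_of_lt X (Finset.mem_range.mp ha)]
    have eS : ∀ ω, U (j + 1) (fun i => X i ω) = U j (past X j ω) + Y j (past X j ω) (X j ω) := by
      intro ω
      rw [eU, eY]
      simp only [hU]
      rw [Finset.sum_range_succ]
    have hpm := hX.measurable_past j
    have hind := hX.indepFun_past hj1
    have m1 : Measurable (fun ω => U j (past X j ω)) := (hUm j).comp hpm
    have m2 : Measurable (fun ω => Y j (past X j ω) (X j ω)) := (hYm j).comp (hpm.prodMk (hX.meas j))
    have i1 : Integrable (fun ω => U j (past X j ω) ^ (2 * (q + 1))) P :=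
      Integrable.of_bound (m1.pow_const _).aestronglyMeasurable ((j * (j * A)) ^ (2 * (q + 1)))
        (ae_of_all _ fun ω => by rw [norm_pow]; exact pow_le_pow_left₀ (norm_nonneg _) (hUb _ _) _)
    have i2 : Integrable (fun ω => Y j (past X j ω) (X j ω) ^ (2 * (q + 1))) P :=
      Integrable.of_bound (m2.pow_const _).aestronglyMeasurable ((j * A) ^ (2 * (q + 1)))
        (ae_of_all _ fun ω => by rw [norm_pow]; exact pow_le_pow_left₀ (norm_nonneg _) (hYb _ _ _) _)
    have b3 : ∀ z y, |U j z ^ (2 * q + 1) * Y j z y| ≤ (j * (j * A)) ^ (2 * q + 1) * (j * A) := by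
      intro z y
      rw [abs_mul, abs_pow]
      exact mul_le_mul (pow_le_pow_left₀ (abs_nonneg _) (hUb _ _) _) (hYb _ _ _) (abs_nonneg _) (by positivity)
    have i3 : Integrable (fun ω => U j (past X j ω) ^ (2 * q + 1) * Y j (past X j ω) (X j ω)) P :=
      Integrable.of_bound ((m1.pow_const _).mul m2).aestronglyMeasurable _ (ae_of_all _ fun ω => b3 _ _)
    -- the martingale property
    have hmart : ∫ ω, U j (past X j ω) ^ (2 * q + 1) * Y j (past X j ω) (X j ω) ∂P = 0 := by
      have := integral_of_indepFun (F := fun z y => U j z ^ (2 * q + 1) * Y j z y) hpm (hX.meas j) (hX.law j) hind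
        ((((hUm j).comp measurable_fst).pow_const _).mul (hYm j)) b3
      rw [this]
      refine (integral_congr_ae (ae_of_all _ fun ω => ?_)).trans (integral_zero _ _)
      rw [integral_const_mul]
      simp only [hY]
      rw [integral_finsetSum]
      · simp [h0']
      · intro a _
        exact Integrable.of_bound (hHc measurable_const measurable_id).aestronglyMeasurable A (ae_of_all _ fun y => hA _ _)
    have hYmom : ∫ ω, Y j (past X j ω) (X j ω) ^ (2 * (q + 1)) ∂P ≤ momentConst (q + 1) * D ^ (q + 1) := by
      have hFb : ∀ z y, |Y j z y ^ (2 * (q + 1))| ≤ (j * A) ^ (2 * (q + 1)) := by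
        intro z y; rw [abs_pow]; exact pow_le_pow_left₀ (abs_nonneg _) (hYb _ _ _) _
      have := integral_of_indepFun (F := fun z y => Y j z y ^ (2 * (q + 1))) hpm (hX.meas j) (hX.law j) hind
        ((hYm j).pow_const _) hFb
      rw [this]
      have hmm : Measurable (fun p : Ω × S => Y j (past X j p.1) p.2 ^ (2 * (q + 1))) :=
        ((hYm j).comp ((hpm.comp measurable_fst).prodMk measurable_snd)).pow_const _
      rw [integral_integral_swap (f := fun ω y => Y j (past X j ω) y ^ (2 * (q + 1)))
        (Integrable.of_bound hmm.aestronglyMeasurable _ (ae_of_all _ fun p => hFb _ _))]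
      have hle : ∀ y, ∫ ω, Y j (past X j ω) y ^ (2 * (q + 1)) ∂P ≤ momentConst (q + 1) * D ^ (q + 1) := by
        intro y
        simp_rw [eY]
        refine hX.integral_sum_pow_le (hHx y) (fun x => hA x y) (h0 y) (h2 y) hD hDA ?_ (q + 1)
        exact (mul_le_mul_of_nonneg_right hjn hσ).trans hDn
      calc _ ≤ ∫ y, momentConst (q + 1) * D ^ (q + 1) ∂μ := by
            refine integral_mono_of_nonneg (ae_of_all _ fun y => integral_nonneg fun ω => ?_)
              (integrable_const _) (ae_of_all _ hle)
            rw [pow_mul]; exact pow_nonneg (sq_nonneg _) _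
        _ = _ := by simp
    have hexp : u (j + 1) ≤ ∫ ω, (U j (past X j ω) ^ (2 * (q + 1)) +
        (2 * (q + 1) : ℕ) * (U j (past X j ω) ^ (2 * q + 1) * Y j (past X j ω) (X j ω)) +
        c * (U j (past X j ω) ^ (2 * (q + 1)) / n + n ^ q * Y j (past X j ω) (X j ω) ^ (2 * (q + 1)))) ∂P := by
      simp only [hu, eS]
      refine integral_mono ?_ ((i1.add (i3.const_mul _)).add
        (((i1.div_const _).add (i2.const_mul _)).const_mul _)) fun ω => add_pow_even_le _ _ hn0 q
      refine Integrable.of_bound ((m1.add m2).pow_const _).aestronglyMeasurable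
        ((j * (j * A) + j * A) ^ (2 * (q + 1))) (ae_of_all _ fun ω => ?_)
      rw [norm_pow]
      exact pow_le_pow_left₀ (norm_nonneg _) ((abs_add_le _ _).trans (add_le_add (hUb _ _) (hYb _ _ _))) _
    have eu : ∫ ω, U j (past X j ω) ^ (2 * (q + 1)) ∂P = u j := by simp only [hu, eU]
    have iA : Integrable (fun ω => U j (past X j ω) ^ (2 * (q + 1)) +
        (2 * (q + 1) : ℕ) * (U j (past X j ω) ^ (2 * q + 1) * Y j (past X j ω) (X j ω))) P :=
      i1.add (i3.const_mul _)
    have iB : Integrable (fun ω => U j (past X j ω) ^ (2 * (q + 1)) / n +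
        (n:ℝ) ^ q * Y j (past X j ω) (X j ω) ^ (2 * (q + 1))) P := (i1.div_const _).add (i2.const_mul _)
    rw [integral_add iA (iB.const_mul c), integral_add i1 (i3.const_mul _), integral_const_mul, hmart,
      integral_const_mul, integral_add (i1.div_const _) (i2.const_mul _), integral_div, integral_const_mul, eu] at hexp
    have : c * (n ^ q * ∫ ω, Y j (past X j ω) (X j ω) ^ (2 * (q + 1)) ∂P) ≤
        c * (n ^ q * (momentConst (q + 1) * D ^ (q + 1))) := by gcongr
    calc u (j + 1) ≤ _ := hexp
      _ = u j * (1 + c / n) + c * (n ^ q * ∫ ω, Y j (past X j ω) (X j ω) ^ (2 * (q + 1)) ∂P) := by ring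
      _ ≤ _ := by linarith
  -- a discrete Gronwall argument
  set K := c * (n ^ q * (momentConst (q + 1) * D ^ (q + 1))) with hK
  have hK0 : 0 ≤ K := by
    have := momentConst_pos (q + 1)
    positivity
  have hcn : 1 ≤ 1 + c / n := by
    have : 0 ≤ c / n := by positivity
    linarith
  have hgr : ∀ j, j ≤ n → u j ≤ j * K * (1 + c / n) ^ j := by
    intro j
    induction j with
    | zero => intro _; simp [hu, hU]
    | succ j ih =>
      intro hj
      have h3 := ih (by omega)
      have h4 : K ≤ K * (1 + c / n) ^ (j + 1) := le_mul_of_one_le_right hK0 (one_le_pow₀ hcn)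
      calc u (j + 1) ≤ u j * (1 + c / n) + K := hstep j (by omega)
        _ ≤ j * K * (1 + c / n) ^ j * (1 + c / n) + K * (1 + c / n) ^ (j + 1) := by gcongr
        _ = _ := by push_cast; ring
  calc _ = u n := rfl
    _ ≤ n * K * (1 + c / n) ^ n := hgr n le_rfl
    _ ≤ n * K * Real.exp c := by
        gcongr
        calc (1 + c / n) ^ n ≤ (Real.exp (c / n)) ^ n := by
              gcongr
              linarith [Real.add_one_le_exp (c / n)]
          _ = Real.exp c := by rw [← Real.exp_nat_mul]; congr 1; field_simp
    _ = _ := by rw [hK, ustatConst, mul_pow, pow_succ (n:ℝ) q]; ring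

end

/-! ### Deviation inequalities -/

section

variable {S Ω : Type*} [MeasurableSpace S] [MeasurableSpace Ω] {P : Measure Ω}
  {X : ℕ → Ω → S} {μ : Measure S} [IsProbabilityMeasure P]

/-- Markov's inequality for an even moment. -/
lemma measureReal_ge_le_of_moment {Z : Ω → ℝ} (hZ : Measurable Z) {C : ℝ} (hC : ∀ ω, |Z ω| ≤ C) {p : ℕ} {E s : ℝ}
    (hs : 0 < s) (hE : ∫ ω, Z ω ^ (2 * p) ∂P ≤ E) :
    P.real {ω | s ≤ |Z ω|} ≤ E / (s ^ 2) ^ p := by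
  have hint : Integrable (fun ω => Z ω ^ (2 * p)) P :=
    Integrable.of_bound (hZ.pow_const _).aestronglyMeasurable (C ^ (2 * p))
      (ae_of_all _ fun ω => by rw [norm_pow]; exact pow_le_pow_left₀ (norm_nonneg _) (hC ω) _)
  have hnn : ∀ ω, 0 ≤ Z ω ^ (2 * p) := fun ω => by rw [pow_mul]; exact pow_nonneg (sq_nonneg _) _
  have h1 := mul_meas_ge_le_integral_of_nonneg (ae_of_all P hnn) hint (s ^ (2 * p))
  rw [le_div_iff₀ (by positivity), ← pow_mul, mul_comm]
  refine le_trans ?_ (h1.trans hE)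
  refine mul_le_mul_of_nonneg_left (measureReal_mono fun ω hω => ?_) (by positivity)
  have : s ^ (2 * p) ≤ |Z ω| ^ (2 * p) := pow_le_pow_left₀ hs.le hω _
  rwa [pow_mul |Z ω|, sq_abs, ← pow_mul] at this

lemma abs_integral_le_of_abs_le [IsProbabilityMeasure μ] {g : S → ℝ} {A : ℝ} (hA : ∀ x, |g x| ≤ A) :
    |∫ x, g x ∂μ| ≤ A := by
  have := norm_integral_le_of_norm_le_const (μ := μ) (f := g) (C := A) (ae_of_all _ hA)
  simpa using this

/-- Deviation of a sum of bounded independent variables from its mean. -/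
lemma IsIID.sum_deviation [IsProbabilityMeasure μ] (hX : IsIID P X μ) {ζ : S → ℝ} (hζ : Measurable ζ) {A s : ℝ}
    (hA : ∀ x, |ζ x| ≤ A) (hA0 : 0 < A) {n : ℕ} (hn : 1 ≤ n) (hs : 0 < s) (q : ℕ) :
    P.real {ω | s ≤ |∑ i ∈ Finset.range n, (ζ (X i ω) - ∫ x, ζ x ∂μ)|} ≤
      momentConst q * (4 * (n * A ^ 2) / s ^ 2) ^ q := by
  set c := ∫ x, ζ x ∂μ with hc
  have hc' : |c| ≤ A := abs_integral_le_of_abs_le hA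
  have hb : ∀ x, |ζ x - c| ≤ 2 * A := fun x => (abs_sub _ _).trans (by linarith [hA x])
  have hm : Measurable (fun x => ζ x - c) := hζ.sub_const c
  have i1 : Integrable ζ μ := Integrable.of_bound hζ.aestronglyMeasurable A (ae_of_all _ hA)
  have h0 : ∫ x, (ζ x - c) ∂μ = 0 := by
    rw [integral_sub i1 (integrable_const _)]; simp [hc]
  have hsq : ∀ x, (ζ x - c) ^ 2 ≤ 4 * A ^ 2 := fun x => by
    have := sq_le_sq.mpr ((hb x).trans (le_abs_self _))
    linarith
  have h2 : ∫ x, (ζ x - c) ^ 2 ∂μ ≤ 4 * A ^ 2 :=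
    (le_abs_self _).trans (abs_integral_le_of_abs_le fun x => by rw [abs_of_nonneg (sq_nonneg _)]; exact hsq x)
  have hn1 : (1:ℝ) ≤ n := by exact_mod_cast hn
  have hmom := hX.integral_sum_pow_le hm hb h0 h2 (n := n) (D := 4 * (n * A ^ 2)) (by positivity)
    (by nlinarith [sq_nonneg A]) (by linarith) q
  have hZm : Measurable (fun ω => ∑ i ∈ Finset.range n, (ζ (X i ω) - c)) :=
    Finset.measurable_fun_sum _ fun i _ => hm.comp (hX.meas i)
  have hZb : ∀ ω, |∑ i ∈ Finset.range n, (ζ (X i ω) - c)| ≤ n * (2 * A) := by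
    intro ω
    refine (Finset.abs_sum_le_sum_abs _ _).trans ((Finset.sum_le_sum fun i _ => hb _).trans ?_)
    simp
  refine (measureReal_ge_le_of_moment hZm hZb hs hmom).trans_eq ?_
  rw [div_pow, mul_div_assoc]

/-- The projection `x ↦ 𝔼 K(x, X)` of a symmetric kernel. -/
def proj (μ : Measure S) (K : S → S → ℝ) (x : S) : ℝ := ∫ y, K x y ∂μ

/-- The degenerate part of a symmetric kernel. -/
def degen (μ : Measure S) (K : S → S → ℝ) (x y : S) : ℝ :=
  K x y - proj μ K x - proj μ K y + ∫ z, proj μ K z ∂μ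

lemma sum_pairs_add (g : ℕ → ℝ) (n : ℕ) :
    ∑ j ∈ Finset.range n, ∑ i ∈ Finset.range j, (g i + g j) = ((n:ℝ) - 1) * ∑ i ∈ Finset.range n, g i := by
  induction n with
  | zero => simp
  | succ n ih =>
    rw [Finset.sum_range_succ, ih, Finset.sum_range_succ, Finset.sum_add_distrib]
    simp only [Finset.sum_const, Finset.card_range, nsmul_eq_mul]
    push_cast; ring

lemma sum_pairs_const (c : ℝ) (n : ℕ) :
    ∑ j ∈ Finset.range n, ∑ _i ∈ Finset.range j, c = (n.choose 2 : ℝ) * c := by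
  simp only [Finset.sum_const, Finset.card_range, nsmul_eq_mul]
  rw [← Finset.sum_mul, ← Nat.cast_sum, Finset.sum_range_id, Nat.choose_two_right]

/-- The Hoeffding decomposition of a `U`-statistic. -/
lemma sum_pairs_eq (μ : Measure S) (K : S → S → ℝ) (x : ℕ → S) {n : ℕ} (hn : 2 ≤ n) :
    (n.choose 2 : ℝ)⁻¹ * ∑ j ∈ Finset.range n, ∑ i ∈ Finset.range j, K (x i) (x j) =
      (n.choose 2 : ℝ)⁻¹ * (∑ j ∈ Finset.range n, ∑ i ∈ Finset.range j, degen μ K (x i) (x j)) +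
      2 * (n:ℝ)⁻¹ * (∑ i ∈ Finset.range n, (proj μ K (x i) - ∫ z, proj μ K z ∂μ)) + ∫ z, proj μ K z ∂μ := by
  set θ := ∫ z, proj μ K z ∂μ with hθ
  have e1 : ∑ j ∈ Finset.range n, ∑ i ∈ Finset.range j, K (x i) (x j) =
      ∑ j ∈ Finset.range n, ∑ i ∈ Finset.range j, degen μ K (x i) (x j) +
      ∑ j ∈ Finset.range n, ∑ i ∈ Finset.range j, ((proj μ K (x i) - θ) + (proj μ K (x j) - θ)) +
      ∑ j ∈ Finset.range n, ∑ i ∈ Finset.range j, θ := by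
    rw [← Finset.sum_add_distrib, ← Finset.sum_add_distrib]
    refine Finset.sum_congr rfl fun j _ => ?_
    rw [← Finset.sum_add_distrib, ← Finset.sum_add_distrib]
    refine Finset.sum_congr rfl fun i _ => ?_
    rw [degen]; ring
  have hch : (n.choose 2 : ℝ) = n * (n - 1) / 2 := Nat.cast_choose_two ℝ n
  have hn2 : (2:ℝ) ≤ n := by exact_mod_cast hn
  have hn0 : (n:ℝ) ≠ 0 := by positivity
  have hn1 : (n:ℝ) - 1 ≠ 0 := by linarith
  rw [e1, sum_pairs_add (fun i => proj μ K (x i) - θ), sum_pairs_const, hch]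
  field_simp

/-- Deviation of the degenerate part of a `U`-statistic. -/
lemma IsIID.degen_deviation [IsProbabilityMeasure μ] (hX : IsIID P X μ) {K : S → S → ℝ} (hK : Measurable (Function.uncurry K))
    (hsymm : ∀ x y, K x y = K y x) {A σ2 D s : ℝ} (hA : ∀ x y, |K x y| ≤ A)
    (h2 : ∀ x, ∫ y, K x y ^ 2 ∂μ ≤ σ2) {n : ℕ} (hn : 1 ≤ n) (hD : 0 < D) (hDA : A ^ 2 ≤ D) (hDn : n * σ2 ≤ D)
    (hs : 0 < s) (q : ℕ) :
    P.real {ω | s ≤ |∑ j ∈ Finset.range n, ∑ i ∈ Finset.range j, degen μ K (X i ω) (X j ω)|} ≤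
      ustatConst q * (16 * (n * D) / s ^ 2) ^ (q + 1) := by
  obtain ⟨ω₀⟩ : Nonempty Ω := nonempty_of_isProbabilityMeasure P
  have hA0 : 0 ≤ A := (abs_nonneg _).trans (hA (X 0 ω₀) (X 0 ω₀))
  have hKc : ∀ x, Measurable (K x) := fun x => hK.comp (measurable_const.prodMk measurable_id)
  have hgm : Measurable (proj μ K) := hK.stronglyMeasurable.integral_prod_right.measurable
  have hgb : ∀ x, |proj μ K x| ≤ A := fun x => abs_integral_le_of_abs_le (hA x)
  have hKi : ∀ x, Integrable (K x) μ := fun x =>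
    Integrable.of_bound (hKc x).aestronglyMeasurable A (ae_of_all _ (hA x))
  have hK2i : ∀ x, Integrable (fun y => K x y ^ 2) μ := fun x =>
    Integrable.of_bound ((hKc x).pow_const 2).aestronglyMeasurable (A ^ 2)
      (ae_of_all _ fun y => by rw [norm_pow]; exact pow_le_pow_left₀ (norm_nonneg _) (hA x y) 2)
  have hgi : Integrable (proj μ K) μ := Integrable.of_bound hgm.aestronglyMeasurable A (ae_of_all _ hgb)
  set θ := ∫ z, proj μ K z ∂μ with hθ
  have hθb : |θ| ≤ A := abs_integral_le_of_abs_le hgb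
  -- the squared mean is at most the mean square
  have hjen : ∀ {g : S → ℝ}, Integrable g μ → Integrable (fun y => g y ^ 2) μ → (∫ y, g y ∂μ) ^ 2 ≤ ∫ y, g y ^ 2 ∂μ := by
    intro g i1 i2
    set c := ∫ y, g y ∂μ with hc
    have h3 : 0 ≤ ∫ y, (g y - c) ^ 2 ∂μ := integral_nonneg fun _ => sq_nonneg _
    have h4 : ∫ y, (g y - c) ^ 2 ∂μ = ∫ y, g y ^ 2 ∂μ - c ^ 2 := by
      have : ∀ y, (g y - c) ^ 2 = g y ^ 2 - (2 * c * g y - c ^ 2) := fun y => by ring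
      simp_rw [this]
      have i3 : Integrable (fun y => 2 * c * g y - c ^ 2) μ := (i1.const_mul _).sub (integrable_const _)
      rw [integral_sub i2 i3, integral_sub (i1.const_mul _) (integrable_const _), integral_const_mul, ← hc]
      simp; ring
    linarith
  have hg2 : ∀ x, proj μ K x ^ 2 ≤ σ2 := fun x => (hjen (hKi x) (hK2i x)).trans (h2 x)
  have hg2i : Integrable (fun x => proj μ K x ^ 2) μ :=
    Integrable.of_bound (hgm.pow_const 2).aestronglyMeasurable (A ^ 2)
      (ae_of_all _ fun y => by rw [norm_pow]; exact pow_le_pow_left₀ (norm_nonneg _) (hgb y) 2)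
  have hEg2 : ∫ x, proj μ K x ^ 2 ∂μ ≤ σ2 := by
    calc _ ≤ ∫ x, σ2 ∂μ := integral_mono hg2i (integrable_const _) hg2
      _ = σ2 := by simp
  have hθ2 : θ ^ 2 ≤ σ2 := (hjen hgi hg2i).trans hEg2
  have hdm : Measurable (Function.uncurry (degen μ K)) :=
    ((hK.sub (hgm.comp measurable_fst)).sub (hgm.comp measurable_snd)).add_const θ
  have hdb : ∀ x y, |degen μ K x y| ≤ 4 * A := by
    intro x y
    have := abs_le.mp (hA x y)
    have := abs_le.mp (hgb x)
    have := abs_le.mp (hgb y)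
    have := abs_le.mp hθb
    rw [degen, abs_le]; constructor <;> linarith
  have hds : ∀ x y, degen μ K x y = degen μ K y x := fun x y => by rw [degen, degen, hsymm x y]; ring
  have hd0' : ∀ x, ∫ y, degen μ K x y ∂μ = 0 := by
    intro x
    simp only [degen]
    have i1 : Integrable (fun y => K x y - proj μ K x) μ := (hKi x).sub (integrable_const _)
    have i2 : Integrable (fun y => K x y - proj μ K x - proj μ K y) μ := i1.sub hgi
    rw [integral_add i2 (integrable_const _), integral_sub i1 hgi, integral_sub (hKi x) (integrable_const _)]
    simp [proj]
  have hd0 : ∀ y, ∫ x, degen μ K x y ∂μ = 0 := by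
    intro y; simp_rw [fun x => hds x y]; exact hd0' y
  have hd2 : ∀ y, ∫ x, degen μ K x y ^ 2 ∂μ ≤ 16 * σ2 := by
    intro y
    have hp : ∀ x, degen μ K x y ^ 2 ≤ 4 * (K y x ^ 2) + (4 * (proj μ K x ^ 2) + 8 * σ2) := by
      intro x
      have h5 := hg2 y
      rw [degen, hsymm x y]
      nlinarith [sq_nonneg (K y x + proj μ K x), sq_nonneg (K y x + proj μ K y), sq_nonneg (K y x - θ),
        sq_nonneg (proj μ K x - proj μ K y), sq_nonneg (proj μ K x + θ), sq_nonneg (proj μ K y + θ)]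
    have i2 : Integrable (fun x => 4 * (proj μ K x ^ 2) + 8 * σ2) μ := (hg2i.const_mul 4).add (integrable_const _)
    have i1 : Integrable (fun x => 4 * (K y x ^ 2)) μ := (hK2i y).const_mul 4
    calc _ ≤ ∫ x, (4 * (K y x ^ 2) + (4 * (proj μ K x ^ 2) + 8 * σ2)) ∂μ :=
          integral_mono_of_nonneg (ae_of_all _ fun x => sq_nonneg _) (i1.add i2) (ae_of_all _ hp)
      _ = 4 * ∫ x, K y x ^ 2 ∂μ + (4 * ∫ x, proj μ K x ^ 2 ∂μ + 8 * σ2) := by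
          rw [integral_add i1 i2, integral_add (hg2i.const_mul 4) (integrable_const _),
            integral_const_mul, integral_const_mul]
          simp
      _ ≤ _ := by linarith [h2 y]
  have hmom := hX.integral_ustat_pow_le hdm hdb hd0 hd0' hd2 hn (D := 16 * D) (by positivity)
    (by nlinarith) (by linarith) q
  have hZm : Measurable (fun ω => ∑ j ∈ Finset.range n, ∑ i ∈ Finset.range j, degen μ K (X i ω) (X j ω)) :=
    Finset.measurable_fun_sum _ fun j _ => Finset.measurable_fun_sum _ fun i _ =>
      hdm.comp ((hX.meas i).prodMk (hX.meas j))
  have hZb : ∀ ω, |∑ j ∈ Finset.range n, ∑ i ∈ Finset.range j, degen μ K (X i ω) (X j ω)| ≤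
      (n.choose 2 : ℝ) * (4 * A) := by
    intro ω
    rw [← sum_pairs_const]
    exact (Finset.abs_sum_le_sum_abs _ _).trans (Finset.sum_le_sum fun j _ =>
      (Finset.abs_sum_le_sum_abs _ _).trans (Finset.sum_le_sum fun i _ => hdb _ _))
  refine (measureReal_ge_le_of_moment hZm hZb hs hmom).trans_eq ?_
  rw [div_pow, mul_div_assoc, mul_left_comm (n:ℝ) 16 D]

end

/-! ### The decomposition of the cross-validation criterion -/

/-- The law of an observation. -/
def obsLaw {d : ℕ} (f : Sph d → ℝ) : Measure (Sph d) := (surf d).withDensity (fun x => ENNReal.ofReal (f x))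

section

variable {d : ℕ} {L : ℝ → ℝ} {f : Sph d → ℝ} {Ω : Type*} [MeasurableSpace Ω] {P : Measure Ω}
  {X : ℕ → Ω → Sph d}

lemma IsSample.isIID (hX : IsSample P X f) : IsIID P X (obsLaw f) := ⟨hX.meas, hX.indep, hX.law⟩

lemma IsSample.isProbabilityMeasure [IsProbabilityMeasure P] (hX : IsSample P X f) : IsProbabilityMeasure (obsLaw f) := by
  rw [obsLaw, ← hX.law 0]
  exact Measure.isProbabilityMeasure_map (hX.meas 0).aemeasurable

lemma integral_obsLaw (hf : IsDensity f) (hfb : IsBM f) (g : Sph d → ℝ) :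
    ∫ x, g x ∂(obsLaw f) = ∫ x, g x * f x ∂(surf d) := by
  rw [obsLaw, integral_withDensity_eq_integral_toReal_smul hfb.meas.ennreal_ofReal (by simp)]
  refine integral_congr_ae (ae_of_all _ fun x => ?_)
  simp only [smul_eq_mul, ENNReal.toReal_ofReal (hf.nonneg x), mul_comm]

lemma integral_obsLaw_le (hf : IsDensity f) (hfb : IsBM f) {C : ℝ} (hC : ∀ x, |f x| ≤ C) {g : Sph d → ℝ}
    (hg0 : ∀ x, 0 ≤ g x) (hg : Integrable g (surf d)) : ∫ x, g x ∂(obsLaw f) ≤ C * ∫ x, g x ∂(surf d) := by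
  rw [integral_obsLaw hf hfb, ← integral_const_mul]
  refine integral_mono_of_nonneg (ae_of_all _ fun x => mul_nonneg (hg0 x) (hf.nonneg x)) (hg.const_mul C)
    (ae_of_all _ fun x => ?_)
  simp only
  rw [mul_comm]
  exact mul_le_mul_of_nonneg_right ((le_abs_self _).trans (hC x)) (hg0 x)

/-- The linear part `(T - 1)² f` of the criterion, where `T` is convolution with the kernel. -/
def linPart {d : ℕ} (L : ℝ → ℝ) (f : Sph d → ℝ) (h : ℝ) (x : Sph d) : ℝ :=
  zonalOp (nker d L h) (bias L f h) x - bias L f h x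

/-- The part of the criterion that does not depend on the bandwidth. -/
def cvShift {d : ℕ} (f : Sph d → ℝ) (n : ℕ) (x : ℕ → Sph d) : ℝ :=
  -(∫ x, f x ^ 2 ∂(surf d)) - 2 * (n:ℝ)⁻¹ * ∑ i ∈ Finset.range n, (f (x i) - ∫ x, f x ^ 2 ∂(surf d))

lemma integral_kerTilde_mul (hL : KernelAssumptions d L) (hd : 1 ≤ d) {h : ℝ} (hh : 0 < h) {g : Sph d → ℝ}
    (hg : IsBM g) (x : Sph d) :
    ∫ y, kerTilde L h x y * g y ∂(surf d) = zonalOp (nker d L h) (zonalOp (nker d L h) g) x := by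
  obtain ⟨B, hB, hk⟩ := hL.exists_isKer
  have hkn := hL.nker_isKer hd hk hh
  obtain ⟨C, hC, hgC⟩ := hg.bdd
  simp only [kerTilde_eq hL hd, zonalOp]
  simp_rw [← integral_mul_const, ← integral_const_mul]
  rw [integral_integral_swap]
  · refine integral_congr_ae (ae_of_all _ fun z => ?_)
    refine integral_congr_ae (ae_of_all _ fun y => ?_)
    have e : ⟪(y : EuclideanSpace ℝ (Fin (d + 1))), z⟫_ℝ = ⟪(z : EuclideanSpace ℝ (Fin (d + 1))), y⟫_ℝ :=
      real_inner_comm _ _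
    simp only
    rw [e]; ring
  · have m1 : Measurable (fun p : Sph d × Sph d => nker d L h (1 - ⟪(x : EuclideanSpace ℝ (Fin (d + 1))), p.2⟫_ℝ)) :=
      (hkn.meas.comp (measurable_zonal x)).comp measurable_snd
    have := hkn.integrable_prod (d := d) (G := fun p => nker d L h (1 - ⟪(x : EuclideanSpace ℝ (Fin (d + 1))), p.2⟫_ℝ) * g p.1)
      (m1.mul (hg.meas.comp measurable_fst)) (C := (mass d L h)⁻¹ * B * C) (fun p => by
        rw [abs_mul]
        exact mul_le_mul (hkn.abs_le _) (hgC _) (abs_nonneg _) hkn.bound_nonneg)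
    refine this.congr (ae_of_all _ fun p => ?_)
    simp only [Function.uncurry]; ring

lemma integral_kerH_mul (hL : KernelAssumptions d L) (hd : 1 ≤ d) (h : ℝ) (g : Sph d → ℝ) (x : Sph d) :
    ∫ y, kerH L h x y * g y ∂(surf d) = zonalOp (nker d L h) g x := by
  simp only [kerH_eq hL hd, zonalOp]

lemma measurable_kerH (hL : KernelAssumptions d L) (hd : 1 ≤ d) {h : ℝ} (hh : 0 < h) :
    Measurable (Function.uncurry (kerH (d := d) L h)) := by
  obtain ⟨B, hB, hk⟩ := hL.exists_isKer
  have e : Function.uncurry (kerH (d := d) L h) = fun p : Sph d × Sph d =>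
      nker d L h (1 - ⟪(p.1 : EuclideanSpace ℝ (Fin (d + 1))), p.2⟫_ℝ) := by
    ext p; exact kerH_eq hL hd h p.1 p.2
  rw [e]
  exact measurable_kernel (hL.nker_isKer hd hk hh).meas

lemma kerH_symm (hL : KernelAssumptions d L) (hd : 1 ≤ d) (h : ℝ) (x y : Sph d) :
    kerH L h x y = kerH L h y x := by
  rw [kerH_eq hL hd, kerH_eq hL hd, real_inner_comm]

lemma kerTilde_symm (L : ℝ → ℝ) (h : ℝ) (x y : Sph d) : kerTilde L h x y = kerTilde L h y x := by
  simp only [kerTilde, mul_comm]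

lemma measurable_comp₂ {S T U : Type*} [MeasurableSpace S] [MeasurableSpace T] [MeasurableSpace U]
    {F : S → T → ℝ} (hF : Measurable (Function.uncurry F)) {a : U → S} {b : U → T} (ha : Measurable a)
    (hb : Measurable b) : Measurable (fun u => F (a u) (b u)) := hF.comp (ha.prodMk hb)

lemma measurable_kerTilde (hL : KernelAssumptions d L) (hd : 1 ≤ d) {h : ℝ} (hh : 0 < h) :
    Measurable (Function.uncurry (kerTilde (d := d) L h)) := by
  have hm := measurable_kerH hL hd hh
  have : Measurable (fun p : (Sph d × Sph d) × Sph d => kerH L h p.1.1 p.2 * kerH L h p.1.2 p.2) :=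
    (measurable_comp₂ (F := kerH L h) hm (measurable_fst.comp measurable_fst) measurable_snd).mul
      (measurable_comp₂ (F := kerH L h) hm (measurable_snd.comp measurable_fst) measurable_snd)
  exact this.stronglyMeasurable.integral_prod_right'.measurable

lemma kerH_nonneg (hL : KernelAssumptions d L) (hd : 1 ≤ d) {h : ℝ} (hh : 0 < h) (x y : Sph d) :
    0 ≤ kerH L h x y := by
  obtain ⟨B, hB, hk⟩ := hL.exists_isKer
  rw [kerH_eq hL hd]
  exact (hL.nker_isKer hd hk hh).nonneg _

lemma kerTilde_nonneg (hL : KernelAssumptions d L) (hd : 1 ≤ d) {h : ℝ} (hh : 0 < h) (x y : Sph d) :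
    0 ≤ kerTilde L h x y :=
  integral_nonneg fun z => mul_nonneg (kerH_nonneg hL hd hh x z) (kerH_nonneg hL hd hh y z)

lemma kerH_le (hL : KernelAssumptions d L) (hd : 1 ≤ d) {B : ℝ} (hk : IsKer (ext0 L) B) {h : ℝ} (hh : 0 < h)
    (x y : Sph d) : kerH L h x y ≤ (mass d L h)⁻¹ * B := by
  rw [kerH_eq hL hd]
  exact (hL.nker_isKer hd hk hh).le _

lemma kerTilde_le (hL : KernelAssumptions d L) (hd : 1 ≤ d) {B : ℝ} (hk : IsKer (ext0 L) B) {h : ℝ} (hh : 0 < h)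
    (x y : Sph d) : kerTilde L h x y ≤ (mass d L h)⁻¹ * B := by
  have hkn := hL.nker_isKer hd hk hh
  rw [kerTilde_eq hL hd]
  have := abs_zonalOp_le hd hkn (g := fun z => nker d L h (1 - ⟪(y : EuclideanSpace ℝ (Fin (d + 1))), z⟫_ℝ))
    (C := (mass d L h)⁻¹ * B) (fun z => hkn.abs_le _) x
  rw [hL.integral_nker hd hh, one_mul] at this
  exact le_of_abs_le this

lemma integral_kerH (hL : KernelAssumptions d L) (hd : 1 ≤ d) {h : ℝ} (hh : 0 < h) (x : Sph d) :
    ∫ y, kerH L h x y ∂(surf d) = 1 := by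
  obtain ⟨B, hB, hk⟩ := hL.exists_isKer
  simp only [kerH_eq hL hd]
  rw [integral_zonal hd x (hL.nker_isKer hd hk hh).meas, hL.integral_nker hd hh]

lemma integral_kerTilde (hL : KernelAssumptions d L) (hd : 1 ≤ d) {h : ℝ} (hh : 0 < h) (x : Sph d) :
    ∫ y, kerTilde L h x y ∂(surf d) = 1 := by
  obtain ⟨B, hB, hk⟩ := hL.exists_isKer
  have hkn := hL.nker_isKer hd hk hh
  have h1 := integral_kerTilde_mul hL hd hh (IsBM.const (d := d) 1) x
  simp only [mul_one] at h1
  have h2 : zonalOp (nker d L h) (fun _ : Sph d => (1:ℝ)) = fun _ => 1 := by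
    ext y; rw [zonalOp_const hd hkn.meas, hL.integral_nker hd hh, one_mul]
  rw [h1, h2, h2]

/-- The projection of `K_h` is `linPart`, which is small with the bias, minus `f`, which does not
depend on the bandwidth. -/
lemma proj_kerK (hX : IsSample P X f) (hL : KernelAssumptions d L) (hd : 1 ≤ d) {h : ℝ} (hh : 0 < h) (x : Sph d) :
    proj (obsLaw f) (kerK L h) x = linPart L f h x - f x := by
  obtain ⟨B, hB, hk⟩ := hL.exists_isKer
  have hkn := hL.nker_isKer hd hk hh
  have hT := hX.bm.zonalOp hd hkn
  have e1 : ∀ y, kerK L h x y * f y = kerTilde L h x y * f y - 2 * (kerH L h x y * f y) := fun y => by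
    rw [kerK]; ring
  have mT : Measurable (fun y => kerTilde L h x y) :=
    measurable_comp₂ (F := kerTilde L h) (measurable_kerTilde hL hd hh) measurable_const measurable_id
  have mH : Measurable (fun y => kerH L h x y) :=
    measurable_comp₂ (F := kerH L h) (measurable_kerH hL hd hh) measurable_const measurable_id
  have bT : IsBM (fun y => kerTilde L h x y) := ⟨mT, (mass d L h)⁻¹ * B, hkn.bound_nonneg, fun y => by
    rw [abs_of_nonneg (kerTilde_nonneg hL hd hh x y)]; exact kerTilde_le hL hd hk hh x y⟩
  have bH : IsBM (fun y => kerH L h x y) := ⟨mH, (mass d L h)⁻¹ * B, hkn.bound_nonneg, fun y => by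
    rw [abs_of_nonneg (kerH_nonneg hL hd hh x y)]; exact kerH_le hL hd hk hh x y⟩
  rw [proj, integral_obsLaw hX.density hX.bm]
  simp_rw [e1]
  rw [integral_sub (bT.mul hX.bm).integrable ((bH.mul hX.bm).const_mul 2).integrable, integral_const_mul,
    integral_kerTilde_mul hL hd hh hX.bm, integral_kerH_mul hL hd, linPart]
  have : zonalOp (nker d L h) (bias L f h) x =
      zonalOp (nker d L h) (zonalOp (nker d L h) f) x - zonalOp (nker d L h) f x := by
    rw [← zonalOp_sub hkn hT hX.bm]; rfl
  rw [this, bias]; ring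

lemma IsBM.linPart (hf : IsBM f) (hL : KernelAssumptions d L) (hd : 1 ≤ d) {h : ℝ} (hh : 0 < h) :
    IsBM (linPart L f h) := by
  obtain ⟨B, hB, hk⟩ := hL.exists_isKer
  have hb := hf.bias hL hd hh
  exact (hb.zonalOp hd (hL.nker_isKer hd hk hh)).sub hb

/-- The linear statistic has the integrated squared bias as its mean, by the symmetry of the zonal
operator. -/
lemma integral_linPart (hX : IsSample P X f) (hL : KernelAssumptions d L) (hd : 1 ≤ d) {h : ℝ} (hh : 0 < h) :
    ∫ x, linPart L f h x ∂(obsLaw f) = isb L f h := by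
  obtain ⟨B, hB, hk⟩ := hL.exists_isKer
  have hkn := hL.nker_isKer hd hk hh
  have hb := hX.bm.bias hL hd hh
  have e1 : ∀ x, linPart L f h x * f x = f x * zonalOp (nker d L h) (bias L f h) x - bias L f h x * f x := by
    intro x; rw [linPart]; ring
  rw [integral_obsLaw hX.density hX.bm]
  simp_rw [e1]
  rw [integral_sub (hX.bm.mul (hb.zonalOp hd hkn)).integrable (hb.mul hX.bm).integrable,
    integral_mul_zonalOp hkn hX.bm hb, ← integral_sub ((hX.bm.zonalOp hd hkn).mul hb).integrable
    (hb.mul hX.bm).integrable, isb]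
  refine integral_congr_ae (ae_of_all _ fun x => ?_)
  simp only [bias]; ring

/-- The cross-validation criterion is the common part of the criteria, up to a term that does not
depend on the bandwidth, a degenerate `U`-statistic and a linear statistic. -/
lemma CV_eq (hX : IsSample P X f) (hL : KernelAssumptions d L) (hd : 1 ≤ d) {h : ℝ} (hh : 0 < h)
    (x : ℕ → Sph d) {n : ℕ} (hn : 2 ≤ n) :
    CV L n x h = crit L f n h + cvShift f n x +
      (n.choose 2 : ℝ)⁻¹ * (∑ j ∈ Finset.range n, ∑ i ∈ Finset.range j,
        degen (obsLaw f) (kerK L h) (x i) (x j)) +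
      2 * (n:ℝ)⁻¹ * ∑ i ∈ Finset.range n, (linPart L f h (x i) - ∫ z, linPart L f h z ∂(obsLaw f)) := by
  have hθ : ∫ z, proj (obsLaw f) (kerK L h) z ∂(obsLaw f) = isb L f h - ∫ z, f z ^ 2 ∂(surf d) := by
    simp_rw [proj_kerK hX hL hd hh]
    have e : ∀ z, (linPart L f h z - f z) * f z = linPart L f h z * f z - f z ^ 2 := fun z => by ring
    rw [integral_obsLaw hX.density hX.bm]
    simp_rw [e]
    rw [integral_sub ((hX.bm.linPart hL hd hh).mul hX.bm).integrable hX.bm.sq.integrable,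
      ← integral_obsLaw hX.density hX.bm, integral_linPart hX hL hd hh]
  rw [CV, sum_pairs_eq (obsLaw f) (kerK L h) x hn, hθ, integral_linPart hX hL hd hh, crit, cvShift]
  simp_rw [proj_kerK hX hL hd hh]
  have e2 : ∑ i ∈ Finset.range n, (linPart L f h (x i) - f (x i) - (isb L f h - ∫ z, f z ^ 2 ∂(surf d))) =
      ∑ i ∈ Finset.range n, (linPart L f h (x i) - isb L f h) -
      ∑ i ∈ Finset.range n, (f (x i) - ∫ z, f z ^ 2 ∂(surf d)) := by
    rw [← Finset.sum_sub_distrib]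
    exact Finset.sum_congr rfl fun i _ => by ring
  rw [e2]; ring

end

/-! ### Deviation of the criterion at a fixed bandwidth -/

section

variable {d : ℕ} {L : ℝ → ℝ} {f : Sph d → ℝ} {Ω : Type*} [MeasurableSpace Ω] {P : Measure Ω}
  {X : ℕ → Ω → Sph d}

/-- A property of all small bandwidths holds uniformly on the search interval for large `n`. -/
lemma eventually_forall_mul_rate {p : ℝ → Prop} (hp : ∀ᶠ h in 𝓝[>] (0:ℝ), p h) {ε M : ℝ} (hε : 0 < ε) :
    ∀ᶠ n : ℕ in atTop, ∀ τ ∈ Icc ε M, p (τ * rate d n) := by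
  obtain ⟨r, hr, hev⟩ := mem_nhdsGT_iff_exists_Ioo_subset.mp hp
  have hr : 0 < r := hr
  have hM' : 0 < max M 1 := lt_max_of_lt_right one_pos
  have hsm : ∀ᶠ η : ℝ in 𝓝[>] 0, η < r / max M 1 := nhdsWithin_le_nhds (gt_mem_nhds (by positivity))
  filter_upwards [(tendsto_rate d).eventually hsm, eventually_ge_atTop 1] with n h1 hn τ hτ
  have hη := rate_pos d hn
  refine hev ⟨mul_pos (hε.trans_le hτ.1) hη, ?_⟩
  calc τ * rate d n ≤ max M 1 * rate d n :=
        mul_le_mul_of_nonneg_right (hτ.2.trans (le_max_left _ _)) hη.le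
    _ < r := by rw [lt_div_iff₀ hM'] at h1; linarith

lemma eventually_rate_lt {r : ℝ} (hr : 0 < r) : ∀ᶠ n : ℕ in atTop, rate d n < r :=
  (tendsto_rate d).eventually (nhdsWithin_le_nhds (gt_mem_nhds hr))

lemma measurable_kerK (hL : KernelAssumptions d L) (hd : 1 ≤ d) {h : ℝ} (hh : 0 < h) :
    Measurable (Function.uncurry (kerK (d := d) L h)) :=
  (measurable_kerTilde hL hd hh).sub ((measurable_kerH hL hd hh).const_mul 2)

lemma kerK_symm (hL : KernelAssumptions d L) (hd : 1 ≤ d) (h : ℝ) (x y : Sph d) :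
    kerK L h x y = kerK L h y x := by
  rw [kerK, kerK, kerTilde_symm, kerH_symm hL hd]

lemma abs_kerK_le (hL : KernelAssumptions d L) (hd : 1 ≤ d) {B K : ℝ} (hk : IsKer (ext0 L) B) {h : ℝ} (hh : 0 < h)
    (hK : (mass d L h)⁻¹ * B ≤ K) (x y : Sph d) : |kerK L h x y| ≤ 3 * K := by
  have h1 := (kerH_le hL hd hk hh x y).trans hK
  have h2 := (kerTilde_le hL hd hk hh x y).trans hK
  have h3 := kerH_nonneg hL hd hh x y
  have h4 := kerTilde_nonneg hL hd hh x y
  rw [kerK, abs_le]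
  constructor <;> linarith

/-- The conditional second moment of `K_h` has the order of its supremum, since both of its parts
are nonnegative with integral one. -/
lemma integral_kerK_sq_le (hX : IsSample P X f) (hL : KernelAssumptions d L) (hd : 1 ≤ d) {B K Cf : ℝ}
    (hk : IsKer (ext0 L) B) {h : ℝ} (hh : 0 < h)
    (hK : (mass d L h)⁻¹ * B ≤ K) (hCf : ∀ x, |f x| ≤ Cf) (x : Sph d) :
    ∫ y, kerK L h x y ^ 2 ∂(obsLaw f) ≤ Cf * (10 * K) := by
  have hkn := hL.nker_isKer hd hk hh
  have hK0 : 0 ≤ K := hkn.bound_nonneg.trans hK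
  have hCf0 : 0 ≤ Cf := (abs_nonneg _).trans (hCf x)
  have mT : Measurable (fun y => kerTilde L h x y) :=
    measurable_comp₂ (F := kerTilde L h) (measurable_kerTilde hL hd hh) measurable_const measurable_id
  have mH : Measurable (fun y => kerH L h x y) :=
    measurable_comp₂ (F := kerH L h) (measurable_kerH hL hd hh) measurable_const measurable_id
  have bT : IsBM (fun y => kerTilde L h x y) := ⟨mT, (mass d L h)⁻¹ * B, hkn.bound_nonneg, fun y => by
    rw [abs_of_nonneg (kerTilde_nonneg hL hd hh x y)]; exact kerTilde_le hL hd hk hh x y⟩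
  have bH : IsBM (fun y => kerH L h x y) := ⟨mH, (mass d L h)⁻¹ * B, hkn.bound_nonneg, fun y => by
    rw [abs_of_nonneg (kerH_nonneg hL hd hh x y)]; exact kerH_le hL hd hk hh x y⟩
  have bK : IsBM (fun y => kerK L h x y ^ 2) := (bT.sub (bH.const_mul 2)).sq
  refine (integral_obsLaw_le hX.density hX.bm hCf (fun y => sq_nonneg (kerK L h x y)) bK.integrable).trans ?_
  refine mul_le_mul_of_nonneg_left ?_ hCf0
  calc ∫ y, kerK L h x y ^ 2 ∂(surf d)
      ≤ ∫ y, (2 * K * kerTilde L h x y + 8 * K * kerH L h x y) ∂(surf d) := by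
        refine integral_mono bK.integrable ((bT.const_mul (2 * K)).add (bH.const_mul (8 * K))).integrable fun y => ?_
        have h1 := (kerH_le hL hd hk hh x y).trans hK
        have h2 := (kerTilde_le hL hd hk hh x y).trans hK
        have h3 := kerH_nonneg hL hd hh x y
        have h4 := kerTilde_nonneg hL hd hh x y
        simp only
        rw [kerK]
        nlinarith [mul_nonneg h3 (sub_nonneg.mpr h1), mul_nonneg h4 (sub_nonneg.mpr h2),
          sq_nonneg (kerTilde L h x y + 2 * kerH L h x y)]
    _ = 10 * K := by
        rw [integral_add (bT.const_mul (2 * K)).integrable (bH.const_mul (8 * K)).integrable,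
          integral_const_mul, integral_const_mul, integral_kerTilde hL hd hh, integral_kerH hL hd hh]
        ring

/-- Deviation of the criterion, from separate deviations `s₁` of its degenerate part and `s₂` of
its linear part. -/
lemma cv_deviation_of_bounds [IsProbabilityMeasure P] (hX : IsSample P X f) (hL : KernelAssumptions d L) (hd : 1 ≤ d)
    {B K Cf : ℝ} (hk : IsKer (ext0 L) B) {h : ℝ} (hh : 0 < h)
    (hK : (mass d L h)⁻¹ * B ≤ K) (hCf : ∀ x, |f x| ≤ Cf) {A D s₁ s₂ : ℝ} (hA0 : 0 < A)
    (hA : ∀ x, |linPart L f h x| ≤ A) {n : ℕ} (hn : 2 ≤ n) (hD : 0 < D) (hD1 : (3 * K) ^ 2 ≤ D)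
    (hD2 : n * (Cf * (10 * K)) ≤ D) (hs₁ : 0 < s₁) (hs₂ : 0 < s₂) (q : ℕ) :
    P.real {ω | (n.choose 2 : ℝ)⁻¹ * s₁ + 2 * (n:ℝ)⁻¹ * s₂ ≤
        |CV L n (fun i => X i ω) h - crit L f n h - cvShift f n (fun i => X i ω)|} ≤
      ustatConst q * (16 * (n * D) / s₁ ^ 2) ^ (q + 1) +
        momentConst (q + 1) * (4 * (n * A ^ 2) / s₂ ^ 2) ^ (q + 1) := by
  have := hX.isProbabilityMeasure
  have h1 := hX.isIID.degen_deviation (measurable_kerK hL hd hh) (kerK_symm hL hd h)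
    (abs_kerK_le hL hd hk hh hK) (integral_kerK_sq_le hX hL hd hk hh hK hCf) (by omega : 1 ≤ n) hD hD1 hD2 hs₁ q
  have h2 := hX.isIID.sum_deviation (hX.bm.linPart hL hd hh).meas hA hA0 (by omega : 1 ≤ n) hs₂ (q + 1)
  refine le_trans ?_ (add_le_add h1 h2)
  refine le_trans (measureReal_mono ?_) (measureReal_union_le _ _)
  intro ω hω
  rw [mem_union]
  by_contra hcon
  push Not at hcon
  obtain ⟨c1, c2⟩ := hcon
  rw [mem_ofPred_eq, not_le] at c1 c2
  rw [mem_ofPred_eq, CV_eq hX hL hd hh (fun i => X i ω) hn] at hω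
  have hch : 0 < (n.choose 2 : ℝ)⁻¹ := inv_pos.mpr (by exact_mod_cast Nat.choose_pos hn)
  have hn0 : (0:ℝ) < (n:ℝ)⁻¹ := inv_pos.mpr (by exact_mod_cast (by omega : 0 < n))
  set S₁ := ∑ j ∈ Finset.range n, ∑ i ∈ Finset.range j, degen (obsLaw f) (kerK L h) (X i ω) (X j ω)
  set S₂ := ∑ i ∈ Finset.range n, (linPart L f h (X i ω) - ∫ z, linPart L f h z ∂(obsLaw f))
  have e : crit L f n h + cvShift f n (fun i => X i ω) + (n.choose 2 : ℝ)⁻¹ * S₁ + 2 * (n:ℝ)⁻¹ * S₂ - crit L f n h -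
      cvShift f n (fun i => X i ω) = (n.choose 2 : ℝ)⁻¹ * S₁ + 2 * (n:ℝ)⁻¹ * S₂ := by ring
  rw [e] at hω
  have t1 : |(n.choose 2 : ℝ)⁻¹ * S₁| < (n.choose 2 : ℝ)⁻¹ * s₁ := by
    rw [abs_mul, abs_of_pos hch]; exact mul_lt_mul_of_pos_left c1 hch
  have t2 : |2 * (n:ℝ)⁻¹ * S₂| < 2 * (n:ℝ)⁻¹ * s₂ := by
    rw [abs_mul, abs_of_pos (show 0 < 2 * (n:ℝ)⁻¹ by positivity)]
    exact mul_lt_mul_of_pos_left c2 (by positivity)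
  linarith [abs_add_le ((n.choose 2 : ℝ)⁻¹ * S₁) (2 * (n:ℝ)⁻¹ * S₂)]

lemma abs_linPart_le (hL : KernelAssumptions d L) (hd : 1 ≤ d) {h : ℝ} (hh : 0 < h) {A : ℝ}
    (hA : ∀ x, |bias L f h x| ≤ A) (x : Sph d) : |linPart L f h x| ≤ 2 * A := by
  obtain ⟨B, hB, hk⟩ := hL.exists_isKer
  have h1 := abs_zonalOp_le hd (hL.nker_isKer hd hk hh) hA x
  rw [hL.integral_nker hd hh, one_mul] at h1
  rw [linPart]
  exact (abs_sub _ _).trans (by linarith [hA x])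

lemma vH_nonneg (d : ℕ) (L : ℝ → ℝ) {h : ℝ} (hh : 0 < h) : 0 ≤ vH d L h := by
  have := KernelAssumptions.integral_nker_sq (d := d) (L := L) hh
  have h1 : 0 ≤ ∫ u, nker d L h u ^ 2 ∂(nu d) := integral_nonneg fun _ => sq_nonneg _
  rw [this] at h1
  exact nonneg_of_mul_nonneg_right h1 (by positivity)

lemma isb_le_crit (L : ℝ → ℝ) (f : Sph d → ℝ) (n : ℕ) {h : ℝ} (hh : 0 < h) : isb L f h ≤ crit L f n h := by
  rw [crit]
  have := vH_nonneg d L hh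
  have : 0 ≤ (n:ℝ)⁻¹ * ((h ^ d)⁻¹ * vH d L h) := by positivity
  linarith

/-- At each bandwidth of the order of the optimal one, the criterion is close to its common part,
in relative terms, outside an event whose probability is smaller than any power of `n⁻¹`. -/
lemma IsSample.cv_deviation [IsProbabilityMeasure P] (hX : IsSample P X f) (hf : IsC2 f)
    (hL : KernelAssumptions d L) (hd : 1 ≤ d) (hfu : ∃ x y, f x ≠ f y) {ε : ℝ} (M : ℝ) (hε : 0 < ε)
    {γ : ℝ} (hγ : 0 < γ) (q : ℕ) :
    ∃ C, ∀ᶠ n : ℕ in atTop, ∀ τ ∈ Icc ε M,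
      P.real {ω | γ * (rate d n ^ 4 + crit L f n (τ * rate d n)) ≤
        |CV L n (fun i => X i ω) (τ * rate d n) - crit L f n (τ * rate d n) - cvShift f n (fun i => X i ω)|} ≤
      C * (rate d n ^ d) ^ (q + 1) := by
  obtain ⟨B, hB, hk⟩ := hL.exists_isKer
  obtain ⟨Cf, hCf0, hCf⟩ := hX.bm.bdd
  obtain ⟨C₃, hC₃, hbias⟩ := hf.bias_sq_le hL hd hfu
  have hlow := hf.isb_lower hL hd hfu one_pos
  have hb := hL.b_pos hd
  have hR := hf.lapRoughness_pos hd hfu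
  have hlam := hL.lam_one_pos
  set C₁ := 2 * B / (lam d L * ε ^ d) with hC₁
  set c₂ := b d L ^ 2 * lapRoughness f * ε ^ 4 / 2 with hc₂
  have hC₁0 : 0 < C₁ := by positivity
  have hc₂0 : 0 < c₂ := by positivity
  set C₄ := 9 * C₁ ^ 2 + 10 * Cf * C₁ with hC₄
  have hC₄0 : 0 < C₄ := by positivity
  have hu := ustatConst_pos q
  have hm := momentConst_pos (q + 1)
  refine ⟨ustatConst q * (256 * C₄ / γ ^ 2) ^ (q + 1) + momentConst (q + 1) * (64 * C₃ / (γ ^ 2 * c₂)) ^ (q + 1), ?_⟩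
  filter_upwards [eventually_forall_mul_rate (d := d) (M := M) hbias hε,
    eventually_forall_mul_rate (d := d) (M := M) hlow hε,
    eventually_forall_mul_rate (d := d) (M := M) (hL.eventually_mass_ge hd) hε,
    eventually_ge_atTop 2, eventually_rate_lt (d := d) one_pos] with n hbias hlow hmass hn hη1 τ hτ
  set η := rate d n with hη
  have hη0 : 0 < η := rate_pos d (by omega)
  have hnη : η ^ (d + 4) = (n:ℝ)⁻¹ := rate_pow d n
  have hτ0 : 0 < τ := hε.trans_le hτ.1
  have hn2 : (2:ℝ) ≤ n := by exact_mod_cast hn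
  have hn0 : (0:ℝ) < n := by linarith
  have hnη' : (n:ℝ) * η ^ (d + 4) = 1 := by rw [hnη, mul_inv_cancel₀ hn0.ne']
  replace hbias := hbias τ hτ
  replace hlow := hlow τ hτ
  replace hmass := hmass τ hτ
  set h := τ * η with hh_def
  have hh : 0 < h := by positivity
  set I := isb L f h with hI
  have hIlow : c₂ * η ^ 4 ≤ I := by
    have h1 : 0 ≤ farMass d L h ^ 2 * ∫ x, (f (-x) - f x) ^ 2 ∂(surf d) :=
      mul_nonneg (sq_nonneg _) (integral_nonneg fun _ => sq_nonneg _)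
    have h2 : ε ^ 4 * η ^ 4 ≤ h ^ 4 := by
      rw [← mul_pow]
      exact pow_le_pow_left₀ (by positivity) (mul_le_mul_of_nonneg_right hτ.1 hη0.le) 4
    have h3 := mul_le_mul_of_nonneg_left h2 (show 0 ≤ b d L ^ 2 * lapRoughness f by positivity)
    rw [hc₂]
    linarith
  have hI0 : 0 < I := lt_of_lt_of_le (by positivity) hIlow
  set K := C₁ * (η ^ d)⁻¹ with hK_def
  have hK : (mass d L h)⁻¹ * B ≤ K := by
    have h1 : lam d L / 2 * (ε ^ d * η ^ d) ≤ mass d L h := by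
      refine le_trans ?_ hmass
      rw [← mul_pow]
      exact mul_le_mul_of_nonneg_left (pow_le_pow_left₀ (by positivity)
        (mul_le_mul_of_nonneg_right hτ.1 hη0.le) d) (by positivity)
    have h2 : (mass d L h)⁻¹ ≤ (lam d L / 2 * (ε ^ d * η ^ d))⁻¹ := inv_anti₀ (by positivity) h1
    refine (mul_le_mul_of_nonneg_right h2 hB.le).trans_eq ?_
    rw [hK_def, hC₁]
    field_simp
  set D := C₄ * (η ^ d)⁻¹ * n with hD
  have hηd : (η ^ d)⁻¹ ≤ n := by
    rw [inv_le_comm₀ (by positivity) hn0, ← hnη, pow_add]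
    exact mul_le_of_le_one_right (by positivity) (pow_le_one₀ hη0.le hη1.le)
  have hηd0 : 0 < (η ^ d)⁻¹ := by positivity
  set A := 2 * √(C₃ * I) with hA
  have hA2 : A ^ 2 = 4 * (C₃ * I) := by
    rw [hA, mul_pow, Real.sq_sqrt (by positivity)]; norm_num
  have hch : (n.choose 2 : ℝ) = n * (n - 1) / 2 := Nat.cast_choose_two ℝ n
  have hch0 : 0 < (n.choose 2 : ℝ) := by exact_mod_cast Nat.choose_pos hn
  have hch4 : (n:ℝ) ^ 2 / 4 ≤ n.choose 2 := by rw [hch]; nlinarith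
  -- `s₁` is `γ η⁴` on the scale of the `n.choose 2` pairs, while the deviation `s₂` of the linear
  -- part is taken relative to `I`, as its variance is of the order of `I`
  have hdev := cv_deviation_of_bounds hX hL hd hk hh hK hCf (A := A) (D := D)
    (s₁ := γ * η ^ 4 * n.choose 2) (s₂ := γ * I * n / 2) (by positivity)
    (abs_linPart_le hL hd hh fun x => by
      rw [← Real.sqrt_sq_eq_abs]; exact Real.sqrt_le_sqrt (hbias x)) hn (by positivity)
    (by
      have h1 := mul_le_mul_of_nonneg_left hηd (show 0 ≤ 9 * C₁ ^ 2 * (η ^ d)⁻¹ by positivity)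
      have h2 : 0 ≤ 10 * Cf * C₁ * (η ^ d)⁻¹ * n := by positivity
      rw [hD, hC₄, hK_def]
      linarith)
    (by
      have h2 : 0 ≤ 9 * C₁ ^ 2 * (η ^ d)⁻¹ * n := by positivity
      rw [hD, hC₄, hK_def]
      linarith)
    (by positivity) (by positivity) q
  have hsub : {ω | γ * (η ^ 4 + crit L f n h) ≤
        |CV L n (fun i => X i ω) h - crit L f n h - cvShift f n (fun i => X i ω)|} ⊆
      {ω | (n.choose 2 : ℝ)⁻¹ * (γ * η ^ 4 * n.choose 2) + 2 * (n:ℝ)⁻¹ * (γ * I * n / 2) ≤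
        |CV L n (fun i => X i ω) h - crit L f n h - cvShift f n (fun i => X i ω)|} := by
    intro ω hω
    rw [mem_ofPred_eq] at hω ⊢
    refine le_trans ?_ hω
    have e : (n.choose 2 : ℝ)⁻¹ * (γ * η ^ 4 * n.choose 2) + 2 * (n:ℝ)⁻¹ * (γ * I * n / 2) = γ * (η ^ 4 + I) := by
      field_simp
    rw [e]
    exact mul_le_mul_of_nonneg_left (by linarith [isb_le_crit L f n hh]) hγ.le
  refine (measureReal_mono hsub).trans (hdev.trans ?_)
  have r1 : 16 * (n * D) / (γ * η ^ 4 * n.choose 2) ^ 2 ≤ 256 * C₄ / γ ^ 2 * η ^ d := by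
    rw [div_le_iff₀ (by positivity)]
    have h1 : (γ * η ^ 4 * ((n:ℝ) ^ 2 / 4)) ^ 2 ≤ (γ * η ^ 4 * n.choose 2) ^ 2 :=
      pow_le_pow_left₀ (by positivity) (mul_le_mul_of_nonneg_left hch4 (by positivity)) 2
    refine le_trans (le_of_eq ?_) (mul_le_mul_of_nonneg_left h1 (by positivity))
    calc 16 * (n * D) = 16 * C₄ * (n:ℝ) ^ 2 * (η ^ d)⁻¹ * ((n:ℝ) * η ^ (d + 4)) ^ 2 := by
          rw [hnη', hD]; ring
      _ = _ := by
          rw [pow_add]; field_simp; ring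
  have r2 : 4 * (n * A ^ 2) / (γ * I * n / 2) ^ 2 ≤ 64 * C₃ / (γ ^ 2 * c₂) * η ^ d := by
    rw [hA2, div_le_iff₀ (by positivity)]
    have h1 : 64 * C₃ / (γ ^ 2 * c₂) * η ^ d * ((γ * (c₂ * η ^ 4) * n / 2) * (γ * I * n / 2)) ≤
        64 * C₃ / (γ ^ 2 * c₂) * η ^ d * (γ * I * n / 2) ^ 2 := by
      rw [sq (γ * I * n / 2)]
      refine mul_le_mul_of_nonneg_left (mul_le_mul_of_nonneg_right ?_ (by positivity)) (by positivity)
      have := mul_le_mul_of_nonneg_left hIlow (show 0 ≤ γ * n / 2 by positivity)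
      linarith
    refine le_trans (le_of_eq ?_) h1
    calc 4 * (n * (4 * (C₃ * I))) = 16 * n * C₃ * I * ((n:ℝ) * η ^ (d + 4)) := by rw [hnη']; ring
      _ = _ := by rw [pow_add]; field_simp; norm_num
  rw [add_mul, mul_assoc (ustatConst q), mul_assoc (momentConst (q + 1)), ← mul_pow, ← mul_pow]
  exact add_le_add (mul_le_mul_of_nonneg_left (pow_le_pow_left₀ (by positivity) r1 _) hu.le)
    (mul_le_mul_of_nonneg_left (pow_le_pow_left₀ (by positivity) r2 _) hm.le)

end

/-! ### Perturbation of the bandwidth -/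

/-- For a monotone `Q` that controls the oscillations of the kernel, this controls the oscillation
of `L(u / h²)` as the bandwidth `h` varies in `[a, c]`. -/
def gap (Q : ℝ → ℝ) (a c u : ℝ) : ℝ := Q (max u 0 / a ^ 2) - Q (max u 0 / c ^ 2)

section

variable {d : ℕ} {L : ℝ → ℝ} {f : Sph d → ℝ} {Q : ℝ → ℝ} {V a c : ℝ}

lemma gap_isKer (hQ : Monotone Q) (hQ0 : ∀ s, 0 ≤ Q s) (hQV : ∀ s, Q s ≤ V) (ha : 0 < a) (hac : a ≤ c) :
    IsKer (gap Q a c) V where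
  meas := by
    unfold gap
    exact (hQ.measurable.comp (by fun_prop)).sub (hQ.measurable.comp (by fun_prop))
  nonneg u := by
    refine sub_nonneg.mpr (hQ ?_)
    exact div_le_div_of_nonneg_left (le_max_right _ _) (by positivity) (pow_le_pow_left₀ ha.le hac 2)
  le u := by
    rw [gap]
    linarith [hQ0 (max u 0 / c ^ 2), hQV (max u 0 / a ^ 2)]

/-- The variation of `L(u / h²)` in the bandwidth is dominated by `gap`. -/
lemma abs_dil_sub_le (hQ : Monotone Q) (hvar : ∀ s t, s ≤ t → |ext0 L t - ext0 L s| ≤ Q t - Q s)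
    (ha : 0 < a) {h : ℝ} (hah : a ≤ h) (hhc : h ≤ c) (u : ℝ) :
    |dil L h u - dil L a u| ≤ gap Q a c u := by
  have hh : 0 < h := ha.trans_le hah
  have hu : 0 ≤ max u 0 := le_max_right _ _
  have e : ∀ r, 0 < r → dil L r u = ext0 L (max u 0 / r ^ 2) := by
    intro r hr
    rw [dil, ext0, ext0, max_eq_left (show 0 ≤ max u 0 / r ^ 2 by positivity)]
    congr 1
    rcases le_total 0 u with h0 | h0
    · rw [max_eq_left h0, max_eq_left (by positivity)]
    · rw [max_eq_right h0, zero_div, max_eq_right (div_nonpos_of_nonpos_of_nonneg h0 (by positivity))]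
  rw [e h hh, e a ha, abs_sub_comm]
  refine (hvar _ _ (div_le_div_of_nonneg_left hu (by positivity) (pow_le_pow_left₀ ha.le hah 2))).trans ?_
  rw [gap]
  exact sub_le_sub_left (hQ (div_le_div_of_nonneg_left hu (by positivity) (pow_le_pow_left₀ hh.le hhc 2))) _

/-- The weight of `nu d` is at most a sum of two inverse square roots; splitting the latter at the
level `t` trades the `L¹` norm of a bounded function against the size of its bound. -/
lemma rpow_weight_le (hd : 1 ≤ d) {u t : ℝ} (hu : u ∈ Ioo (0:ℝ) 2) (ht : 0 < t) :
    (u * (2 - u)) ^ ((d:ℝ) / 2 - 1) ≤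
      2 * t + (√t)⁻¹ * (u ^ (-(3/4) : ℝ) + (2 - u) ^ (-(3/4) : ℝ)) := by
  have hd0 : (1:ℝ) ≤ d := by exact_mod_cast hd
  obtain ⟨h1, h2⟩ := hu
  have h2' : 0 < 2 - u := by linarith
  have h0 : 0 < u * (2 - u) := mul_pos h1 h2'
  have key : ∀ y : ℝ, 0 < y → y ^ (-(1/2) : ℝ) ≤ t + (√t)⁻¹ * y ^ (-(3/4) : ℝ) := by
    intro y hy
    have hp : 0 < y ^ (-(1/4) : ℝ) := Real.rpow_pos_of_pos hy _
    set p := y ^ (-(1/4) : ℝ) with hp_def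
    have e2 : y ^ (-(1/2) : ℝ) = p ^ 2 := by
      rw [hp_def, ← Real.rpow_natCast, ← Real.rpow_mul hy.le]; norm_num
    have e3 : y ^ (-(3/4) : ℝ) = p ^ 3 := by
      rw [hp_def, ← Real.rpow_natCast, ← Real.rpow_mul hy.le]; norm_num
    have hs : 0 < √t := Real.sqrt_pos.mpr ht
    have hst : t = √t ^ 2 := (Real.sq_sqrt ht.le).symm
    rw [e2, e3]
    rcases le_total p (√t) with h | h
    · have h3 : p ^ 2 ≤ √t ^ 2 := pow_le_pow_left₀ hp.le h 2
      have h4 : 0 ≤ (√t)⁻¹ * p ^ 3 := by positivity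
      linarith
    · have h3 : p ^ 2 ≤ (√t)⁻¹ * p ^ 3 := by
        rw [inv_mul_eq_div, le_div_iff₀ hs, pow_succ p 2]
        exact mul_le_mul_of_nonneg_left h (by positivity)
      linarith
  have hle : (u * (2 - u)) ^ ((d:ℝ) / 2 - 1) ≤ u ^ (-(1/2) : ℝ) + (2 - u) ^ (-(1/2) : ℝ) := by
    refine (Real.rpow_le_rpow_of_exponent_ge h0 (by nlinarith [sq_nonneg (u - 1)])
      (show -(1/2 : ℝ) ≤ (d:ℝ) / 2 - 1 by linarith)).trans ?_
    have p1 := Real.rpow_nonneg h1.le (-(1/2) : ℝ)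
    have p2 := Real.rpow_nonneg h2'.le (-(1/2) : ℝ)
    rcases le_total u 1 with h | h
    · have := Real.rpow_le_rpow_of_nonpos h1 (show u ≤ u * (2 - u) by nlinarith) (show -(1/2 : ℝ) ≤ 0 by norm_num)
      linarith
    · have := Real.rpow_le_rpow_of_nonpos h2' (show 2 - u ≤ u * (2 - u) by nlinarith) (show -(1/2 : ℝ) ≤ 0 by norm_num)
      linarith
  have k1 := key u h1
  have k2 := key (2 - u) h2'
  rw [mul_add]
  linarith

/-- The Lebesgue integral of `gap` is at most a multiple of the relative change of the
squared bandwidth: `Q` is bounded, and the two dilates differ by a change of scale. -/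
lemma integral_gap_le (hQ : Monotone Q) (hQ0 : ∀ s, 0 ≤ Q s) (hQV : ∀ s, Q s ≤ V) (ha : 0 < a) (hac : a ≤ c) :
    ∫ u in Ioo (0:ℝ) 2, gap Q a c u ≤ 2 * V * (1 - a ^ 2 / c ^ 2) := by
  have hc : 0 < c := ha.trans_le hac
  have hint : ∀ x y, IntervalIntegrable Q volume x y := fun x y => hQ.intervalIntegrable
  have hmono : ∀ r : ℝ, 0 < r → Monotone (fun u => Q (u / r ^ 2)) := fun r hr u w huw =>
    hQ (div_le_div_of_nonneg_right huw (by positivity))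
  have e1 : ∫ u in Ioo (0:ℝ) 2, gap Q a c u = ∫ u in (0:ℝ)..2, (Q (u / a ^ 2) - Q (u / c ^ 2)) := by
    rw [intervalIntegral.integral_of_le (by norm_num), integral_Ioc_eq_integral_Ioo]
    refine setIntegral_congr_fun measurableSet_Ioo fun u hu => ?_
    simp only [gap, max_eq_left hu.1.le]
  rw [e1, intervalIntegral.integral_sub ((hmono a ha).intervalIntegrable) ((hmono c hc).intervalIntegrable),
    intervalIntegral.integral_comp_div _ (by positivity), intervalIntegral.integral_comp_div _ (by positivity),
    zero_div, zero_div, smul_eq_mul, smul_eq_mul]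
  have hle : 2 / c ^ 2 ≤ 2 / a ^ 2 :=
    div_le_div_of_nonneg_left (by norm_num) (by positivity) (pow_le_pow_left₀ ha.le hac 2)
  have h0 : 0 ≤ ∫ s in (0:ℝ)..(2 / c ^ 2), Q s := intervalIntegral.integral_nonneg (by positivity) fun s _ => hQ0 s
  have h1 : ∫ s in (2 / c ^ 2)..(2 / a ^ 2), Q s ≤ (2 / a ^ 2 - 2 / c ^ 2) * V := by
    have := intervalIntegral.integral_mono_on (μ := volume) hle (hint _ _) (intervalIntegrable_const (c := V)) fun s _ => hQV s
    rwa [intervalIntegral.integral_const, smul_eq_mul] at this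
  rw [← intervalIntegral.integral_add_adjacent_intervals (hint 0 (2 / c ^ 2)) (hint (2 / c ^ 2) (2 / a ^ 2))]
  have h2 : a ^ 2 * ∫ s in (0:ℝ)..(2 / c ^ 2), Q s ≤ c ^ 2 * ∫ s in (0:ℝ)..(2 / c ^ 2), Q s :=
    mul_le_mul_of_nonneg_right (pow_le_pow_left₀ ha.le hac 2) h0
  have h3 := mul_le_mul_of_nonneg_left h1 (sq_nonneg a)
  have e2 : a ^ 2 * ((2 / a ^ 2 - 2 / c ^ 2) * V) = 2 * V * (1 - a ^ 2 / c ^ 2) := by field_simp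
  rw [e2] at h3
  linarith

/-- The corresponding bound for `nu d`, whose density may be unbounded at both ends; the free
parameter `t` is the truncation level of the density. -/
lemma exists_integral_gap_le (hd : 1 ≤ d) (hQ : Monotone Q) (hQ0 : ∀ s, 0 ≤ Q s) (hQV : ∀ s, Q s ≤ V) :
    ∃ J, 0 ≤ J ∧ ∀ a c t : ℝ, 0 < a → a ≤ c → 0 < t →
      ∫ u, gap Q a c u ∂(nu d) ≤ J * (t * (1 - a ^ 2 / c ^ 2) + (√t)⁻¹) := by
  have hV : 0 ≤ V := (hQ0 0).trans (hQV 0)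
  set g : ℝ → ℝ := fun u => u ^ (-(3/4) : ℝ) + (2 - u) ^ (-(3/4) : ℝ) with hg
  have hgi : IntegrableOn g (Ioo 0 2) := by
    have i1 : IntervalIntegrable (fun u : ℝ => u ^ (-(3/4) : ℝ)) volume 0 2 :=
      intervalIntegral.intervalIntegrable_rpow' (by norm_num)
    have i2 := i1.comp_sub_left 2
    rw [sub_zero, sub_self] at i2
    have := i1.add i2.symm
    rw [intervalIntegrable_iff_integrableOn_Ioo_of_le (by norm_num)] at this
    exact this
  have hg0 : ∀ u ∈ Ioo (0:ℝ) 2, 0 ≤ g u := fun u hu =>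
    add_nonneg (Real.rpow_nonneg hu.1.le _) (Real.rpow_nonneg (by linarith [hu.2]) _)
  set G := ∫ u in Ioo (0:ℝ) 2, g u with hG
  have hG0 : 0 ≤ G := setIntegral_nonneg measurableSet_Ioo hg0
  have har := area_pos (d - 1)
  refine ⟨area (d - 1) * V * (4 + G), by positivity, fun a c t ha hac ht => ?_⟩
  have hk := gap_isKer hQ hQ0 hQV ha hac
  have hki : IntegrableOn (gap Q a c) (Ioo 0 2) :=
    Integrable.of_bound hk.meas.aestronglyMeasurable V (ae_of_all _ hk.abs_le)
  have h1 := integral_gap_le hQ hQ0 hQV ha hac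
  have hst : 0 < (√t)⁻¹ := inv_pos.mpr (Real.sqrt_pos.mpr ht)
  have hx : 0 ≤ 1 - a ^ 2 / c ^ 2 := by
    have hc : 0 < c := ha.trans_le hac
    rw [sub_nonneg, div_le_one (by positivity)]
    exact pow_le_pow_left₀ ha.le hac 2
  have h2 : ∫ u in Ioo (0:ℝ) 2, gap Q a c u * (u * (2 - u)) ^ ((d:ℝ) / 2 - 1) ≤
      2 * t * (∫ u in Ioo (0:ℝ) 2, gap Q a c u) + (√t)⁻¹ * V * G := by
    have ia : IntegrableOn (fun u => 2 * t * gap Q a c u) (Ioo 0 2) := hki.const_mul _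
    have ib : IntegrableOn (fun u => (√t)⁻¹ * V * g u) (Ioo 0 2) := hgi.const_mul _
    have iab : IntegrableOn (fun u => 2 * t * gap Q a c u + (√t)⁻¹ * V * g u) (Ioo 0 2) := ia.add ib
    rw [hG, ← integral_const_mul, ← integral_const_mul, ← integral_add ia ib]
    refine integral_mono_of_nonneg ?_ iab ?_
    · filter_upwards [ae_restrict_mem measurableSet_Ioo] with u hu
      exact mul_nonneg (hk.nonneg u) (Real.rpow_nonneg (mul_nonneg hu.1.le (by linarith [hu.2])) _)
    · filter_upwards [ae_restrict_mem measurableSet_Ioo] with u hu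
      have h3 := mul_le_mul_of_nonneg_left (rpow_weight_le hd hu ht) (hk.nonneg u)
      have h4 : gap Q a c u * ((√t)⁻¹ * g u) ≤ V * ((√t)⁻¹ * g u) :=
        mul_le_mul_of_nonneg_right (hk.le u) (mul_nonneg hst.le (hg0 u hu))
      simp only [hg] at h4 ⊢
      linarith
  rw [integral_nu, mul_assoc, mul_assoc]
  refine mul_le_mul_of_nonneg_left (h2.trans ?_) har.le
  have h3 := mul_le_mul_of_nonneg_left h1 (show 0 ≤ 2 * t by positivity)
  have h4 : 0 ≤ V * G * (t * (1 - a ^ 2 / c ^ 2)) := by positivity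
  have h5 : 0 ≤ V * 4 * (√t)⁻¹ := by positivity
  linarith

/-- The normalized kernels at the bandwidths `a` and `h ∈ [a, c]` differ by at most a multiple of
`gap`, from the dilation, plus a constant, from the normalization. -/
lemma abs_nker_sub_le (hL : KernelAssumptions d L) (hd : 1 ≤ d) (hQ : Monotone Q) (hQ0 : ∀ s, 0 ≤ Q s)
    (hQV : ∀ s, Q s ≤ V) (hvar : ∀ s t, s ≤ t → |ext0 L t - ext0 L s| ≤ Q t - Q s) {B : ℝ} (hk : IsKer (ext0 L) B)
    (ha : 0 < a) {h r : ℝ} (hah : a ≤ h) (hhc : h ≤ c) (hra : (mass d L a)⁻¹ ≤ r) (hrh : (mass d L h)⁻¹ ≤ r) (u : ℝ) :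
    |nker d L h u - nker d L a u| ≤ r * gap Q a c u + r ^ 2 * B * ∫ w, gap Q a c w ∂(nu d) := by
  have hh : 0 < h := ha.trans_le hah
  have hg := gap_isKer hQ hQ0 hQV ha (hah.trans hhc)
  have ma := hL.mass_pos hd ha
  have mh := hL.mass_pos hd hh
  have hr : 0 ≤ r := (inv_pos.mpr ma).le.trans hra
  have ka : IsKer (dil L a) B := KernelAssumptions.dil_isKer hk a
  have kh : IsKer (dil L h) B := KernelAssumptions.dil_isKer hk h
  have hm : |mass d L h - mass d L a| ≤ ∫ w, gap Q a c w ∂(nu d) := by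
    rw [mass, mass, ← integral_sub (kh.integrable hd) (ka.integrable hd)]
    exact abs_integral_le_integral_abs.trans (integral_mono_of_nonneg (ae_of_all _ fun _ => abs_nonneg _)
      (hg.integrable hd) (ae_of_all _ fun w => abs_dil_sub_le hQ hvar ha hah hhc w))
  have e : nker d L h u - nker d L a u = (mass d L h)⁻¹ * (dil L h u - dil L a u) +
      (mass d L h)⁻¹ * (mass d L a)⁻¹ * (dil L a u) * (mass d L a - mass d L h) := by
    rw [nker, nker]; field_simp; ring
  rw [e]
  refine (abs_add_le _ _).trans (add_le_add ?_ ?_)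
  · rw [abs_mul, abs_of_pos (inv_pos.mpr mh)]
    exact mul_le_mul hrh (abs_dil_sub_le hQ hvar ha hah hhc u) (abs_nonneg _) hr
  · rw [abs_mul, abs_mul, abs_mul, abs_of_pos (inv_pos.mpr mh), abs_of_pos (inv_pos.mpr ma), abs_sub_comm, pow_two]
    exact mul_le_mul (mul_le_mul (mul_le_mul hrh hra (inv_pos.mpr ma).le hr) (ka.abs_le u) (abs_nonneg _)
      (mul_nonneg hr hr)) hm (abs_nonneg _) (mul_nonneg (mul_nonneg hr hr) hk.bound_nonneg)

lemma abs_zonalOp_sub_le (hd : 1 ≤ d) {k k' E : ℝ → ℝ} {B B' B'' : ℝ} (hk : IsKer k B) (hk' : IsKer k' B')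
    (hE : IsKer E B'') (hkE : ∀ u, |k' u - k u| ≤ E u) {g : Sph d → ℝ} (hg : IsBM g) {C : ℝ} (hC : ∀ x, |g x| ≤ C)
    (x : Sph d) : |zonalOp k' g x - zonalOp k g x| ≤ (∫ u, E u ∂(nu d)) * C := by
  have hC0 : 0 ≤ C := (abs_nonneg _).trans (hC x)
  rw [zonalOp, zonalOp, ← integral_sub (hk'.integrable_zonal_mul x hg) (hk.integrable_zonal_mul x hg),
    ← integral_zonal hd x hE.meas, ← integral_mul_const]
  refine abs_integral_le_integral_abs.trans (integral_mono_of_nonneg (ae_of_all _ fun y => abs_nonneg _)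
    (hE.integrable_zonal_mul x (IsBM.const C)) (ae_of_all _ fun y => ?_))
  simp only
  rw [← sub_mul, abs_mul]
  exact mul_le_mul (hkE _) (hC y) (abs_nonneg _) (hE.nonneg _)

/-- The criterion and its common part vary little on a short interval of bandwidths: the variation
of the criterion is controlled by a `U`-statistic. The number `r` bounds the normalizing
constants. -/
lemma exists_abs_CV_sub_le (hX : IsBM f) (hL : KernelAssumptions d L) (hd : 1 ≤ d) (hQ : Monotone Q)
    (hQ0 : ∀ s, 0 ≤ Q s) (hQV : ∀ s, Q s ≤ V) (hvar : ∀ s t, s ≤ t → |ext0 L t - ext0 L s| ≤ Q t - Q s) :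
    ∃ C, 0 ≤ C ∧ ∀ a c h r : ℝ, 0 < a → a ≤ h → h ≤ c → 1 ≤ r → (mass d L a)⁻¹ ≤ r → (mass d L h)⁻¹ ≤ r →
      ∀ (n : ℕ), 2 ≤ n → ∀ x : ℕ → Sph d,
      |CV L n x h - CV L n x a| ≤ C * r ^ 3 * (∫ u, gap Q a c u ∂(nu d)) +
        2 * r * ((n.choose 2 : ℝ)⁻¹ * ∑ j ∈ Finset.range n, ∑ i ∈ Finset.range j,
          gap Q a c (1 - ⟪(x i : EuclideanSpace ℝ (Fin (d + 1))), x j⟫_ℝ)) ∧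
      |crit L f n h - crit L f n a| ≤ C * r ^ 3 * ∫ u, gap Q a c u ∂(nu d) := by
  obtain ⟨B, hB, hk⟩ := hL.exists_isKer
  obtain ⟨Cf, hCf0, hCf⟩ := hX.bdd
  have := isFiniteMeasure_nu hd
  set W := (nu d).real univ with hW
  set S := (surf d).real univ with hS
  have hW0 : 0 ≤ W := measureReal_nonneg
  have hS0 : 0 ≤ S := measureReal_nonneg
  set C := (4 * B + 4 * S * Cf ^ 2) * (1 + B * W) + 2 * B with hC
  refine ⟨C, by positivity, fun a c h r ha hah hhc hr hra hrh n hn x => ?_⟩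
  have hr0 : 0 < r := by linarith
  have hh : 0 < h := ha.trans_le hah
  have hg := gap_isKer hQ hQ0 hQV ha (hah.trans hhc)
  set δ := ∫ u, gap Q a c u ∂(nu d) with hδ
  have hδ0 : 0 ≤ δ := hg.integral_nonneg
  set E : ℝ → ℝ := fun u => r * gap Q a c u + r ^ 2 * B * δ with hE_def
  have hE : IsKer E (r * V + r ^ 2 * B * δ) :=
    ⟨(hg.meas.const_mul r).add_const _, fun u => add_nonneg (mul_nonneg hr0.le (hg.nonneg u)) (by positivity),
      fun u => add_le_add (mul_le_mul_of_nonneg_left (hg.le u) hr0.le) le_rfl⟩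
  have hnE : ∀ u, |nker d L h u - nker d L a u| ≤ E u :=
    abs_nker_sub_le hL hd hQ hQ0 hQV hvar hk ha hah hhc hra hrh
  have kh := hL.nker_isKer hd hk hh
  have ka := hL.nker_isKer hd hk ha
  set e := ∫ u, E u ∂(nu d) with he
  have he1 : e ≤ (1 + B * W) * (r ^ 2 * δ) := by
    have : e = r * δ + r ^ 2 * B * δ * W := by
      rw [he, hE_def, integral_add ((hg.integrable hd).const_mul r) (integrable_const _), integral_const_mul,
        integral_const, smul_eq_mul]
      ring
    rw [this]
    have h1 : r * δ ≤ r ^ 2 * δ := mul_le_mul_of_nonneg_right (le_self_pow₀ hr two_ne_zero) hδ0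
    linarith
  have he0 : 0 ≤ e := hE.integral_nonneg
  -- the convolution squares of the kernels
  have hrB : ∀ {m : ℝ}, (mass d L m)⁻¹ ≤ r → (mass d L m)⁻¹ * B ≤ r * B := fun hm =>
    mul_le_mul_of_nonneg_right hm hB.le
  have hT : ∀ y z : Sph d, |kerTilde L h y z - kerTilde L a y z| ≤ 2 * (r * B) * e := by
    intro y z
    have bH : ∀ {m : ℝ} (hm : 0 < m), IsBM (fun w => kerH L m z w) := fun {m} hm =>
      ⟨measurable_comp₂ (F := kerH L m) (measurable_kerH hL hd hm) measurable_const measurable_id,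
        (mass d L m)⁻¹ * B, (hL.nker_isKer hd hk hm).bound_nonneg, fun w => by
        rw [abs_of_nonneg (kerH_nonneg hL hd hm z w)]; exact kerH_le hL hd hk hm z w⟩
    have eT : ∀ m : ℝ, kerTilde L m y z = zonalOp (nker d L m) (fun w => kerH L m z w) y := fun m => by
      rw [kerTilde_eq hL hd]; simp only [kerH_eq hL hd]
    have s1 : |zonalOp (nker d L h) (fun w => kerH L h z w) y - zonalOp (nker d L a) (fun w => kerH L h z w) y| ≤
        e * (r * B) :=
      abs_zonalOp_sub_le hd ka kh hE hnE (bH hh) (fun w => by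
        rw [abs_of_nonneg (kerH_nonneg hL hd hh z w)]; exact (kerH_le hL hd hk hh z w).trans (hrB hrh)) y
    have s2 : |zonalOp (nker d L a) (fun w => kerH L h z w) y - zonalOp (nker d L a) (fun w => kerH L a z w) y| ≤
        e * (r * B) := by
      rw [← zonalOp_sub ka (bH hh) (bH ha)]
      rw [zonalOp]
      refine abs_integral_le_integral_abs.trans ?_
      rw [he, ← integral_zonal hd z hE.meas, ← integral_mul_const]
      refine integral_mono_of_nonneg (ae_of_all _ fun w => abs_nonneg _)
        (hE.integrable_zonal_mul z (IsBM.const (r * B))) (ae_of_all _ fun w => ?_)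
      simp only
      rw [abs_mul, mul_comm, kerH_eq hL hd, kerH_eq hL hd]
      exact mul_le_mul (hnE _) ((ka.abs_le _).trans (hrB hra)) (abs_nonneg _) (hE.nonneg _)
    rw [eT, eT]
    have := abs_sub_le (zonalOp (nker d L h) (fun w => kerH L h z w) y)
      (zonalOp (nker d L a) (fun w => kerH L h z w) y) (zonalOp (nker d L a) (fun w => kerH L a z w) y)
    linarith
  have hK : ∀ y z : Sph d, |kerK L h y z - kerK L a y z| ≤
      2 * (r * B) * e + 2 * r ^ 2 * B * δ + 2 * r * gap Q a c (1 - ⟪(y : EuclideanSpace ℝ (Fin (d + 1))), z⟫_ℝ) := by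
    intro y z
    have h1 := hT y z
    have h2 := hnE (1 - ⟪(y : EuclideanSpace ℝ (Fin (d + 1))), z⟫_ℝ)
    rw [← kerH_eq hL hd, ← kerH_eq hL hd] at h2
    have e1 : kerK L h y z - kerK L a y z = (kerTilde L h y z - kerTilde L a y z) -
        2 * (kerH L h y z - kerH L a y z) := by rw [kerK, kerK]; ring
    rw [e1]
    refine (abs_sub _ _).trans ?_
    rw [abs_mul, abs_two]
    simp only [hE_def] at h2
    linarith
  have hvar_term : |(h ^ d)⁻¹ * vH d L h - (a ^ d)⁻¹ * vH d L a| ≤ 2 * (r * B) * e := by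
    rw [← kerTilde_self hL hd hh (x 0), ← kerTilde_self hL hd ha (x 0)]
    exact hT _ _
  have hn1 : (n:ℝ)⁻¹ ≤ 1 := inv_le_one_of_one_le₀ (by exact_mod_cast (by omega : 1 ≤ n))
  have hn0 : (0:ℝ) ≤ (n:ℝ)⁻¹ := by positivity
  have hdiag : |(n:ℝ)⁻¹ * ((h ^ d)⁻¹ * vH d L h) - (n:ℝ)⁻¹ * ((a ^ d)⁻¹ * vH d L a)| ≤ 2 * (r * B) * e := by
    rw [← mul_sub, abs_mul, abs_of_nonneg hn0]
    refine (mul_le_mul hn1 hvar_term (abs_nonneg _) zero_le_one).trans_eq (one_mul _)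
  have hre : r * e ≤ (1 + B * W) * (r ^ 3 * δ) := by
    have := mul_le_mul_of_nonneg_left he1 hr0.le
    linarith
  have hr3 : r ^ 2 * δ ≤ r ^ 3 * δ := mul_le_mul_of_nonneg_right (pow_le_pow_right₀ hr (by norm_num)) hδ0
  have h3δ : 0 ≤ r ^ 3 * δ := by positivity
  constructor
  · have hch : 0 < (n.choose 2 : ℝ) := by exact_mod_cast Nat.choose_pos hn
    set G := ∑ j ∈ Finset.range n, ∑ i ∈ Finset.range j,
          gap Q a c (1 - ⟪(x i : EuclideanSpace ℝ (Fin (d + 1))), x j⟫_ℝ) with hG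
    have hsum : |∑ j ∈ Finset.range n, ∑ i ∈ Finset.range j, kerK L h (x i) (x j) -
        ∑ j ∈ Finset.range n, ∑ i ∈ Finset.range j, kerK L a (x i) (x j)| ≤
        (n.choose 2 : ℝ) * (2 * (r * B) * e + 2 * r ^ 2 * B * δ) + 2 * r * G := by
      rw [← sum_pairs_const, hG, Finset.mul_sum, ← Finset.sum_add_distrib, ← Finset.sum_sub_distrib]
      refine (Finset.abs_sum_le_sum_abs _ _).trans (Finset.sum_le_sum fun j _ => ?_)
      rw [Finset.mul_sum, ← Finset.sum_add_distrib, ← Finset.sum_sub_distrib]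
      exact (Finset.abs_sum_le_sum_abs _ _).trans (Finset.sum_le_sum fun i _ => hK _ _)
    have e1 : CV L n x h - CV L n x a =
        ((n:ℝ)⁻¹ * ((h ^ d)⁻¹ * vH d L h) - (n:ℝ)⁻¹ * ((a ^ d)⁻¹ * vH d L a)) + (n.choose 2 : ℝ)⁻¹ *
        (∑ j ∈ Finset.range n, ∑ i ∈ Finset.range j, kerK L h (x i) (x j) -
        ∑ j ∈ Finset.range n, ∑ i ∈ Finset.range j, kerK L a (x i) (x j)) := by
      rw [CV, CV]; ring
    rw [e1]
    refine (abs_add_le _ _).trans ?_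
    rw [abs_mul, abs_of_pos (inv_pos.mpr hch)]
    have h1 := mul_le_mul_of_nonneg_left hsum (inv_pos.mpr hch).le
    rw [mul_add, ← mul_assoc, inv_mul_cancel₀ hch.ne', one_mul] at h1
    have h2 := mul_le_mul_of_nonneg_left hre (show 0 ≤ 4 * B by positivity)
    have h3 := mul_le_mul_of_nonneg_left hr3 (show 0 ≤ 2 * B by positivity)
    have h4 : 0 ≤ 4 * S * Cf ^ 2 * (1 + B * W) * (r ^ 3 * δ) := by positivity
    rw [hC]
    linarith
  · have hb : ∀ {m : ℝ}, 0 < m → ∀ y, |bias L f m y| ≤ 2 * Cf := by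
      intro m hm y
      have h1 := abs_zonalOp_le hd (hL.nker_isKer hd hk hm) hCf y
      rw [hL.integral_nker hd hm, one_mul] at h1
      rw [bias]
      exact (abs_sub _ _).trans (by linarith [hCf y])
    have hisb : |isb L f h - isb L f a| ≤ e * Cf * (4 * Cf) * S := by
      have bh := hX.bias hL hd hh
      have ba := hX.bias hL hd ha
      rw [isb, isb, ← integral_sub bh.sq.integrable ba.sq.integrable]
      refine norm_integral_le_of_norm_le_const (μ := surf d) (f := fun y => bias L f h y ^ 2 - bias L f a y ^ 2)
        (ae_of_all _ fun y => ?_)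
      have e1 : bias L f h y ^ 2 - bias L f a y ^ 2 =
          (zonalOp (nker d L h) f y - zonalOp (nker d L a) f y) * (bias L f h y + bias L f a y) := by
        have : zonalOp (nker d L h) f y - zonalOp (nker d L a) f y = bias L f h y - bias L f a y := by
          rw [bias, bias]; ring
        rw [this]; ring
      rw [e1, norm_mul]
      refine mul_le_mul (abs_zonalOp_sub_le hd ka kh hE hnE hX hCf y) ?_ (norm_nonneg _) (by positivity)
      exact (abs_add_le _ _).trans (by linarith [hb hh y, hb ha y])
    have e1 : crit L f n h - crit L f n a =
        ((n:ℝ)⁻¹ * ((h ^ d)⁻¹ * vH d L h) - (n:ℝ)⁻¹ * ((a ^ d)⁻¹ * vH d L a)) + (isb L f h - isb L f a) := by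
      rw [crit, crit]; ring
    rw [e1]
    refine (abs_add_le _ _).trans ?_
    have h2 := mul_le_mul_of_nonneg_left hre (show 0 ≤ 2 * B by positivity)
    have her : e ≤ r * e := le_mul_of_one_le_left he0 hr
    have h3 := mul_le_mul_of_nonneg_left (her.trans hre) (show 0 ≤ 4 * S * Cf ^ 2 by positivity)
    have h4 : 0 ≤ 2 * B * (r ^ 3 * δ) := by positivity
    have h5 : 0 ≤ 2 * B * (1 + B * W) * (r ^ 3 * δ) := by positivity
    rw [hC]
    linarith

end

/-! ### Uniform closeness of the criterion to its common part -/

section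

variable {d : ℕ} {L : ℝ → ℝ} {f : Sph d → ℝ} {Ω : Type*} [MeasurableSpace Ω] {P : Measure Ω}
  {X : ℕ → Ω → Sph d}

/-- Deviation of a zonal `U`-statistic with a kernel of small integral. -/
lemma IsSample.zonal_ustat_deviation [IsProbabilityMeasure P] (hX : IsSample P X f) (hd : 1 ≤ d) {k : ℝ → ℝ} {V Cf : ℝ}
    (hk : IsKer k V) (hCf : ∀ x, |f x| ≤ Cf) {ρ : ℝ} (hρ : 0 < ρ) {n : ℕ} (hn : 2 ≤ n)
    (h1 : n * ∫ u, k u ∂(nu d) ≤ 1) (h2 : 6 * Cf * (n * ∫ u, k u ∂(nu d)) ≤ ρ) (q : ℕ) :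
    P.real {ω | ρ * (n:ℝ)⁻¹ ≤ (n.choose 2 : ℝ)⁻¹ * ∑ j ∈ Finset.range n, ∑ i ∈ Finset.range j,
        k (1 - ⟪(X i ω : EuclideanSpace ℝ (Fin (d + 1))), X j ω⟫_ℝ)} ≤
      ustatConst q * (1024 * (V ^ 2 + V * Cf + 1) / ρ ^ 2 * (n:ℝ)⁻¹) ^ (q + 1) := by
  have := hX.isProbabilityMeasure
  set K : Sph d → Sph d → ℝ := fun x y => k (1 - ⟪(x : EuclideanSpace ℝ (Fin (d + 1))), y⟫_ℝ) with hK
  set δ := ∫ u, k u ∂(nu d) with hδ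
  have hδ0 : 0 ≤ δ := hk.integral_nonneg
  obtain ⟨ω₀⟩ : Nonempty Ω := nonempty_of_isProbabilityMeasure P
  have hCf0 : 0 ≤ Cf := (abs_nonneg _).trans (hCf (X 0 ω₀))
  have hV := hk.bound_nonneg
  have hn2 : (2:ℝ) ≤ n := by exact_mod_cast hn
  have hn0 : (0:ℝ) < n := by linarith
  have hKi : ∀ x, Integrable (K x) (surf d) := fun x =>
    Integrable.of_bound (hk.meas.comp (measurable_zonal x)).aestronglyMeasurable V (ae_of_all _ fun y => hk.abs_le _)
  have hKδ : ∀ x, ∫ y, K x y ∂(surf d) = δ := fun x => integral_zonal hd x hk.meas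
  have hp : ∀ x, proj (obsLaw f) K x ≤ Cf * δ := fun x => by
    have := integral_obsLaw_le hX.density hX.bm hCf (g := K x) (fun y => hk.nonneg _) (hKi x)
    rwa [hKδ] at this
  have hp0 : ∀ x, 0 ≤ proj (obsLaw f) K x := fun x => integral_nonneg fun y => hk.nonneg _
  have hpa : ∀ x, |proj (obsLaw f) K x| ≤ Cf * δ := fun x => by rw [abs_of_nonneg (hp0 x)]; exact hp x
  set θ := ∫ z, proj (obsLaw f) K z ∂(obsLaw f) with hθ
  have hθ0 : 0 ≤ θ := integral_nonneg hp0
  have hθ1 : θ ≤ Cf * δ := (le_abs_self _).trans (abs_integral_le_of_abs_le hpa)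
  have hσ : ∀ x, ∫ y, K x y ^ 2 ∂(obsLaw f) ≤ V * (Cf * δ) := by
    intro x
    have i2 : Integrable (fun y => K x y ^ 2) (surf d) :=
      Integrable.of_bound ((hk.meas.comp (measurable_zonal x)).pow_const 2).aestronglyMeasurable (V ^ 2)
        (ae_of_all _ fun y => by rw [norm_pow]; exact pow_le_pow_left₀ (norm_nonneg _) (hk.abs_le _) 2)
    refine (integral_obsLaw_le hX.density hX.bm hCf (fun y => sq_nonneg (K x y)) i2).trans ?_
    have : ∫ y, K x y ^ 2 ∂(surf d) ≤ V * δ := by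
      rw [← hKδ x, ← integral_const_mul]
      refine integral_mono i2 ((hKi x).const_mul V) fun y => ?_
      simp only
      rw [pow_two]
      exact mul_le_mul_of_nonneg_right (hk.le _) (hk.nonneg _)
    linarith [mul_le_mul_of_nonneg_left this hCf0]
  have hD : 0 < V ^ 2 + V * Cf + 1 := by positivity
  have hdev := hX.isIID.degen_deviation (K := K) (measurable_kernel hk.meas)
    (fun x y => by simp only [hK]; rw [real_inner_comm]) (fun x y => hk.abs_le _) hσ (by omega : 1 ≤ n) hD
    (by linarith [mul_nonneg hV hCf0])
    (by
      have := mul_le_mul_of_nonneg_left h1 (mul_nonneg hV hCf0)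
      linarith [sq_nonneg V]) (s := ρ * n / 8) (by positivity) q
  refine le_trans (measureReal_mono fun ω hω => ?_) (hdev.trans_eq ?_)
  · rw [mem_ofPred_eq] at hω ⊢
    have e := sum_pairs_eq (obsLaw f) K (fun i => X i ω) hn
    simp only [← hθ] at e
    set S := ∑ j ∈ Finset.range n, ∑ i ∈ Finset.range j, degen (obsLaw f) K (X i ω) (X j ω) with hS
    have hω' : ρ * (n:ℝ)⁻¹ ≤ (n.choose 2 : ℝ)⁻¹ * S + 2 * (n:ℝ)⁻¹ *
        (∑ i ∈ Finset.range n, (proj (obsLaw f) K (X i ω) - θ)) + θ := e ▸ hω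
    have hs : ∑ i ∈ Finset.range n, (proj (obsLaw f) K (X i ω) - θ) ≤ n * (Cf * δ) := by
      refine (Finset.sum_le_sum (g := fun _ => Cf * δ) fun i _ => by linarith [hp (X i ω)]).trans_eq ?_
      simp
    have hs' : 2 * (n:ℝ)⁻¹ * (∑ i ∈ Finset.range n, (proj (obsLaw f) K (X i ω) - θ)) ≤ 2 * (Cf * δ) := by
      have := mul_le_mul_of_nonneg_left hs (show 0 ≤ 2 * (n:ℝ)⁻¹ by positivity)
      refine this.trans_eq ?_
      field_simp
    have h2' : 3 * (Cf * δ) ≤ ρ * (n:ℝ)⁻¹ / 2 := by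
      have := mul_le_mul_of_nonneg_right h2 (inv_pos.mpr hn0).le
      have e2 : 6 * Cf * (n * δ) * (n:ℝ)⁻¹ = 6 * (Cf * δ) := by field_simp
      rw [e2] at this
      linarith
    have h3 : ρ * (n:ℝ)⁻¹ / 2 ≤ (n.choose 2 : ℝ)⁻¹ * S := by linarith
    have hch : (n.choose 2 : ℝ) = n * (n - 1) / 2 := Nat.cast_choose_two ℝ n
    have hch0 : 0 < (n.choose 2 : ℝ) := by exact_mod_cast Nat.choose_pos hn
    rw [le_inv_mul_iff₀ hch0] at h3
    refine le_trans ?_ (h3.trans (le_abs_self S))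
    have h4 : (n:ℝ) ^ 2 / 4 ≤ n.choose 2 := by rw [hch]; nlinarith
    refine le_trans (le_of_eq ?_) (mul_le_mul_of_nonneg_right h4 (by positivity))
    field_simp
    norm_num
  · congr 2
    field_simp
    norm_num

/-- The number of grid points times the bound for a single bad event. -/
lemma grid_mul_le {d m p n : ℕ} {η C₁ C₂ : ℝ} (hη0 : 0 < η) (hη1 : η ≤ 1) (hn : 1 ≤ n)
    (hnη : (n:ℝ) * η ^ (d + 4) = 1) (hC₁ : 0 ≤ C₁) (hC₂ : 0 ≤ C₂) (h1 : (d + 4) * m + 1 ≤ d * p) (h2 : m + 1 ≤ p) :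
    ((n ^ m + 1 : ℕ) : ℝ) * (C₁ * (η ^ d) ^ p + C₂ * (n:ℝ)⁻¹ ^ p) ≤ 2 * (C₁ * η + C₂ * (n:ℝ)⁻¹) := by
  have hn1 : (1:ℝ) ≤ n := by exact_mod_cast hn
  have hn0 : (0:ℝ) < n := by linarith
  have hN : ((n ^ m + 1 : ℕ) : ℝ) ≤ 2 * (n:ℝ) ^ m := by
    have : 1 ≤ (n:ℝ) ^ m := one_le_pow₀ hn1
    push_cast; linarith
  have e1 : (η ^ d) ^ p ≤ η ^ ((d + 4) * m + 1) := by
    rw [← pow_mul]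
    exact pow_le_pow_of_le_one hη0.le hη1 h1
  have e2 : (n:ℝ)⁻¹ ^ p ≤ (n:ℝ)⁻¹ ^ (m + 1) := pow_le_pow_of_le_one (by positivity) (inv_le_one_of_one_le₀ hn1) h2
  have e3 : (n:ℝ) ^ m * η ^ ((d + 4) * m + 1) = η := by
    rw [pow_succ, pow_mul, ← mul_assoc, ← mul_pow, hnη, one_pow, one_mul]
  have e4 : (n:ℝ) ^ m * (n:ℝ)⁻¹ ^ (m + 1) = (n:ℝ)⁻¹ := by
    rw [pow_succ, ← mul_assoc, ← mul_pow, mul_inv_cancel₀ hn0.ne', one_pow, one_mul]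
  calc _ ≤ (2 * (n:ℝ) ^ m) * (C₁ * η ^ ((d + 4) * m + 1) + C₂ * (n:ℝ)⁻¹ ^ (m + 1)) :=
        mul_le_mul hN (add_le_add (mul_le_mul_of_nonneg_left e1 hC₁) (mul_le_mul_of_nonneg_left e2 hC₂))
          (by positivity) (by positivity)
    _ = 2 * (C₁ * ((n:ℝ) ^ m * η ^ ((d + 4) * m + 1)) + C₂ * ((n:ℝ) ^ m * (n:ℝ)⁻¹ ^ (m + 1))) := by ring
    _ = _ := by rw [e3, e4]

/-- Uniformly over the search interval, the criterion is close to its common part, in relative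
terms, with probability tending to one. A grid with polynomially many points suffices, because
the kernel has bounded variation and each bad event has a probability smaller than any power
of `n⁻¹`. -/
theorem IsSample.tendsto_cv_uniform [IsProbabilityMeasure P] (hX : IsSample P X f) (hf : IsC2 f)
    (hL : KernelAssumptions d L) (hd : 1 ≤ d) (hfu : ∃ x y, f x ≠ f y) {ε M : ℝ} (hε : 0 < ε) (hεM : ε < M)
    {γ : ℝ} (hγ : 0 < γ) (hγ1 : γ ≤ 1) :
    Tendsto (fun n : ℕ => P.real {ω | ∃ τ ∈ Icc ε M, γ * (rate d n ^ 4 + crit L f n (τ * rate d n)) ≤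
      |CV L n (fun i => X i ω) (τ * rate d n) - crit L f n (τ * rate d n) - cvShift f n (fun i => X i ω)|})
      atTop (𝓝 0) := by
  obtain ⟨Q, V, hQ, hQ0, hQV, hvar⟩ := hL.exists_variation
  obtain ⟨Cf, hCf0, hCf⟩ := hX.bm.bdd
  obtain ⟨C, hC, hpert⟩ := exists_abs_CV_sub_le hX.bm hL hd hQ hQ0 hQV hvar
  obtain ⟨J, hJ, hgap⟩ := exists_integral_gap_le hd hQ hQ0 hQV
  -- with `n ^ 15` grid points, the moment of order `2 (q + 1) = 160` suffices for the union bound, as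
  -- `15 (d + 4) + 1 ≤ 80 d` for `d ≥ 1`
  obtain ⟨q, hq⟩ : ∃ q : ℕ, q = 79 := ⟨79, rfl⟩
  obtain ⟨C₁, hdev⟩ := hX.cv_deviation hf hL hd hfu M hε (show 0 < γ / 4 by positivity) q
  have hlam := hL.lam_one_pos
  set C₅ := max 1 (2 / (lam d L * ε ^ d)) with hC₅
  have hC₅1 : 1 ≤ C₅ := le_max_left _ _
  have hC₅0 : 0 < C₅ := by linarith
  set Cδ := J * (2 * (M - ε) / ε + 1) with hCδ
  have hMε : 0 < M - ε := by linarith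
  have hCδ0 : 0 ≤ Cδ := by positivity
  set ρ := γ / (16 * C₅) with hρ
  have hρ0 : 0 < ρ := by positivity
  set C₆ := ustatConst q * (1024 * (V ^ 2 + V * Cf + 1) / ρ ^ 2) ^ (q + 1) with hC₆
  have hninv : Tendsto (fun n : ℕ => (n:ℝ)⁻¹) atTop (𝓝 0) := tendsto_natCast_atTop_atTop.inv_tendsto_atTop
  have hlim : Tendsto (fun n : ℕ => 2 * (|C₁| * rate d n + C₆ * (n:ℝ)⁻¹)) atTop (𝓝 0) := by
    have h1 : Tendsto (rate d) atTop (𝓝 0) := (tendsto_rate d).mono_right nhdsWithin_le_nhds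
    simpa using ((h1.const_mul |C₁|).add (hninv.const_mul C₆)).const_mul 2
  refine squeeze_zero' (Eventually.of_forall fun _ => measureReal_nonneg) ?_ hlim
  have hev : ∀ {c s : ℝ}, 0 < s → ∀ᶠ n : ℕ in atTop, c * (n:ℝ)⁻¹ < s := fun {c s} hs => by
    have := hninv.const_mul c
    rw [mul_zero] at this
    exact this.eventually (gt_mem_nhds hs)
  filter_upwards [hdev, eventually_forall_mul_rate (d := d) (M := M) (hL.eventually_mass_ge hd) hε,
    eventually_ge_atTop 2, eventually_rate_lt (d := d) one_pos,
    hev (c := C * C₅ ^ 3 * Cδ) (show 0 < γ / 8 by positivity), hev (c := Cδ) one_pos,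
    hev (c := 6 * Cf * Cδ) hρ0] with n hdev hmass hn hη1 hsm1 hsm2 hsm3
  set η := rate d n with hη
  have hη0 : 0 < η := rate_pos d (by omega)
  have hnη : η ^ (d + 4) = (n:ℝ)⁻¹ := rate_pow d n
  have hn2 : (2:ℝ) ≤ n := by exact_mod_cast hn
  have hn1 : (1:ℝ) ≤ n := by linarith
  have hn0 : (0:ℝ) < n := by linarith
  have hnη' : (n:ℝ) * η ^ (d + 4) = 1 := by rw [hnη, mul_inv_cancel₀ hn0.ne']
  have hηd : (η ^ d)⁻¹ = η ^ 4 * n := by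
    rw [inv_eq_iff_eq_inv, ← mul_inv_cancel_left₀ (show η ^ d ≠ 0 by positivity) (η ^ 4 * (n:ℝ))⁻¹]
    field_simp
    rw [← hnη']; ring
  -- the grid
  set N : ℕ := n ^ 15 with hN
  have hN0 : (0:ℝ) < N := by rw [hN]; positivity
  set w := (M - ε) / N with hw
  have hw0 : 0 < w := by positivity
  set T : ℕ → ℝ := fun k => ε + k * w with hT
  have hTε : ∀ k, ε ≤ T k := fun k => by
    have : 0 ≤ (k:ℝ) * w := by positivity
    simp only [hT]; linarith
  have hTM : ∀ k ∈ Finset.range (N + 1), T k ≤ M := fun k hk => by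
    have hkN : (k:ℝ) ≤ N := by exact_mod_cast Nat.lt_succ_iff.mp (Finset.mem_range.mp hk)
    have h1 := mul_le_mul_of_nonneg_right hkN hw0.le
    have h2 : (N:ℝ) * w = M - ε := by rw [hw]; field_simp
    simp only [hT]; linarith
  have hT1 : ∀ k, T (k + 1) = T k + w := fun k => by simp only [hT]; push_cast; ring
  set a : ℕ → ℝ := fun k => T k * η with ha
  have ha0 : ∀ k, 0 < a k := fun k => mul_pos (hε.trans_le (hTε k)) hη0
  have haa : ∀ k, a k ≤ a (k + 1) := fun k => by
    simp only [ha]; rw [hT1]; exact mul_le_mul_of_nonneg_right (by linarith) hη0.le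
  have hδ : ∀ k, ∫ u, gap Q (a k) (a (k + 1)) u ∂(nu d) ≤ Cδ * ((n:ℝ)⁻¹) ^ 5 := by
    intro k
    refine (hgap (a k) (a (k + 1)) ((n:ℝ) ^ 10) (ha0 k) (haa k) (by positivity)).trans ?_
    rw [hCδ, mul_assoc]
    refine mul_le_mul_of_nonneg_left ?_ hJ
    have e1 : √((n:ℝ) ^ 10) = (n:ℝ) ^ 5 := by
      rw [show (n:ℝ) ^ 10 = ((n:ℝ) ^ 5) ^ 2 by ring, Real.sqrt_sq (by positivity)]
    have hTk : 0 < T k := hε.trans_le (hTε k)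
    have hTk1 : ε ≤ T (k + 1) := hTε (k + 1)
    have e2 : 1 - a k ^ 2 / a (k + 1) ^ 2 ≤ 2 * w / ε := by
      have h0 : 0 < T (k + 1) := hε.trans_le hTk1
      have h1 : a k ^ 2 / a (k + 1) ^ 2 = (T k / T (k + 1)) ^ 2 := by
        simp only [ha]; rw [mul_pow, mul_pow, div_pow]; field_simp
      have h2 : T k / T (k + 1) = 1 - w / T (k + 1) := by rw [hT1] at h0 ⊢; field_simp; ring
      have h3 : w / T (k + 1) ≤ w / ε := div_le_div_of_nonneg_left hw0.le hε hTk1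
      rw [h1, h2, mul_div_assoc]
      nlinarith [sq_nonneg (w / T (k + 1))]
    have e3 : (n:ℝ) ^ 10 * (2 * w / ε) = 2 * (M - ε) / ε * ((n:ℝ)⁻¹) ^ 5 := by
      rw [hw, hN]; push_cast; field_simp
    rw [e1, ← inv_pow, add_mul, one_mul, ← e3]
    linarith [mul_le_mul_of_nonneg_left e2 (show 0 ≤ (n:ℝ) ^ 10 by positivity)]
  have hninv1 : (n:ℝ)⁻¹ ≤ 1 := inv_le_one_of_one_le₀ hn1
  have hninv0 : 0 < (n:ℝ)⁻¹ := inv_pos.mpr hn0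
  have hnδ : ∀ k, n * ∫ u, gap Q (a k) (a (k + 1)) u ∂(nu d) ≤ Cδ * (n:ℝ)⁻¹ := by
    intro k
    have h1 := mul_le_mul_of_nonneg_left (hδ k) hn0.le
    have h2 : (n:ℝ) * (Cδ * ((n:ℝ)⁻¹) ^ 5) = Cδ * (n:ℝ)⁻¹ ^ 4 := by field_simp
    rw [h2] at h1
    exact h1.trans (mul_le_mul_of_nonneg_left (pow_le_of_le_one hninv0.le hninv1 (by norm_num)) hCδ0)
  -- the bad events
  set A₁ : ℕ → Set Ω := fun k => {ω | γ / 4 * (η ^ 4 + crit L f n (a k)) ≤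
      |CV L n (fun i => X i ω) (a k) - crit L f n (a k) - cvShift f n (fun i => X i ω)|} with hA₁
  set A₂ : ℕ → Set Ω := fun k => {ω | ρ * (n:ℝ)⁻¹ ≤ (n.choose 2 : ℝ)⁻¹ * ∑ j ∈ Finset.range n,
      ∑ i ∈ Finset.range j, gap Q (a k) (a (k + 1))
        (1 - ⟪(X i ω : EuclideanSpace ℝ (Fin (d + 1))), X j ω⟫_ℝ)} with hA₂
  have hsub : {ω | ∃ τ ∈ Icc ε M, γ * (η ^ 4 + crit L f n (τ * η)) ≤
      |CV L n (fun i => X i ω) (τ * η) - crit L f n (τ * η) - cvShift f n (fun i => X i ω)|} ⊆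
      ⋃ k ∈ Finset.range (N + 1), (A₁ k ∪ A₂ k) := by
    rintro ω ⟨τ, hτ, hω⟩
    by_contra hcon
    simp only [mem_iUnion, mem_union, not_exists, not_or] at hcon
    set k := ⌊(τ - ε) / w⌋₊ with hk
    have hx0 : 0 ≤ (τ - ε) / w := div_nonneg (by linarith [hτ.1]) hw0.le
    have hk1 : (k:ℝ) ≤ (τ - ε) / w := Nat.floor_le hx0
    have hk2 : (τ - ε) / w < k + 1 := Nat.lt_floor_add_one _
    rw [le_div_iff₀ hw0] at hk1
    rw [div_lt_iff₀ hw0] at hk2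
    have hkN : k ∈ Finset.range (N + 1) := by
      rw [Finset.mem_range, Nat.lt_succ_iff]
      refine Nat.floor_le_of_le ?_
      rw [div_le_iff₀ hw0, hw, mul_div_cancel₀ _ hN0.ne']
      linarith [hτ.2]
    obtain ⟨g1, g2⟩ := hcon k hkN
    rw [hA₁, mem_ofPred_eq, not_le] at g1
    rw [hA₂, mem_ofPred_eq, not_le] at g2
    set h := τ * η with hh
    have hTτ : T k ≤ τ := by simp only [hT]; linarith
    have hτT : τ ≤ T (k + 1) := by rw [hT1]; simp only [hT]; linarith
    have hah : a k ≤ h := mul_le_mul_of_nonneg_right hTτ hη0.le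
    have hha : h ≤ a (k + 1) := mul_le_mul_of_nonneg_right hτT hη0.le
    have hh0 : 0 < h := (ha0 k).trans_le hah
    set r := C₅ * (η ^ d)⁻¹ with hr
    have hr' : r = C₅ * (η ^ 4 * n) := by rw [hr, hηd]
    have hr1 : 1 ≤ r := by
      have : 1 ≤ (η ^ d)⁻¹ := (one_le_inv₀ (by positivity)).mpr (pow_le_one₀ hη0.le hη1.le)
      exact one_le_mul_of_one_le_of_one_le hC₅1 this
    have hrm : ∀ s ∈ Icc ε M, (mass d L (s * η))⁻¹ ≤ r := by
      intro s hs
      have h1 : lam d L / 2 * (ε ^ d * η ^ d) ≤ mass d L (s * η) := by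
        refine le_trans ?_ (hmass s hs)
        rw [← mul_pow]
        exact mul_le_mul_of_nonneg_left (pow_le_pow_left₀ (by positivity)
          (mul_le_mul_of_nonneg_right hs.1 hη0.le) d) (by positivity)
      refine (inv_anti₀ (by positivity) h1).trans ?_
      have h2 : (lam d L / 2 * (ε ^ d * η ^ d))⁻¹ = 2 / (lam d L * ε ^ d) * (η ^ d)⁻¹ := by field_simp
      rw [h2, hr]
      exact mul_le_mul_of_nonneg_right (le_max_right _ _) (by positivity)
    obtain ⟨p1, p2⟩ := hpert (a k) (a (k + 1)) h r (ha0 k) hah hha hr1 (hrm _ ⟨hTε k, hTM k hkN⟩) (hrm _ hτ) n hn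
      (fun i => X i ω)
    have hη4 : η ^ 4 ≤ 1 := pow_le_one₀ hη0.le hη1.le
    have hrn : r ≤ C₅ * n := by
      rw [hr']
      exact mul_le_mul_of_nonneg_left (mul_le_of_le_one_left hn0.le hη4) hC₅0.le
    have hsmall : C * r ^ 3 * (∫ u, gap Q (a k) (a (k + 1)) u ∂(nu d)) ≤ γ / 8 * η ^ 4 := by
      have h1 : C * r ^ 3 ≤ C * (C₅ * n) ^ 3 :=
        mul_le_mul_of_nonneg_left (pow_le_pow_left₀ (by linarith) hrn 3) hC
      have h2 := mul_le_mul h1 (hδ k) (gap_isKer hQ hQ0 hQV (ha0 k) (haa k)).integral_nonneg (by positivity)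
      have h3 : C * (C₅ * n) ^ 3 * (Cδ * (n:ℝ)⁻¹ ^ 5) = C * C₅ ^ 3 * Cδ * (n:ℝ)⁻¹ * (n:ℝ)⁻¹ := by field_simp
      rw [h3] at h2
      refine h2.trans ?_
      have h4 : (n:ℝ)⁻¹ ≤ η ^ 4 := by
        rw [← hnη, pow_add]
        exact mul_le_of_le_one_left (by positivity) (pow_le_one₀ hη0.le hη1.le)
      exact mul_le_mul hsm1.le h4 hninv0.le (by positivity)
    have hU : 2 * r * ((n.choose 2 : ℝ)⁻¹ * ∑ j ∈ Finset.range n, ∑ i ∈ Finset.range j,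
        gap Q (a k) (a (k + 1)) (1 - ⟪(X i ω : EuclideanSpace ℝ (Fin (d + 1))), X j ω⟫_ℝ)) ≤ γ / 8 * η ^ 4 := by
      refine (mul_le_mul_of_nonneg_left g2.le (by linarith)).trans_eq ?_
      rw [hr', hρ]; field_simp; norm_num
    have hcrit0 : 0 ≤ crit L f n h := (isb_nonneg L f h).trans (isb_le_crit L f n hh0)
    have q1 : |CV L n (fun i => X i ω) h - CV L n (fun i => X i ω) (a k)| ≤ γ / 4 * η ^ 4 := by linarith
    have q2 : |crit L f n h - crit L f n (a k)| ≤ γ / 8 * η ^ 4 := p2.trans hsmall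
    have q3 := abs_le.mp q2
    have hη4' : 0 < η ^ 4 := by positivity
    have e : CV L n (fun i => X i ω) h - crit L f n h - cvShift f n (fun i => X i ω) =
        (CV L n (fun i => X i ω) h - CV L n (fun i => X i ω) (a k)) - (crit L f n h - crit L f n (a k)) +
        (CV L n (fun i => X i ω) (a k) - crit L f n (a k) - cvShift f n (fun i => X i ω)) := by ring
    rw [e] at hω
    have t1 := (abs_add_le ((CV L n (fun i => X i ω) h - CV L n (fun i => X i ω) (a k)) -
      (crit L f n h - crit L f n (a k)))
      (CV L n (fun i => X i ω) (a k) - crit L f n (a k) - cvShift f n (fun i => X i ω)))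
    have t2 := abs_sub (CV L n (fun i => X i ω) h - CV L n (fun i => X i ω) (a k)) (crit L f n h - crit L f n (a k))
    have t3 : γ / 4 * (η ^ 4 + crit L f n (a k)) ≤ γ / 4 * (η ^ 4 + crit L f n h + 1 * (1 / 8) * η ^ 4) := by
      refine mul_le_mul_of_nonneg_left ?_ (by positivity)
      have : γ / 8 * η ^ 4 ≤ 1 * (1 / 8) * η ^ 4 := mul_le_mul_of_nonneg_right (by linarith) hη4'.le
      linarith
    have t4 : 0 < γ * η ^ 4 := by positivity
    have t5 : 0 ≤ γ * crit L f n h := by positivity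
    linarith
  have hP₁ : ∀ k ∈ Finset.range (N + 1), P.real (A₁ k) ≤ |C₁| * (η ^ d) ^ (q + 1) := fun k hk =>
    (hdev (T k) ⟨hTε k, hTM k hk⟩).trans (mul_le_mul_of_nonneg_right (le_abs_self _) (by positivity))
  have hP₂ : ∀ k, P.real (A₂ k) ≤ C₆ * (n:ℝ)⁻¹ ^ (q + 1) := fun k => by
    refine (hX.zonal_ustat_deviation hd (gap_isKer hQ hQ0 hQV (ha0 k) (haa k)) hCf hρ0 hn ((hnδ k).trans hsm2.le)
      ?_ q).trans_eq ?_
    · have := mul_le_mul_of_nonneg_left (hnδ k) (show 0 ≤ 6 * Cf by positivity)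
      linarith
    · rw [hC₆, mul_pow, mul_assoc]
  have hC₆0 : 0 ≤ C₆ := by
    have := ustatConst_pos q
    have hV : 0 ≤ V := (hQ0 0).trans (hQV 0)
    positivity
  calc P.real _ ≤ P.real (⋃ k ∈ Finset.range (N + 1), (A₁ k ∪ A₂ k)) := measureReal_mono hsub (measure_ne_top _ _)
    _ ≤ ∑ k ∈ Finset.range (N + 1), P.real (A₁ k ∪ A₂ k) := measureReal_biUnion_finset_le _ _
    _ ≤ ∑ _k ∈ Finset.range (N + 1), (|C₁| * (η ^ d) ^ (q + 1) + C₆ * (n:ℝ)⁻¹ ^ (q + 1)) :=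
        Finset.sum_le_sum fun k hk => (measureReal_union_le _ _).trans (add_le_add (hP₁ k hk) (hP₂ k))
    _ = ((N + 1 : ℕ) : ℝ) * (|C₁| * (η ^ d) ^ (q + 1) + C₆ * (n:ℝ)⁻¹ ^ (q + 1)) := by
        rw [Finset.sum_const, Finset.card_range, nsmul_eq_mul]
    _ ≤ 2 * (|C₁| * η + C₆ * (n:ℝ)⁻¹) :=
        grid_mul_le hη0 hη1.le (by omega) hnη' (abs_nonneg _) hC₆0 (by rw [hq]; omega) (by rw [hq]; omega)

end

/-! ### Consistency of the cross-validation bandwidth -/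

section

variable {d : ℕ} {L : ℝ → ℝ} {f : Sph d → ℝ} {Ω : Type*} [MeasurableSpace Ω] {P : Measure Ω}
  {X : ℕ → Ω → Sph d}

/-- The cross-validation bandwidth is of the order of `c₀ n^{-1/(d+4)}`, in probability. -/
theorem IsSample.tendsto_CV_bandwidth [IsProbabilityMeasure P] (hX : IsSample P X f) (hf : IsC2 f)
    (hL : KernelAssumptions d L) (hd : 1 ≤ d) (hfu : ∃ x y, f x ≠ f y) {ε M : ℝ} (hε : 0 < ε) (hεM : ε < M)
    (hεc : ε ≤ c₀ L f) (hcM : c₀ L f ≤ M) {hCV : ℕ → Ω → ℝ}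
    (hmin : ∀ n, 2 ≤ n → ∀ᵐ ω ∂P, hCV n ω ∈ searchInterval d ε M n ∧
      IsMinOn (CV L n (fun i => X i ω)) (searchInterval d ε M n) (hCV n ω)) {κ : ℝ} (hκ : 0 < κ) :
    Tendsto (fun n => P.real {ω | κ ≤ |hCV n ω / rate d n - c₀ L f|}) atTop (𝓝 0) := by
  obtain ⟨ι, hι, hge⟩ := hf.eventually_crit_ge hL hd hfu hκ
  have hA : 0 < amise L f (c₀ L f) := hf.amise_pos hL hd hfu (hf.c₀_pos hL hd hfu)
  set A := amise L f (c₀ L f) with hA_def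
  -- with this `γ` the gap `ι` exceeds the error made at both bandwidths
  set γ := min 1 (ι / (2 * (2 * A + ι + 4))) with hγ_def
  have hγ : 0 < γ := lt_min one_pos (by positivity)
  have hγ1 : γ ≤ 1 := min_le_left _ _
  have hγι : γ * (2 * A + ι + 4) < ι := by
    have h1 : γ * (2 * A + ι + 4) ≤ ι / (2 * (2 * A + ι + 4)) * (2 * A + ι + 4) :=
      mul_le_mul_of_nonneg_right (min_le_right _ _) (by positivity)
    have h2 : ι / (2 * (2 * A + ι + 4)) * (2 * A + ι + 4) = ι / 2 := by field_simp
    linarith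
  have hle := hf.eventually_exists_crit_le hL hd hfu hε hεM hεc hcM hγ
  refine squeeze_zero' (Eventually.of_forall fun _ => measureReal_nonneg) ?_
    (hX.tendsto_cv_uniform hf hL hd hfu hε hεM hγ hγ1)
  filter_upwards [hge, hle, eventually_ge_atTop 2] with n hge ⟨τ, hτ, hle⟩ hn
  have hη0 : 0 < rate d n := rate_pos d (by omega)
  refine ENNReal.toReal_mono (measure_ne_top _ _) (measure_mono_ae ?_)
  filter_upwards [hmin n hn] with ω ⟨hmem, hm⟩ hω
  have hI : searchInterval d ε M n = Icc (ε * rate d n) (M * rate d n) := rfl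
  rw [hI] at hmem hm
  have hω' : κ ≤ |hCV n ω / rate d n - c₀ L f| := hω
  have hmem' : hCV n ω / rate d n ∈ Icc ε M :=
    ⟨(le_div_iff₀ hη0).mpr hmem.1, (div_le_iff₀ hη0).mpr hmem.2⟩
  have hτη : τ * rate d n ∈ Icc (ε * rate d n) (M * rate d n) :=
    ⟨mul_le_mul_of_nonneg_right hτ.1 hη0.le, mul_le_mul_of_nonneg_right hτ.2 hη0.le⟩
  have hcv : CV L n (fun i => X i ω) (hCV n ω) ≤ CV L n (fun i => X i ω) (τ * rate d n) := hm hτη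
  by_contra hcon
  have hcon' : ∀ t ∈ Icc ε M, |CV L n (fun i => X i ω) (t * rate d n) - crit L f n (t * rate d n) -
      cvShift f n (fun i => X i ω)| < γ * (rate d n ^ 4 + crit L f n (t * rate d n)) := fun t ht => by
    by_contra h
    exact hcon ⟨t, ht, not_lt.mp h⟩
  have g1 := (abs_lt.mp (hcon' _ hmem')).1
  have g2 := (abs_lt.mp (hcon' τ hτ)).2
  rw [div_mul_cancel₀ _ hη0.ne'] at g1
  have g3 := hge (hCV n ω) ((mul_pos hε hη0).trans_le hmem.1) hω'
  have hη4 : 0 < rate d n ^ 4 := by positivity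
  set E := rate d n ^ 4
  have g4 : (1 - γ) * ((A + ι) * E) ≤ (1 - γ) * crit L f n (hCV n ω) :=
    mul_le_mul_of_nonneg_left g3 (by linarith)
  have g5 : (1 + γ) * crit L f n (τ * rate d n) ≤ (1 + γ) * ((A + γ) * E) :=
    mul_le_mul_of_nonneg_left hle (by linarith)
  have g6 : (1 - γ) * ((A + ι) * E) < (1 + γ) * ((A + γ) * E) + 2 * γ * E := by linarith
  have g7 : ((1 - γ) * (A + ι) - (1 + γ) * (A + γ) - 2 * γ) * E < 0 := by linarith
  have g8 : 0 < (1 - γ) * (A + ι) - (1 + γ) * (A + γ) - 2 * γ := by nlinarith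
  exact absurd g7 (not_lt.mpr (mul_pos g8 hη4).le)

end

end SphereKDE

end

theorem theorem2 (d : ℕ) (hd : 1 ≤ d)
    -- the density: its radial extension is C², and it is not the uniform density
    (f : SphereKDE.Sph d → ℝ) (hf : SphereKDE.IsDensity f)
    (hfC : ContDiffOn ℝ 2 (SphereKDE.radialExt f) {0}ᶜ)
    (hfu : ∃ x y, f x ≠ f y)
    -- the kernel
    (L : ℝ → ℝ) (hL : SphereKDE.KernelAssumptions d L)
    -- the iid sample
    {Ω : Type*} [MeasurableSpace Ω] (P : Measure Ω) [IsProbabilityMeasure P]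
    (X : ℕ → Ω → SphereKDE.Sph d) (hXm : ∀ i, Measurable (X i)) (hXi : iIndepFun X P)
    (hXf : ∀ i, P.map (X i) =
      (SphereKDE.surf d).withDensity (fun x => ENNReal.ofReal (f x)))
    -- the constants of the search interval
    (ε M : ℝ) (hε : 0 < ε) (hεM : ε < M)
    (hεc : ε ≤ SphereKDE.c₀ L f) (hcM : SphereKDE.c₀ L f ≤ M)
    -- the MISE-optimal bandwidth
    (hMISE : ℕ → ℝ)
    (hMISE_min : ∀ᶠ n in atTop, 0 < hMISE n ∧
      IsMinOn (SphereKDE.MISE P X L f n) (Ioi 0) (hMISE n))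
    -- the cross-validation bandwidth
    (hCV : ℕ → Ω → ℝ)
    (hCV_min : ∀ n, 2 ≤ n → ∀ᵐ ω ∂P,
      hCV n ω ∈ SphereKDE.searchInterval d ε M n ∧
      IsMinOn (SphereKDE.CV L n (fun i => X i ω)) (SphereKDE.searchInterval d ε M n)
        (hCV n ω)) :
    TendstoInMeasure P (fun n ω => hCV n ω / hMISE n) atTop (fun _ => 1) := by
  have hC2 : SphereKDE.IsC2 f := hfC
  have hX : SphereKDE.IsSample P X f := ⟨hXm, hXi, hXf, hf, hC2.isBM⟩
  have hc : 0 < SphereKDE.c₀ L f := hC2.c₀_pos hL hd hfu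
  have hM := hX.tendsto_MISE_bandwidth hC2 hL hd hfu hMISE_min
  rw [tendstoInMeasure_iff_norm]
  intro s hs
  set κ := min (SphereKDE.c₀ L f / 2) (s * SphereKDE.c₀ L f / 4) with hκ
  have hκ0 : 0 < κ := lt_min (by positivity) (by positivity)
  have hP := hX.tendsto_CV_bandwidth hC2 hL hd hfu hε hεM hεc hcM hCV_min hκ0
  have hP' : Tendsto (fun n => P {ω | κ ≤ |hCV n ω / SphereKDE.rate d n - SphereKDE.c₀ L f|}) atTop (𝓝 0) := by
    rw [← ENNReal.tendsto_toReal_iff (fun _ => measure_ne_top _ _) ENNReal.zero_ne_top]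
    exact hP
  refine tendsto_of_tendsto_of_tendsto_of_le_of_le' tendsto_const_nhds hP'
    (Eventually.of_forall fun _ => zero_le) ?_
  filter_upwards [hM.eventually (Metric.ball_mem_nhds _ hκ0), eventually_ge_atTop 1] with n hn hn1
  refine measure_mono fun ω hω => ?_
  rw [mem_ofPred_eq] at hω ⊢
  by_contra hcon
  rw [not_le] at hcon
  have hη := SphereKDE.rate_pos d hn1
  replace hn : |hMISE n / SphereKDE.rate d n - SphereKDE.c₀ L f| < κ := hn
  have k1 : κ ≤ SphereKDE.c₀ L f / 2 := min_le_left _ _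
  have k2 : κ ≤ s * SphereKDE.c₀ L f / 4 := min_le_right _ _
  set t := hMISE n / SphereKDE.rate d n with ht
  set u := hCV n ω / SphereKDE.rate d n with hu
  have ht0 : SphereKDE.c₀ L f / 2 < t := by linarith [(abs_lt.mp hn).1]
  have ht1 : 0 < t := by linarith
  have e : hCV n ω / hMISE n - 1 = (u - t) / t := by
    have hM0 : hMISE n ≠ 0 := by
      intro h0
      rw [ht, h0, zero_div] at ht1
      exact lt_irrefl _ ht1
    rw [hu, ht]
    field_simp
  rw [e, Real.norm_eq_abs, abs_div, abs_of_pos ht1, le_div_iff₀ ht1] at hω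
  have h1 : |u - t| < 2 * κ := by
    rw [abs_lt] at hn hcon ⊢
    constructor <;> linarith [hn.1, hn.2, hcon.1, hcon.2]
  have h2 := mul_lt_mul_of_pos_left ht0 hs
  linarith
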